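/- **Local existence.** For a function $f$ of $(u,r)$ write $\bar f(u,r)=\frac1r\int_0^r f(u,s)\,ds$. Let $\xi(u,r)$ be the profile of the hedgehog Skyrme field and $h=\partial_r(r\xi)$, so that $\xi=\bar h$ and $\xi(u,0)=h(u,0)$. Fix a coupling constant $\alpha>0$. The spherically symmetric Einstein–Skyrme system in (dimensionless) Bondi coordinates reduces to an equation for $h$, with the metric functions $$g=\exp\Big[-\alpha\int_r^\infty\frac{(h-\bar h)^2}{s}\Big(1+2\frac{\sin^2\bar h}{s^2}\Big)ds\Big],\qquad \tilde g=\bar g-\frac{\alpha}{r}\int_0^r s^2g\Big(2\frac{\sin^2\bar h}{s^2}+\frac{\sin^4\bar h}{s^4}\Big)ds,$$ and, with $D=\partial_u-\frac{\tilde g}{2}\partial_r$, the integro-differential equation (for $r>0$) $$\begin{aligned}0={}&Dh-\frac{(h-\bar h)(g-\tilde g)}{2r}+\frac{\alpha}{2}(h-\bar h)gr\Big(2\frac{\sin^2\bar h}{r^2}+\frac{\sin^4\bar h}{r^4}\Big)+\frac gr\sin\bar h\cos\bar h+2\frac{\sin^2\bar h}{r^2}Dh\\&+2\frac{\sin\bar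 h}{r}\Big(hD\Big(\frac{\sin\bar h}{r}\Big)-D\Big(\sin\bar h\,\frac{\bar h}{r}\Big)-\sin\bar h\frac{(h-\bar h)(g-\tilde g)}{2r^2}+\frac\alpha2\sin\bar h\,(h-\bar h)g\Big(2\frac{\sin^2\bar h}{r^2}+\frac{\sin^4\bar h}{r^4}\Big)\Big)\\&+\frac{g}{r^3}\sin^3\bar h\cos\bar h.\end{aligned}$$ A function $h$ has topological charge $B$ at time $u$ if $\sin\xi(u,0)=0$ and $-\frac{1}{2\pi^2}\int_0^\infty\int_0^{\pi}\int_0^{2\pi}\sin^2\xi\,\partial_r\xi\,\sin\theta\,d\varphi\,d\theta\,dr=B$. For $u_0>0$ let $\tilde X$ be the space of $h\in C^1([0,u_0]\times[0,\infty))$ with $$\sup_{u\in[0,u_0]}\sup_{r\ge0}\big\{(1+r)^2|h(u,r)|+(1+r)^3|\partial_rh(u,r)|\big\}<\infty .$$ Let $B>0$ be an integer, and let $h_0\in C^1[0,\infty)$ have topological charge $B$ and satisfy $h_0(r)=O(r^{-2})$ and $\partial_rh_0(r)=O(r^{-3})$ as $r\to\infty$. Then there is $u_0>0$ such that there is exactly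 one $h\in\tilde X$ with $h(0,r)=h_0(r)$ for all $r\geq 0$ that satisfies the equation above for all $u\in[0,u_0]$ and $r>0$ and has topological charge $B$ at every $u\in[0,u_0]$. Moreover $h(u,r)=O(r^{-2})$ and $\partial_rh(u,r)=O(r^{-3})$ as $r\to\infty$ for every $u\in[0,u_0]$. -/

import Mathlib

open Set Filter Asymptotics Topology

noncomputable section

namespace EinsteinSkyrme

/-- The radial average `f̄(r) = (1/r) ∫₀ʳ f(s) ds` (used for `r > 0`; its limit at the centre is
`f 0`).  For `f = h(u, ·)` it is the Skyrme profile `ξ(u, r)`, where `h = ∂ᵣ(r ξ)`. -/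
def avg (f : ℝ → ℝ) (r : ℝ) : ℝ :=
  (1 / r) * ∫ s in (0 : ℝ)..r, f s

/-- The topological charge of the hedgehog field with profile `ξ = f̄`:
`-(1/2π²) ∫ √(-γ) (sin θ / (r² sin θ)) e^{-(ρ+σ)} sin²ξ ∂ᵣξ dφ dθ dr`, in which
`√(-γ) = e^{ρ+σ} r² sin θ`. -/
def topologicalCharge (f : ℝ → ℝ) : ℝ :=
  -(1 / (2 * Real.pi ^ 2)) *
    ∫ r in Ioi (0 : ℝ), ∫ θ in (0 : ℝ)..Real.pi, ∫ _φ in (0 : ℝ)..(2 * Real.pi),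
      Real.sin (avg f r) ^ 2 * deriv (avg f) r * Real.sin θ

/-- The metric function `g = e^{ρ+σ}` of the profile `h(u, ·) = f`:
`g(r) = exp(-α ∫_r^∞ ((h - h̄)²/s) (1 + 2 sin²h̄ / s²) ds)`. -/
def metricG (α : ℝ) (f : ℝ → ℝ) (r : ℝ) : ℝ :=
  Real.exp (-α * ∫ s in Ioi r,
    (f s - avg f s) ^ 2 / s * (1 + 2 * (Real.sin (avg f s) ^ 2 / s ^ 2)))

/-- The potential-type combination `2 sin²h̄ / r² + sin⁴h̄ / r⁴`. -/
def skyrmePotential (f : ℝ → ℝ) (r : ℝ) : ℝ :=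
  2 * (Real.sin (avg f r) ^ 2 / r ^ 2) + Real.sin (avg f r) ^ 4 / r ^ 4

/-- The metric function `g̃ = e^{ρ-σ}` of the profile `h(u, ·) = f`:
`g̃(r) = ḡ(r) - (α/r) ∫₀ʳ s² g (2 sin²h̄ / s² + sin⁴h̄ / s⁴) ds`. -/
def metricGTilde (α : ℝ) (f : ℝ → ℝ) (r : ℝ) : ℝ :=
  avg (metricG α f) r -
    α / r * ∫ s in (0 : ℝ)..r, s ^ 2 * metricG α f s * skyrmePotential f s

/-- The partial derivative in `u` of a function on `[0, u₀] × [0, ∞)`. -/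
def partialU (u₀ : ℝ) (F : ℝ → ℝ → ℝ) (u r : ℝ) : ℝ :=
  derivWithin (fun v => F v r) (Icc 0 u₀) u

/-- The partial derivative in `r` of a function on `[0, u₀] × [0, ∞)`. -/
def partialR (F : ℝ → ℝ → ℝ) (u r : ℝ) : ℝ :=
  derivWithin (F u) (Ici 0) r

/-- The operator `D = ∂ᵤ - (g̃/2) ∂ᵣ`, with `g̃` computed from `h`, acting on `F`. -/
def opD (α u₀ : ℝ) (h F : ℝ → ℝ → ℝ) (u r : ℝ) : ℝ :=
  partialU u₀ F u r - metricGTilde α (h u) r / 2 * partialR F u r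

/-- The left-hand side of the integro-differential equation for `h` to which the spherically
symmetric Einstein-Skyrme system in Bondi coordinates reduces. -/
def dynamicalExpr (α u₀ : ℝ) (h : ℝ → ℝ → ℝ) (u r : ℝ) : ℝ :=
  let m : ℝ := avg (h u) r
  let S : ℝ := Real.sin m
  let g : ℝ := metricG α (h u) r
  let gt : ℝ := metricGTilde α (h u) r
  let V : ℝ := skyrmePotential (h u) r
  opD α u₀ h h u r
    - (h u r - m) * (g - gt) / (2 * r)
    + α / 2 * (h u r - m) * g * r * V
    + g / r * S * Real.cos m
    + 2 * (S ^ 2 / r ^ 2) * opD α u₀ h h u r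
    + 2 * (S / r) *
      (h u r * opD α u₀ h (fun v s => Real.sin (avg (h v) s) / s) u r
        - opD α u₀ h (fun v s => Real.sin (avg (h v) s) * (avg (h v) s / s)) u r
        - S * ((h u r - m) * (g - gt) / (2 * r ^ 2))
        + α / 2 * S * (h u r - m) * g * V)
    + g / r ^ 3 * S ^ 3 * Real.cos m

/-- The weighted space of `h ∈ C¹([0, u₀] × [0, ∞))` with
`sup_{u, r} {(1 + r)² |h| + (1 + r)³ |∂ᵣh|} < ∞`. -/
def MemWeightedC1 (u₀ : ℝ) (h : ℝ → ℝ → ℝ) : Prop :=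
  ContDiffOn ℝ 1 (fun p : ℝ × ℝ => h p.1 p.2) (Icc 0 u₀ ×ˢ Ici 0) ∧
    ∃ C : ℝ, ∀ u ∈ Icc (0 : ℝ) u₀, ∀ r : ℝ, 0 ≤ r →
      (1 + r) ^ 2 * |h u r| + (1 + r) ^ 3 * |partialR h u r| ≤ C

/-- `h` is a classical (`C¹`, decaying) solution on `[0, u₀]` of the reduced Einstein-Skyrme system
with topological charge `B` and initial datum `h₀`. The central value is `ξ(u, 0) = h(u, 0)`, and
`sin ξ(u, 0) = 0` is the condition for the Skyrme field to be well defined at the centre. -/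
structure IsClassicalSolution (α : ℝ) (B : ℤ) (u₀ : ℝ) (h₀ : ℝ → ℝ) (h : ℝ → ℝ → ℝ) : Prop where
  mem : MemWeightedC1 u₀ h
  initial : ∀ r : ℝ, 0 ≤ r → h 0 r = h₀ r
  center : ∀ u ∈ Icc (0 : ℝ) u₀, Real.sin (h u 0) = 0
  charge : ∀ u ∈ Icc (0 : ℝ) u₀, topologicalCharge (h u) = B
  equation : ∀ u ∈ Icc (0 : ℝ) u₀, ∀ r : ℝ, 0 < r → dynamicalExpr α u₀ h u r = 0

end EinsteinSkyrme

end

/-!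
# Local existence for the spherically symmetric Einstein–Skyrme system

**The equation as a transport equation.** Let `ξ` be the average of `h`, let `κ` be the central value
of `ξ`, and let `a = ξ - κ`. The charge density is the `r`-derivative of a multiple of
`ξ - sin ξ cos ξ` (`IsProfileFamily.topologicalCharge_eq`), so that a profile which decays and
satisfies `sin κ = 0` has charge `B` exactly if `κ = π B`; the charge thus only fixes `κ`. With
`theta r y = ∫₀ʸ √(r² + 2 sin² t) dt`, put `X = theta r a` and `W = ∂ᵣ X`. The reduced equation is
then equivalent to `D W = source`, where `D = ∂ᵤ - (g̃ / 2) ∂ᵣ` and `source` contains no derivative of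
`W` (`mul_dynamicalExpr`).

**No loss of derivatives.** The metric depends on `W`, and `∂ᵣ W` is needed to propagate the regularity
of `h`. The field `Z = (∂ᵣ + 2 / r) W` determines everything else by integration, and it satisfies
`D Z = …` with a right-hand side built from `W`, `∂ᵣ W = Z - 2 W / r` and the metric only. The potential
terms are harmless because of the identity `theta_div_add_intK`: up to a regular kernel integral they
equal `X / r²`, and `(∂ᵣ + 2 / r) (X / r²) = W / r²` is cancelled to leading order by the commutator of
`D` with `∂ᵣ + 2 / r`. Since `a → -κ ∈ π ℤ` at infinity, `Z` has the tail `-2 κ / r`, which is carried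
by an explicit reference field; the remainder of `Z` decays.

**Evolution as an ordinary differential equation.** In labels that move with the characteristics
`dr/du = -g̃ / 2` the operator `D` is the time derivative. A `State` consists of the motion of the
label `0`, the logarithm of `∂ᵣ/∂ₓ` and the weighted remainder of `Z`, and the evolution is an integral
curve of the vector field `field` in the Banach space of states. The calculus of `Weighted`
functionals, which keeps track of the orders at the centre and at infinity, shows that `field` is
Lipschitz on bounded sets (`field_bounds`); the theorem of Picard and Lindelöf gives evolutions
(`exists_solution`).

**Existence.** For an evolution `W` satisfies its transport equation
(`IsEvolution.hasDerivWithinAt_W_rad`), hence the profile `h = ξ + r ∂ᵣ ξ` solves the reduced equation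
(`IsEvolution.dynamicalExpr_eq_zero`). Limits at the centre give the regularity up to `r = 0`
(`IsEvolution.contDiffOn_profile`), and integration along the characteristics gives the decay
(`IsEvolution.memWeightedC1`).

**Uniqueness.** A classical solution is a curve of states with the trivial labels `rad x = x`
(`MemWeightedC1.exists_isEulerian`). Its `W` satisfies the transport equation at fixed radius, although
`Z` need not be differentiable in `u`. Its metric defines labels that move with the characteristics.
Differentiated in the label, the integrated balance of `r² W` becomes one of `r² Z ∂ᵣ/∂ₓ`, so that
the remainder of `Z` in the moving labels is differentiable in time
(`IsEulerian.hasDerivWithinAt_zeta_rad`). The relabelled curve is therefore an evolution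
(`IsEulerian.exists_isEvolution`), and evolutions are determined by their initial state
(`IsEvolution.eq_of_eq`).
-/

noncomputable section

namespace EinsteinSkyrme

open scoped BoundedContinuousFunction

/-! ### States: labels, radii and amplitudes -/

section

/-- A state `(c, j, z)` in Lagrangian form.  The shells of matter carry labels `x : ℝ`; the shell `x`
sits at the radius `rad x = c + ∫₀ˣ exp j`, and `z` is the amplitude, weighted by `(1 + |x|)^(5/2)`,
of the remainder `zeta` of the field `Z`.  The labels range over all of `ℝ`, and the radius over
both signs, so that no moving boundary occurs as shells fall into the centre. -/
abbrev State : Type := ℝ × (ℝ →ᵇ ℝ) × (ℝ →ᵇ ℝ)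

namespace State

/-- The derivative of the radius with respect to the label. -/
def jac (s : State) (x : ℝ) : ℝ := Real.exp (s.2.1 x)

/-- The radius of the shell with label `x`. -/
def rad (s : State) (x : ℝ) : ℝ := s.1 + ∫ y in (0 : ℝ)..x, jac s y

lemma jac_pos (s : State) (x : ℝ) : 0 < jac s x := Real.exp_pos _

lemma continuous_jac (s : State) : Continuous (jac s) :=
  Real.continuous_exp.comp s.2.1.continuous

lemma abs_fst_le {s : State} {L : ℝ} (h : ‖s‖ ≤ L) : |s.1| ≤ L :=
  (norm_fst_le s).trans h

lemma abs_log_jac_le {s : State} {L : ℝ} (h : ‖s‖ ≤ L) (x : ℝ) : |s.2.1 x| ≤ L :=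
  (s.2.1.norm_coe_le_norm x).trans (((norm_fst_le s.2).trans (norm_snd_le s)).trans h)

lemma abs_amp_le {s : State} {L : ℝ} (h : ‖s‖ ≤ L) (x : ℝ) : |s.2.2 x| ≤ L :=
  (s.2.2.norm_coe_le_norm x).trans (((norm_snd_le s.2).trans (norm_snd_le s)).trans h)

lemma jac_le {s : State} {L : ℝ} (h : ‖s‖ ≤ L) (x : ℝ) : jac s x ≤ Real.exp L :=
  Real.exp_le_exp.2 ((le_abs_self _).trans (abs_log_jac_le h x))

lemma le_jac {s : State} {L : ℝ} (h : ‖s‖ ≤ L) (x : ℝ) : Real.exp (-L) ≤ jac s x :=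
  Real.exp_le_exp.2 (abs_le.1 (abs_log_jac_le h x)).1

lemma hasDerivAt_rad (s : State) (x : ℝ) : HasDerivAt (rad s) (jac s x) x := by
  have := intervalIntegral.integral_hasDerivAt_right
    ((continuous_jac s).intervalIntegrable 0 x)
    ((continuous_jac s).stronglyMeasurableAtFilter _ _) (continuous_jac s).continuousAt
  exact this.const_add s.1

lemma continuous_rad (s : State) : Continuous (rad s) :=
  continuous_iff_continuousAt.2 fun x => (hasDerivAt_rad s x).continuousAt

lemma rad_sub_rad (s : State) (x y : ℝ) : rad s y - rad s x = ∫ t in x..y, jac s t := by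
  have h := fun a b => (continuous_jac s).intervalIntegrable (μ := MeasureTheory.volume) a b
  unfold rad
  rw [add_sub_add_left_eq_sub, intervalIntegral.integral_interval_sub_left (h _ _) (h _ _)]

lemma mul_sub_le_rad_sub {s : State} {L : ℝ} (h : ‖s‖ ≤ L) {x y : ℝ} (hxy : x ≤ y) :
    Real.exp (-L) * (y - x) ≤ rad s y - rad s x := by
  rw [rad_sub_rad]
  have := intervalIntegral.integral_mono_on hxy
    (intervalIntegrable_const (c := Real.exp (-L)) (μ := MeasureTheory.volume))
    ((continuous_jac s).intervalIntegrable x y) (fun t _ => le_jac h t)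
  simp only [intervalIntegral.integral_const, smul_eq_mul] at this
  linarith

lemma rad_sub_le_mul_sub {s : State} {L : ℝ} (h : ‖s‖ ≤ L) {x y : ℝ} (hxy : x ≤ y) :
    rad s y - rad s x ≤ Real.exp L * (y - x) := by
  rw [rad_sub_rad]
  have := intervalIntegral.integral_mono_on hxy
    ((continuous_jac s).intervalIntegrable x y)
    (intervalIntegrable_const (c := Real.exp L) (μ := MeasureTheory.volume))
    (fun t _ => jac_le h t)
  simp only [intervalIntegral.integral_const, smul_eq_mul] at this
  linarith

lemma mul_abs_sub_le {s : State} {L : ℝ} (h : ‖s‖ ≤ L) (x y : ℝ) :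
    Real.exp (-L) * |y - x| ≤ |rad s y - rad s x| := by
  rcases le_total x y with hxy | hxy
  · rw [abs_of_nonneg (sub_nonneg.2 hxy)]
    exact (mul_sub_le_rad_sub h hxy).trans (le_abs_self _)
  · rw [abs_sub_comm, abs_of_nonneg (sub_nonneg.2 hxy), abs_sub_comm]
    exact (mul_sub_le_rad_sub h hxy).trans (le_abs_self _)

lemma strictMono_rad (s : State) : StrictMono (rad s) := by
  intro x y hxy
  have := mul_sub_le_rad_sub (le_refl ‖s‖) hxy.le
  have h2 : 0 < Real.exp (-‖s‖) * (y - x) := mul_pos (Real.exp_pos _) (sub_pos.2 hxy)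
  linarith

lemma rad_zero (s : State) : rad s 0 = s.1 := by simp [rad]

lemma surjective_rad (s : State) : Function.Surjective (rad s) := by
  intro r
  have hE : 0 < Real.exp (-‖s‖) := Real.exp_pos _
  set N := |r - s.1| / Real.exp (-‖s‖)
  have hN : 0 ≤ N := by positivity
  have hNE : Real.exp (-‖s‖) * N = |r - s.1| := by
    simp only [N]; field_simp
  have h1 := mul_sub_le_rad_sub (le_refl ‖s‖) hN
  have h2 := mul_sub_le_rad_sub (le_refl ‖s‖) (neg_nonpos.2 hN)
  rw [rad_zero] at h1 h2
  have h3 := le_abs_self (r - s.1)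
  have h4 := neg_abs_le (r - s.1)
  have : r ∈ rad s '' (Icc (-N) N) :=
    intermediate_value_Icc (by linarith) (continuous_rad s).continuousOn
      ⟨by linarith, by linarith⟩
  obtain ⟨x, -, hx⟩ := this
  exact ⟨x, hx⟩

/-- The radius as an order isomorphism from labels to radii. -/
def radIso (s : State) : ℝ ≃o ℝ :=
  (strictMono_rad s).orderIsoOfSurjective _ (surjective_rad s)

/-- The label of the shell at the radius `r`. -/
def label (s : State) (r : ℝ) : ℝ := (radIso s).symm r

@[simp] lemma rad_label (s : State) (r : ℝ) : rad s (label s r) = r :=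
  (radIso s).apply_symm_apply r

@[simp] lemma label_rad (s : State) (x : ℝ) : label s (rad s x) = x :=
  (radIso s).symm_apply_apply x

lemma continuous_label (s : State) : Continuous (label s) := (radIso s).symm.continuous

lemma label_lt_iff (s : State) (r x : ℝ) : label s r < x ↔ r < rad s x := by
  rw [← (strictMono_rad s).lt_iff_lt, rad_label]

/-- The remainder `Z - refZ` as a function of the radius.  It really decays like `(1 + r)⁻³`; the
weaker weight `(1 + |x|)^(-5/2)` makes the amplitudes of solutions tend to zero at infinity, which
gives their continuity in the supremum norm. -/
def zeta (s : State) (r : ℝ) : ℝ := s.2.2 (label s r) * ((√(1 + |label s r|))⁻¹) ^ 5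

lemma continuous_zeta (s : State) : Continuous (zeta s) := by
  unfold zeta
  refine (s.2.2.continuous.comp (continuous_label s)).mul (Continuous.pow (Continuous.inv₀ ?_ ?_) 5)
  · exact Real.continuous_sqrt.comp (continuous_const.add (continuous_label s).abs)
  · intro x; positivity

lemma one_add_abs_le {s : State} {L : ℝ} (h : ‖s‖ ≤ L) {x : ℝ} (hx : 0 ≤ rad s x) :
    1 + |x| ≤ (1 + L) * Real.exp L * (1 + rad s x) := by
  have hL : 0 ≤ L := (norm_nonneg s).trans h
  have h1 := mul_abs_sub_le h 0 x
  rw [rad_zero, sub_zero] at h1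
  have h2 : |rad s x - s.1| ≤ rad s x + L := by
    have := abs_fst_le h
    calc _ ≤ |rad s x| + |s.1| := abs_sub _ _
      _ ≤ _ := by rw [abs_of_nonneg hx]; linarith
  have hE : Real.exp L * Real.exp (-L) = 1 := by rw [← Real.exp_add]; simp
  have h3 : |x| ≤ Real.exp L * (rad s x + L) := by
    calc |x| = Real.exp L * (Real.exp (-L) * |x|) := by rw [← mul_assoc, hE, one_mul]
      _ ≤ _ := by gcongr; linarith
  have h4 : 1 ≤ Real.exp L := Real.one_le_exp hL
  nlinarith [mul_nonneg hL hx, mul_nonneg (mul_nonneg hL hx) (Real.exp_pos L).le]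

lemma one_add_rad_le {s : State} {L : ℝ} (h : ‖s‖ ≤ L) (x : ℝ) :
    1 + |rad s x| ≤ (1 + L) * Real.exp L * (1 + |x|) := by
  have hL : 0 ≤ L := (norm_nonneg s).trans h
  have h2 := abs_fst_le h
  have h4 : 1 ≤ Real.exp L := Real.one_le_exp hL
  have h3 : |rad s x - s.1| ≤ Real.exp L * |x| := by
    rw [← rad_zero s, rad_sub_rad]
    have := intervalIntegral.norm_integral_le_of_norm_le_const (a := 0) (b := x) (f := jac s)
      (C := Real.exp L) (fun t _ => by
        rw [Real.norm_eq_abs, abs_of_pos (jac_pos s t)]; exact jac_le h t)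
    simpa using this
  have h5 : |rad s x| ≤ |rad s x - s.1| + |s.1| := by
    simpa using abs_add_le (rad s x - s.1) s.1
  nlinarith [mul_nonneg hL (abs_nonneg x), mul_nonneg (mul_nonneg hL (abs_nonneg x)) (Real.exp_pos L).le]

lemma abs_exp_sub_exp_le {L a b : ℝ} (ha : a ≤ L) (hb : b ≤ L) :
    |Real.exp a - Real.exp b| ≤ Real.exp L * |a - b| := by
  have := Convex.norm_image_sub_le_of_norm_hasDerivWithin_le
    (𝕜 := ℝ) (f := Real.exp) (f' := Real.exp) (C := Real.exp L) (s := Iic L)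
    (fun x _ => (Real.hasDerivAt_exp x).hasDerivWithinAt)
    (fun x hx => by
      rw [Real.norm_eq_abs, abs_of_pos (Real.exp_pos x)]; exact Real.exp_le_exp.2 hx)
    (convex_Iic L) hb ha
  simpa using this

lemma abs_jac_sub_le {s₁ s₂ : State} {L : ℝ} (h₁ : ‖s₁‖ ≤ L) (h₂ : ‖s₂‖ ≤ L) (x : ℝ) :
    |jac s₁ x - jac s₂ x| ≤ Real.exp L * ‖s₁ - s₂‖ := by
  refine (abs_exp_sub_exp_le ((le_abs_self _).trans (abs_log_jac_le h₁ x))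
    ((le_abs_self _).trans (abs_log_jac_le h₂ x))).trans ?_
  gcongr
  exact abs_log_jac_le (s := s₁ - s₂) le_rfl x

lemma abs_rad_sub_le {s₁ s₂ : State} {L : ℝ} (h₁ : ‖s₁‖ ≤ L) (h₂ : ‖s₂‖ ≤ L) (x : ℝ) :
    |rad s₁ x - rad s₂ x| ≤ Real.exp L * ‖s₁ - s₂‖ * (1 + |x|) := by
  have hL : 0 ≤ L := (norm_nonneg s₁).trans h₁
  have h4 : 1 ≤ Real.exp L := Real.one_le_exp hL
  have e : rad s₁ x - rad s₂ x = (s₁.1 - s₂.1) + ∫ y in (0:ℝ)..x, (jac s₁ y - jac s₂ y) := by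
    rw [intervalIntegral.integral_sub ((continuous_jac _).intervalIntegrable _ _)
      ((continuous_jac _).intervalIntegrable _ _)]
    unfold rad; ring
  have hc : |s₁.1 - s₂.1| ≤ ‖s₁ - s₂‖ := abs_fst_le (s := s₁ - s₂) le_rfl
  have hi : |∫ y in (0:ℝ)..x, (jac s₁ y - jac s₂ y)| ≤ Real.exp L * ‖s₁ - s₂‖ * |x| := by
    have := intervalIntegral.norm_integral_le_of_norm_le_const (a := 0) (b := x)
      (f := fun y => jac s₁ y - jac s₂ y)
      (C := Real.exp L * ‖s₁ - s₂‖) (fun t _ => abs_jac_sub_le h₁ h₂ t)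
    simpa using this
  rw [e]
  refine (abs_add_le _ _).trans ?_
  nlinarith [norm_nonneg (s₁ - s₂)]

end State

/-! ### Weights in the radius -/

/-- The weight `(r / (1 + r))^k (1 + r)^(-l/2)`, of order `k` at the centre and `-l/2` at infinity. -/
def wt (k l : ℤ) (r : ℝ) : ℝ := (r / (1 + r)) ^ k * ((√(1 + r))⁻¹) ^ l

lemma wt_pos (k l : ℤ) {r : ℝ} (hr : 0 < r) : 0 < wt k l r := by
  unfold wt; positivity

lemma wt_mul (k l k' l' : ℤ) {r : ℝ} (hr : 0 < r) :
    wt k l r * wt k' l' r = wt (k + k') (l + l') r := by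
  unfold wt
  have h1 : r / (1 + r) ≠ 0 := by positivity
  have h2 : (√(1 + r))⁻¹ ≠ 0 := by positivity
  rw [zpow_add₀ h1, zpow_add₀ h2]; ring

lemma wt_zero_zero (r : ℝ) : wt 0 0 r = 1 := by simp [wt]

lemma wt_mono {k l k' l' : ℤ} (hk : k' ≤ k) (hl : l' ≤ l) {r : ℝ} (hr : 0 < r) :
    wt k l r ≤ wt k' l' r := by
  unfold wt
  have h1 : r / (1 + r) ≤ 1 := by rw [div_le_one (by positivity)]; linarith
  have h2 : (√(1 + r))⁻¹ ≤ 1 := by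
    apply inv_le_one_of_one_le₀; rw [Real.one_le_sqrt]; linarith
  have := zpow_le_zpow_right_of_le_one₀ (by positivity) h1 hk
  have := zpow_le_zpow_right_of_le_one₀ (by positivity) h2 hl
  gcongr

/-- The radii are positive and differ by a factor of at most two. -/
def Comparable (r₁ r₂ : ℝ) : Prop := 0 < r₁ ∧ 0 < r₂ ∧ r₁ ≤ 2 * r₂ ∧ r₂ ≤ 2 * r₁

lemma zpow_le_two_pow_mul {a b : ℝ} (ha : 0 < a) (hb : 0 < b) (h1 : b ≤ 2 * a) (h2 : a ≤ 2 * b)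
    (k : ℤ) : b ^ k ≤ 2 ^ k.natAbs * a ^ k := by
  rcases Int.natAbs_eq k with h | h <;> rw [h] <;> simp only [Int.natAbs_neg, Int.natAbs_natCast]
  · rw [zpow_natCast, zpow_natCast, ← mul_pow]
    exact pow_le_pow_left₀ hb.le h1 _
  · rw [zpow_neg, zpow_neg, zpow_natCast, zpow_natCast, ← div_eq_mul_inv,
      le_div_iff₀ (by positivity), inv_mul_le_iff₀ (by positivity), ← mul_pow, mul_comm b]
    exact pow_le_pow_left₀ ha.le h2 _

lemma wt_le_of_comparable (k l : ℤ) {r₁ r₂ : ℝ} (h : Comparable r₁ r₂) :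
    wt k l r₂ ≤ 2 ^ k.natAbs * 2 ^ l.natAbs * wt k l r₁ := by
  obtain ⟨h1, h2, h3, h4⟩ := h
  have aux : ∀ {a b : ℝ}, 0 < a → 0 < b → a ≤ 2 * b → a / (1 + a) ≤ 2 * (b / (1 + b)) := by
    intro a b ha hb hab
    rw [← mul_div_assoc, div_le_div_iff₀ (by positivity) (by positivity)]
    nlinarith [mul_pos ha hb]
  have aux2 : ∀ {a b : ℝ}, 0 < a → 0 < b → b ≤ 2 * a → (√(1 + a))⁻¹ ≤ 2 * (√(1 + b))⁻¹ := by
    intro a b ha hb hab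
    rw [← div_eq_mul_inv, inv_eq_one_div, div_le_div_iff₀ (by positivity) (by positivity), one_mul]
    rw [show (2:ℝ) * √(1 + a) = √(4 * (1 + a)) by
      rw [Real.sqrt_mul (by norm_num)]; congr 1
      rw [show (4:ℝ) = 2 ^ 2 by norm_num]; simp]
    exact Real.sqrt_le_sqrt (by linarith)
  have e1 := zpow_le_two_pow_mul (a := r₁ / (1 + r₁)) (b := r₂ / (1 + r₂)) (by positivity)
    (by positivity) (aux h2 h1 h4) (aux h1 h2 h3) k
  have e2 := zpow_le_two_pow_mul (a := (√(1 + r₁))⁻¹) (b := (√(1 + r₂))⁻¹) (by positivity)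
    (by positivity) (aux2 h2 h1 h3) (aux2 h1 h2 h4) l
  unfold wt
  calc _ ≤ (2 ^ k.natAbs * (r₁ / (1 + r₁)) ^ k) * (2 ^ l.natAbs * ((√(1 + r₁))⁻¹) ^ l) := by
        gcongr
    _ = _ := by ring

lemma sq_sqrt_inv {r : ℝ} (hr : 0 ≤ r) : ((√(1 + r))⁻¹) ^ 2 = 1 / (1 + r) := by
  rw [inv_pow, Real.sq_sqrt (by linarith), one_div]

lemma wt_one_neg_two {r : ℝ} (hr : 0 < r) : wt 1 (-2) r = r := by
  unfold wt
  rw [zpow_neg, zpow_one, show (2:ℤ) = ((2:ℕ):ℤ) by rfl, zpow_natCast, sq_sqrt_inv hr.le]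
  field_simp

lemma wt_neg_one_two {r : ℝ} (hr : 0 < r) : wt (-1) 2 r = r⁻¹ := by
  unfold wt
  rw [zpow_neg, zpow_one, show (2:ℤ) = ((2:ℕ):ℤ) by rfl, zpow_natCast, sq_sqrt_inv hr.le]
  field_simp

lemma wt_zero_neg_two {r : ℝ} (hr : 0 < r) : wt 0 (-2) r = 1 + r := by
  unfold wt
  rw [zpow_neg, zpow_zero, show (2:ℤ) = ((2:ℕ):ℤ) by rfl, zpow_natCast, sq_sqrt_inv hr.le]
  field_simp

lemma wt_zero_two {r : ℝ} (hr : 0 < r) : wt 0 2 r = 1 / (1 + r) := by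
  unfold wt
  rw [zpow_zero, show (2:ℤ) = ((2:ℕ):ℤ) by rfl, zpow_natCast, sq_sqrt_inv hr.le, one_mul]

lemma wt_zero_five (r : ℝ) : wt 0 5 r = ((√(1 + r))⁻¹) ^ 5 := by
  unfold wt
  rw [zpow_zero, one_mul, show (5:ℤ) = ((5:ℕ):ℤ) by rfl, zpow_natCast]

lemma wt_one_zero {r : ℝ} : wt 1 0 r = r / (1 + r) := by
  simp [wt]

end

/-! ### Weighted functionals of the state -/

section

open State

/-- `f s r t` is a functional of the state `s`, of the radius `r` and of an auxiliary parameter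
`t ∈ [0, 1]`, which is continuous in `(r, t)`, bounded by a multiple of `wt k l r`, and Lipschitz in
the state, the constants being uniform on bounded sets of states.  States are compared at the same label, hence at different radii; since
these differ by `O(‖s₁ - s₂‖ (1 + r))`, the Lipschitz bound is asked for at comparable radii only
and loses one power of `r / (1 + r)`. -/
structure Weighted (k l : ℤ) (f : State → ℝ → ℝ → ℝ) : Prop where
  bound : ∀ L : ℝ, ∃ C : ℝ, 0 ≤ C ∧ ∀ s : State, ‖s‖ ≤ L → ∀ r : ℝ, 0 < r →
    ∀ t ∈ Icc (0 : ℝ) 1, |f s r t| ≤ C * wt k l r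
  lip : ∀ L : ℝ, ∃ C : ℝ, 0 ≤ C ∧ ∀ s₁ s₂ : State, ‖s₁‖ ≤ L → ‖s₂‖ ≤ L → ∀ x : ℝ,
    Comparable (rad s₁ x) (rad s₂ x) → ∀ t ∈ Icc (0 : ℝ) 1,
    |f s₁ (rad s₁ x) t - f s₂ (rad s₂ x) t| ≤ C * ‖s₁ - s₂‖ * wt (k - 1) l (rad s₁ x)
  cont : ∀ s : State,
    ContinuousOn (fun p : ℝ × ℝ => f s p.1 p.2) (Ioi 0 ×ˢ Icc 0 1)

namespace Weighted

variable {k l k' l' : ℤ} {f g : State → ℝ → ℝ → ℝ}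

lemma congr (hf : Weighted k l f)
    (h : ∀ s : State, ∀ r : ℝ, 0 < r → ∀ t ∈ Icc (0 : ℝ) 1, g s r t = f s r t) :
    Weighted k l g where
  bound L := by
    obtain ⟨C, hC, H⟩ := hf.bound L
    exact ⟨C, hC, fun s hs r hr t ht => by rw [h s r hr t ht]; exact H s hs r hr t ht⟩
  lip L := by
    obtain ⟨C, hC, H⟩ := hf.lip L
    exact ⟨C, hC, fun s₁ s₂ h₁ h₂ x hx t ht => by
      rw [h s₁ _ hx.1 t ht, h s₂ _ hx.2.1 t ht]; exact H s₁ s₂ h₁ h₂ x hx t ht⟩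
  cont s := (hf.cont s).congr fun p hp => h s p.1 hp.1 p.2 hp.2

lemma cast (hf : Weighted k l f) (hk : k = k') (hl : l = l') : Weighted k' l' f := by
  subst hk hl; exact hf

lemma mono (hf : Weighted k l f) (hk : k' ≤ k) (hl : l' ≤ l) : Weighted k' l' f where
  bound L := by
    obtain ⟨C, hC, H⟩ := hf.bound L
    exact ⟨C, hC, fun s hs r hr t ht => (H s hs r hr t ht).trans
      (mul_le_mul_of_nonneg_left (wt_mono hk hl hr) hC)⟩
  lip L := by
    obtain ⟨C, hC, H⟩ := hf.lip L
    exact ⟨C, hC, fun s₁ s₂ h₁ h₂ x hx t ht => (H s₁ s₂ h₁ h₂ x hx t ht).trans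
      (mul_le_mul_of_nonneg_left (wt_mono (by omega) hl hx.1) (by positivity))⟩
  cont := hf.cont

lemma add (hf : Weighted k l f) (hg : Weighted k l g) :
    Weighted k l (fun s r t => f s r t + g s r t) where
  bound L := by
    obtain ⟨C, hC, H⟩ := hf.bound L
    obtain ⟨C', hC', H'⟩ := hg.bound L
    refine ⟨C + C', by positivity, fun s hs r hr t ht => (abs_add_le _ _).trans ?_⟩
    have := H s hs r hr t ht; have := H' s hs r hr t ht
    linarith
  lip L := by
    obtain ⟨C, hC, H⟩ := hf.lip L
    obtain ⟨C', hC', H'⟩ := hg.lip L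
    refine ⟨C + C', by positivity, fun s₁ s₂ h₁ h₂ x hx t ht => ?_⟩
    rw [add_sub_add_comm]
    refine (abs_add_le _ _).trans ?_
    have := H s₁ s₂ h₁ h₂ x hx t ht; have := H' s₁ s₂ h₁ h₂ x hx t ht
    linarith
  cont s := (hf.cont s).add (hg.cont s)

lemma const_mul (c : ℝ) (hf : Weighted k l f) : Weighted k l (fun s r t => c * f s r t) where
  bound L := by
    obtain ⟨C, hC, H⟩ := hf.bound L
    refine ⟨|c| * C, by positivity, fun s hs r hr t ht => ?_⟩
    rw [abs_mul, mul_assoc]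
    exact mul_le_mul_of_nonneg_left (H s hs r hr t ht) (abs_nonneg c)
  lip L := by
    obtain ⟨C, hC, H⟩ := hf.lip L
    refine ⟨|c| * C, by positivity, fun s₁ s₂ h₁ h₂ x hx t ht => ?_⟩
    rw [← mul_sub, abs_mul, mul_assoc, mul_assoc, ← mul_assoc C]
    exact mul_le_mul_of_nonneg_left (H s₁ s₂ h₁ h₂ x hx t ht) (abs_nonneg c)
  cont s := continuousOn_const.mul (hf.cont s)

lemma neg (hf : Weighted k l f) : Weighted k l (fun s r t => -f s r t) :=
  (hf.const_mul (-1)).congr fun _ _ _ _ _ => by ring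

lemma sub (hf : Weighted k l f) (hg : Weighted k l g) :
    Weighted k l (fun s r t => f s r t - g s r t) :=
  (hf.add hg.neg).congr fun _ _ _ _ _ => by ring

lemma mul (hf : Weighted k l f) (hg : Weighted k' l' g) :
    Weighted (k + k') (l + l') (fun s r t => f s r t * g s r t) where
  bound L := by
    obtain ⟨C, hC, H⟩ := hf.bound L
    obtain ⟨C', hC', H'⟩ := hg.bound L
    refine ⟨C * C', by positivity, fun s hs r hr t ht => ?_⟩
    rw [abs_mul, ← wt_mul _ _ _ _ hr]
    calc _ ≤ (C * wt k l r) * (C' * wt k' l' r) :=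
          mul_le_mul (H s hs r hr t ht) (H' s hs r hr t ht) (abs_nonneg _)
            (mul_nonneg hC (wt_pos _ _ hr).le)
      _ = _ := by ring
  lip L := by
    obtain ⟨C, hC, H⟩ := hf.bound L
    obtain ⟨C', hC', H'⟩ := hg.bound L
    obtain ⟨D, hD, I⟩ := hf.lip L
    obtain ⟨D', hD', I'⟩ := hg.lip L
    set M : ℝ := 2 ^ k'.natAbs * 2 ^ l'.natAbs
    have hM : 0 ≤ M := by positivity
    refine ⟨C * D' + C' * M * D, by positivity, fun s₁ s₂ h₁ h₂ x hx t ht => ?_⟩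
    set r₁ := rad s₁ x
    set r₂ := rad s₂ x
    have a1 := H s₁ h₁ r₁ hx.1 t ht
    have a2 := (H' s₂ h₂ r₂ hx.2.1 t ht).trans
      (mul_le_mul_of_nonneg_left (wt_le_of_comparable k' l' hx) hC')
    have a3 := I s₁ s₂ h₁ h₂ x hx t ht
    have a4 := I' s₁ s₂ h₁ h₂ x hx t ht
    have w1 := wt_mul k l (k' - 1) l' hx.1
    have w2 := wt_mul (k - 1) l k' l' hx.1
    rw [show k + (k' - 1) = k + k' - 1 by ring] at w1
    rw [show k - 1 + k' = k + k' - 1 by ring] at w2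
    have p1 := (wt_pos k l hx.1).le
    have p2 := (wt_pos k' l' hx.1).le
    have p3 := (wt_pos (k - 1) l hx.1).le
    calc |f s₁ r₁ t * g s₁ r₁ t - f s₂ r₂ t * g s₂ r₂ t|
        = |f s₁ r₁ t * (g s₁ r₁ t - g s₂ r₂ t) + g s₂ r₂ t * (f s₁ r₁ t - f s₂ r₂ t)| := by
          congr 1; ring
      _ ≤ |f s₁ r₁ t| * |g s₁ r₁ t - g s₂ r₂ t| + |g s₂ r₂ t| * |f s₁ r₁ t - f s₂ r₂ t| := by
          rw [← abs_mul, ← abs_mul]; exact abs_add_le _ _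
      _ ≤ (C * wt k l r₁) * (D' * ‖s₁ - s₂‖ * wt (k' - 1) l' r₁)
          + (C' * (M * wt k' l' r₁)) * (D * ‖s₁ - s₂‖ * wt (k - 1) l r₁) := by
          gcongr
      _ = C * D' * ‖s₁ - s₂‖ * (wt k l r₁ * wt (k' - 1) l' r₁)
          + C' * M * D * ‖s₁ - s₂‖ * (wt (k - 1) l r₁ * wt k' l' r₁) := by ring
      _ = _ := by rw [w1, w2]; ring
  cont s := (hf.cont s).mul (hg.cont s)

lemma const (c : ℝ) : Weighted 0 0 (fun _ _ _ => c) where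
  bound _ := ⟨|c|, abs_nonneg _, fun s _ r _ t _ => by rw [wt_zero_zero, mul_one]⟩
  lip _ := ⟨0, le_rfl, fun s₁ s₂ _ _ x _ t _ => by simp⟩
  cont s := continuousOn_const

lemma pow (hf : Weighted k l f) (n : ℕ) :
    Weighted (n * k) (n * l) (fun s r t => f s r t ^ n) := by
  induction n with
  | zero => simpa using const 1
  | succ n ih =>
    refine ((ih.mul hf).cast ?_ ?_).congr fun _ _ _ _ _ => pow_succ _ _
    · push_cast; ring
    · push_cast; ring

lemma of_scalar {c : State → ℝ}
    (hb : ∀ L : ℝ, ∃ C : ℝ, 0 ≤ C ∧ ∀ s : State, ‖s‖ ≤ L → |c s| ≤ C)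
    (hl : ∀ L : ℝ, ∃ C : ℝ, 0 ≤ C ∧ ∀ s₁ s₂ : State, ‖s₁‖ ≤ L → ‖s₂‖ ≤ L →
      |c s₁ - c s₂| ≤ C * ‖s₁ - s₂‖) : Weighted 0 0 (fun s _ _ => c s) where
  bound L := by
    obtain ⟨C, hC, H⟩ := hb L
    exact ⟨C, hC, fun s hs r hr t ht => by rw [wt_zero_zero, mul_one]; exact H s hs⟩
  lip L := by
    obtain ⟨C, hC, H⟩ := hl L
    refine ⟨C, hC, fun s₁ s₂ h₁ h₂ x hx t ht => (H s₁ s₂ h₁ h₂).trans ?_⟩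
    have := wt_mono (k := 0) (l := 0) (k' := 0 - 1) (l' := 0) (by norm_num) le_rfl hx.1
    rw [wt_zero_zero] at this
    exact le_mul_of_one_le_right (by positivity) this
  cont s := continuousOn_const

lemma radius : Weighted 1 (-2) (fun _ r _ => r) where
  bound _ := ⟨1, zero_le_one, fun s _ r hr t _ => by
    rw [wt_one_neg_two hr, one_mul, abs_of_pos hr]⟩
  lip L := by
    refine ⟨Real.exp |L| * ((1 + |L|) * Real.exp |L|), by positivity,
      fun s₁ s₂ h₁ h₂ x hx t ht => ?_⟩
    have h₁' := h₁.trans (le_abs_self L)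
    have h₂' := h₂.trans (le_abs_self L)
    refine (abs_rad_sub_le h₁' h₂' x).trans ?_
    rw [show (1:ℤ) - 1 = 0 by norm_num, wt_zero_neg_two hx.1]
    have := one_add_abs_le h₁' hx.1.le
    calc _ ≤ Real.exp |L| * ‖s₁ - s₂‖ * ((1 + |L|) * Real.exp |L| * (1 + rad s₁ x)) := by gcongr
      _ = _ := by ring
  cont s := continuousOn_fst

lemma inv_radius : Weighted (-1) 2 (fun _ r _ => r⁻¹) where
  bound _ := ⟨1, zero_le_one, fun s _ r hr t _ => by
    rw [wt_neg_one_two hr, one_mul, abs_of_pos (inv_pos.2 hr)]⟩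
  lip L := by
    obtain ⟨C, hC, H⟩ := radius.lip L
    refine ⟨C * 2, by positivity, fun s₁ s₂ h₁ h₂ x hx t ht => ?_⟩
    have h := H s₁ s₂ h₁ h₂ x hx t ht
    obtain ⟨p1, p2, p3, p4⟩ := hx
    rw [inv_sub_inv p1.ne' p2.ne', abs_div, abs_sub_comm, abs_of_pos (mul_pos p1 p2),
      div_le_iff₀ (mul_pos p1 p2)]
    refine h.trans ?_
    rw [show (1:ℤ) - 1 = 0 by norm_num]
    have w := wt_mul (-1 - 1) 2 1 (-2) p1
    have w' := wt_mul (-1 - 1 + 1) (2 + -2) 1 (-2) p1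
    rw [wt_one_neg_two p1] at w w'
    have e : wt 0 (-2) (rad s₁ x) = wt (-1 - 1) 2 (rad s₁ x) * rad s₁ x * rad s₁ x := by
      rw [w, w']; norm_num
    rw [e]
    have hw := wt_pos (-1 - 1) 2 p1
    calc C * ‖s₁ - s₂‖ * (wt (-1 - 1) 2 (rad s₁ x) * rad s₁ x * rad s₁ x)
        ≤ C * ‖s₁ - s₂‖ * (wt (-1 - 1) 2 (rad s₁ x) * rad s₁ x * (2 * rad s₂ x)) := by gcongr
      _ = _ := by ring
  cont s := continuousOn_fst.inv₀ fun p hp => (show (0:ℝ) < p.1 from hp.1).ne'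

lemma div_radius (hf : Weighted k l f) : Weighted (k - 1) (l + 2) (fun s r t => f s r t / r) :=
  ((hf.mul inv_radius).cast (by ring) rfl).congr fun _ _ _ _ _ => div_eq_mul_inv _ _

lemma mul_radius (hf : Weighted k l f) : Weighted (k + 1) (l - 2) (fun s r t => r * f s r t) :=
  ((hf.mul radius).cast (by ring) (by ring)).congr fun _ _ _ _ _ => mul_comm _ _

lemma inv_one_add_radius : Weighted 0 2 (fun _ r _ => 1 / (1 + r)) where
  bound _ := ⟨1, zero_le_one, fun s _ r hr t _ => by
    rw [wt_zero_two hr, one_mul, abs_of_pos (by positivity)]⟩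
  lip L := by
    obtain ⟨C, hC, H⟩ := radius.lip L
    refine ⟨C * 2, by positivity, fun s₁ s₂ h₁ h₂ x hx t ht => ?_⟩
    have h := H s₁ s₂ h₁ h₂ x hx t ht
    obtain ⟨p1, p2, p3, p4⟩ := hx
    rw [show (1:ℤ) - 1 = 0 by norm_num, wt_zero_neg_two p1] at h
    have w := wt_mono (k := 0) (l := 2) (k' := 0 - 1) (l' := 2) (by norm_num) le_rfl p1
    rw [wt_zero_two p1] at w
    rw [div_sub_div _ _ (by positivity) (by positivity), abs_div,
      abs_of_pos (show 0 < (1 + rad s₁ x) * (1 + rad s₂ x) by positivity),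
      show 1 * (1 + rad s₂ x) - (1 + rad s₁ x) * 1 = -(rad s₁ x - rad s₂ x) by ring, abs_neg]
    calc _ ≤ (C * ‖s₁ - s₂‖ * (1 + rad s₁ x)) / ((1 + rad s₁ x) * (1 + rad s₂ x)) := by gcongr
      _ = C * ‖s₁ - s₂‖ * (1 / (1 + rad s₂ x)) := by field_simp
      _ ≤ C * ‖s₁ - s₂‖ * (2 * (1 / (1 + rad s₁ x))) := by
          gcongr
          rw [← mul_div_assoc, div_le_div_iff₀ (by positivity) (by positivity)]; linarith
      _ ≤ C * ‖s₁ - s₂‖ * (2 * wt (0 - 1) 2 (rad s₁ x)) := by gcongr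
      _ = _ := by ring
  cont s := continuousOn_const.div (continuousOn_const.add continuousOn_fst)
    fun p hp => by have : (0:ℝ) < p.1 := hp.1; positivity

lemma ratio : Weighted 1 0 (fun _ r _ => r / (1 + r)) :=
  (radius.mul inv_one_add_radius).congr fun _ _ _ _ _ => by ring

/-- The first hypothesis is the better one near the centre, the second near infinity; together they
give the better exponent at both ends. -/
lemma combine (hf : Weighted k l f) (hf' : Weighted k' l' f) (hk : k' ≤ k) (hl : l ≤ l') :
    Weighted k l' f := by
  have key : ∀ k k' l l' : ℤ, k' ≤ k → l ≤ l' → ∃ M : ℝ, 0 ≤ M ∧ ∀ r : ℝ, 0 < r →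
      wt k l r ≤ M * wt k l' r ∨ wt k' l' r ≤ M * wt k l' r := by
    intro k k' l l' hk hl
    obtain ⟨m, hm⟩ := Int.eq_ofNat_of_zero_le (sub_nonneg.2 hk)
    obtain ⟨n, hn⟩ := Int.eq_ofNat_of_zero_le (sub_nonneg.2 hl)
    refine ⟨2 ^ m + 2 ^ n, by positivity, fun r hr => ?_⟩
    have w := wt_pos k l' hr
    rcases le_total r 1 with h | h
    · left
      have e := wt_mul k l' 0 (-n) hr
      rw [show l' + (-(n:ℤ)) = l by omega, add_zero] at e
      rw [← e, mul_comm]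
      refine mul_le_mul_of_nonneg_right ?_ w.le
      have : wt 0 (-n) r ≤ 2 ^ n := by
        unfold wt
        rw [zpow_zero, one_mul, zpow_neg, zpow_natCast, inv_pow, inv_inv]
        refine pow_le_pow_left₀ (by positivity) ?_ n
        rw [Real.sqrt_le_left (by norm_num)]; linarith
      have : (0:ℝ) ≤ 2 ^ m := by positivity
      linarith
    · right
      have e := wt_mul k l' (-m) 0 hr
      rw [show k + (-(m:ℤ)) = k' by omega, add_zero] at e
      rw [← e, mul_comm]
      refine mul_le_mul_of_nonneg_right ?_ w.le
      have : wt (-m) 0 r ≤ 2 ^ m := by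
        unfold wt
        rw [zpow_zero, mul_one, zpow_neg, zpow_natCast, ← inv_pow]
        refine pow_le_pow_left₀ (by positivity) ?_ m
        rw [inv_div, div_le_iff₀ hr]; linarith
      have : (0:ℝ) ≤ 2 ^ n := by positivity
      linarith
  refine ⟨fun L => ?_, fun L => ?_, hf.cont⟩
  · obtain ⟨C, hC, H⟩ := hf.bound L
    obtain ⟨C', hC', H'⟩ := hf'.bound L
    obtain ⟨M, hM, hw⟩ := key k k' l l' hk hl
    refine ⟨(C + C') * M, by positivity, fun s hs r hr t ht => ?_⟩
    have w := mul_nonneg hM (wt_pos k l' hr).le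
    rcases hw r hr with h | h
    · refine (H s hs r hr t ht).trans ((mul_le_mul_of_nonneg_left h hC).trans ?_)
      nlinarith
    · refine (H' s hs r hr t ht).trans ((mul_le_mul_of_nonneg_left h hC').trans ?_)
      nlinarith
  · obtain ⟨C, hC, H⟩ := hf.lip L
    obtain ⟨C', hC', H'⟩ := hf'.lip L
    obtain ⟨M, hM, hw⟩ := key (k - 1) (k' - 1) l l' (by omega) hl
    refine ⟨(C + C') * M, by positivity, fun s₁ s₂ h₁ h₂ x hx t ht => ?_⟩
    have w := mul_nonneg (norm_nonneg (s₁ - s₂)) (mul_nonneg hM (wt_pos (k - 1) l' hx.1).le)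
    rcases hw _ hx.1 with h | h
    · refine (H s₁ s₂ h₁ h₂ x hx t ht).trans
        ((mul_le_mul_of_nonneg_left h (by positivity)).trans ?_)
      nlinarith
    · refine (H' s₁ s₂ h₁ h₂ x hx t ht).trans
        ((mul_le_mul_of_nonneg_left h (by positivity)).trans ?_)
      nlinarith

/-- Composition with a locally Lipschitz function vanishing at 0. -/
lemma comp (hf : Weighted k l f) (hk : 0 ≤ k) (hl : 0 ≤ l) {D : Set ℝ} {φ : ℝ → ℝ}
    (hD : ∀ s r t, f s r t ∈ D) (h0 : (0 : ℝ) ∈ D) (hφ0 : φ 0 = 0)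
    (hφ : ∀ M : ℝ, ∃ K : ℝ, 0 ≤ K ∧ ∀ x ∈ D, ∀ y ∈ D, |x| ≤ M → |y| ≤ M →
      |φ x - φ y| ≤ K * |x - y|) (hc : ContinuousOn φ D) :
    Weighted k l (fun s r t => φ (f s r t)) := by
  have hw : ∀ r : ℝ, 0 < r → wt k l r ≤ 1 := fun r hr => by
    rw [← wt_zero_zero r]; exact wt_mono hk hl hr
  refine ⟨fun L => ?_, fun L => ?_, fun s => hc.comp (hf.cont s) fun p _ => hD _ _ _⟩
  · obtain ⟨C, hC, H⟩ := hf.bound L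
    obtain ⟨K, hK, h⟩ := hφ C
    refine ⟨K * C, by positivity, fun s hs r hr t ht => ?_⟩
    have b := H s hs r hr t ht
    have := h _ (hD s r t) 0 h0 (b.trans (mul_le_of_le_one_right hC (hw r hr))) (by simpa using hC)
    rw [hφ0, sub_zero, sub_zero] at this
    rw [mul_assoc]
    exact this.trans (mul_le_mul_of_nonneg_left b hK)
  · obtain ⟨C, hC, H⟩ := hf.bound L
    obtain ⟨C', hC', H'⟩ := hf.lip L
    obtain ⟨K, hK, h⟩ := hφ C
    refine ⟨K * C', by positivity, fun s₁ s₂ h₁ h₂ x hx t ht => ?_⟩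
    have b1 := (H s₁ h₁ _ hx.1 t ht).trans (mul_le_of_le_one_right hC (hw _ hx.1))
    have b2 := (H s₂ h₂ _ hx.2.1 t ht).trans (mul_le_of_le_one_right hC (hw _ hx.2.1))
    refine (h _ (hD _ _ _) _ (hD _ _ _) b1 b2).trans ?_
    rw [mul_assoc, mul_assoc, ← mul_assoc C']
    exact mul_le_mul_of_nonneg_left (H' s₁ s₂ h₁ h₂ x hx t ht) hK

lemma sin (hf : Weighted k l f) (hk : 0 ≤ k) (hl : 0 ≤ l) :
    Weighted k l (fun s r t => Real.sin (f s r t)) :=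
  hf.comp (φ := Real.sin) hk hl (D := univ) (fun _ _ _ => mem_univ _) (mem_univ _) Real.sin_zero
    (fun _ => ⟨1, zero_le_one, fun x _ y _ _ _ => by
      have := Real.lipschitzWith_sin.dist_le_mul x y
      simpa [Real.dist_eq] using this⟩) Real.continuous_sin.continuousOn

lemma cos (hf : Weighted k l f) (hk : 0 ≤ k) (hl : 0 ≤ l) :
    Weighted 0 0 (fun s r t => Real.cos (f s r t)) := by
  have h : Weighted k l (fun s r t => Real.cos (f s r t) - 1) :=
    hf.comp (φ := fun x => Real.cos x - 1) hk hl (D := univ) (fun _ _ _ => mem_univ _) (mem_univ _)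
      (by simp)
      (fun _ => ⟨1, zero_le_one, fun x _ y _ _ _ => by
        have := Real.lipschitzWith_cos.dist_le_mul x y
        simpa [Real.dist_eq] using this⟩) (by fun_prop)
  exact ((h.mono hk hl).add (const 1)).congr fun _ _ _ _ _ => by ring

lemma average (hf : Weighted k l f) :
    Weighted k l (fun s r _ => ∫ t in (0 : ℝ)..1, f s r t) := by
  have hint : ∀ s r, 0 < r → IntervalIntegrable (f s r) MeasureTheory.volume 0 1 := fun s r hr => by
    apply ContinuousOn.intervalIntegrable
    rw [uIcc_of_le zero_le_one]
    exact (hf.cont s).comp (f := fun t : ℝ => (r, t)) (by fun_prop) fun t ht => ⟨hr, ht⟩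
  refine ⟨fun L => ?_, fun L => ?_, fun s => ?_⟩
  · obtain ⟨C, hC, H⟩ := hf.bound L
    refine ⟨C, hC, fun s hs r hr _ _ => ?_⟩
    have := intervalIntegral.norm_integral_le_of_norm_le_const (a := 0) (b := 1) (f := f s r)
      (C := C * wt k l r) (fun t ht => by
        rw [uIoc_of_le zero_le_one] at ht
        exact H s hs r hr t ⟨ht.1.le, ht.2⟩)
    simpa using this
  · obtain ⟨C, hC, H⟩ := hf.lip L
    refine ⟨C, hC, fun s₁ s₂ h₁ h₂ x hx _ _ => ?_⟩
    rw [← intervalIntegral.integral_sub (hint _ _ hx.1) (hint _ _ hx.2.1)]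
    have := intervalIntegral.norm_integral_le_of_norm_le_const (a := 0) (b := 1)
      (f := fun t => f s₁ (rad s₁ x) t - f s₂ (rad s₂ x) t)
      (C := C * ‖s₁ - s₂‖ * wt (k - 1) l (rad s₁ x)) (fun t ht => by
        rw [uIoc_of_le zero_le_one] at ht
        exact H s₁ s₂ h₁ h₂ x hx t ⟨ht.1.le, ht.2⟩)
    simpa using this
  · have h1 : ContinuousOn (fun r : ℝ => ∫ t in (0 : ℝ)..1, f s r t) (Ioi 0) := by
      have h2 : Continuous fun p : ℝ × ℝ =>
          f s (Real.exp p.1) (projIcc (0 : ℝ) 1 zero_le_one p.2) := by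
        refine (hf.cont s).comp_continuous
          (f := fun p : ℝ × ℝ => (Real.exp p.1, (projIcc (0 : ℝ) 1 zero_le_one p.2 : ℝ))) ?_ ?_
        · exact (Real.continuous_exp.comp continuous_fst).prodMk
            (continuous_subtype_val.comp (continuous_projIcc.comp continuous_snd))
        · exact fun p => ⟨Real.exp_pos _, (projIcc (0 : ℝ) 1 zero_le_one p.2).2⟩
      have h3 := intervalIntegral.continuous_parametric_intervalIntegral_of_continuous'
        (μ := MeasureTheory.volume)
        (f := fun p t => f s (Real.exp p) (projIcc (0 : ℝ) 1 zero_le_one t)) h2 0 1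
      refine (h3.comp_continuousOn (Real.continuousOn_log.mono fun x hx => (mem_Ioi.1 hx).ne')).congr
        fun r hr => ?_
      refine intervalIntegral.integral_congr fun t ht => ?_
      rw [uIcc_of_le zero_le_one] at ht
      simp only [Real.exp_log (mem_Ioi.1 hr), projIcc_of_mem zero_le_one ht]
    exact h1.comp continuousOn_fst fun p hp => hp.1

end Weighted

end

/-! ### Radial integrals of weighted functionals -/

section

open State

/-- The extension of a function of the radius by zero to nonpositive arguments. -/
def extZero (f : ℝ → ℝ) (r : ℝ) : ℝ := if 0 < r then f r else 0

lemma extZero_of_pos {f : ℝ → ℝ} {r : ℝ} (hr : 0 < r) : extZero f r = f r := if_pos hr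

lemma extZero_of_nonpos {f : ℝ → ℝ} {r : ℝ} (hr : r ≤ 0) : extZero f r = 0 := if_neg hr.not_gt

lemma extZero_nonneg {f : ℝ → ℝ} (hf : ∀ r, 0 < r → 0 ≤ f r) (r : ℝ) : 0 ≤ extZero f r := by
  unfold extZero; split_ifs with h
  · exact hf r h
  · exact le_rfl

lemma continuous_wt_max {k : ℤ} (hk : 0 ≤ k) (l : ℤ) : Continuous fun r : ℝ => wt k l (max 0 r) := by
  have h : Continuous fun r : ℝ => 1 + max 0 r := by fun_prop
  have h0 : ∀ r : ℝ, 0 < 1 + max 0 r := fun r => by positivity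
  unfold wt
  refine Continuous.mul ?_ ?_
  · exact Continuous.zpow₀ (by fun_prop (disch := intro r; exact (h0 r).ne')) k fun _ => Or.inr hk
  · refine Continuous.zpow₀ (Continuous.inv₀ (Real.continuous_sqrt.comp h) fun r => ?_) l
      fun r => Or.inl ?_
    · exact (Real.sqrt_pos.2 (h0 r)).ne'
    · exact inv_ne_zero (Real.sqrt_pos.2 (h0 r)).ne'

lemma integral_wt_three_le {r : ℝ} (hr : 0 < r) :
    ∫ x in (0 : ℝ)..r, wt 0 3 (max 0 x) ≤ 2 * wt 1 0 r := by
  have h : ∀ x ∈ uIcc 0 r, HasDerivAt (fun x : ℝ => -2 * (√(1 + x))⁻¹) (wt 0 3 (max 0 x)) x := by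
    intro x hx
    rw [uIcc_of_le hr.le] at hx
    have hx0 : 0 < 1 + x := by linarith [hx.1]
    have h1 := (((hasDerivAt_id x).const_add 1).sqrt hx0.ne').inv (Real.sqrt_pos.2 hx0).ne'
    refine (h1.const_mul (-2)).congr_deriv ?_
    rw [max_eq_right hx.1]
    unfold wt
    have := Real.sqrt_pos.2 hx0
    rw [zpow_zero, one_mul, show (3:ℤ) = ((3:ℕ):ℤ) by rfl, zpow_natCast]
    simp only [id]
    field_simp
  rw [intervalIntegral.integral_eq_sub_of_hasDerivAt h
    ((continuous_wt_max le_rfl 3).intervalIntegrable _ _), wt_one_zero]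
  have h1 : (1 + r)⁻¹ ≤ (√(1 + r))⁻¹ := by
    apply inv_anti₀ (by positivity)
    rw [Real.sqrt_le_left (by positivity)]; nlinarith
  have h2 : r / (1 + r) = 1 - (1 + r)⁻¹ := by field_simp; ring
  rw [h2]; simp; linarith

lemma integral_wt_one_le {r : ℝ} (hr : 0 < r) :
    ∫ x in (0 : ℝ)..r, wt 0 1 (max 0 x) ≤ 2 * wt 1 (-1) r := by
  have h : ∀ x ∈ uIcc 0 r, HasDerivAt (fun x : ℝ => 2 * √(1 + x)) (wt 0 1 (max 0 x)) x := by
    intro x hx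
    rw [uIcc_of_le hr.le] at hx
    have hx0 : 0 < 1 + x := by linarith [hx.1]
    have h1 := (((hasDerivAt_id x).const_add 1).sqrt hx0.ne')
    refine (h1.const_mul 2).congr_deriv ?_
    rw [max_eq_right hx.1]
    unfold wt
    have := Real.sqrt_pos.2 hx0
    rw [zpow_zero, one_mul, zpow_one]
    simp only [id]
    field_simp
  rw [intervalIntegral.integral_eq_sub_of_hasDerivAt h
    ((continuous_wt_max le_rfl 1).intervalIntegrable _ _)]
  have h0 : 0 < √(1 + r) := by positivity
  have e : wt 1 (-1) r = r / √(1 + r) := by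
    unfold wt
    rw [zpow_one, zpow_neg, zpow_one, inv_inv, div_mul_eq_mul_div, div_eq_div_iff (by positivity) (by positivity),
      mul_assoc, Real.mul_self_sqrt (by positivity)]
  have h1 : √(1 + r) - 1 ≤ r / √(1 + r) := by
    rw [le_div_iff₀ h0]
    nlinarith [Real.mul_self_sqrt (show 0 ≤ 1 + r by positivity), Real.one_le_sqrt.2 (show 1 ≤ 1 + r by linarith)]
  rw [e]; simp; linarith

/-- A primitive gains one power at the centre.  At infinity it stays bounded if the weight decays like
`r^(-3/2)` or faster, and it grows like `r^(1/2)` for the weight `r^(-1/2)`. -/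
lemma integral_wt_le {k l l' : ℤ} (hk : 0 ≤ k) (h : 3 ≤ l ∧ l' = 0 ∨ l = 1 ∧ l' = -1) {r : ℝ}
    (hr : 0 < r) : ∫ x in (0 : ℝ)..r, wt k l (max 0 x) ≤ 2 * wt (k + 1) l' r := by
  obtain ⟨m, hm, hm'⟩ : ∃ m : ℤ, m ≤ l ∧
      ∫ x in (0 : ℝ)..r, wt 0 m (max 0 x) ≤ 2 * wt 1 l' r := by
    rcases h with ⟨h1, h2⟩ | ⟨h1, h2⟩
    · exact ⟨3, h1, h2 ▸ integral_wt_three_le hr⟩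
    · exact ⟨1, h1.ge, h2 ▸ integral_wt_one_le hr⟩
  have hb : ∀ x ∈ Icc 0 r, wt k l (max 0 x) ≤ wt k 0 r * wt 0 m (max 0 x) := by
    intro x hx
    rw [max_eq_right hx.1]
    unfold wt
    have hx0 := hx.1
    simp only [zpow_zero, mul_one, one_mul]
    have h2 : (√(1 + x))⁻¹ ≤ 1 := by
      apply inv_le_one_of_one_le₀; rw [Real.one_le_sqrt]; linarith
    have h3 : x / (1 + x) ≤ r / (1 + r) := by
      rw [div_le_div_iff₀ (by positivity) (by positivity)]; nlinarith [hx.2]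
    have := zpow_le_zpow_right_of_le_one₀ (by positivity) h2 hm
    have := zpow_le_zpow_left₀ hk (by positivity) h3
    gcongr
  calc _ ≤ ∫ x in (0 : ℝ)..r, wt k 0 r * wt 0 m (max 0 x) :=
        intervalIntegral.integral_mono_on hr.le ((continuous_wt_max hk l).intervalIntegrable _ _)
          (((continuous_wt_max le_rfl m).const_mul _).intervalIntegrable _ _) hb
    _ = wt k 0 r * ∫ x in (0 : ℝ)..r, wt 0 m (max 0 x) := intervalIntegral.integral_const_mul _ _
    _ ≤ wt k 0 r * (2 * wt 1 l' r) := by gcongr; exact (wt_pos _ _ hr).le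
    _ = 2 * (wt k 0 r * wt 1 l' r) := by ring
    _ = _ := by rw [wt_mul _ _ _ _ hr, zero_add]

namespace State

lemma rad_neg_le {s : State} {L : ℝ} (h : ‖s‖ ≤ L) : rad s (-(L * Real.exp L)) ≤ 0 := by
  have hL : 0 ≤ L := (norm_nonneg s).trans h
  have h1 := mul_sub_le_rad_sub h (show -(L * Real.exp L) ≤ 0 by simp; positivity)
  have hE : Real.exp (-L) * (0 - -(L * Real.exp L)) = L := by
    rw [Real.exp_neg]; field_simp; ring
  rw [hE, rad_zero] at h1
  linarith [le_abs_self s.1, abs_fst_le h]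

end State

namespace Weighted

variable {k l k' l' : ℤ} {f g : State → ℝ → ℝ}

lemma continuous_extZero (hf : Weighted k l fun s r _ => f s r) (hk : 1 ≤ k) (s : State) :
    Continuous (extZero (f s)) := by
  rw [continuous_iff_continuousAt]
  intro r
  rcases lt_trichotomy r 0 with h | h | h
  · have : extZero (f s) =ᶠ[𝓝 r] fun _ => 0 := by
      filter_upwards [Iio_mem_nhds h] with x hx using extZero_of_nonpos (le_of_lt hx)
    exact continuousAt_const.congr this.symm
  · subst h
    obtain ⟨C, hC, H⟩ := hf.bound ‖s‖
    have hc := (continuous_wt_max (k := 1) (by norm_num) l).tendsto 0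
    have h0 : wt 1 l (max 0 0) = 0 := by simp [wt]
    rw [h0] at hc
    have hc' := hc.const_mul C
    rw [mul_zero] at hc'
    rw [ContinuousAt, extZero_of_nonpos le_rfl]
    refine squeeze_zero_norm (fun x => ?_) hc'
    unfold extZero
    split_ifs with hx
    · rw [max_eq_right hx.le]
      exact (H s le_rfl x hx 0 (by simp)).trans
        (mul_le_mul_of_nonneg_left (wt_mono hk le_rfl hx) hC)
    · rw [norm_zero, max_eq_left (not_lt.1 hx)]
      simp [wt]
  · have : extZero (f s) =ᶠ[𝓝 r] f s := by
      filter_upwards [Ioi_mem_nhds h] with x hx using extZero_of_pos hx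
    refine ContinuousAt.congr ?_ this.symm
    have h2 : ContinuousOn (f s) (Ioi 0) :=
      (hf.cont s).comp (f := fun r : ℝ => (r, (0:ℝ))) (by fun_prop) fun t ht => ⟨ht, by simp⟩
    exact h2.continuousAt (Ioi_mem_nhds h)

/-- The Lipschitz bound without comparability of the radii: if they are not comparable, both are
bounded by a multiple of the displacement, and so are the values of `f` divided by
`wt (k - 1) l`. -/
lemma abs_extZero_sub_le (hf : Weighted k l fun s r _ => f s r) (L : ℝ) :
    ∃ C : ℝ, 0 ≤ C ∧ ∀ s₁ s₂ : State, ‖s₁‖ ≤ L → ‖s₂‖ ≤ L → ∀ x : ℝ,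
      |extZero (f s₁) (rad s₁ x) - extZero (f s₂) (rad s₂ x)| ≤ C * ‖s₁ - s₂‖ *
        (extZero (wt (k - 1) l) (rad s₁ x) + extZero (wt (k - 1) l) (rad s₂ x)) := by
  obtain ⟨C, hC, H⟩ := hf.bound L
  obtain ⟨D, hD, I⟩ := hf.lip L
  set M : ℝ := 2 * (Real.exp |L| * ((1 + |L|) * Real.exp |L|))
  have hM : 0 ≤ M := by positivity
  have nn : ∀ r, 0 ≤ extZero (wt (k - 1) l) r := extZero_nonneg fun r hr => (wt_pos _ _ hr).le
  -- a value at a radius bounded by the displacement is itself controlled by the displacement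
  have small : ∀ s₁ s₂ : State, ‖s₁‖ ≤ L → ‖s₂‖ ≤ L → ∀ x : ℝ, ∀ s : State, ‖s‖ ≤ L →
      0 < rad s x → rad s x ≤ 2 * |rad s₁ x - rad s₂ x| →
      |extZero (f s) (rad s x)| ≤ C * M * ‖s₁ - s₂‖ * extZero (wt (k - 1) l) (rad s x) := by
    intro s₁ s₂ h₁ h₂ x s hs hr hle
    have e1 := abs_rad_sub_le (h₁.trans (le_abs_self L)) (h₂.trans (le_abs_self L)) x
    have e2 := one_add_abs_le (hs.trans (le_abs_self L)) hr.le
    rw [extZero_of_pos hr, extZero_of_pos hr]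
    have e3 : wt 1 0 (rad s x) ≤ M * ‖s₁ - s₂‖ := by
      rw [wt_one_zero, div_le_iff₀ (by positivity)]
      calc rad s x ≤ 2 * (Real.exp |L| * ‖s₁ - s₂‖ * ((1 + |L|) * Real.exp |L| * (1 + rad s x))) := by
            refine hle.trans ?_
            gcongr
            refine e1.trans ?_
            gcongr
        _ = _ := by simp only [M]; ring
    have w := wt_mul 1 0 (k - 1) l hr
    rw [show 1 + (k - 1) = k by ring, zero_add] at w
    have := H s hs _ hr 0 (by simp)
    rw [← w] at this
    calc _ ≤ C * (wt 1 0 (rad s x) * wt (k - 1) l (rad s x)) := this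
      _ ≤ C * (M * ‖s₁ - s₂‖ * wt (k - 1) l (rad s x)) := by
          gcongr; exact (wt_pos _ _ hr).le
      _ = _ := by ring
  have split : ∀ s₁ s₂ : State, ‖s₁‖ ≤ L → ‖s₂‖ ≤ L → ∀ x : ℝ,
      (∀ s : State, s = s₁ ∨ s = s₂ → 0 < rad s x → rad s x ≤ 2 * |rad s₁ x - rad s₂ x|) →
      |extZero (f s₁) (rad s₁ x) - extZero (f s₂) (rad s₂ x)| ≤ (C * M + D) * ‖s₁ - s₂‖ *
        (extZero (wt (k - 1) l) (rad s₁ x) + extZero (wt (k - 1) l) (rad s₂ x)) := by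
    intro s₁ s₂ h₁ h₂ x hx
    have one : ∀ s : State, s = s₁ ∨ s = s₂ → ‖s‖ ≤ L → |extZero (f s) (rad s x)| ≤
        C * M * ‖s₁ - s₂‖ * extZero (wt (k - 1) l) (rad s x) := by
      intro s hs hsL
      rcases lt_or_ge 0 (rad s x) with h | h
      · exact small s₁ s₂ h₁ h₂ x s hsL h (hx s hs h)
      · rw [extZero_of_nonpos h, extZero_of_nonpos h]; simp
    refine (abs_sub _ _).trans ?_
    have a1 := one s₁ (Or.inl rfl) h₁
    have a2 := one s₂ (Or.inr rfl) h₂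
    have : 0 ≤ D * ‖s₁ - s₂‖ *
        (extZero (wt (k - 1) l) (rad s₁ x) + extZero (wt (k - 1) l) (rad s₂ x)) := by
      have := nn (rad s₁ x); have := nn (rad s₂ x); positivity
    linarith
  refine ⟨C * M + D, by positivity, fun s₁ s₂ h₁ h₂ x => ?_⟩
  by_cases hcomp : Comparable (rad s₁ x) (rad s₂ x)
  · have a := I s₁ s₂ h₁ h₂ x hcomp 0 (by simp)
    rw [extZero_of_pos hcomp.1, extZero_of_pos hcomp.2.1, extZero_of_pos hcomp.1,
      extZero_of_pos hcomp.2.1]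
    refine a.trans ?_
    have w1 := (wt_pos (k - 1) l hcomp.1).le
    have w2 := (wt_pos (k - 1) l hcomp.2.1).le
    have n := norm_nonneg (s₁ - s₂)
    have q : 0 ≤ C * M * ‖s₁ - s₂‖ * (wt (k - 1) l (rad s₁ x) + wt (k - 1) l (rad s₂ x)) := by
      positivity
    have q2 : 0 ≤ D * ‖s₁ - s₂‖ * wt (k - 1) l (rad s₂ x) := by positivity
    linarith
  · refine split s₁ s₂ h₁ h₂ x ?_
    have d1 := le_abs_self (rad s₁ x - rad s₂ x)
    have d2 := neg_abs_le (rad s₁ x - rad s₂ x)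
    rintro s (rfl | rfl) hs
    · by_contra hlt
      exact hcomp ⟨hs, by linarith, by linarith, by linarith⟩
    · by_contra hlt
      exact hcomp ⟨by linarith, hs, by linarith, by linarith⟩

/-- Radial integrals in terms of the labels.  Any starting label with nonpositive radius will do, so
that two states can be integrated over the same interval of labels. -/
lemma integral_extZero (hf : Weighted k l fun s r _ => f s r) (hk : 1 ≤ k) {s t : State} {a x : ℝ}
    (ha : rad s a ≤ 0) (hx : 0 ≤ rad s x) :
    ∫ y in a..x, extZero (f t) (rad s y) * jac s y = ∫ r in (0 : ℝ)..rad s x, f t r := by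
  have hc := hf.continuous_extZero hk t
  have h1 := intervalIntegral.integral_comp_mul_deriv (a := a) (b := x) (f := rad s) (f' := jac s)
    (g := extZero (f t)) (fun y _ => hasDerivAt_rad s y) (continuous_jac s).continuousOn hc
  simp only [Function.comp] at h1
  rw [h1, ← intervalIntegral.integral_add_adjacent_intervals (hc.intervalIntegrable _ 0)
    (hc.intervalIntegrable 0 _)]
  have h2 : ∫ r in rad s a..0, extZero (f t) r = 0 := by
    rw [intervalIntegral.integral_congr (g := fun _ => (0:ℝ)), intervalIntegral.integral_zero]
    intro r hr
    rw [uIcc_of_le ha] at hr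
    exact extZero_of_nonpos hr.2
  rw [h2, zero_add]
  refine intervalIntegral.integral_congr_ae (Filter.Eventually.of_forall fun r hr => ?_)
  rw [uIoc_of_le hx] at hr
  exact extZero_of_pos hr.1

lemma intervalIntegrable_extZero_wt {k : ℤ} (hk : 0 ≤ k) (l : ℤ) (s : State) (a b : ℝ) :
    IntervalIntegrable (fun y => extZero (wt k l) (rad s y)) MeasureTheory.volume a b := by
  have hc : Continuous fun y => wt k l (max 0 (rad s y)) :=
    (continuous_wt_max hk l).comp (continuous_rad s)
  have e : (fun y => extZero (wt k l) (rad s y)) =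
      (Ioi (label s 0)).indicator fun y => wt k l (max 0 (rad s y)) := by
    funext y
    by_cases h : 0 < rad s y
    · rw [extZero_of_pos h, indicator_of_mem (show y ∈ Ioi _ from (label_lt_iff s 0 y).2 h),
        max_eq_right h.le]
    · rw [extZero_of_nonpos (not_lt.1 h), indicator_of_notMem]
      exact fun h' => h ((label_lt_iff s 0 y).1 h')
  rw [e]
  exact ⟨(hc.intervalIntegrable a b).1.indicator measurableSet_Ioi,
    (hc.intervalIntegrable a b).2.indicator measurableSet_Ioi⟩

lemma integral_extZero_wt_le {k : ℤ} (hk : 0 ≤ k) (h : 3 ≤ l ∧ l' = 0 ∨ l = 1 ∧ l' = -1)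
    {s : State} {L : ℝ} (hs : ‖s‖ ≤ L) {a x : ℝ} (ha : rad s a ≤ 0) (hx : 0 < rad s x) :
    ∫ y in a..x, extZero (wt k l) (rad s y) ≤ Real.exp L * 2 * wt (k + 1) l' (rad s x) := by
  set c := label s 0
  have hc : Continuous fun y => wt k l (max 0 (rad s y)) :=
    (continuous_wt_max hk l).comp (continuous_rad s)
  have hac : a ≤ c := by
    rw [← (strictMono_rad s).le_iff_le]; simpa [c] using ha
  have hcx : c ≤ x := by
    rw [← (strictMono_rad s).le_iff_le]; simpa [c] using hx.le
  have hI := fun p q => intervalIntegrable_extZero_wt hk l s p q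
  rw [← intervalIntegral.integral_add_adjacent_intervals (hI a c) (hI c x)]
  have e1 : ∫ y in a..c, extZero (wt k l) (rad s y) = 0 := by
    rw [intervalIntegral.integral_congr (g := fun _ => (0:ℝ)), intervalIntegral.integral_zero]
    intro y hy
    rw [uIcc_of_le hac] at hy
    refine extZero_of_nonpos ?_
    have := (strictMono_rad s).monotone hy.2
    simpa [c] using this
  rw [e1, zero_add]
  have h1 := intervalIntegral.integral_comp_mul_deriv (a := c) (b := x) (f := rad s) (f' := jac s)
    (g := fun r => wt k l (max 0 r)) (fun y _ => hasDerivAt_rad s y) (continuous_jac s).continuousOn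
    (continuous_wt_max hk l)
  simp only [Function.comp, c, rad_label] at h1
  have e2 := integral_wt_le hk h hx
  rw [← h1] at e2
  calc ∫ y in c..x, extZero (wt k l) (rad s y)
      ≤ ∫ y in c..x, Real.exp L * (wt k l (max 0 (rad s y)) * jac s y) := by
        refine intervalIntegral.integral_mono_on hcx (hI c x)
          (((hc.mul (continuous_jac s)).const_mul _).intervalIntegrable _ _) fun y hy => ?_
        have hr : 0 ≤ rad s y := by
          have := (strictMono_rad s).monotone hy.1
          simpa [c] using this
        have w : 0 ≤ wt k l (max 0 (rad s y)) := by
          rw [max_eq_right hr]; unfold wt; positivity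
        have e3 : extZero (wt k l) (rad s y) ≤ wt k l (max 0 (rad s y)) := by
          unfold extZero
          split_ifs with h0
          · rw [max_eq_right hr]
          · exact w
        have e4 : 1 ≤ Real.exp L * jac s y := by
          have := mul_le_mul_of_nonneg_left (le_jac hs y) (Real.exp_pos L).le
          rwa [← Real.exp_add, add_neg_cancel, Real.exp_zero] at this
        calc _ ≤ wt k l (max 0 (rad s y)) := e3
          _ ≤ (Real.exp L * jac s y) * wt k l (max 0 (rad s y)) := le_mul_of_one_le_left w e4
          _ = _ := by ring
    _ = Real.exp L * ∫ y in c..x, wt k l (max 0 (rad s y)) * jac s y :=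
        intervalIntegral.integral_const_mul _ _
    _ ≤ Real.exp L * (2 * wt (k + 1) l' (rad s x)) := by gcongr
    _ = _ := by ring

lemma abs_extZero_le (hf : Weighted k l fun s r _ => f s r) (L : ℝ) :
    ∃ C : ℝ, 0 ≤ C ∧ ∀ s : State, ‖s‖ ≤ L → ∀ r : ℝ,
      |extZero (f s) r| ≤ C * extZero (wt k l) r := by
  obtain ⟨C, hC, H⟩ := hf.bound L
  refine ⟨C, hC, fun s hs r => ?_⟩
  rcases lt_or_ge 0 r with h | h
  · rw [extZero_of_pos h, extZero_of_pos h]; exact H s hs r h 0 (by simp)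
  · rw [extZero_of_nonpos h, extZero_of_nonpos h]; simp

/-- The primitive in the radius of a weighted functional. -/
lemma integral (hf : Weighted k l fun s r _ => f s r) (hk : 1 ≤ k)
    (hl : 3 ≤ l ∧ l' = 0 ∨ l = 1 ∧ l' = -1) :
    Weighted (k + 1) l' (fun s r _ => ∫ x in (0 : ℝ)..r, f s x) := by
  have hext : ∀ s r, 0 < r → ∫ x in (0 : ℝ)..r, f s x = ∫ x in (0 : ℝ)..r, extZero (f s) x := by
    intro s r hr
    refine intervalIntegral.integral_congr_ae (Filter.Eventually.of_forall fun x hx => ?_)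
    rw [uIoc_of_le hr.le] at hx
    exact (extZero_of_pos hx.1).symm
  refine ⟨fun L => ?_, fun L => ?_, fun s => ?_⟩
  · obtain ⟨C, hC, H⟩ := hf.bound L
    refine ⟨C * 2, by positivity, fun s hs r hr _ _ => ?_⟩
    have := intervalIntegral.norm_integral_le_of_norm_le (μ := MeasureTheory.volume) (a := 0)
      (b := r) hr.le (f := f s) (g := fun x => C * wt k l (max 0 x))
      (Filter.Eventually.of_forall fun x hx => by
        rw [max_eq_right hx.1.le]; exact H s hs x hx.1 0 (by simp))
      (((continuous_wt_max (by omega) l).const_mul C).intervalIntegrable _ _)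
    rw [intervalIntegral.integral_const_mul] at this
    calc _ ≤ _ := this
      _ ≤ C * (2 * wt (k + 1) l' r) := by gcongr; exact integral_wt_le (by omega) hl hr
      _ = _ := by ring
  · obtain ⟨C, hC, H⟩ := hf.abs_extZero_le L
    obtain ⟨D, hD, I⟩ := hf.abs_extZero_sub_le L
    set M : ℝ := 2 ^ (k + 1 - 1).natAbs * 2 ^ l'.natAbs
    have hM : 0 ≤ M := by positivity
    set A := Real.exp L * D + C * Real.exp L
    have hA : 0 ≤ A := by positivity
    refine ⟨(A * (Real.exp L * 2)) * (1 + M), by positivity, fun s₁ s₂ h₁ h₂ x hx _ _ => ?_⟩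
    have hL : 0 ≤ L := (norm_nonneg _).trans h₁
    set a := -(L * Real.exp L)
    have ha₁ : rad s₁ a ≤ 0 := rad_neg_le h₁
    have ha₂ : rad s₂ a ≤ 0 := rad_neg_le h₂
    have hax : a ≤ x := by
      rw [← (strictMono_rad s₁).le_iff_le]; linarith [hx.1]
    have hc : ∀ s, Continuous fun y => extZero (f s) (rad s y) * jac s y :=
      fun s => ((hf.continuous_extZero hk s).comp (continuous_rad s)).mul (continuous_jac s)
    have hI := fun s => intervalIntegrable_extZero_wt (k := k - 1) (by omega) l s a x
    rw [← hf.integral_extZero hk ha₁ hx.1.le, ← hf.integral_extZero hk ha₂ hx.2.1.le,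
      ← intervalIntegral.integral_sub ((hc s₁).intervalIntegrable _ _)
        ((hc s₂).intervalIntegrable _ _)]
    have hpt : ∀ y : ℝ, |extZero (f s₁) (rad s₁ y) * jac s₁ y - extZero (f s₂) (rad s₂ y) * jac s₂ y|
        ≤ A * ‖s₁ - s₂‖ *
        (extZero (wt (k - 1) l) (rad s₁ y) + extZero (wt (k - 1) l) (rad s₂ y)) := by
      intro y
      have b1 := I s₁ s₂ h₁ h₂ y
      have b2 := H s₂ h₂ (rad s₂ y)
      have b3 := abs_jac_sub_le h₁ h₂ y
      have b4 := jac_le h₁ y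
      have nn : ∀ r, 0 ≤ extZero (wt (k - 1) l) r := extZero_nonneg fun r hr => (wt_pos _ _ hr).le
      have n1 := nn (rad s₁ y)
      have n2 := nn (rad s₂ y)
      have b5 : extZero (wt k l) (rad s₂ y) ≤ extZero (wt (k - 1) l) (rad s₂ y) := by
        unfold extZero; split_ifs with h
        · exact wt_mono (by omega) le_rfl h
        · exact le_rfl
      calc _ = |(extZero (f s₁) (rad s₁ y) - extZero (f s₂) (rad s₂ y)) * jac s₁ y
            + extZero (f s₂) (rad s₂ y) * (jac s₁ y - jac s₂ y)| := by congr 1; ring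
        _ ≤ |extZero (f s₁) (rad s₁ y) - extZero (f s₂) (rad s₂ y)| * jac s₁ y
            + |extZero (f s₂) (rad s₂ y)| * |jac s₁ y - jac s₂ y| := by
            refine (abs_add_le _ _).trans ?_
            rw [abs_mul, abs_mul, abs_of_pos (jac_pos s₁ y)]
        _ ≤ (D * ‖s₁ - s₂‖ * (extZero (wt (k - 1) l) (rad s₁ y)
              + extZero (wt (k - 1) l) (rad s₂ y))) * Real.exp L
            + (C * extZero (wt (k - 1) l) (rad s₂ y)) * (Real.exp L * ‖s₁ - s₂‖) := by
            have := (jac_pos s₁ y).le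
            have b6 := b2.trans (mul_le_mul_of_nonneg_left b5 hC)
            gcongr
        _ ≤ _ := by
            have : 0 ≤ C * Real.exp L * ‖s₁ - s₂‖ * extZero (wt (k - 1) l) (rad s₁ y) := by
              positivity
            simp only [A]; linarith
    have h3 := intervalIntegral.norm_integral_le_of_norm_le (μ := MeasureTheory.volume) hax
      (f := fun y => extZero (f s₁) (rad s₁ y) * jac s₁ y - extZero (f s₂) (rad s₂ y) * jac s₂ y)
      (Filter.Eventually.of_forall fun y _ => hpt y) (((hI s₁).add (hI s₂)).const_mul _)
    rw [intervalIntegral.integral_const_mul] at h3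
    refine h3.trans ?_
    have e : ∫ y in a..x, (extZero (wt (k - 1) l) (rad s₁ y) + extZero (wt (k - 1) l) (rad s₂ y))
        = (∫ y in a..x, extZero (wt (k - 1) l) (rad s₁ y))
          + ∫ y in a..x, extZero (wt (k - 1) l) (rad s₂ y) :=
      intervalIntegral.integral_add (hI s₁) (hI s₂)
    rw [e]
    have i1 := integral_extZero_wt_le (k := k - 1) (by omega) hl h₁ ha₁ hx.1
    have i2 := integral_extZero_wt_le (k := k - 1) (by omega) hl h₂ ha₂ hx.2.1
    rw [show k - 1 + 1 = k + 1 - 1 by ring] at i1 i2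
    have i3 := wt_le_of_comparable (k + 1 - 1) l' hx
    have hw := (wt_pos (k + 1 - 1) l' hx.1).le
    calc _ ≤ A * ‖s₁ - s₂‖ * (Real.exp L * 2 * wt (k + 1 - 1) l' (rad s₁ x)
          + Real.exp L * 2 * (M * wt (k + 1 - 1) l' (rad s₁ x))) := by
          gcongr
          exact i2.trans (by gcongr)
      _ = _ := by ring
  · have h1 : ContinuousOn (fun r : ℝ => ∫ x in (0 : ℝ)..r, f s x) (Ioi 0) := by
      have : Continuous fun r : ℝ => ∫ x in (0 : ℝ)..r, extZero (f s) x :=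
        intervalIntegral.continuous_primitive
          (fun a b => (hf.continuous_extZero hk s).intervalIntegrable a b) 0
      exact this.continuousOn.congr fun r hr => hext s r hr
    exact h1.comp continuousOn_fst fun p hp => hp.1

lemma zeta : Weighted 0 5 (fun s r _ => State.zeta s r) := by
  have hM : ∀ L : ℝ, ∀ s : State, ‖s‖ ≤ L → ∀ x, 0 ≤ rad s x →
      (√(1 + |x|))⁻¹ ≤ √((1 + |L|) * Real.exp |L|) * (√(1 + rad s x))⁻¹ := by
    intro L s hs x hx
    have := one_add_rad_le (hs.trans (le_abs_self L)) x
    rw [abs_of_nonneg hx] at this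
    rw [← div_eq_mul_inv, inv_eq_one_div, div_le_div_iff₀ (by positivity) (by positivity), one_mul,
      ← Real.sqrt_mul (by positivity)]
    exact Real.sqrt_le_sqrt this
  refine ⟨fun L => ?_, fun L => ?_, fun s =>
    (continuous_zeta s).continuousOn.comp continuousOn_fst fun _ _ => mem_univ _⟩
  · refine ⟨|L| * √((1 + |L|) * Real.exp |L|) ^ 5, by positivity, fun s hs r hr t _ => ?_⟩
    have h1 := hM L s hs (label s r) (by simpa using hr.le)
    rw [rad_label] at h1
    rw [State.zeta, wt_zero_five, abs_mul, mul_assoc, ← mul_pow,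
      abs_of_pos (show 0 < ((√(1 + |label s r|))⁻¹) ^ 5 by positivity)]
    have := abs_amp_le (hs.trans (le_abs_self L)) (label s r)
    gcongr
  · refine ⟨√((1 + |L|) * Real.exp |L|) ^ 5, by positivity, fun s₁ s₂ h₁ h₂ x hx t _ => ?_⟩
    unfold State.zeta
    rw [label_rad, label_rad, ← sub_mul, abs_mul,
      abs_of_pos (show 0 < ((√(1 + |x|))⁻¹) ^ 5 by positivity)]
    have h1 := hM L s₁ h₁ x hx.1.le
    have h2 : |s₁.2.2 x - s₂.2.2 x| ≤ ‖s₁ - s₂‖ := abs_amp_le (s := s₁ - s₂) le_rfl x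
    have h3 := wt_mono (k := 0) (l := 5) (k' := 0 - 1) (l' := 5) (by norm_num) le_rfl hx.1
    rw [wt_zero_five] at h3
    calc _ ≤ ‖s₁ - s₂‖ * (√((1 + |L|) * Real.exp |L|) * (√(1 + rad s₁ x))⁻¹) ^ 5 := by gcongr
      _ = √((1 + |L|) * Real.exp |L|) ^ 5 * ‖s₁ - s₂‖ * (√(1 + rad s₁ x))⁻¹ ^ 5 := by ring
      _ ≤ _ := by gcongr

end Weighted

end

section

/-! ### The kernel `√(r² + 2 sin² t)` and its primitives in `t` -/

lemma continuousOn_integral_kernel {k : ℝ → ℝ → ℝ}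
    (hk : ContinuousOn (fun p : ℝ × ℝ => k p.1 p.2) (Ioi 0 ×ˢ univ)) :
    ContinuousOn (fun p : ℝ × ℝ => ∫ t in (0 : ℝ)..p.2, k p.1 t) (Ioi 0 ×ˢ univ) := by
  have h1 : Continuous (Function.uncurry fun p t : ℝ => k (Real.exp p) t) :=
    hk.comp_continuous (f := fun p : ℝ × ℝ => (Real.exp p.1, p.2)) (by fun_prop)
      fun p => ⟨Real.exp_pos _, mem_univ _⟩
  have h2 := intervalIntegral.continuous_parametric_primitive_of_continuous
    (μ := MeasureTheory.volume) (a₀ := 0) h1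
  have h3 : ContinuousOn (fun p : ℝ × ℝ => (Real.log p.1, p.2)) (Ioi 0 ×ˢ univ) :=
    ((Real.continuousOn_log.mono fun x hx => (mem_Ioi.1 hx).ne').comp continuousOn_fst
      fun p hp => hp.1).prodMk continuousOn_snd
  refine (h2.comp_continuousOn h3).congr fun p hp => ?_
  simp only [Function.comp, Real.exp_log (show 0 < p.1 from hp.1)]

/-- Joint differentiability of `(r, y) ↦ ∫₀ʸ k(r, t) dt` for `r > 0`. -/
lemma hasFDerivAt_integral_kernel {k k' : ℝ → ℝ → ℝ}
    (hd : ∀ r, 0 < r → ∀ t, HasDerivAt (fun r => k r t) (k' r t) r)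
    (hk : ContinuousOn (fun p : ℝ × ℝ => k p.1 p.2) (Ioi 0 ×ˢ univ))
    (hk' : ContinuousOn (fun p : ℝ × ℝ => k' p.1 p.2) (Ioi 0 ×ˢ univ)) {r : ℝ} (hr : 0 < r)
    (y : ℝ) :
    HasFDerivAt (fun p : ℝ × ℝ => ∫ t in (0 : ℝ)..p.2, k p.1 t)
      ((ContinuousLinearMap.toSpanSingleton ℝ (∫ t in (0 : ℝ)..y, k' r t)).coprod
        (ContinuousLinearMap.toSpanSingleton ℝ (k r y))) (r, y) := by
  have hsl : ∀ {k : ℝ → ℝ → ℝ}, ContinuousOn (fun p : ℝ × ℝ => k p.1 p.2) (Ioi 0 ×ˢ univ) →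
      ∀ r, 0 < r → Continuous (k r) := fun hk r hr =>
    hk.comp_continuous (f := fun t : ℝ => (r, t)) (by fun_prop) fun t => ⟨hr, mem_univ _⟩
  have hopen : ∀ᶠ v : ℝ × ℝ in 𝓝 (r, y), 0 < v.1 :=
    continuous_fst.continuousAt.eventually (Ioi_mem_nhds hr)
  have hmem : (Ioi (0:ℝ) ×ˢ (univ : Set ℝ)) ∈ 𝓝 (r, y) :=
    prod_mem_nhds (Ioi_mem_nhds hr) univ_mem
  have key := hasStrictFDerivAt_uncurry_coprod (𝕜 := ℝ) (u := (r, y))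
    (f := fun r y => ∫ t in (0 : ℝ)..y, k r t)
    (f₁ := fun r y => ContinuousLinearMap.toSpanSingleton ℝ (∫ t in (0 : ℝ)..y, k' r t))
    (f₂ := fun r y => ContinuousLinearMap.toSpanSingleton ℝ (k r y)) ?_ ?_ ?_ ?_
  · exact key.hasFDerivAt
  · filter_upwards [hopen] with v hv
    refine HasDerivAt.hasFDerivAt (f := fun r => ∫ t in (0 : ℝ)..v.2, k r t) ?_
    -- a compact neighbourhood of the parameter bounds the derivative
    have hcpt : IsCompact (Icc (v.1 / 2) (2 * v.1) ×ˢ uIcc 0 v.2) :=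
      isCompact_Icc.prod isCompact_uIcc
    obtain ⟨C, hC⟩ := hcpt.exists_bound_of_continuousOn
      (hk'.mono (prod_mono (fun x hx => lt_of_lt_of_le (by positivity) hx.1) (subset_univ _)))
    refine (intervalIntegral.hasDerivAt_integral_of_dominated_loc_of_deriv_le (μ := MeasureTheory.volume)
      (bound := fun _ => C)
      (F := fun r t => k r t) (F' := fun r t => k' r t) (x₀ := v.1) (a := 0) (b := v.2)
      (s := Icc (v.1 / 2) (2 * v.1)) (Icc_mem_nhds (by linarith) (by linarith)) ?_ ?_ ?_ ?_ ?_ ?_).2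
    · filter_upwards [Ioi_mem_nhds hv] with x hx
      exact (hsl hk x hx).aestronglyMeasurable
    · exact (hsl hk v.1 hv).intervalIntegrable _ _
    · exact (hsl hk' v.1 hv).aestronglyMeasurable
    · exact Filter.Eventually.of_forall fun t ht x hx => hC (x, t) ⟨hx, uIoc_subset_uIcc ht⟩
    · simp
    · exact Filter.Eventually.of_forall fun t _ x hx =>
        hd x (lt_of_lt_of_le (by positivity) hx.1) t
  · filter_upwards [hopen] with v hv
    refine HasDerivAt.hasFDerivAt (f := fun y => ∫ t in (0 : ℝ)..y, k v.1 t) ?_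
    exact (hsl hk v.1 hv).integral_hasStrictDerivAt 0 v.2 |>.hasDerivAt
  · have h1 := (continuousOn_integral_kernel hk').continuousAt hmem
    exact (ContinuousLinearMap.toSpanSingletonCLE (𝕜 := ℝ) (E := ℝ)).continuous.continuousAt.comp h1
  · have h1 := hk.continuousAt hmem
    exact (ContinuousLinearMap.toSpanSingletonCLE (𝕜 := ℝ) (E := ℝ)).continuous.continuousAt.comp h1

lemma hasDerivWithinAt_integral_kernel {k k' : ℝ → ℝ → ℝ}
    (hd : ∀ r, 0 < r → ∀ t, HasDerivAt (fun r => k r t) (k' r t) r)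
    (hk : ContinuousOn (fun p : ℝ × ℝ => k p.1 p.2) (Ioi 0 ×ˢ univ))
    (hk' : ContinuousOn (fun p : ℝ × ℝ => k' p.1 p.2) (Ioi 0 ×ˢ univ)) {ρ y : ℝ → ℝ} {ρ' y' : ℝ}
    {s : Set ℝ} {x : ℝ} (hr : 0 < ρ x) (hρ : HasDerivWithinAt ρ ρ' s x)
    (hy : HasDerivWithinAt y y' s x) :
    HasDerivWithinAt (fun x => ∫ t in (0 : ℝ)..y x, k (ρ x) t)
      (ρ' * (∫ t in (0 : ℝ)..y x, k' (ρ x) t) + y' * k (ρ x) (y x)) s x := by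
  have h := (hasFDerivAt_integral_kernel hd hk hk' hr (y x)).comp_hasDerivWithinAt x
    (hρ.prodMk hy)
  refine HasDerivWithinAt.congr_deriv (f := fun x => ∫ t in (0 : ℝ)..y x, k (ρ x) t) h ?_
  simp

/-- The square root of the coefficient `r² + 2 sin² ξ` of the principal part of the equation, with
`ξ` replaced by `t`. -/
def root (r t : ℝ) : ℝ := √(r ^ 2 + 2 * Real.sin t ^ 2)

lemma root_pos {r : ℝ} (hr : 0 < r) (t : ℝ) : 0 < root r t := by
  unfold root; positivity

lemma sq_root (r t : ℝ) : root r t ^ 2 = r ^ 2 + 2 * Real.sin t ^ 2 :=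
  Real.sq_sqrt (by positivity)

lemma le_root {r : ℝ} (t : ℝ) : r ≤ root r t :=
  Real.le_sqrt_of_sq_le (by nlinarith [sq_nonneg (Real.sin t)])

lemma continuous_root : Continuous fun p : ℝ × ℝ => root p.1 p.2 := by
  unfold root; fun_prop

lemma hasDerivAt_root_fst {r : ℝ} (hr : 0 < r) (t : ℝ) :
    HasDerivAt (fun r => root r t) (r / root r t) r := by
  have h := root_pos hr t
  have h1 := (((hasDerivAt_id r).pow 2).add_const (2 * Real.sin t ^ 2)).sqrt
    (by simp only [id, Pi.pow_apply]; positivity)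
  refine h1.congr_deriv ?_
  unfold root at h ⊢
  simp only [id, Pi.pow_apply]
  field_simp
  norm_num

lemma hasDerivAt_root_snd {r : ℝ} (hr : 0 < r) (t : ℝ) :
    HasDerivAt (root r) (2 * Real.sin t * Real.cos t / root r t) t := by
  have h := root_pos hr t
  have h1 := ((((Real.hasDerivAt_sin t).pow 2).const_mul 2).const_add (r ^ 2)).sqrt
    (by simp only [Pi.pow_apply]; positivity)
  refine h1.congr_deriv ?_
  unfold root at h ⊢
  simp only [Pi.pow_apply]
  field_simp
  norm_num
  ring

/-- The first `r`-derivative of `root`. -/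
def ker1 (r t : ℝ) : ℝ := r / root r t
/-- The second `r`-derivative of `root`. -/
def ker2 (r t : ℝ) : ℝ := 2 * Real.sin t ^ 2 / root r t ^ 3
/-- The third `r`-derivative of `root`. -/
def ker3 (r t : ℝ) : ℝ := -(6 * r * Real.sin t ^ 2) / root r t ^ 5
/-- The kernel for which `root / r² + kerK` is the `t`-derivative of the potential terms in
`theta_div_add_intK`. -/
def kerK (r t : ℝ) : ℝ :=
  -(2 * Real.sin t ^ 2 * (r ^ 4 + 3 * Real.sin t ^ 2 * r ^ 2 + 3 * Real.sin t ^ 4)) /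
    (r ^ 2 * root r t ^ 3)
/-- The kernel `(∂ᵣ + 2 / r) kerK`. -/
def kerL (r t : ℝ) : ℝ :=
  -(2 * Real.sin t ^ 2 * (r ^ 4 + 5 * Real.sin t ^ 2 * r ^ 2 + 3 * Real.sin t ^ 4)) /
    (r * root r t ^ 5)

lemma hasDerivAt_ker1 {r : ℝ} (hr : 0 < r) (t : ℝ) :
    HasDerivAt (fun r => ker1 r t) (ker2 r t) r := by
  have h := root_pos hr t
  refine ((hasDerivAt_id r).div (hasDerivAt_root_fst hr t) h.ne').congr_deriv ?_
  unfold ker2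
  have := sq_root r t
  simp only [id]
  field_simp
  linarith

lemma hasDerivAt_ker2 {r : ℝ} (hr : 0 < r) (t : ℝ) :
    HasDerivAt (fun r => ker2 r t) (ker3 r t) r := by
  have h := root_pos hr t
  refine ((hasDerivAt_const r (2 * Real.sin t ^ 2)).div ((hasDerivAt_root_fst hr t).pow 3)
    (pow_ne_zero 3 h.ne')).congr_deriv ?_
  unfold ker3
  simp only [Pi.pow_apply]
  field_simp
  norm_num; ring

lemma hasDerivAt_kerK {r : ℝ} (hr : 0 < r) (t : ℝ) :
    HasDerivAt (fun r => kerK r t) (kerL r t - 2 * kerK r t / r) r := by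
  have h := root_pos hr t
  have h1 := (((((hasDerivAt_id r).pow 4).add (((hasDerivAt_id r).pow 2).const_mul
    (3 * Real.sin t ^ 2))).add_const (3 * Real.sin t ^ 4)).const_mul (2 * Real.sin t ^ 2)).neg.div
    (((hasDerivAt_id r).pow 2).mul ((hasDerivAt_root_fst hr t).pow 3))
    (mul_ne_zero (pow_ne_zero 2 hr.ne') (pow_ne_zero 3 h.ne'))
  refine h1.congr_deriv ?_
  unfold kerK kerL
  simp only [Pi.mul_apply, Pi.pow_apply, Pi.add_apply, Pi.neg_apply, id]
  have hs : Real.sin t ^ 2 = (root r t ^ 2 - r ^ 2) / 2 := by rw [sq_root]; ring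
  have hs4 : Real.sin t ^ 4 = ((root r t ^ 2 - r ^ 2) / 2) ^ 2 := by rw [← hs]; ring
  rw [hs4, hs]
  field_simp
  ring

lemma continuousOn_ker (n : ℕ) {φ : ℝ × ℝ → ℝ} (hφ : ContinuousOn φ (Ioi 0 ×ˢ univ)) :
    ContinuousOn (fun p : ℝ × ℝ => φ p / root p.1 p.2 ^ n) (Ioi 0 ×ˢ univ) :=
  hφ.div (continuous_root.pow n).continuousOn fun p hp => (pow_pos (root_pos hp.1 p.2) n).ne'

lemma continuousOn_root : ContinuousOn (fun p : ℝ × ℝ => root p.1 p.2) (Ioi 0 ×ˢ univ) :=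
  continuous_root.continuousOn

lemma continuousOn_ker1 : ContinuousOn (fun p : ℝ × ℝ => ker1 p.1 p.2) (Ioi 0 ×ˢ univ) := by
  simpa [ker1] using continuousOn_ker 1 (φ := fun p => p.1) (by fun_prop)

lemma continuousOn_ker2 : ContinuousOn (fun p : ℝ × ℝ => ker2 p.1 p.2) (Ioi 0 ×ˢ univ) :=
  continuousOn_ker 3 (φ := fun p => 2 * Real.sin p.2 ^ 2) (by fun_prop)

lemma continuousOn_ker3 : ContinuousOn (fun p : ℝ × ℝ => ker3 p.1 p.2) (Ioi 0 ×ˢ univ) :=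
  continuousOn_ker 5 (φ := fun p => -(6 * p.1 * Real.sin p.2 ^ 2)) (by fun_prop)

lemma continuousOn_kerK : ContinuousOn (fun p : ℝ × ℝ => kerK p.1 p.2) (Ioi 0 ×ˢ univ) := by
  refine (continuousOn_ker 3 (φ := fun p => -(2 * Real.sin p.2 ^ 2 *
    (p.1 ^ 4 + 3 * Real.sin p.2 ^ 2 * p.1 ^ 2 + 3 * Real.sin p.2 ^ 4)) / p.1 ^ 2) ?_).congr ?_
  · exact ContinuousOn.div (by fun_prop) (by fun_prop) fun p hp =>
      (pow_pos (show (0:ℝ) < p.1 from hp.1) 2).ne'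
  · intro p _; simp only [kerK]; rw [div_div]

lemma continuousOn_kerL : ContinuousOn (fun p : ℝ × ℝ => kerL p.1 p.2) (Ioi 0 ×ˢ univ) := by
  refine (continuousOn_ker 5 (φ := fun p => -(2 * Real.sin p.2 ^ 2 *
    (p.1 ^ 4 + 5 * Real.sin p.2 ^ 2 * p.1 ^ 2 + 3 * Real.sin p.2 ^ 4)) / p.1) ?_).congr ?_
  · exact ContinuousOn.div (by fun_prop) (by fun_prop) fun p hp =>
      (show (0:ℝ) < p.1 from hp.1).ne'
  · intro p _; simp only [kerL]; rw [div_div]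

lemma continuousOn_kerK' :
    ContinuousOn (fun p : ℝ × ℝ => kerL p.1 p.2 - 2 * kerK p.1 p.2 / p.1) (Ioi 0 ×ˢ univ) :=
  continuousOn_kerL.sub ((continuousOn_const.mul continuousOn_kerK).div continuousOn_fst
    fun p hp => (show (0:ℝ) < p.1 from hp.1).ne')

/-- The primitive `∫₀ʸ √(r² + 2 sin² t) dt`. -/
def theta (r y : ℝ) : ℝ := ∫ t in (0 : ℝ)..y, root r t
/-- The first `r`-derivative of `theta`. -/
def theta1 (r y : ℝ) : ℝ := ∫ t in (0 : ℝ)..y, ker1 r t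
/-- The second `r`-derivative of `theta`. -/
def theta2 (r y : ℝ) : ℝ := ∫ t in (0 : ℝ)..y, ker2 r t
/-- The third `r`-derivative of `theta`. -/
def theta3 (r y : ℝ) : ℝ := ∫ t in (0 : ℝ)..y, ker3 r t
/-- The primitive of `kerK` in the angle. -/
def intK (r y : ℝ) : ℝ := ∫ t in (0 : ℝ)..y, kerK r t
/-- The primitive of `kerL` in the angle, which equals `(∂ᵣ + 2 / r) intK`. -/
def intL (r y : ℝ) : ℝ := ∫ t in (0 : ℝ)..y, kerL r t

section deriv
variable {ρ y : ℝ → ℝ} {ρ' y' : ℝ} {s : Set ℝ} {x : ℝ}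

lemma hasDerivWithinAt_theta (hr : 0 < ρ x) (hρ : HasDerivWithinAt ρ ρ' s x)
    (hy : HasDerivWithinAt y y' s x) :
    HasDerivWithinAt (fun x => theta (ρ x) (y x))
      (ρ' * theta1 (ρ x) (y x) + y' * root (ρ x) (y x)) s x :=
  hasDerivWithinAt_integral_kernel (fun _ h t => hasDerivAt_root_fst h t) continuousOn_root
    continuousOn_ker1 hr hρ hy

lemma hasDerivWithinAt_theta1 (hr : 0 < ρ x) (hρ : HasDerivWithinAt ρ ρ' s x)
    (hy : HasDerivWithinAt y y' s x) :
    HasDerivWithinAt (fun x => theta1 (ρ x) (y x))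
      (ρ' * theta2 (ρ x) (y x) + y' * ker1 (ρ x) (y x)) s x :=
  hasDerivWithinAt_integral_kernel (fun _ h t => hasDerivAt_ker1 h t) continuousOn_ker1
    continuousOn_ker2 hr hρ hy

lemma hasDerivWithinAt_theta2 (hr : 0 < ρ x) (hρ : HasDerivWithinAt ρ ρ' s x)
    (hy : HasDerivWithinAt y y' s x) :
    HasDerivWithinAt (fun x => theta2 (ρ x) (y x))
      (ρ' * theta3 (ρ x) (y x) + y' * ker2 (ρ x) (y x)) s x :=
  hasDerivWithinAt_integral_kernel (fun _ h t => hasDerivAt_ker2 h t) continuousOn_ker2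
    continuousOn_ker3 hr hρ hy

lemma hasDerivWithinAt_intK (hr : 0 < ρ x) (hρ : HasDerivWithinAt ρ ρ' s x)
    (hy : HasDerivWithinAt y y' s x) :
    HasDerivWithinAt (fun x => intK (ρ x) (y x))
      (ρ' * (intL (ρ x) (y x) - 2 * intK (ρ x) (y x) / ρ x) + y' * kerK (ρ x) (y x)) s x := by
  have h := hasDerivWithinAt_integral_kernel (fun _ h t => hasDerivAt_kerK h t) continuousOn_kerK
    continuousOn_kerK' hr hρ hy
  refine h.congr_deriv ?_
  have hsl : ∀ {k : ℝ → ℝ → ℝ}, ContinuousOn (fun p : ℝ × ℝ => k p.1 p.2) (Ioi 0 ×ˢ univ) →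
      Continuous (k (ρ x)) := fun hk =>
    hk.comp_continuous (f := fun t : ℝ => (ρ x, t)) (by fun_prop) fun t => ⟨hr, mem_univ _⟩
  rw [intervalIntegral.integral_sub ((hsl continuousOn_kerL).intervalIntegrable _ _)
    ((((hsl continuousOn_kerK).const_mul 2).div_const _).intervalIntegrable _ _)]
  simp only [intervalIntegral.integral_div, intervalIntegral.integral_const_mul]
  rfl

end deriv

/-- The potential term of the equation for `W` up to an integral of `kerK`.  Its singular part is
`theta r y / r² = X / r²`, whose image under `∂ᵣ + 2 / r` is `W / r²` and involves no derivative of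
the field. -/
lemma theta_div_add_intK {r : ℝ} (hr : 0 < r) (y : ℝ) :
    theta r y / r ^ 2 + intK r y = 1 / 2 * theta2 r y +
      Real.sin y * Real.cos y * (1 + Real.sin y ^ 2 / r ^ 2) / root r y := by
  have hsl : ∀ {k : ℝ → ℝ → ℝ}, ContinuousOn (fun p : ℝ × ℝ => k p.1 p.2) (Ioi 0 ×ˢ univ) →
      Continuous (k r) := fun hk =>
    hk.comp_continuous (f := fun t : ℝ => (r, t)) (by fun_prop) fun t => ⟨hr, mem_univ _⟩
  have hd : ∀ y, HasDerivAt (fun y => theta r y / r ^ 2 + intK r y - (1 / 2 * theta2 r y +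
      Real.sin y * Real.cos y * (1 + Real.sin y ^ 2 / r ^ 2) / root r y)) 0 y := by
    intro y
    have d1 := ((hsl continuousOn_root).integral_hasStrictDerivAt 0 y).hasDerivAt
    have d2 := ((hsl continuousOn_kerK).integral_hasStrictDerivAt 0 y).hasDerivAt
    have d3 := ((hsl continuousOn_ker2).integral_hasStrictDerivAt 0 y).hasDerivAt
    have d4 := (((Real.hasDerivAt_sin y).mul (Real.hasDerivAt_cos y)).mul
      ((((Real.hasDerivAt_sin y).pow 2).div_const (r ^ 2)).const_add 1)).div
      (hasDerivAt_root_snd hr y) (root_pos hr y).ne'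
    refine (((d1.div_const (r ^ 2)).add d2).sub ((d3.const_mul (1 / 2)).add d4)).congr_deriv ?_
    have h := root_pos hr y
    unfold kerK ker2
    simp only [Pi.mul_apply, Pi.pow_apply]
    have hc : Real.cos y ^ 2 = 1 - Real.sin y ^ 2 := Real.cos_sq' y
    field_simp
    have h4 : root r y ^ 4 = (r ^ 2 + 2 * Real.sin y ^ 2) ^ 2 := by rw [← sq_root]; ring
    rw [hc, h4, sq_root]
    norm_num
    ring
  have hdd : Differentiable ℝ (fun y => theta r y / r ^ 2 + intK r y - (1 / 2 * theta2 r y +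
      Real.sin y * Real.cos y * (1 + Real.sin y ^ 2 / r ^ 2) / root r y)) :=
    fun y => (hd y).differentiableAt
  have h0 := is_const_of_deriv_eq_zero hdd (fun y => (hd y).deriv) y 0
  simp only [theta, intK, theta2, intervalIntegral.integral_same, Real.sin_zero] at h0
  simp only [theta, intK, theta2]
  simp at h0
  linarith

/-! ### Inversion of `theta` in the angle -/

lemma integral_eq_mul_average (k : ℝ → ℝ) (y : ℝ) :
    ∫ t in (0 : ℝ)..y, k t = y * ∫ t in (0 : ℝ)..1, k (t * y) := by
  simp

lemma continuous_root_snd (r : ℝ) : Continuous (root r) :=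
  continuous_root.comp (f := fun t : ℝ => (r, t)) (by fun_prop)

lemma mul_sub_le_theta_sub (r : ℝ) {y₁ y₂ : ℝ} (h : y₁ ≤ y₂) :
    r * (y₂ - y₁) ≤ theta r y₂ - theta r y₁ := by
  have hI := fun a b => (continuous_root_snd r).intervalIntegrable (μ := MeasureTheory.volume) a b
  unfold theta
  rw [intervalIntegral.integral_interval_sub_left (hI _ _) (hI _ _)]
  have := intervalIntegral.integral_mono_on h
    (intervalIntegrable_const (c := r) (μ := MeasureTheory.volume))
    (hI y₁ y₂) (fun t _ => le_root t)
  simp only [intervalIntegral.integral_const, smul_eq_mul] at this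
  linarith

lemma mul_abs_sub_le_theta (r : ℝ) (y₁ y₂ : ℝ) :
    r * |y₁ - y₂| ≤ |theta r y₁ - theta r y₂| := by
  rcases le_total y₁ y₂ with h | h
  · rw [abs_sub_comm, abs_of_nonneg (sub_nonneg.2 h), abs_sub_comm]
    exact (mul_sub_le_theta_sub r h).trans (le_abs_self _)
  · rw [abs_of_nonneg (sub_nonneg.2 h)]
    exact (mul_sub_le_theta_sub r h).trans (le_abs_self _)

lemma theta_zero (r : ℝ) : theta r 0 = 0 := by simp [theta]

lemma continuous_theta_snd (r : ℝ) : Continuous (theta r) :=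
  intervalIntegral.continuous_primitive
    (fun a b => (continuous_root_snd r).intervalIntegrable a b) 0

lemma injective_theta {r : ℝ} (hr : 0 < r) : Function.Injective (theta r) := by
  intro y₁ y₂ h
  have := mul_abs_sub_le_theta r y₁ y₂
  rw [h, sub_self, abs_zero] at this
  have h2 : |y₁ - y₂| ≤ 0 := by
    by_contra hlt
    have := mul_pos hr (not_le.1 hlt)
    linarith
  exact sub_eq_zero.1 (abs_nonpos_iff.1 h2)

lemma surjective_theta {r : ℝ} (hr : 0 < r) : Function.Surjective (theta r) := by
  intro x
  have hN : 0 ≤ |x| / r := by positivity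
  have e : r * (|x| / r) = |x| := by field_simp
  have h1 := mul_sub_le_theta_sub r hN
  have h2 := mul_sub_le_theta_sub r (neg_nonpos.2 hN)
  rw [theta_zero] at h1 h2
  have : x ∈ theta r '' Icc (-(|x| / r)) (|x| / r) :=
    intermediate_value_Icc (by linarith) (continuous_theta_snd r).continuousOn
      ⟨by linarith [neg_abs_le x], by linarith [le_abs_self x]⟩
  obtain ⟨y, -, hy⟩ := this
  exact ⟨y, hy⟩

/-- The inverse of `theta r`, meaningful for `r > 0`. -/
def thetaInv (r x : ℝ) : ℝ := Function.invFun (theta r) x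

lemma theta_thetaInv {r : ℝ} (hr : 0 < r) (x : ℝ) : theta r (thetaInv r x) = x :=
  Function.rightInverse_invFun (surjective_theta hr) x

lemma thetaInv_theta {r : ℝ} (hr : 0 < r) (y : ℝ) : thetaInv r (theta r y) = y :=
  Function.leftInverse_invFun (injective_theta hr) y

end

/-! ### Fields reconstructed from a state -/

section

/-- A reference field `X`, independent of the state, which carries the non-decaying part: the angle
tends to `-κ` at infinity, hence `X` behaves like `-κ r` there. -/
def refX (κ r : ℝ) : ℝ := -κ * (r * (r / (1 + r)) ^ 3)
/-- The derivative of `refX`; it tends to `-κ` at infinity. -/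
def refW (κ r : ℝ) : ℝ := -κ * ((r / (1 + r)) ^ 3 * (4 - 3 * (r / (1 + r))))
/-- The reference field `Z`, that is `(∂ᵣ + 2 / r) refW`. -/
def refZ (κ r : ℝ) : ℝ :=
  -κ * ((r / (1 + r)) ^ 2 * (1 / (1 + r)) * (2 + 6 * (1 / (1 + r)) + 12 * (1 / (1 + r)) ^ 2))
/-- The derivative of `refZ`. -/
def dRefZ (κ r : ℝ) : ℝ :=
  -κ * ((1 / (1 + r)) ^ 2 * (2 * (r / (1 + r)) *
      (2 * (1 / (1 + r)) + 6 * (1 / (1 + r)) ^ 2 + 12 * (1 / (1 + r)) ^ 3)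
    - (r / (1 + r)) ^ 2 * (2 + 12 * (1 / (1 + r)) + 36 * (1 / (1 + r)) ^ 2)))

lemma hasDerivAt_ratio {r : ℝ} (hr : 0 ≤ r) :
    HasDerivAt (fun r : ℝ => r / (1 + r)) ((1 / (1 + r)) ^ 2) r := by
  have h : (1 + r) ≠ 0 := by positivity
  refine ((hasDerivAt_id r).div ((hasDerivAt_id r).const_add 1) h).congr_deriv ?_
  simp only [id]
  field_simp
  ring

lemma hasDerivAt_inv_one_add {r : ℝ} (hr : 0 ≤ r) :
    HasDerivAt (fun r : ℝ => 1 / (1 + r)) (-(1 / (1 + r)) ^ 2) r := by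
  have h : (1 + r) ≠ 0 := by positivity
  refine ((hasDerivAt_const r (1:ℝ)).div ((hasDerivAt_id r).const_add 1) h).congr_deriv ?_
  simp only [id]
  field_simp
  ring

lemma hasDerivAt_refX (κ : ℝ) {r : ℝ} (hr : 0 ≤ r) : HasDerivAt (refX κ) (refW κ r) r := by
  have h : (1 + r) ≠ 0 := by positivity
  refine (((hasDerivAt_id r).mul ((hasDerivAt_ratio hr).pow 3)).const_mul (-κ)).congr_deriv ?_
  unfold refW
  simp only [id, Pi.pow_apply]
  simp only [Nat.cast_ofNat, Nat.reduceSub]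
  field_simp
  ring

lemma hasDerivAt_refW (κ : ℝ) {r : ℝ} (hr : 0 ≤ r) :
    HasDerivAt (refW κ) (-κ * (12 * (r / (1 + r)) ^ 2 * (1 / (1 + r)) ^ 3)) r := by
  have h : (1 + r) ≠ 0 := by positivity
  refine ((((hasDerivAt_ratio hr).pow 3).mul (((hasDerivAt_ratio hr).const_mul 3).const_sub 4)).const_mul
    (-κ)).congr_deriv ?_
  simp only [Pi.pow_apply]
  simp only [Nat.cast_ofNat, Nat.reduceSub]
  field_simp
  ring

lemma hasDerivAt_refZ (κ : ℝ) {r : ℝ} (hr : 0 ≤ r) : HasDerivAt (refZ κ) (dRefZ κ r) r := by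
  have h : (1 + r) ≠ 0 := by positivity
  refine (((((hasDerivAt_ratio hr).pow 2).mul (hasDerivAt_inv_one_add hr)).mul
    ((((hasDerivAt_inv_one_add hr).const_mul 6).const_add 2).add
      (((hasDerivAt_inv_one_add hr).pow 2).const_mul 12))).const_mul (-κ)).congr_deriv ?_
  unfold dRefZ
  simp only [Pi.pow_apply, Pi.mul_apply, Pi.add_apply]
  simp only [Nat.cast_ofNat, Nat.reduceSub, pow_one]
  field_simp
  ring

lemma hasDerivAt_sq_mul_refW (κ : ℝ) {r : ℝ} (hr : 0 ≤ r) :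
    HasDerivAt (fun r => r ^ 2 * refW κ r) (r ^ 2 * refZ κ r) r := by
  have h : (1 + r) ≠ 0 := by positivity
  refine (((hasDerivAt_id r).pow 2).mul (hasDerivAt_refW κ hr)).congr_deriv ?_
  unfold refZ refW
  simp only [Pi.pow_apply, id]
  simp only [Nat.cast_ofNat, Nat.reduceSub, pow_one, mul_one]
  field_simp
  ring

namespace State

/-- The field `Z = (∂ᵣ + 2 / r) W`, from which all others are reconstructed. -/
def Z (κ : ℝ) (s : State) (r : ℝ) : ℝ := refZ κ r + zeta s r
/-- The field `W = ∂ᵣ X`. -/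
def W (κ : ℝ) (s : State) (r : ℝ) : ℝ := (∫ x in (0 : ℝ)..r, x ^ 2 * Z κ s x) / r ^ 2
/-- The field `X = theta r a`, where `a = ξ - κ`. -/
def X (κ : ℝ) (s : State) (r : ℝ) : ℝ := ∫ x in (0 : ℝ)..r, W κ s x
/-- The angle `a = ξ - κ` relative to the central value. -/
def ang (κ : ℝ) (s : State) (r : ℝ) : ℝ := thetaInv r (X κ s r)
/-- `Q = √(r² + 2 sin² a) ∂ᵣ a`; its square divided by `r` is the integrand in `g`. -/
def Q (κ : ℝ) (s : State) (r : ℝ) : ℝ := W κ s r - theta1 r (ang κ s r)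
/-- The radial derivative of the angle. -/
def slope (κ : ℝ) (s : State) (r : ℝ) : ℝ := Q κ s r / root r (ang κ s r)
/-- The metric function `g`. -/
def lapse (α κ : ℝ) (s : State) (r : ℝ) : ℝ :=
  Real.exp (-α * ∫ x in Ioi r, Q κ s x ^ 2 / x)
/-- The integrand of `mass`. -/
def massDensity (α κ : ℝ) (s : State) (r : ℝ) : ℝ :=
  lapse α κ s r * (Q κ s r ^ 2 + 2 * Real.sin (ang κ s r) ^ 2 + Real.sin (ang κ s r) ^ 4 / r ^ 2)
/-- The function `m` for which `g̃ = g - α m / r`. -/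
def mass (α κ : ℝ) (s : State) (r : ℝ) : ℝ := ∫ x in (0 : ℝ)..r, massDensity α κ s x
/-- `r` times the potential combination `2 sin² a / r² + sin⁴ a / r⁴`. -/
def pot (κ : ℝ) (s : State) (r : ℝ) : ℝ :=
  2 * Real.sin (ang κ s r) ^ 2 / r + Real.sin (ang κ s r) ^ 4 / r ^ 3
/-- The radial derivative of `pot`. -/
def dPot (κ : ℝ) (s : State) (r : ℝ) : ℝ :=
  4 * Real.sin (ang κ s r) * Real.cos (ang κ s r) * slope κ s r / r
    - 2 * Real.sin (ang κ s r) ^ 2 / r ^ 2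
    + 4 * Real.sin (ang κ s r) ^ 3 * Real.cos (ang κ s r) * slope κ s r / r ^ 3
    - 3 * Real.sin (ang κ s r) ^ 4 / r ^ 4
/-- The metric function `g̃`. -/
def lapseT (α κ : ℝ) (s : State) (r : ℝ) : ℝ := lapse α κ s r - α * mass α κ s r / r
/-- The radial derivative of `lapseT`. -/
def dLapseT (α κ : ℝ) (s : State) (r : ℝ) : ℝ :=
  α * mass α κ s r / r ^ 2 - α * lapse α κ s r * pot κ s r
/-- The radial derivative of `lapse`. -/
def dLapse (α κ : ℝ) (s : State) (r : ℝ) : ℝ := α * lapse α κ s r * (Q κ s r ^ 2 / r)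
/-- The second radial derivative of `lapseT`. -/
def d2LapseT (α κ : ℝ) (s : State) (r : ℝ) : ℝ :=
  α * massDensity α κ s r / r ^ 2 - 2 * α * mass α κ s r / r ^ 3
    - α * dLapse α κ s r * pot κ s r - α * lapse α κ s r * dPot κ s r
/-- The radial derivative of `W`. -/
def dW (κ : ℝ) (s : State) (r : ℝ) : ℝ := Z κ s r - 2 * W κ s r / r
/-- The radial derivative of `Q`. -/
def dQ (κ : ℝ) (s : State) (r : ℝ) : ℝ :=
  dW κ s r - theta2 r (ang κ s r) - slope κ s r * ker1 r (ang κ s r)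

/-- The right-hand side of the transport equation `D W = source` to which the reduced equation is
equivalent. -/
def source (α κ : ℝ) (s : State) (r : ℝ) : ℝ :=
  1 / 2 * dLapseT α κ s r * Q κ s r + 1 / 2 * (α * mass α κ s r / r) * theta2 r (ang κ s r)
    - lapse α κ s r * (X κ s r / r ^ 2 + intK r (ang κ s r))

/-- The right-hand side of the transport equation of the remainder `Z - refZ`, obtained by applying
`∂ᵣ + 2 / r` to `D W = source`.  The terms `g̃ W / r²` from the commutator and `-g W / r²` from
`theta_div_add_intK` cancel up to a multiple of the mass. -/
def zSource (α κ : ℝ) (s : State) (r : ℝ) : ℝ :=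
  1 / 2 * ((d2LapseT α κ s r + 2 * dLapseT α κ s r / r) * Q κ s r + dLapseT α κ s r * dQ κ s r)
    + 1 / 2 * ((α * massDensity α κ s r / r + α * mass α κ s r / r ^ 2) * theta2 r (ang κ s r)
      + α * mass α κ s r / r *
        (theta3 r (ang κ s r) + slope κ s r * ker2 r (ang κ s r)))
    - dLapse α κ s r * (X κ s r / r ^ 2 + intK r (ang κ s r))
    - lapse α κ s r * (slope κ s r * kerK r (ang κ s r))
    - lapse α κ s r * (intL r (ang κ s r) - 1 / 2 * dRefZ κ r)
    - 1 / 2 * (α * mass α κ s r / r) * dRefZ κ r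
    - α * mass α κ s r / r * W κ s r / r ^ 2 + 1 / 2 * dLapseT α κ s r * dW κ s r

end State

open State
namespace Weighted

variable {k l k' l' : ℤ} {f g : State → ℝ → ℝ → ℝ}

lemma param : Weighted 0 0 (fun _ _ t => t) where
  bound _ := ⟨1, zero_le_one, fun s _ r _ t ht => by
    rw [wt_zero_zero, mul_one, abs_of_nonneg ht.1]; exact ht.2⟩
  lip _ := ⟨0, le_rfl, fun s₁ s₂ _ _ x _ t _ => by simp⟩
  cont s := continuousOn_snd

lemma eval_one (hf : Weighted k l f) : Weighted k l (fun s r _ => f s r 1) where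
  bound L := by
    obtain ⟨C, hC, H⟩ := hf.bound L
    exact ⟨C, hC, fun s hs r hr _ _ => H s hs r hr 1 (by simp)⟩
  lip L := by
    obtain ⟨C, hC, H⟩ := hf.lip L
    exact ⟨C, hC, fun s₁ s₂ h₁ h₂ x hx _ _ => H s₁ s₂ h₁ h₂ x hx 1 (by simp)⟩
  cont s := (hf.cont s).comp (f := fun p : ℝ × ℝ => (p.1, (1:ℝ))) (by fun_prop)
    fun p hp => ⟨hp.1, by simp⟩

lemma refX_div (κ : ℝ) : Weighted 3 0 (fun _ r _ => refX κ r / r) :=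
  (((ratio.pow 3).const_mul (-κ)).cast (by norm_num) (by norm_num)).congr fun _ r hr _ _ => by
    unfold refX; field_simp

lemma refW (κ : ℝ) : Weighted 3 0 (fun _ r _ => EinsteinSkyrme.refW κ r) :=
  (((((ratio.pow 3).mul ((const 4).sub ((ratio.mono (k' := 0) (by norm_num) le_rfl).const_mul 3)))).const_mul (-κ)).cast
    (by norm_num) (by norm_num)).congr fun _ r _ _ _ => rfl

lemma integral_sq_refZ (κ : ℝ) {r : ℝ} (hr : 0 < r) :
    ∫ x in (0 : ℝ)..r, x ^ 2 * refZ κ x = r ^ 2 * EinsteinSkyrme.refW κ r := by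
  rw [intervalIntegral.integral_eq_sub_of_hasDerivAt (f := fun r => r ^ 2 * EinsteinSkyrme.refW κ r)]
  · simp
  · intro x hx
    rw [uIcc_of_le hr.le] at hx
    exact hasDerivAt_sq_mul_refW κ hx.1
  · apply ContinuousOn.intervalIntegrable
    intro x hx
    rw [uIcc_of_le hr.le] at hx
    exact (((continuous_pow 2).continuousAt).mul (hasDerivAt_refZ κ hx.1).continuousAt).continuousWithinAt

lemma integral_refW (κ : ℝ) {r : ℝ} (hr : 0 < r) :
    ∫ x in (0 : ℝ)..r, EinsteinSkyrme.refW κ x = refX κ r := by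
  rw [intervalIntegral.integral_eq_sub_of_hasDerivAt (f := refX κ)]
  · simp [refX]
  · intro x hx
    rw [uIcc_of_le hr.le] at hx
    exact hasDerivAt_refX κ hx.1
  · apply ContinuousOn.intervalIntegrable
    intro x hx
    rw [uIcc_of_le hr.le] at hx
    exact (hasDerivAt_refW κ hx.1).continuousAt.continuousWithinAt

lemma sq_zeta : Weighted 2 1 (fun s r _ => r ^ 2 * State.zeta s r) :=
  ((radius.pow 2).mul zeta).mono (k' := 2) (l' := 1) (by norm_num) (by norm_num)

lemma remW : Weighted 1 3 (fun s r _ => (∫ x in (0 : ℝ)..r, x ^ 2 * State.zeta s x) / r ^ 2) := by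
  have h := sq_zeta.integral (l' := -1) (by norm_num) (Or.inr ⟨rfl, rfl⟩)
  exact ((h.div_radius.div_radius).cast (by norm_num) (by norm_num)).congr fun _ r _ _ _ => by
    rw [div_div, sq]

lemma W_eq (κ : ℝ) (s : State) {r : ℝ} (hr : 0 < r) : State.W κ s r =
    EinsteinSkyrme.refW κ r + (∫ x in (0 : ℝ)..r, x ^ 2 * State.zeta s x) / r ^ 2 := by
  have hi : IntervalIntegrable (fun x => x ^ 2 * refZ κ x) MeasureTheory.volume 0 r := by
    apply ContinuousOn.intervalIntegrable
    intro x hx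
    rw [uIcc_of_le hr.le] at hx
    exact (((continuous_pow 2).continuousAt).mul (hasDerivAt_refZ κ hx.1).continuousAt).continuousWithinAt
  have hi' : IntervalIntegrable (fun x => x ^ 2 * State.zeta s x) MeasureTheory.volume 0 r :=
    ((continuous_pow 2).mul (continuous_zeta s)).intervalIntegrable _ _
  unfold State.W State.Z
  simp only [mul_add]
  rw [intervalIntegral.integral_add hi hi', integral_sq_refZ κ hr]
  field_simp

lemma W_sub_ref (κ : ℝ) : Weighted 1 3 (fun s r _ => State.W κ s r - EinsteinSkyrme.refW κ r) :=
  remW.congr fun s r hr _ _ => by rw [W_eq κ s hr]; ring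

lemma W (κ : ℝ) : Weighted 1 0 (fun s r _ => State.W κ s r) :=
  (((refW κ).mono (k' := 1) (l' := 0) (by norm_num) le_rfl).add ((W_sub_ref κ).mono (l' := 0)
    le_rfl (by norm_num))).congr fun s r _ _ _ => by ring

lemma intervalIntegrable (hf : Weighted k l f) (hk : 1 ≤ k)
    (hf1 : ∀ s r t, f s r t = f s r 0) (s : State) (a b : ℝ) (ha : 0 ≤ a) (hb : 0 ≤ b) :
    IntervalIntegrable (fun r => f s r 0) MeasureTheory.volume a b := by
  have h : Weighted k l fun s r _ => f s r 0 := hf.congr fun s r _ t _ => (hf1 s r t).symm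
  refine ((h.continuous_extZero hk s).intervalIntegrable a b).congr fun r hr => ?_
  have : 0 < r := lt_of_le_of_lt (le_min ha hb) hr.1
  exact extZero_of_pos this

lemma X_sub_ref (κ : ℝ) : Weighted 2 0 (fun s r _ => State.X κ s r - refX κ r) := by
  refine ((W_sub_ref κ).integral (l' := 0) le_rfl (Or.inl ⟨le_rfl, rfl⟩)).congr
    fun s r hr _ _ => ?_
  have h1 := (W κ).intervalIntegrable le_rfl (fun _ _ _ => rfl) s 0 r le_rfl hr.le
  have h2 := ((refW κ).intervalIntegrable (by norm_num) (fun _ _ _ => rfl) s 0 r le_rfl hr.le)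
  rw [intervalIntegral.integral_sub h1 h2, integral_refW κ hr]
  rfl

lemma X_div_sub_ref (κ : ℝ) :
    Weighted 1 2 (fun s r _ => State.X κ s r / r - refX κ r / r) :=
  ((X_sub_ref κ).div_radius.cast (by norm_num) (by norm_num)).congr fun _ _ _ _ _ =>
    (sub_div _ _ _).symm

lemma X_div (κ : ℝ) : Weighted 1 0 (fun s r _ => State.X κ s r / r) :=
  (((refX_div κ).mono (k' := 1) (l' := 0) (by norm_num) le_rfl).add ((X_div_sub_ref κ).mono
    (l' := 0) le_rfl (by norm_num))).congr fun s r _ _ _ => by ring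

end Weighted

end

/-! ### Weights of the angle and of the kernels -/

section

open State
namespace Weighted

variable {k l k' l' : ℤ} {f g : State → ℝ → ℝ → ℝ}

lemma abs_sqrt_sub_sqrt_le {a b : ℝ} (ha : 0 ≤ a) (hb : 0 ≤ b) :
    |√(1 + 2 * a) - √(1 + 2 * b)| ≤ |a - b| := by
  have h1 : 1 ≤ √(1 + 2 * a) := Real.one_le_sqrt.2 (by linarith)
  have h2 : 1 ≤ √(1 + 2 * b) := Real.one_le_sqrt.2 (by linarith)
  have e : (√(1 + 2 * a) - √(1 + 2 * b)) * (√(1 + 2 * a) + √(1 + 2 * b)) = 2 * (a - b) := by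
    have := Real.mul_self_sqrt (show 0 ≤ 1 + 2 * a by linarith)
    have := Real.mul_self_sqrt (show 0 ≤ 1 + 2 * b by linarith)
    ring_nf at *; linarith
  have e2 : |√(1 + 2 * a) - √(1 + 2 * b)| * (√(1 + 2 * a) + √(1 + 2 * b)) = 2 * |a - b| := by
    rw [← abs_of_pos (show 0 < √(1 + 2 * a) + √(1 + 2 * b) by linarith), ← abs_mul, e, abs_mul]
    norm_num
  nlinarith [abs_nonneg (√(1 + 2 * a) - √(1 + 2 * b))]

lemma root_eq {r : ℝ} (hr : 0 < r) (t : ℝ) :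
    root r t = r * √(1 + 2 * (Real.sin t ^ 2 / r ^ 2)) := by
  unfold root
  rw [show r ^ 2 + 2 * Real.sin t ^ 2 = r ^ 2 * (1 + 2 * (Real.sin t ^ 2 / r ^ 2)) by field_simp,
    Real.sqrt_mul (by positivity), Real.sqrt_sq hr.le]

/-- Stability of `theta r y / r` under a change of the radius. -/
lemma abs_theta_div_sub_le {r₁ r₂ : ℝ} (h : Comparable r₁ r₂) (y : ℝ) :
    |theta r₁ y / r₁ - theta r₂ y / r₂| ≤ |y| * (3 * (y ^ 2 / r₂ ^ 2) * (|r₁ - r₂| / r₁)) := by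
  obtain ⟨h1, h2, h3, h4⟩ := h
  have e : theta r₁ y / r₁ - theta r₂ y / r₂ =
      ∫ t in (0 : ℝ)..y, (root r₁ t / r₁ - root r₂ t / r₂) := by
    unfold theta
    rw [intervalIntegral.integral_sub (((continuous_root_snd _).div_const _).intervalIntegrable _ _)
      (((continuous_root_snd _).div_const _).intervalIntegrable _ _),
      intervalIntegral.integral_div, intervalIntegral.integral_div]
  rw [e]
  have hb : ∀ t ∈ uIoc 0 y, ‖root r₁ t / r₁ - root r₂ t / r₂‖ ≤
      3 * (y ^ 2 / r₂ ^ 2) * (|r₁ - r₂| / r₁) := by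
    intro t ht
    have hty : |t| ≤ |y| := by
      rcases le_total 0 y with hy | hy
      · rw [uIoc_of_le hy] at ht
        rw [abs_of_pos ht.1, abs_of_nonneg hy]; exact ht.2
      · rw [uIoc_of_ge hy] at ht
        rw [abs_of_nonpos ht.2, abs_of_nonpos hy]; linarith [ht.1]
    have hs : Real.sin t ^ 2 ≤ y ^ 2 := by
      rw [← sq_abs, ← sq_abs y]
      exact pow_le_pow_left₀ (abs_nonneg _) (Real.abs_sin_le_abs.trans hty) 2
    rw [root_eq h1, root_eq h2, mul_div_cancel_left₀ _ h1.ne', mul_div_cancel_left₀ _ h2.ne']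
    refine (abs_sqrt_sub_sqrt_le (by positivity) (by positivity)).trans ?_
    rw [show Real.sin t ^ 2 / r₁ ^ 2 - Real.sin t ^ 2 / r₂ ^ 2
      = -(Real.sin t ^ 2 / r₂ ^ 2 * ((r₁ + r₂) / r₁) * ((r₁ - r₂) / r₁)) by field_simp; ring,
      abs_neg, abs_mul, abs_mul, abs_div (r₁ - r₂), abs_of_pos h1,
      abs_of_nonneg (show 0 ≤ Real.sin t ^ 2 / r₂ ^ 2 by positivity),
      abs_of_pos (show 0 < (r₁ + r₂) / r₁ by positivity)]
    have e3 : (r₁ + r₂) / r₁ ≤ 3 := by rw [div_le_iff₀ h1]; linarith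
    calc _ ≤ y ^ 2 / r₂ ^ 2 * 3 * (|r₁ - r₂| / r₁) := by gcongr
      _ = _ := by ring
  have := intervalIntegral.norm_integral_le_of_norm_le_const hb
  rw [sub_zero, mul_comm] at this
  exact this

lemma mul_abs_ang_le (κ : ℝ) (s : State) {r : ℝ} (hr : 0 < r) :
    |State.ang κ s r| ≤ |State.X κ s r / r| := by
  have := mul_abs_sub_le_theta r (State.ang κ s r) 0
  rw [theta_zero, sub_zero, sub_zero, State.ang, theta_thetaInv hr] at this
  rw [abs_div, abs_of_pos hr, le_div_iff₀ hr, mul_comm]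
  exact this

/-- The angle is stable although `theta r` is inverted at a radius that depends on the state:
`∂_y theta ≥ r`, and `theta r y / r` varies little with `r` as long as `y = O(r)`. -/
lemma ang (κ : ℝ) : Weighted 1 0 (fun s r _ => State.ang κ s r) where
  bound L := by
    obtain ⟨C, hC, H⟩ := (X_div κ).bound L
    exact ⟨C, hC, fun s hs r hr t ht => (mul_abs_ang_le κ s hr).trans (H s hs r hr t ht)⟩
  lip L := by
    obtain ⟨C, hC, H⟩ := (X_div κ).bound L
    obtain ⟨D, hD, I⟩ := (X_div κ).lip L
    obtain ⟨E, hE, J⟩ := radius.lip L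
    refine ⟨D + 2 * C * (3 * C ^ 2) * E, by positivity, fun s₁ s₂ h₁ h₂ x hx t ht => ?_⟩
    have i := I s₁ s₂ h₁ h₂ x hx t ht
    have j := J s₁ s₂ h₁ h₂ x hx t ht
    have b := (mul_abs_ang_le κ s₂ hx.2.1).trans (H s₂ h₂ _ hx.2.1 t ht)
    set r₁ := rad s₁ x
    set r₂ := rad s₂ x
    obtain ⟨p1, p2, p3, p4⟩ := hx
    have hx : Comparable r₁ r₂ := ⟨p1, p2, p3, p4⟩
    set a₁ := State.ang κ s₁ r₁
    set a₂ := State.ang κ s₂ r₂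
    have t1 : theta r₁ a₁ = State.X κ s₁ r₁ := theta_thetaInv p1 _
    have t2 : theta r₂ a₂ = State.X κ s₂ r₂ := theta_thetaInv p2 _
    rw [show (1:ℤ) - 1 = 0 by norm_num, wt_zero_zero, mul_one] at i ⊢
    rw [show (1:ℤ) - 1 = 0 by norm_num, wt_zero_neg_two p1] at j
    rw [wt_one_zero] at b
    have m := mul_abs_sub_le_theta r₁ a₁ a₂
    have m2 : |a₁ - a₂| ≤ |theta r₁ a₁ / r₁ - theta r₁ a₂ / r₁| := by
      rw [← sub_div, abs_div, abs_of_pos p1, le_div_iff₀ p1, mul_comm]; exact m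
    have e : theta r₁ a₁ / r₁ - theta r₁ a₂ / r₁ =
        (State.X κ s₁ r₁ / r₁ - State.X κ s₂ r₂ / r₂)
          - (theta r₁ a₂ / r₁ - theta r₂ a₂ / r₂) := by rw [t1, ← t2]; ring
    have st := abs_theta_div_sub_le hx a₂
    have b2 : |a₂| ≤ C * r₂ := b.trans (by
      gcongr; exact div_le_self p2.le (by linarith))
    have b3 : a₂ ^ 2 / r₂ ^ 2 ≤ C ^ 2 := by
      rw [div_le_iff₀ (by positivity), ← mul_pow, ← sq_abs]
      exact pow_le_pow_left₀ (abs_nonneg _) b2 2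
    have b4 : |a₂| ≤ 2 * C * (r₁ / (1 + r₁)) := by
      refine b.trans ?_
      have : r₂ / (1 + r₂) ≤ 2 * (r₁ / (1 + r₁)) := by
        rw [← mul_div_assoc, div_le_div_iff₀ (by positivity) (by positivity)]
        nlinarith [mul_pos p1 p2]
      calc _ ≤ C * (2 * (r₁ / (1 + r₁))) := by gcongr
        _ = _ := by ring
    have st2 : |theta r₁ a₂ / r₁ - theta r₂ a₂ / r₂| ≤ 2 * C * (3 * C ^ 2) * E * ‖s₁ - s₂‖ := by
      calc _ ≤ |a₂| * (3 * (a₂ ^ 2 / r₂ ^ 2) * (|r₁ - r₂| / r₁)) := st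
        _ ≤ (2 * C * (r₁ / (1 + r₁))) * (3 * C ^ 2 * ((E * ‖s₁ - s₂‖ * (1 + r₁)) / r₁)) := by
          gcongr
        _ = _ := by field_simp
    calc |a₁ - a₂| ≤ _ := m2
      _ ≤ |State.X κ s₁ r₁ / r₁ - State.X κ s₂ r₂ / r₂|
          + |theta r₁ a₂ / r₁ - theta r₂ a₂ / r₂| := by rw [e]; exact abs_sub _ _
      _ ≤ D * ‖s₁ - s₂‖ + 2 * C * (3 * C ^ 2) * E * ‖s₁ - s₂‖ := add_le_add i st2
      _ = _ := by ring
  cont s := by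
    have hX : ContinuousOn (fun r => State.X κ s r / r) (Ioi 0) :=
      ((X_div κ).cont s).comp (f := fun r : ℝ => (r, (0:ℝ))) (by fun_prop) fun r hr => ⟨hr, by simp⟩
    have h1 : ContinuousOn (fun r => State.ang κ s r) (Ioi 0) := by
      intro r hr
      apply ContinuousAt.continuousWithinAt
      have hr' : 0 < r := hr
      have hc1 := hX.continuousAt (Ioi_mem_nhds hr')
      have hc2 : ContinuousAt (fun x => theta x (State.ang κ s r) / x) r :=
        (((continuousOn_integral_kernel continuousOn_root).comp
          (f := fun x : ℝ => (x, State.ang κ s r)) (by fun_prop)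
          (fun x hx => ⟨hx, mem_univ _⟩)).continuousAt (Ioi_mem_nhds hr')).div continuousAt_id hr'.ne'
      have hc := (hc1.sub hc2).abs
      have h0 : |State.X κ s r / r - theta r (State.ang κ s r) / r| = 0 := by
        rw [State.ang, theta_thetaInv hr', sub_self, abs_zero]
      unfold ContinuousAt at hc
      simp only [Pi.sub_apply, h0] at hc
      rw [ContinuousAt, tendsto_iff_norm_sub_tendsto_zero]
      refine squeeze_zero' (Filter.Eventually.of_forall fun _ => norm_nonneg _) ?_ hc
      filter_upwards [Ioi_mem_nhds hr'] with x hx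
      have hx' : 0 < x := hx
      have := mul_abs_sub_le_theta x (State.ang κ s x) (State.ang κ s r)
      rw [← sub_div, abs_div, abs_of_pos hx', le_div_iff₀ hx', mul_comm]
      have e : theta x (State.ang κ s x) = State.X κ s x := theta_thetaInv hx' _
      rw [e] at this
      exact this
    exact h1.comp continuousOn_fst fun p hp => hp.1

/-- `sin²(t a) / r²`, with the angle rescaled to an interval that does not depend on the state. -/
def ratioSq (κ : ℝ) (s : State) (r t : ℝ) : ℝ := Real.sin (t * State.ang κ s r) ^ 2 / r ^ 2
/-- `(1 + 2 sin²(t a)/r²)^{-1/2}` -/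
def invRoot (κ : ℝ) (s : State) (r t : ℝ) : ℝ := 1 / √(1 + 2 * ratioSq κ s r t)

lemma ratioSq_nonneg (κ : ℝ) (s : State) (r t : ℝ) : 0 ≤ ratioSq κ s r t := by
  unfold ratioSq; positivity

lemma sin_param (κ : ℝ) : Weighted 1 0 (fun s r t => Real.sin (t * State.ang κ s r)) :=
  ((param.mul (ang κ)).cast (zero_add 1) (zero_add 0)).sin zero_le_one le_rfl

lemma weighted_ratioSq (κ : ℝ) : Weighted 0 4 (ratioSq κ) :=
  (((sin_param κ).pow 2).div_radius.div_radius.cast (by norm_num) (by norm_num)).congr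
    fun s r _ t _ => by rw [ratioSq, div_div, sq r]

lemma invRoot_sub_one (κ : ℝ) : Weighted 0 4 (fun s r t => invRoot κ s r t - 1) := by
  refine (weighted_ratioSq κ).comp (φ := fun x => 1 / √(1 + 2 * x) - 1) le_rfl (by norm_num) (D := Ici 0)
    (fun s r t => ratioSq_nonneg κ s r t) (mem_Ici.2 le_rfl) (by simp) (fun _ => ⟨1, zero_le_one, ?_⟩) ?_
  · intro x hx y hy _ _
    have hx' : 0 ≤ x := hx
    have hy' : 0 ≤ y := hy
    have h1 : 1 ≤ √(1 + 2 * x) := Real.one_le_sqrt.2 (by linarith)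
    have h2 : 1 ≤ √(1 + 2 * y) := Real.one_le_sqrt.2 (by linarith)
    have h3 := abs_sqrt_sub_sqrt_le hx' hy'
    rw [sub_sub_sub_cancel_right, div_sub_div _ _ (by positivity) (by positivity), abs_div,
      abs_of_pos (show 0 < √(1 + 2 * x) * √(1 + 2 * y) by positivity),
      div_le_iff₀ (by positivity), one_mul, mul_one, abs_sub_comm]
    refine h3.trans ?_
    rw [one_mul]
    exact le_mul_of_one_le_right (abs_nonneg _) (by nlinarith)
  · refine ContinuousOn.sub (ContinuousOn.div continuousOn_const (by fun_prop) fun x hx => ?_)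
      continuousOn_const
    have hx' : 0 ≤ x := hx
    positivity

lemma weighted_invRoot (κ : ℝ) : Weighted 0 0 (invRoot κ) :=
  (((invRoot_sub_one κ).mono (l' := 0) le_rfl (by norm_num)).add (const 1)).congr
    fun _ _ _ _ _ => by ring

lemma invRoot_pos (κ : ℝ) (s : State) (r t : ℝ) : 0 < invRoot κ s r t := by
  have := ratioSq_nonneg κ s r t
  unfold invRoot; positivity

lemma invRoot_sq (κ : ℝ) (s : State) (r t : ℝ) :
    invRoot κ s r t ^ 2 * (1 + 2 * ratioSq κ s r t) = 1 := by
  have := ratioSq_nonneg κ s r t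
  unfold invRoot
  rw [div_pow, one_pow, Real.sq_sqrt (by positivity)]
  field_simp

lemma root_param (κ : ℝ) (s : State) {r : ℝ} (hr : 0 < r) (t : ℝ) :
    root r (t * State.ang κ s r) = r / invRoot κ s r t := by
  rw [root_eq hr, invRoot, div_div_eq_mul_div, div_one]
  rfl

lemma sin_sq_param (κ : ℝ) (s : State) {r : ℝ} (hr : 0 < r) (t : ℝ) :
    Real.sin (t * State.ang κ s r) ^ 2 = r ^ 2 * ratioSq κ s r t := by
  unfold ratioSq; field_simp

lemma ker1_param (κ : ℝ) (s : State) {r : ℝ} (hr : 0 < r) (t : ℝ) :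
    ker1 r (t * State.ang κ s r) = invRoot κ s r t := by
  have := invRoot_pos κ s r t
  rw [ker1, root_param κ s hr]; field_simp

lemma ker2_param (κ : ℝ) (s : State) {r : ℝ} (hr : 0 < r) (t : ℝ) :
    ker2 r (t * State.ang κ s r) = 2 * ratioSq κ s r t * invRoot κ s r t ^ 3 / r := by
  have := invRoot_pos κ s r t
  rw [ker2, root_param κ s hr, sin_sq_param κ s hr]; field_simp

lemma ker3_param (κ : ℝ) (s : State) {r : ℝ} (hr : 0 < r) (t : ℝ) :
    ker3 r (t * State.ang κ s r) = -6 * ratioSq κ s r t * invRoot κ s r t ^ 5 / r / r := by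
  have := invRoot_pos κ s r t
  rw [ker3, root_param κ s hr, sin_sq_param κ s hr]; field_simp

lemma kerK_param (κ : ℝ) (s : State) {r : ℝ} (hr : 0 < r) (t : ℝ) :
    kerK r (t * State.ang κ s r) = r * (-2 * ratioSq κ s r t *
      (1 + 3 * ratioSq κ s r t + 3 * ratioSq κ s r t ^ 2) * invRoot κ s r t ^ 3) := by
  have := invRoot_pos κ s r t
  rw [kerK, root_param κ s hr, show Real.sin (t * State.ang κ s r) ^ 4
    = (Real.sin (t * State.ang κ s r) ^ 2) ^ 2 by ring, sin_sq_param κ s hr]; field_simp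

lemma kerL_param (κ : ℝ) (s : State) {r : ℝ} (hr : 0 < r) (t : ℝ) :
    kerL r (t * State.ang κ s r) = -2 * ratioSq κ s r t *
      (1 + 5 * ratioSq κ s r t + 3 * ratioSq κ s r t ^ 2) * invRoot κ s r t ^ 5 := by
  have := invRoot_pos κ s r t
  rw [kerL, root_param κ s hr, show Real.sin (t * State.ang κ s r) ^ 4
    = (Real.sin (t * State.ang κ s r) ^ 2) ^ 2 by ring, sin_sq_param κ s hr]; field_simp

/-- Integrals up to the angle, written over the fixed interval `[0, 1]`. -/
lemma integral_kernel {κ : ℝ} {ker : ℝ → ℝ → ℝ}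
    (h : Weighted k l (fun s r t => ker r (t * State.ang κ s r))) :
    Weighted (k + 1) l (fun s r _ => ∫ t in (0 : ℝ)..State.ang κ s r, ker r t) :=
  ((((ang κ).mul h.average).cast (add_comm _ _) (zero_add _))).congr fun _ _ _ _ _ =>
    integral_eq_mul_average _ _

lemma ker1 (κ : ℝ) : Weighted 0 0 (fun s r t => EinsteinSkyrme.ker1 r (t * State.ang κ s r)) :=
  (weighted_invRoot κ).congr fun s _ hr t _ => ker1_param κ s hr t

lemma ratioSq_mul_pow (κ : ℝ) (n : ℕ) :
    Weighted 0 4 (fun s r t => ratioSq κ s r t * invRoot κ s r t ^ n) :=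
  ((weighted_ratioSq κ).mul ((weighted_invRoot κ).pow n)).cast (by simp) (by simp)

lemma ker2 (κ : ℝ) : Weighted (-1) 6 (fun s r t => EinsteinSkyrme.ker2 r (t * State.ang κ s r)) :=
  (((ratioSq_mul_pow κ 3).const_mul 2).div_radius.cast (by norm_num) (by norm_num)).congr
    fun s _ hr t _ => by rw [ker2_param κ s hr t]; ring

lemma ker3 (κ : ℝ) : Weighted (-2) 8 (fun s r t => EinsteinSkyrme.ker3 r (t * State.ang κ s r)) :=
  (((ratioSq_mul_pow κ 5).const_mul (-6)).div_radius.div_radius.cast (by norm_num)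
    (by norm_num)).congr fun s _ hr t _ => by rw [ker3_param κ s hr t]; ring

lemma poly_ratioSq (κ c : ℝ) :
    Weighted 0 0 (fun s r t => 1 + c * ratioSq κ s r t + 3 * ratioSq κ s r t ^ 2) :=
  ((const 1).add (((weighted_ratioSq κ).mono (l' := 0) le_rfl (by norm_num)).const_mul c)).add
    ((((weighted_ratioSq κ).pow 2).mono (k' := 0) (l' := 0) (by norm_num) (by norm_num)).const_mul 3)

lemma kerK (κ : ℝ) : Weighted 1 2 (fun s r t => EinsteinSkyrme.kerK r (t * State.ang κ s r)) :=
  (((((ratioSq_mul_pow κ 3).mul (poly_ratioSq κ 3)).const_mul (-2)).mul_radius).cast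
    (by norm_num) (by norm_num)).congr fun s _ hr t _ => by rw [kerK_param κ s hr t]; ring

lemma kerL (κ : ℝ) : Weighted 0 4 (fun s r t => EinsteinSkyrme.kerL r (t * State.ang κ s r)) :=
  ((((ratioSq_mul_pow κ 5).mul (poly_ratioSq κ 5)).const_mul (-2)).cast
    (by norm_num) (by norm_num)).congr fun s _ hr t _ => by rw [kerL_param κ s hr t]; ring

/-- To leading order at infinity `kerL` is `-2 sin² t / r²`. -/
lemma kerL_add (κ : ℝ) :
    Weighted 0 8 (fun s r t => EinsteinSkyrme.kerL r (t * State.ang κ s r) + 2 * ratioSq κ s r t) := by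
  have h1 : Weighted 0 4 (fun s r t => 1 - invRoot κ s r t ^ 5) := by
    have hp : Weighted 0 0 (fun s r t => 1 + invRoot κ s r t + invRoot κ s r t ^ 2
        + invRoot κ s r t ^ 3 + invRoot κ s r t ^ 4) := by
      have h := fun n : ℕ => ((weighted_invRoot κ).pow n).cast (k' := 0) (l' := 0) (by simp) (by simp)
      exact ((((const 1).add (weighted_invRoot κ)).add (h 2)).add (h 3)).add (h 4)
    exact ((((invRoot_sub_one κ).mul hp).const_mul (-1)).cast (by norm_num) (by norm_num)).congr
      fun _ _ _ _ _ => by ring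
  have h2 : Weighted 0 4 (fun s r t =>
      (5 * ratioSq κ s r t + 3 * ratioSq κ s r t ^ 2) * invRoot κ s r t ^ 5) := by
    have h := ((weighted_invRoot κ).pow 5).cast (k' := 0) (l' := 0) (by simp) (by simp)
    exact (((((weighted_ratioSq κ).const_mul 5).add ((((weighted_ratioSq κ).pow 2).mono (k' := 0) (l' := 4)
      (by norm_num) (by norm_num)).const_mul 3)).mul h)).cast (by norm_num) (by norm_num)
  exact ((((weighted_ratioSq κ).mul (h1.sub h2)).const_mul 2).cast (by norm_num) (by norm_num)).congr
    fun s _ hr t _ => by rw [kerL_param κ s hr t]; ring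

lemma theta2 (κ : ℝ) : Weighted 0 6 (fun s r _ => EinsteinSkyrme.theta2 r (State.ang κ s r)) :=
  (ker2 κ).integral_kernel.cast (by norm_num) rfl

lemma theta3 (κ : ℝ) : Weighted (-1) 8 (fun s r _ => EinsteinSkyrme.theta3 r (State.ang κ s r)) :=
  (ker3 κ).integral_kernel.cast (by norm_num) rfl

lemma intK (κ : ℝ) : Weighted 2 2 (fun s r _ => EinsteinSkyrme.intK r (State.ang κ s r)) :=
  (kerK κ).integral_kernel.cast (by norm_num) rfl

lemma intL (κ : ℝ) : Weighted 1 4 (fun s r _ => EinsteinSkyrme.intL r (State.ang κ s r)) :=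
  (kerL κ).integral_kernel.cast (by norm_num) rfl

lemma theta1_sub_ang (κ : ℝ) :
    Weighted 1 4 (fun s r _ => EinsteinSkyrme.theta1 r (State.ang κ s r) - State.ang κ s r) := by
  refine (((ang κ).mul (invRoot_sub_one κ).average).cast (by norm_num) (by norm_num)).congr
    fun s r hr _ _ => ?_
  have h : Continuous fun t => EinsteinSkyrme.ker1 r (t * State.ang κ s r) :=
    (continuousOn_ker1.comp_continuous (f := fun t : ℝ => (r, t * State.ang κ s r)) (by fun_prop)
      fun t => ⟨hr, mem_univ _⟩)
  simp only [← ker1_param κ s hr]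
  rw [EinsteinSkyrme.theta1, integral_eq_mul_average,
    intervalIntegral.integral_sub (h.intervalIntegrable _ _) (by simp)]
  simp only [intervalIntegral.integral_const, smul_eq_mul]
  ring

lemma ang_sub_X_div (κ : ℝ) :
    Weighted 1 4 (fun s r _ => State.ang κ s r - State.X κ s r / r) := by
  have h0 : Weighted 0 4 (fun s r t => (invRoot κ s r t - 1)
      + 2 * (ratioSq κ s r t * invRoot κ s r t ^ 1)) :=
    (invRoot_sub_one κ).add ((ratioSq_mul_pow κ 1).const_mul 2)
  refine ((((ang κ).mul h0.average).const_mul (-1)).cast (by norm_num) (by norm_num)).congr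
    fun s r hr _ _ => ?_
  have e : ∀ t, (invRoot κ s r t - 1) + 2 * (ratioSq κ s r t * invRoot κ s r t ^ 1)
      = root r (t * State.ang κ s r) / r - 1 := by
    intro t
    have h1 := invRoot_pos κ s r t
    have h2 := invRoot_sq κ s r t
    rw [root_param κ s hr]
    field_simp
    linarith
  simp only [e]
  have h : Continuous fun t => root r (t * State.ang κ s r) / r :=
    ((continuous_root_snd r).comp (by fun_prop)).div_const r
  have hX : State.X κ s r = EinsteinSkyrme.theta r (State.ang κ s r) := (theta_thetaInv hr _).symm
  rw [hX, EinsteinSkyrme.theta, integral_eq_mul_average (root r),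
    intervalIntegral.integral_sub (h.intervalIntegrable _ _) (by simp),
    intervalIntegral.integral_div]
  simp only [intervalIntegral.integral_const, smul_eq_mul]
  ring

lemma ang_sub_ref (κ : ℝ) :
    Weighted 1 2 (fun s r _ => State.ang κ s r - EinsteinSkyrme.refW κ r) := by
  have h : Weighted 1 2 (fun _ r _ => refX κ r / r - EinsteinSkyrme.refW κ r) := by
    refine (((((ratio.pow 3).mul inv_one_add_radius).const_mul (3 * κ)).mono (k' := 1) (l' := 2)
      (by norm_num) (by norm_num))).congr fun s r hr _ _ => ?_
    unfold refX EinsteinSkyrme.refW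
    field_simp
    ring
  exact ((((ang_sub_X_div κ).mono (l' := 2) le_rfl (by norm_num)).add (X_div_sub_ref κ)).add h).congr
    fun _ _ _ _ _ => by ring

lemma Q (κ : ℝ) : Weighted 1 2 (fun s r _ => State.Q κ s r) :=
  ((((W_sub_ref κ).mono (l' := 2) le_rfl (by norm_num)).sub (ang_sub_ref κ)).sub
    ((theta1_sub_ang κ).mono (l' := 2) le_rfl (by norm_num))).congr
    fun _ _ _ _ _ => by unfold State.Q; ring

/-- At infinity the angle tends to `-κ`, a multiple of `π`, so that its sine decays. -/
lemma sin_ang {κ : ℝ} (hκ : Real.sin κ = 0) :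
    Weighted 1 2 (fun s r _ => Real.sin (State.ang κ s r)) := by
  refine combine (k' := 0) ((ang κ).sin zero_le_one le_rfl) ?_ (by norm_num) (by norm_num)
  have h1 : Weighted 0 2 (fun _ r _ => κ + EinsteinSkyrme.refW κ r) := by
    have hp : Weighted 0 0 (fun _ r _ =>
        1 + 2 * (r / (1 + r)) + 3 * (r / (1 + r)) ^ 2) :=
      ((const 1).add ((ratio.mono (k' := 0) (by norm_num) le_rfl).const_mul 2)).add
        (((ratio.pow 2).mono (k' := 0) (l' := 0) (by norm_num) (by norm_num)).const_mul 3)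
    refine (((((inv_one_add_radius.pow 2).mul hp).const_mul κ).mono (k' := 0) (l' := 2) (by norm_num)
      (by norm_num))).congr fun s r hr _ _ => ?_
    unfold EinsteinSkyrme.refW
    field_simp
    ring
  have h2 := (h1.add ((ang_sub_ref κ).mono (k' := 0) (by norm_num) le_rfl)).sin le_rfl (by norm_num)
  refine ((h2.const_mul (Real.cos κ))).congr fun s r _ _ _ => ?_
  rw [show κ + EinsteinSkyrme.refW κ r + (State.ang κ s r - EinsteinSkyrme.refW κ r)
    = κ + State.ang κ s r by ring, Real.sin_add, hκ]
  have : Real.cos κ ^ 2 = 1 := by rw [Real.cos_sq', hκ]; norm_num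
  linear_combination (-Real.sin (State.ang κ s r)) * this

end Weighted

end

/-! ### Weights of the metric functions and of the sources -/

section

open State

lemma tendsto_rad (s : State) : Tendsto (rad s) atTop atTop :=
  (radIso s).tendsto_atTop

lemma integrableOn_wt_three : MeasureTheory.IntegrableOn (fun x => wt 0 3 (max 0 x)) (Ioi 0) := by
  refine MeasureTheory.integrableOn_Ioi_of_intervalIntegral_norm_bounded (l := atTop)
    (b := fun x : ℝ => x) 2 0
    (fun i => ((continuous_wt_max le_rfl 3).integrableOn_Icc).mono_set Ioc_subset_Icc_self)
    tendsto_id ?_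
  filter_upwards [Ioi_mem_atTop 0] with r hr
  have h0 : 0 < r := hr
  have h : ∀ x, ‖wt 0 3 (max 0 x)‖ = wt 0 3 (max 0 x) := fun x => by
    rw [Real.norm_of_nonneg]; unfold wt; positivity
  simp only [h]
  refine (integral_wt_three_le h0).trans ?_
  have : wt 1 0 r ≤ 1 := by rw [wt_one_zero, div_le_one (by positivity)]; linarith
  linarith

namespace Weighted

variable {k l : ℤ}

lemma integrableOn_Ioi {f : State → ℝ → ℝ} (hf : Weighted k l fun s r _ => f s r) (hk : 1 ≤ k)
    (hl : 3 ≤ l) (s : State) : MeasureTheory.IntegrableOn (f s) (Ioi 0) := by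
  obtain ⟨C, hC, H⟩ := hf.bound ‖s‖
  have h1 : MeasureTheory.IntegrableOn (extZero (f s)) (Ioi 0) := by
    refine (integrableOn_wt_three.const_mul C).mono'
      (hf.continuous_extZero hk s).aestronglyMeasurable ?_
    filter_upwards [MeasureTheory.ae_restrict_mem measurableSet_Ioi] with x hx
    have hx' : 0 < x := hx
    rw [extZero_of_pos hx', max_eq_right hx'.le]
    refine (H s le_rfl x hx' 0 (by simp)).trans ?_
    gcongr
    exact wt_mono (by omega) hl hx'
  exact h1.congr_fun (fun x hx => extZero_of_pos hx) measurableSet_Ioi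

lemma integral_Ioi_bounds {f : State → ℝ → ℝ} (hf : Weighted k l fun s r _ => f s r) (hk : 1 ≤ k)
    (hl : 3 ≤ l) (L : ℝ) : ∃ C : ℝ, 0 ≤ C ∧ (∀ s : State, ‖s‖ ≤ L → |∫ x in Ioi 0, f s x| ≤ C) ∧
      ∀ s₁ s₂ : State, ‖s₁‖ ≤ L → ‖s₂‖ ≤ L →
        |(∫ x in Ioi 0, f s₁ x) - ∫ x in Ioi 0, f s₂ x| ≤ C * ‖s₁ - s₂‖ := by
  have hG := hf.integral hk (l' := 0) (Or.inl ⟨hl, rfl⟩)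
  have hlim : ∀ s, Tendsto (fun x => extZero (fun r => ∫ x in (0:ℝ)..r, f s x) (rad s x)) atTop
      (𝓝 (∫ x in Ioi 0, f s x)) := by
    intro s
    refine (MeasureTheory.intervalIntegral_tendsto_integral_Ioi 0 (hf.integrableOn_Ioi hk hl s)
      (tendsto_rad s)).congr' ?_
    filter_upwards [(tendsto_rad s).eventually (Ioi_mem_atTop 0)] with x hx
    exact (extZero_of_pos (f := fun r => ∫ x in (0:ℝ)..r, f s x) hx).symm
  have w1 : ∀ k : ℤ, 0 ≤ k → ∀ r, extZero (wt k 0) r ≤ 1 := by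
    intro k hk r
    unfold extZero; split_ifs with h
    · rw [← wt_zero_zero r]; exact wt_mono hk le_rfl h
    · exact zero_le_one
  obtain ⟨C, hC, H⟩ := hG.abs_extZero_le L
  obtain ⟨D, hD, I⟩ := hG.abs_extZero_sub_le L
  refine ⟨C + D * 2, by positivity, fun s hs => ?_, fun s₁ s₂ h₁ h₂ => ?_⟩
  · refine le_of_tendsto (hlim s).abs (Filter.Eventually.of_forall fun x => ?_)
    have := (H s hs (rad s x)).trans (mul_le_of_le_one_right hC (w1 _ (by omega) _))
    linarith
  · refine le_of_tendsto ((hlim s₁).sub (hlim s₂)).abs (Filter.Eventually.of_forall fun x => ?_)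
    refine (I s₁ s₂ h₁ h₂ x).trans ?_
    have a := w1 (k + 1 - 1) (by omega) (rad s₁ x)
    have b := w1 (k + 1 - 1) (by omega) (rad s₂ x)
    have : 0 ≤ D * ‖s₁ - s₂‖ := by positivity
    have : 0 ≤ C * ‖s₁ - s₂‖ := by positivity
    nlinarith

lemma integral_Ioi {f : State → ℝ → ℝ} (hf : Weighted k l fun s r _ => f s r) (hk : 1 ≤ k)
    (hl : 3 ≤ l) : Weighted 0 0 (fun s _ _ => ∫ x in Ioi 0, f s x) := by
  refine of_scalar (fun L => ?_) fun L => ?_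
  · obtain ⟨C, hC, H, -⟩ := hf.integral_Ioi_bounds hk hl L
    exact ⟨C, hC, H⟩
  · obtain ⟨C, hC, -, H⟩ := hf.integral_Ioi_bounds hk hl L
    exact ⟨C, hC, H⟩

lemma exp {f : State → ℝ → ℝ → ℝ} (hf : Weighted 0 0 f) :
    Weighted 0 0 (fun s r t => Real.exp (f s r t)) := by
  have h : Weighted 0 0 (fun s r t => Real.exp (f s r t) - 1) := by
    refine hf.comp (φ := fun x => Real.exp x - 1) le_rfl le_rfl (D := univ)
      (fun _ _ _ => mem_univ _) (mem_univ _) (by simp) (fun M => ⟨Real.exp M, (Real.exp_pos _).le, ?_⟩)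
      (by fun_prop)
    intro x _ y _ hx hy
    rw [sub_sub_sub_cancel_right]
    exact abs_exp_sub_exp_le ((le_abs_self _).trans hx) ((le_abs_self _).trans hy)
  exact (h.add (const 1)).congr fun _ _ _ _ _ => by ring

lemma kerK_ang (κ : ℝ) : Weighted 1 2 (fun s r _ => EinsteinSkyrme.kerK r (State.ang κ s r)) := by
  simpa using (kerK κ).eval_one

lemma ker2_ang (κ : ℝ) : Weighted (-1) 6 (fun s r _ => EinsteinSkyrme.ker2 r (State.ang κ s r)) := by
  simpa using (ker2 κ).eval_one

lemma ker1_ang (κ : ℝ) : Weighted 0 0 (fun s r _ => EinsteinSkyrme.ker1 r (State.ang κ s r)) := by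
  simpa using (ker1 κ).eval_one

lemma slope (κ : ℝ) : Weighted 0 4 (fun s r _ => State.slope κ s r) :=
  (((Q κ).div_radius.mul (weighted_invRoot κ).eval_one).cast (by norm_num) (by norm_num)).congr
    fun s r hr _ _ => by
      have h := root_param κ s hr 1
      have := invRoot_pos κ s r 1
      rw [one_mul] at h
      rw [State.slope, h]; field_simp

lemma energy (κ : ℝ) : Weighted 1 6 (fun s r _ => State.Q κ s r ^ 2 / r) :=
  ((Q κ).pow 2).div_radius.cast (by norm_num) (by norm_num)

/-- Splitting off the part inside the radius `r` reduces the lapse to its central value and a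
primitive. -/
lemma integral_Ioi_energy (κ : ℝ) (s : State) {r : ℝ} (hr : 0 ≤ r) :
    ∫ x in Ioi r, State.Q κ s x ^ 2 / x =
      (∫ x in Ioi 0, State.Q κ s x ^ 2 / x) - ∫ x in (0 : ℝ)..r, State.Q κ s x ^ 2 / x := by
  have h := (energy κ).integrableOn_Ioi le_rfl (by norm_num) s
  rw [eq_sub_iff_add_eq, add_comm]
  exact intervalIntegral.integral_interval_add_Ioi h (h.mono_set (Ioi_subset_Ioi hr))

lemma lapse (α κ : ℝ) : Weighted 0 0 (fun s r _ => State.lapse α κ s r) := by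
  have h1 := (energy κ).integral_Ioi le_rfl (by norm_num)
  have h2 := (energy κ).integral (l' := 0) le_rfl (Or.inl ⟨by norm_num, rfl⟩)
  exact ((h1.sub (h2.mono (k' := 0) (by norm_num) le_rfl)).const_mul (-α)).exp.congr
    fun s r hr _ _ => by rw [State.lapse, integral_Ioi_energy κ s hr.le]

lemma cos_ang (κ : ℝ) : Weighted 0 0 (fun s r _ => Real.cos (State.ang κ s r)) :=
  (ang κ).cos zero_le_one le_rfl

section
variable (α : ℝ) {κ : ℝ} (hκ : Real.sin κ = 0)
include hκ

lemma sin_sq : Weighted 2 4 (fun s r _ => Real.sin (State.ang κ s r) ^ 2) :=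
  ((sin_ang hκ).pow 2).cast (by norm_num) (by norm_num)

lemma massDensity : Weighted 2 4 (fun s r _ => State.massDensity α κ s r) := by
  have h1 : Weighted 2 4 (fun s r _ => Real.sin (State.ang κ s r) ^ 4 / r ^ 2) :=
    (((sin_ang hκ).pow 4).div_radius.div_radius.mono (by norm_num) (by norm_num)).congr
      fun s r _ _ _ => by rw [div_div, sq]
  have h2 := (((Q κ).pow 2).cast (k' := 2) (l' := 4) (by norm_num) (by norm_num))
  exact ((lapse α κ).mul ((h2.add ((sin_sq hκ).const_mul 2)).add h1)).cast (by norm_num) (by norm_num)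

lemma mass : Weighted 3 0 (fun s r _ => State.mass α κ s r) :=
  ((massDensity α hκ).integral (l' := 0) (by norm_num) (Or.inl ⟨by norm_num, rfl⟩)).cast
    (by norm_num) rfl

lemma mass_div : Weighted 2 2 (fun s r _ => α * State.mass α κ s r / r) :=
  ((mass α hκ).const_mul α).div_radius.cast (by norm_num) (by norm_num)

lemma mass_div_sq : Weighted 1 4 (fun s r _ => α * State.mass α κ s r / r ^ 2) :=
  ((mass_div α hκ).div_radius.cast (by norm_num) (by norm_num)).congr
    fun s r _ _ _ => by rw [div_div, sq]

lemma mass_div_cube : Weighted 0 6 (fun s r _ => α * State.mass α κ s r / r ^ 3) :=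
  ((mass_div_sq α hκ).div_radius.cast (by norm_num) (by norm_num)).congr
    fun s r _ _ _ => by rw [div_div]; rfl

lemma pot : Weighted 1 6 (fun s r _ => State.pot κ s r) := by
  have h1 : Weighted 1 6 (fun s r _ => Real.sin (State.ang κ s r) ^ 4 / r ^ 3) :=
    (((sin_ang hκ).pow 4).div_radius.div_radius.div_radius.mono (by norm_num) (by norm_num)).congr
      fun s r _ _ _ => by rw [div_div, div_div]; congr 1; ring
  exact ((((sin_sq hκ).const_mul 2).div_radius.cast (by norm_num) (by norm_num)).add h1)

lemma dPot : Weighted 0 8 (fun s r _ => State.dPot κ s r) := by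
  have hS := sin_ang hκ
  have h1 : Weighted 0 8 (fun s r _ => Real.sin (State.ang κ s r) * Real.cos (State.ang κ s r)
      * State.slope κ s r / r) :=
    (((hS.mul (cos_ang κ)).mul (slope κ)).div_radius).cast (by norm_num) (by norm_num)
  have h2 : Weighted 0 8 (fun s r _ => Real.sin (State.ang κ s r) ^ 2 / r ^ 2) :=
    ((sin_sq hκ).div_radius.div_radius.cast (by norm_num) (by norm_num)).congr
      fun s r _ _ _ => by rw [div_div, sq r]
  exact ((((h1.const_mul 4).sub (h2.const_mul 2)).add
    (((h1.mul h2).mono (k' := 0) (l' := 8) (by norm_num) (by norm_num)).const_mul 4)).sub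
    (((h2.mul h2).mono (k' := 0) (l' := 8) (by norm_num) (by norm_num)).const_mul 3)).congr
      fun s r hr _ _ => by unfold State.dPot; field_simp

lemma lapseT : Weighted 0 0 (fun s r _ => State.lapseT α κ s r) :=
  (lapse α κ).sub ((mass_div α hκ).mono (by norm_num) (by norm_num))

lemma dLapseT : Weighted 1 4 (fun s r _ => State.dLapseT α κ s r) :=
  ((mass_div_sq α hκ).sub ((((lapse α κ).mul (pot hκ)).const_mul α).mono (by norm_num)
    (by norm_num))).congr fun s r _ _ _ => by unfold State.dLapseT; ring

omit hκ in
lemma dLapse : Weighted 1 6 (fun s r _ => State.dLapse α κ s r) :=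
  ((((lapse α κ).mul (energy κ)).const_mul α).cast (by norm_num) (by norm_num)).congr
    fun s r _ _ _ => by unfold State.dLapse; ring

lemma massDensity_div : Weighted 1 6 (fun s r _ => α * State.massDensity α κ s r / r) :=
  ((massDensity α hκ).const_mul α).div_radius.cast (by norm_num) (by norm_num)

lemma d2LapseT : Weighted 0 6 (fun s r _ => State.d2LapseT α κ s r) := by
  have h1 : Weighted 0 6 (fun s r _ => α * State.massDensity α κ s r / r ^ 2) :=
    ((massDensity_div α hκ).div_radius.mono (by norm_num) (by norm_num)).congr
      fun s r _ _ _ => by rw [div_div, sq]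
  have h2 : Weighted 0 6 (fun s r _ => State.dLapse α κ s r * State.pot κ s r) :=
    (((dLapse (κ := κ) α).mul (pot hκ))).mono (by norm_num) (by norm_num)
  have h3 : Weighted 0 6 (fun s r _ => State.lapse α κ s r * State.dPot κ s r) :=
    (((lapse α κ).mul (dPot hκ))).mono (by norm_num) (by norm_num)
  exact (((h1.sub ((mass_div_cube α hκ).const_mul 2)).sub (h2.const_mul α)).sub
    (h3.const_mul α)).congr fun s r _ _ _ => by unfold State.d2LapseT; ring

omit hκ in
lemma dW (κ : ℝ) : Weighted 0 5 (fun s r _ => State.dW κ s r) := by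
  have h1 : Weighted 0 5 (fun _ r _ => -κ * (12 * (r / (1 + r)) ^ 2 * (1 / (1 + r)) ^ 3)) :=
    ((((ratio.pow 2).mul (inv_one_add_radius.pow 3)).const_mul (-κ * 12)).mono (by norm_num)
      (by norm_num)).congr fun s r _ _ _ => by ring
  have h2 : Weighted 0 5 (fun s r _ => (State.W κ s r - EinsteinSkyrme.refW κ r) / r) :=
    (W_sub_ref κ).div_radius.cast (by norm_num) (by norm_num)
  refine ((h1.add zeta).sub (h2.const_mul 2)).congr
    fun s r hr _ _ => ?_
  unfold State.dW State.Z refZ EinsteinSkyrme.refW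
  field_simp
  ring

omit hκ in
lemma dQ : Weighted 0 4 (fun s r _ => State.dQ κ s r) :=
  (((dW κ).mono (l' := 4) le_rfl (by norm_num)).sub
    ((theta2 κ).mono (l' := 4) le_rfl (by norm_num))).sub
    (((slope κ).mul (ker1_ang κ)).cast (by norm_num) (by norm_num))

omit hκ in
lemma dRefZ (κ : ℝ) : Weighted 1 4 (fun _ r _ => EinsteinSkyrme.dRefZ κ r) := by
  have he := inv_one_add_radius
  have hp : Weighted 0 0 (fun _ r _ => 2 * (2 * (1 / (1 + r)) + 6 * (1 / (1 + r)) ^ 2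
      + 12 * (1 / (1 + r)) ^ 3) - r / (1 + r) * (2 + 12 * (1 / (1 + r)) + 36 * (1 / (1 + r)) ^ 2)) := by
    have h := fun n : ℕ => (he.pow n).mono (k' := 0) (l' := 0) (by simp) (by simp)
    have h1 := he.mono (k' := 0) (l' := 0) (by simp) (by simp)
    exact ((((h1.const_mul 2).add ((h 2).const_mul 6)).add ((h 3).const_mul 12)).const_mul 2).sub
      (((ratio.mono (k' := 0) (by norm_num) le_rfl).mul
      (((const 2).add (h1.const_mul 12)).add ((h 2).const_mul 36))).cast (by norm_num) (by norm_num))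
  exact (((((he.pow 2).mul ratio).mul hp).const_mul (-κ)).cast (by norm_num) (by norm_num)).congr
    fun s r _ _ _ => by unfold EinsteinSkyrme.dRefZ; ring

/-- Both terms behave like `κ / r²` at infinity, because the integral of `-2 sin² t` up to the limit
`-κ ∈ π ℤ` of the angle is `κ`; this cancellation is what fixes the tail of the reference field. -/
lemma intL_sub_ref :
    Weighted 1 6 (fun s r _ => EinsteinSkyrme.intL r (State.ang κ s r) - 1 / 2 * EinsteinSkyrme.dRefZ κ r) := by
  refine combine (k' := -1) ((intL κ).sub ((dRefZ κ).const_mul (1 / 2))) ?_ (by norm_num) (by norm_num)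
  have h1 : Weighted (-1) 6 (fun s r _ => State.ang κ s r * ∫ t in (0 : ℝ)..1,
      (EinsteinSkyrme.kerL r (t * State.ang κ s r) + 2 * ratioSq κ s r t)) :=
    ((ang κ).mul (kerL_add κ).average).mono (by norm_num) (by norm_num)
  have h2 : Weighted (-1) 6 (fun s r _ => (State.ang κ s r - EinsteinSkyrme.refW κ r
      - Real.sin (State.ang κ s r) * Real.cos (State.ang κ s r)) / r ^ 2) :=
    ((((ang_sub_ref κ).sub (((sin_ang hκ).mul (cos_ang κ)).cast (by norm_num)
      (by norm_num))).div_radius.div_radius).cast (by norm_num) (by norm_num)).congr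
      fun s r _ _ _ => by rw [div_div, sq]
  have h3 : Weighted (-1) 6 (fun _ r _ => EinsteinSkyrme.refW κ r / r ^ 2
      + 1 / 2 * EinsteinSkyrme.dRefZ κ r) := by
    have he := inv_one_add_radius
    have hp : Weighted 0 0 (fun _ r _ => -κ * (6 + 6 * (1 / (1 + r)) + 12 * (1 / (1 + r)) ^ 2
        - r / (1 + r) * (6 + 18 * (1 / (1 + r))))) := by
      have h2 := (he.pow 2).mono (k' := 0) (l' := 0) (by simp) (by simp)
      have h1 := he.mono (k' := 0) (l' := 0) (by simp) (by simp)
      exact ((((const 6).add (h1.const_mul 6)).add (h2.const_mul 12)).sub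
        (((ratio.mono (k' := 0) (by norm_num) le_rfl).mul
        ((const 6).add (h1.const_mul 18))).cast (by norm_num) (by norm_num))).const_mul (-κ)
    refine ((((he.pow 3).mul ratio).mul hp).mono (by norm_num) (by norm_num)).congr
      fun s r hr _ _ => ?_
    unfold EinsteinSkyrme.dRefZ EinsteinSkyrme.refW
    field_simp
    ring
  refine ((h1.sub h2).sub h3).congr fun s r hr _ _ => ?_
  have hc : Continuous fun t => EinsteinSkyrme.kerL r (t * State.ang κ s r) :=
    (continuousOn_kerL.comp_continuous (f := fun t : ℝ => (r, t * State.ang κ s r)) (by fun_prop)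
      fun t => ⟨hr, mem_univ _⟩)
  have hc2 : Continuous fun t => 2 * ratioSq κ s r t := by unfold ratioSq; fun_prop
  rw [intervalIntegral.integral_add (hc.intervalIntegrable _ _) (hc2.intervalIntegrable _ _), mul_add,
    ← integral_eq_mul_average, EinsteinSkyrme.intL]
  have e : State.ang κ s r * ∫ t in (0 : ℝ)..1, 2 * ratioSq κ s r t =
      (State.ang κ s r - Real.sin (State.ang κ s r) * Real.cos (State.ang κ s r)) / r ^ 2 := by
    unfold ratioSq
    rw [← integral_eq_mul_average (fun t => 2 * (Real.sin t ^ 2 / r ^ 2))]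
    simp only [intervalIntegral.integral_const_mul, intervalIntegral.integral_div, integral_sin_sq]
    simp
    ring
  rw [e]
  ring

/-- The source of the remainder vanishes at the centre and is `O(r⁻³)` at infinity: no derivative of
`Z` occurs, and the remainder stays in its weighted space. -/
lemma zSource : Weighted 1 6 (fun s r _ => State.zSource α κ s r) := by
  have hQ := Q κ
  have hX : Weighted 0 2 (fun s r _ => State.X κ s r / r ^ 2) :=
    ((X_div κ).div_radius.cast (by norm_num) (by norm_num)).congr
      fun s r _ _ _ => by rw [div_div, sq]
  have hXK := hX.add ((intK κ).mono (k' := 0) (by norm_num) le_rfl)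
  have t1 : Weighted 1 6 (fun s r _ => State.d2LapseT α κ s r * State.Q κ s r) :=
    ((d2LapseT α hκ).mul hQ).mono (by norm_num) (by norm_num)
  have t2 : Weighted 1 6 (fun s r _ => State.dLapseT α κ s r / r * State.Q κ s r) :=
    ((dLapseT α hκ).div_radius.mul hQ).mono (by norm_num) (by norm_num)
  have t3 : Weighted 1 6 (fun s r _ => State.dLapseT α κ s r * State.dQ κ s r) :=
    ((dLapseT α hκ).mul dQ).mono (by norm_num) (by norm_num)
  have t4 : Weighted 1 6 (fun s r _ => (α * State.massDensity α κ s r / r)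
      * EinsteinSkyrme.theta2 r (State.ang κ s r)) :=
    ((massDensity_div α hκ).mul (theta2 κ)).mono (by norm_num) (by norm_num)
  have t5 : Weighted 1 6 (fun s r _ => (α * State.mass α κ s r / r ^ 2)
      * EinsteinSkyrme.theta2 r (State.ang κ s r)) :=
    ((mass_div_sq α hκ).mul (theta2 κ)).mono (by norm_num) (by norm_num)
  have t6 : Weighted 1 6 (fun s r _ => α * State.mass α κ s r / r
      * EinsteinSkyrme.theta3 r (State.ang κ s r)) :=
    ((mass_div α hκ).mul (theta3 κ)).mono (by norm_num) (by norm_num)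
  have t7 : Weighted 1 6 (fun s r _ => α * State.mass α κ s r / r
      * (State.slope κ s r * EinsteinSkyrme.ker2 r (State.ang κ s r))) :=
    ((mass_div α hκ).mul ((slope κ).mul (ker2_ang κ))).mono (by norm_num) (by norm_num)
  have t8 : Weighted 1 6 (fun s r _ => State.dLapse α κ s r
      * (State.X κ s r / r ^ 2 + EinsteinSkyrme.intK r (State.ang κ s r))) :=
    ((dLapse α).mul hXK).mono (by norm_num) (by norm_num)
  have t9 : Weighted 1 6 (fun s r _ => State.lapse α κ s r
      * (State.slope κ s r * EinsteinSkyrme.kerK r (State.ang κ s r))) :=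
    ((lapse α κ).mul ((slope κ).mul (kerK_ang κ))).mono (by norm_num) (by norm_num)
  have t10 : Weighted 1 6 (fun s r _ => State.lapse α κ s r
      * (EinsteinSkyrme.intL r (State.ang κ s r) - 1 / 2 * EinsteinSkyrme.dRefZ κ r)) :=
    ((lapse α κ).mul (intL_sub_ref hκ)).mono (by norm_num) (by norm_num)
  have t11 : Weighted 1 6 (fun s r _ => (α * State.mass α κ s r / r) * EinsteinSkyrme.dRefZ κ r) :=
    ((mass_div α hκ).mul (dRefZ κ)).mono (by norm_num) (by norm_num)
  have t12 : Weighted 1 6 (fun s r _ => α * State.mass α κ s r / r * State.W κ s r / r ^ 2) :=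
    (((mass_div α hκ).mul (W κ)).div_radius.div_radius.mono (by norm_num) (by norm_num)).congr
      fun s r _ _ _ => by rw [div_div (α * State.mass α κ s r / r * State.W κ s r), sq]
  have t13 : Weighted 1 6 (fun s r _ => State.dLapseT α κ s r * State.dW κ s r) :=
    ((dLapseT α hκ).mul (dW κ)).mono (by norm_num) (by norm_num)
  exact ((((((((((t1.add (t2.const_mul 2)).add t3).const_mul (1 / 2)).add
    ((((t4.add t5).add t6).add t7).const_mul (1 / 2))).sub t8).sub t9).sub t10).sub
    (t11.const_mul (1 / 2))).sub t12).add (t13.const_mul (1 / 2))).congr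
    fun s r _ _ _ => by unfold State.zSource; ring

lemma X_div_sq_add_intK : Weighted 0 4 (fun s r _ =>
    State.X κ s r / r ^ 2 + EinsteinSkyrme.intK r (State.ang κ s r)) := by
  have hS := sin_ang hκ
  have h1 : Weighted 0 4 (fun s r _ => Real.sin (State.ang κ s r) * Real.cos (State.ang κ s r)
      * (1 + ratioSq κ s r 1) * invRoot κ s r 1 / r) :=
    ((((hS.mul (cos_ang κ)).mul ((const 1).add ((weighted_ratioSq κ).eval_one.mono (l' := 0) le_rfl
      (by norm_num)))).mul (weighted_invRoot κ).eval_one).div_radius).cast (by norm_num) (by norm_num)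
  refine ((((theta2 κ).mono (l' := 4) le_rfl (by norm_num)).const_mul (1 / 2)).add h1).congr
    fun s r hr _ _ => ?_
  have hX : State.X κ s r = EinsteinSkyrme.theta r (State.ang κ s r) := (theta_thetaInv hr _).symm
  have h := root_param κ s hr 1
  have := invRoot_pos κ s r 1
  rw [one_mul] at h
  rw [hX, theta_div_add_intK hr, h, ratioSq, one_mul]
  field_simp

lemma source : Weighted 0 4 (fun s r _ => State.source α κ s r) :=
  ((((((dLapseT α hκ).mul (Q κ)).const_mul (1/2)).mono (by norm_num) (by norm_num)).add
    ((((mass_div α hκ).mul (theta2 κ)).const_mul (1/2)).mono (by norm_num) (by norm_num))).sub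
    (((lapse α κ).mul (X_div_sq_add_intK hκ)).cast (by norm_num) (by norm_num))).congr
    fun s r _ _ _ => by unfold State.source; ring

end
end Weighted

end

/-! ### Radial derivatives -/

section

open State

/-- Differentiation of an implicitly defined function that is known to be continuous, within a set and
at a point where `F` is differentiable. -/
lemma hasDerivWithinAt_of_implicit {F : ℝ × ℝ → ℝ} {F₁ F₂ G' x : ℝ} {y G : ℝ → ℝ} {S : Set ℝ}
    (hF : HasFDerivAt F ((ContinuousLinearMap.toSpanSingleton ℝ F₁).coprod
      (ContinuousLinearMap.toSpanSingleton ℝ F₂)) (x, y x)) (h0 : F₂ ≠ 0)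
    (hy : ContinuousWithinAt y S x) (hG : HasDerivWithinAt G G' S x)
    (hFG : ∀ z ∈ S, F (z, y z) = G z) (hx : x ∈ S) :
    HasDerivWithinAt y ((G' - F₁) / F₂) S x := by
  have ht : Tendsto (fun z => (z, y z)) (𝓝[S] x) (𝓝 (x, y x)) :=
    (tendsto_nhdsWithin_of_tendsto_nhds tendsto_id).prodMk_nhds hy
  have h1 := hF.isLittleO.comp_tendsto ht
  have h2 := hasDerivWithinAt_iff_isLittleO.1 hG
  set k := (G' - F₁) / F₂
  set η : ℝ → ℝ := fun z => y z - y x - (z - x) * k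
  have h3 : (fun z => F₂ * η z) =o[𝓝[S] x] fun z => |z - x| + |η z| := by
    have e1 : (fun z => F₂ * η z) =ᶠ[𝓝[S] x] fun z => (G z - G x - (z - x) • G')
        - (F (z, y z) - F (x, y x) - ((ContinuousLinearMap.toSpanSingleton ℝ F₁).coprod
      (ContinuousLinearMap.toSpanSingleton ℝ F₂)) ((z, y z) - (x, y x))) := by
      filter_upwards [self_mem_nhdsWithin] with z hz
      rw [hFG z hz, hFG x hx]
      simp only [η, k]
      simp
      field_simp
      ring
    refine IsLittleO.congr' (IsLittleO.sub (h2.trans_le fun z => ?_)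
      (h1.trans_isBigO (IsBigO.of_bound (1 + |k|) (Filter.Eventually.of_forall fun z => ?_)))) e1.symm
      EventuallyEq.rfl
    · rw [Real.norm_eq_abs, Real.norm_of_nonneg (by positivity)]
      linarith [abs_nonneg (η z)]
    · have : |y z - y x| ≤ |η z| + |z - x| * |k| := by
        rw [← abs_mul]
        calc |y z - y x| = |η z + (z - x) * k| := by simp only [η]; congr 1; ring
          _ ≤ _ := abs_add_le _ _
      rw [Real.norm_of_nonneg (show 0 ≤ |z - x| + |η z| by positivity)]
      simp only [Function.comp, Prod.mk_sub_mk, Prod.norm_mk, Real.norm_eq_abs]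
      have a := abs_nonneg (η z)
      have b := abs_nonneg (z - x)
      have c := abs_nonneg k
      refine max_le ?_ ?_ <;> nlinarith
  have h4 : η =o[𝓝[S] x] fun z => |z - x| + |η z| := by
    simpa [h0] using h3.const_mul_left F₂⁻¹
  have h5 : η =O[𝓝[S] x] fun z => z - x := by
    refine IsBigO.of_bound 1 ?_
    filter_upwards [h4.bound (show (0:ℝ) < 1 / 2 by norm_num)] with z hz
    rw [Real.norm_of_nonneg (show 0 ≤ |z - x| + |η z| by positivity)] at hz
    simp only [Real.norm_eq_abs] at hz ⊢
    linarith
  have h6 : (fun z => |z - x| + |η z|) =O[𝓝[S] x] fun z => z - x :=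
    (isBigO_refl _ _).abs_left.add h5.abs_left
  exact hasDerivWithinAt_iff_isLittleO.2 (h4.trans_isBigO h6)

namespace Weighted

variable {k l : ℤ} {f : State → ℝ → ℝ}

lemma hasDerivAt_integral (hf : Weighted k l fun s r _ => f s r) (hk : 1 ≤ k) (s : State) {r : ℝ}
    (hr : 0 < r) : HasDerivAt (fun r => ∫ x in (0 : ℝ)..r, f s x) (f s r) r := by
  have h1 := ((hf.continuous_extZero hk s).integral_hasStrictDerivAt 0 r).hasDerivAt
  rw [extZero_of_pos hr] at h1
  refine h1.congr_of_eventuallyEq ?_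
  filter_upwards [Ioi_mem_nhds hr] with z hz
  refine intervalIntegral.integral_congr_ae (Filter.Eventually.of_forall fun x hx => ?_)
  rw [uIoc_of_le (le_of_lt hz)] at hx
  exact (extZero_of_pos hx.1).symm

lemma continuousAt (hf : Weighted k l fun s r _ => f s r) (s : State) {r : ℝ} (hr : 0 < r) :
    ContinuousAt (f s) r := by
  have h2 : ContinuousOn (f s) (Ioi 0) :=
    (hf.cont s).comp (f := fun r : ℝ => (r, (0:ℝ))) (by fun_prop) fun t ht => ⟨ht, by simp⟩
  exact h2.continuousAt (Ioi_mem_nhds hr)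

lemma Z (κ : ℝ) : Weighted 0 2 (fun s r _ => State.Z κ s r) := by
  have h : Weighted 0 2 (fun _ r _ => refZ κ r) := by
    have he := inv_one_add_radius
    have h1 := he.mono (k' := 0) (l' := 0) (by simp) (by simp)
    have h2 := (he.pow 2).mono (k' := 0) (l' := 0) (by simp) (by simp)
    exact (((((ratio.pow 2).mul he).mul
      (((const 2).add (h1.const_mul 6)).add (h2.const_mul 12))).const_mul (-κ)).mono (by norm_num)
        (by norm_num)).congr fun s r _ _ _ => rfl
  exact h.add (zeta.mono le_rfl (by norm_num))

lemma sq_Z (κ : ℝ) : Weighted 2 (-2) (fun s r _ => r ^ 2 * State.Z κ s r) :=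
  ((radius.pow 2).mul (Z κ)).cast (by norm_num) (by norm_num)

end Weighted

namespace State

variable (α : ℝ) (κ : ℝ) (s : State) {r : ℝ}

lemma theta_ang (hr : 0 < r) : theta r (ang κ s r) = X κ s r := theta_thetaInv hr _

lemma root_mul_slope (hr : 0 < r) : root r (ang κ s r) * slope κ s r = Q κ s r := by
  have := root_pos hr (ang κ s r)
  rw [slope]; field_simp

lemma hasDerivAt_W (hr : 0 < r) : HasDerivAt (W κ s) (dW κ s r) r := by
  have h := ((Weighted.sq_Z κ).hasDerivAt_integral (by norm_num) s hr).div
    ((hasDerivAt_id r).pow 2) (by simpa using hr.ne')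
  refine h.congr_deriv ?_
  simp only [Pi.pow_apply, id]
  unfold dW W
  field_simp
  norm_num
  ring

lemma hasDerivAt_X (hr : 0 < r) : HasDerivAt (X κ s) (W κ s r) r :=
  (Weighted.W κ).hasDerivAt_integral le_rfl s hr

lemma hasDerivAt_ang (hr : 0 < r) : HasDerivAt (ang κ s) (slope κ s r) r := by
  have hF := hasFDerivAt_integral_kernel (fun _ h t => hasDerivAt_root_fst h t) continuousOn_root
    continuousOn_ker1 hr (ang κ s r)
  have hS : Ioi 0 ∈ 𝓝 r := Ioi_mem_nhds hr
  have h := hasDerivWithinAt_of_implicit (S := Ioi 0) hF (root_pos hr _).ne'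
    ((Weighted.ang κ).continuousAt s hr).continuousWithinAt
    (hasDerivAt_X κ s hr).hasDerivWithinAt (fun z hz => theta_ang κ s hz) hr
  exact h.hasDerivAt hS

/-- The second radial derivative of the angle. -/
def dSlope : ℝ → ℝ := fun r => dQ κ s r / root r (ang κ s r) -
  Q κ s r * (r + 2 * Real.sin (ang κ s r) * Real.cos (ang κ s r) * slope κ s r)
    / root r (ang κ s r) ^ 3

lemma hasDerivAt_root_ang (hr : 0 < r) : HasDerivAt (fun r => root r (ang κ s r))
    ((r + 2 * Real.sin (ang κ s r) * Real.cos (ang κ s r) * slope κ s r) / root r (ang κ s r)) r := by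
  have hp : (0:ℝ) < r ^ 2 + 2 * Real.sin (ang κ s r) ^ 2 := by positivity
  have h1 := (((hasDerivAt_id r).pow 2).add (((hasDerivAt_ang κ s hr).sin.pow 2).const_mul 2)).sqrt
    (by simpa using hp.ne')
  refine HasDerivAt.congr_deriv (f := fun r => root r (ang κ s r)) h1 ?_
  have := root_pos hr (ang κ s r)
  unfold root at this ⊢
  simp only [Pi.add_apply, Pi.pow_apply, id]
  field_simp
  norm_num
  ring

lemma hasDerivAt_Q (hr : 0 < r) : HasDerivAt (Q κ s) (dQ κ s r) r := by
  have h := hasDerivWithinAt_theta1 (s := univ) (ρ := id) hr (hasDerivAt_id r).hasDerivWithinAt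
    (hasDerivAt_ang κ s hr).hasDerivWithinAt
  rw [hasDerivWithinAt_univ] at h
  refine ((hasDerivAt_W κ s hr).sub h).congr_deriv ?_
  unfold dQ
  simp only [id]
  ring

lemma hasDerivAt_slope (hr : 0 < r) : HasDerivAt (slope κ s) (dSlope κ s r) r := by
  have h0 := root_pos hr (ang κ s r)
  refine ((hasDerivAt_Q κ s hr).div (hasDerivAt_root_ang κ s hr) h0.ne').congr_deriv ?_
  unfold dSlope
  field_simp

lemma hasDerivAt_lapse (hr : 0 < r) : HasDerivAt (lapse α κ s) (dLapse α κ s r) r := by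
  have h1 := (Weighted.energy κ).hasDerivAt_integral le_rfl s hr
  have h2 := ((h1.const_sub (∫ x in Ioi 0, Q κ s x ^ 2 / x)).const_mul (-α)).exp
  have h3 : lapse α κ s =ᶠ[𝓝 r] fun r => Real.exp (-α *
      ((∫ x in Ioi 0, Q κ s x ^ 2 / x) - ∫ x in (0:ℝ)..r, Q κ s x ^ 2 / x)) := by
    filter_upwards [Ioi_mem_nhds hr] with x hx
    rw [lapse, Weighted.integral_Ioi_energy κ s (le_of_lt hx)]
  refine (h2.congr_of_eventuallyEq h3).congr_deriv ?_
  rw [dLapse, lapse, Weighted.integral_Ioi_energy κ s hr.le]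
  ring

lemma continuousAt_lapse (hr : 0 < r) : ContinuousAt (lapse α κ s) r :=
  (hasDerivAt_lapse α κ s hr).continuousAt

section
variable (hκ : Real.sin κ = 0)
include hκ

lemma hasDerivAt_mass (hr : 0 < r) : HasDerivAt (mass α κ s) (massDensity α κ s r) r :=
  (Weighted.massDensity α hκ).hasDerivAt_integral (by norm_num) s hr

omit hκ in
lemma hasDerivAt_pot (hr : 0 < r) : HasDerivAt (pot κ s) (dPot κ s r) r := by
  have hS := (hasDerivAt_ang κ s hr).sin
  refine ((((hS.pow 2).const_mul 2).div (hasDerivAt_id r) hr.ne').add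
    ((hS.pow 4).div ((hasDerivAt_id r).pow 3) (by simpa using hr.ne'))).congr_deriv ?_
  unfold dPot
  simp only [Pi.pow_apply, id]
  field_simp
  norm_num
  ring

lemma hasDerivAt_lapseT (hr : 0 < r) : HasDerivAt (lapseT α κ s) (dLapseT α κ s r) r := by
  refine ((hasDerivAt_lapse α κ s hr).sub (((hasDerivAt_mass α κ s hκ hr).const_mul α).div
    (hasDerivAt_id r) hr.ne')).congr_deriv ?_
  unfold dLapse dLapseT massDensity pot
  simp only [id]
  field_simp
  ring

lemma hasDerivAt_mass_div (hr : 0 < r) : HasDerivAt (fun r => α * mass α κ s r / r)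
    (α * massDensity α κ s r / r - α * mass α κ s r / r ^ 2) r := by
  refine (((hasDerivAt_mass α κ s hκ hr).const_mul α).div (hasDerivAt_id r) hr.ne').congr_deriv ?_
  simp only [id]
  field_simp

lemma hasDerivAt_dLapseT (hr : 0 < r) : HasDerivAt (dLapseT α κ s) (d2LapseT α κ s r) r := by
  refine ((((hasDerivAt_mass α κ s hκ hr).const_mul α).div ((hasDerivAt_id r).pow 2)
    (by simpa using hr.ne')).sub (((hasDerivAt_lapse α κ s hr).const_mul α).mul
      (hasDerivAt_pot κ s hr))).congr_deriv ?_
  unfold d2LapseT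
  simp only [Pi.pow_apply, id]
  field_simp
  norm_num
  ring

/-- The radial derivative of `source`. -/
def dSource (α κ : ℝ) (s : State) (r : ℝ) : ℝ :=
  zSource α κ s r - 2 * source α κ s r / r - lapseT α κ s r * W κ s r / r ^ 2
    - 1 / 2 * dLapseT α κ s r * dW κ s r - 1 / 2 * lapseT α κ s r * dRefZ κ r

lemma hasDerivAt_source (hr : 0 < r) : HasDerivAt (source α κ s) (dSource α κ s r) r := by
  have ha := hasDerivAt_ang κ s hr
  have h2 := hasDerivWithinAt_theta2 (s := univ) (ρ := id) hr (hasDerivAt_id r).hasDerivWithinAt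
    ha.hasDerivWithinAt
  have hK := hasDerivWithinAt_intK (s := univ) (ρ := id) hr (hasDerivAt_id r).hasDerivWithinAt
    ha.hasDerivWithinAt
  rw [hasDerivWithinAt_univ] at h2 hK
  have h1 := (((hasDerivAt_dLapseT α κ s hκ hr).const_mul (1 / 2)).mul (hasDerivAt_Q κ s hr))
  have h3 := ((hasDerivAt_mass_div α κ s hκ hr).const_mul (1 / 2)).mul h2
  have h4 := (hasDerivAt_lapse α κ s hr).mul (((hasDerivAt_X κ s hr).div ((hasDerivAt_id r).pow 2)
    (by simpa using hr.ne')).add hK)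
  refine ((h1.add h3).sub h4).congr_deriv ?_
  unfold dSource zSource source
  simp only [Pi.pow_apply, Pi.add_apply, Pi.div_apply, id]
  have e : lapseT α κ s r = lapse α κ s r - α * mass α κ s r / r := rfl
  rw [e]
  field_simp
  norm_num
  ring

/-- The rate of change of `r² W` along a characteristic. -/
def flux (α κ : ℝ) (s : State) (r : ℝ) : ℝ :=
  r ^ 2 * source α κ s r - r * (lapseT α κ s r * W κ s r)
/-- The radial derivative of `flux`, with the derivative of the source expressed by `zSource`; it is
the rate of change of `r² Z ∂ᵣ/∂ₓ` along a characteristic, divided by `∂ᵣ/∂ₓ`. -/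
def dFlux (α κ : ℝ) (s : State) (r : ℝ) : ℝ :=
  r ^ 2 * (zSource α κ s r - 1 / 2 * lapseT α κ s r * dRefZ κ r)
    - r * lapseT α κ s r * Z κ s r - 1 / 2 * r ^ 2 * Z κ s r * dLapseT α κ s r

lemma hasDerivAt_flux (hr : 0 < r) : HasDerivAt (flux α κ s) (dFlux α κ s r) r := by
  refine ((((hasDerivAt_id r).pow 2).mul (hasDerivAt_source α κ s hκ hr)).sub
    ((hasDerivAt_id r).mul ((hasDerivAt_lapseT α κ s hκ hr).mul (hasDerivAt_W κ s hr)))).congr_deriv ?_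
  unfold dFlux dSource dW
  simp only [Pi.pow_apply, Pi.mul_apply, id]
  field_simp
  norm_num
  ring

end
end State

namespace Weighted
variable (α : ℝ) {κ : ℝ} (hκ : Real.sin κ = 0)
include hκ

lemma flux : Weighted 1 (-2) (fun s r _ => State.flux α κ s r) :=
  (((radius.pow 2).mul (source α hκ)).mono (k' := 1) (l' := -2) (by norm_num) (by norm_num)).sub
    (((lapseT α hκ).mul (W κ)).mul_radius.mono (k' := 1) (l' := -2) (by norm_num) (by norm_num))

lemma dFlux : Weighted 1 (-2) (fun s r _ => State.dFlux α κ s r) := by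
  have h0 : Weighted 1 4 (fun s r _ => State.zSource α κ s r
      - 1 / 2 * (State.lapseT α κ s r * EinsteinSkyrme.dRefZ κ r)) :=
    ((zSource α hκ).mono le_rfl (by norm_num)).sub
      (((lapseT α hκ).mul (dRefZ κ)).const_mul (1 / 2))
  have h1 := ((radius.pow 2).mul h0).mono (k' := 1) (l' := -2) (by norm_num) (by norm_num)
  have h2 := ((lapseT α hκ).mul (Z κ)).mul_radius.mono (k' := 1) (l' := -2) (by norm_num)
    (by norm_num)
  have h3 := (((sq_Z κ).mul (dLapseT α hκ)).const_mul (1 / 2)).mono (k' := 1) (l' := -2)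
    (by norm_num) (by norm_num)
  exact ((h1.sub h2).sub h3).congr fun s r _ _ _ => by unfold State.dFlux; ring

end Weighted

end

/-! ### Joint continuity in the state and the radius -/

section

open State

namespace State

lemma continuous_rad_uncurry : Continuous fun p : State × ℝ => rad p.1 p.2 := by
  rw [continuous_iff_continuousAt]
  rintro ⟨s₀, x₀⟩
  set L := ‖s₀‖ + 1
  have hL : ‖s₀‖ ≤ L := by simp [L]
  rw [ContinuousAt, tendsto_iff_norm_sub_tendsto_zero]
  have hb : Tendsto (fun p : State × ℝ => Real.exp L * ‖p.1 - s₀‖ * (1 + |p.2|)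
      + ‖rad s₀ p.2 - rad s₀ x₀‖) (𝓝 (s₀, x₀)) (𝓝 0) := by
    have hc : Continuous fun p : State × ℝ => Real.exp L * ‖p.1 - s₀‖ * (1 + |p.2|)
      + ‖rad s₀ p.2 - rad s₀ x₀‖ := by
      have := continuous_rad s₀
      fun_prop
    simpa using hc.tendsto (s₀, x₀)
  refine squeeze_zero' (Filter.Eventually.of_forall fun _ => norm_nonneg _) ?_ hb
  have hev : ∀ᶠ p : State × ℝ in 𝓝 (s₀, x₀), ‖p.1‖ ≤ L := by
    have : ContinuousAt (fun p : State × ℝ => ‖p.1‖) (s₀, x₀) := by fun_prop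
    filter_upwards [this.eventually (gt_mem_nhds (show ‖s₀‖ < L by simp [L]))] with p hp using hp.le
  filter_upwards [hev] with p hp
  calc _ ≤ ‖rad p.1 p.2 - rad s₀ p.2‖ + ‖rad s₀ p.2 - rad s₀ x₀‖ := norm_sub_le_norm_sub_add_norm_sub _ _ _
    _ ≤ _ := by gcongr; exact abs_rad_sub_le hp hL p.2

lemma continuous_label_uncurry : Continuous fun p : State × ℝ => label p.1 p.2 := by
  rw [continuous_iff_continuousAt]
  rintro ⟨s₀, r₀⟩
  set L := ‖s₀‖ + 1
  set x₀ := label s₀ r₀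
  rw [ContinuousAt, tendsto_iff_norm_sub_tendsto_zero]
  have hb : Tendsto (fun p : State × ℝ => Real.exp L * |p.2 - rad p.1 x₀|) (𝓝 (s₀, r₀)) (𝓝 0) := by
    have hc : Continuous fun p : State × ℝ => Real.exp L * |p.2 - rad p.1 x₀| :=
      continuous_const.mul (continuous_snd.sub (continuous_rad_uncurry.comp
        (f := fun p : State × ℝ => (p.1, x₀)) (by fun_prop))).abs
    simpa [x₀] using hc.tendsto (s₀, r₀)
  refine squeeze_zero' (Filter.Eventually.of_forall fun _ => norm_nonneg _) ?_ hb
  have hev : ∀ᶠ p : State × ℝ in 𝓝 (s₀, r₀), ‖p.1‖ ≤ L := by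
    have : ContinuousAt (fun p : State × ℝ => ‖p.1‖) (s₀, r₀) := by fun_prop
    filter_upwards [this.eventually (gt_mem_nhds (show ‖s₀‖ < L by simp [L]))] with p hp using hp.le
  filter_upwards [hev] with p hp
  have := mul_abs_sub_le hp x₀ (label p.1 p.2)
  rw [rad_label, Real.exp_neg, inv_mul_le_iff₀ (Real.exp_pos _)] at this
  exact this

lemma continuous_zeta_uncurry : Continuous fun p : State × ℝ => zeta p.1 p.2 := by
  unfold zeta
  have h : Continuous fun p : State × ℝ => p.1.2.2 (label p.1 p.2) := by
    have := continuous_label_uncurry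
    have h2 : Continuous fun p : State × ℝ => p.1.2.2 := by fun_prop
    exact continuous_eval.comp (h2.prodMk this)
  have h2 : Continuous fun p : State × ℝ => √(1 + |label p.1 p.2|) :=
    Real.continuous_sqrt.comp (continuous_const.add continuous_label_uncurry.abs)
  exact h.mul ((h2.inv₀ fun p => by positivity).pow 5)

end State

namespace Weighted

variable {k l : ℤ} {f : State → ℝ → ℝ}

lemma continuous_extZero_rad (hf : Weighted k l fun s r _ => f s r) (hk : 1 ≤ k) :
    Continuous fun p : State × ℝ => extZero (f p.1) (rad p.1 p.2) := by
  rw [continuous_iff_continuousAt]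
  rintro ⟨s₀, x₀⟩
  set L := ‖s₀‖ + 1
  have hL : ‖s₀‖ ≤ L := by simp [L]
  obtain ⟨C, hC, H⟩ := hf.abs_extZero_sub_le L
  have hw : Continuous fun r : ℝ => wt (k - 1) l (max 0 r) := continuous_wt_max (by omega) l
  have hle : ∀ r, extZero (wt (k - 1) l) r ≤ wt (k - 1) l (max 0 r) := by
    intro r; unfold extZero; split_ifs with h
    · rw [max_eq_right h.le]
    · have : 0 ≤ max 0 r := le_max_left _ _
      unfold wt; positivity
  rw [ContinuousAt, tendsto_iff_norm_sub_tendsto_zero]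
  have hb : Tendsto (fun p : State × ℝ => C * ‖p.1 - s₀‖ * (wt (k - 1) l (max 0 (rad p.1 p.2)) +
      wt (k - 1) l (max 0 (rad s₀ p.2)))
      + ‖extZero (f s₀) (rad s₀ p.2) - extZero (f s₀) (rad s₀ x₀)‖) (𝓝 (s₀, x₀)) (𝓝 0) := by
    have hc : Continuous fun p : State × ℝ => C * ‖p.1 - s₀‖ * (wt (k - 1) l (max 0 (rad p.1 p.2)) +
      wt (k - 1) l (max 0 (rad s₀ p.2)))
      + ‖extZero (f s₀) (rad s₀ p.2) - extZero (f s₀) (rad s₀ x₀)‖ := by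
      have c1 := hw.comp continuous_rad_uncurry
      have c2 := hw.comp ((continuous_rad s₀).comp (continuous_snd (X := State)))
      have c3 := (hf.continuous_extZero hk s₀).comp ((continuous_rad s₀).comp (continuous_snd (X := State)))
      exact ((continuous_const.mul (by fun_prop)).mul (c1.add c2)).add (c3.sub continuous_const).norm
    simpa using hc.tendsto (s₀, x₀)
  refine squeeze_zero' (Filter.Eventually.of_forall fun _ => norm_nonneg _) ?_ hb
  have hev : ∀ᶠ p : State × ℝ in 𝓝 (s₀, x₀), ‖p.1‖ ≤ L := by
    have : ContinuousAt (fun p : State × ℝ => ‖p.1‖) (s₀, x₀) := by fun_prop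
    filter_upwards [this.eventually (gt_mem_nhds (show ‖s₀‖ < L by simp [L]))] with p hp using hp.le
  filter_upwards [hev] with p hp
  refine (norm_sub_le_norm_sub_add_norm_sub _ (extZero (f s₀) (rad s₀ p.2)) _).trans ?_
  gcongr
  exact (H p.1 s₀ hp hL p.2).trans (by gcongr <;> exact hle _)

lemma continuous_extZero_uncurry (hf : Weighted k l fun s r _ => f s r) (hk : 1 ≤ k) :
    Continuous fun p : State × ℝ => extZero (f p.1) p.2 := by
  have := (hf.continuous_extZero_rad hk).comp
    (f := fun p : State × ℝ => (p.1, label p.1 p.2)) (continuous_fst.prodMk continuous_label_uncurry)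
  simpa [Function.comp_def] using this

lemma continuousOn_uncurry (hf : Weighted k l fun s r _ => f s r) :
    ContinuousOn (fun p : State × ℝ => f p.1 p.2) (univ ×ˢ Ioi 0) := by
  obtain ⟨n, hn⟩ : ∃ n : ℕ, 1 ≤ k + n := ⟨(1 - k).toNat, by omega⟩
  have h1 : Weighted (k + n) l (fun s r _ => (r / (1 + r)) ^ n * f s r) :=
    ((ratio.pow n).mul hf).cast (by ring) (by ring)
  have h2 := (h1.continuous_extZero_uncurry hn).continuousOn (s := univ ×ˢ Ioi 0)
  have h3 : ContinuousOn (fun p : State × ℝ => (p.2 / (1 + p.2)) ^ n) (univ ×ˢ Ioi 0) := by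
    refine ContinuousOn.pow (continuousOn_snd.div (by fun_prop) fun p hp => ?_) n
    have : (0:ℝ) < p.2 := hp.2
    positivity
  refine (h2.div h3 fun p hp => ?_).congr fun p hp => ?_
  · have : (0:ℝ) < p.2 := hp.2
    positivity
  · have h : (0:ℝ) < p.2 := hp.2
    have e : extZero (fun r => (r / (1 + r)) ^ n * f p.1 r) p.2 = (p.2 / (1 + p.2)) ^ n * f p.1 p.2 :=
      extZero_of_pos h
    have h0 : (p.2 / (1 + p.2)) ^ n ≠ 0 := by positivity
    simp only [Pi.div_apply, e]
    rw [mul_div_cancel_left₀ _ h0]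

end Weighted

/-! ### The evolution vector field -/

/-- The weight of the amplitudes, the inverse of the one in `zeta`. -/
def amp (x : ℝ) : ℝ := √(1 + |x|) ^ 5

lemma amp_pos (x : ℝ) : 0 < amp x := by unfold amp; positivity
lemma continuous_amp : Continuous amp := by
  unfold amp
  exact (Real.continuous_sqrt.comp (by fun_prop)).pow 5

/-- For states in a bounded set, `1 + |x|` is bounded by a multiple of `1 + r` at positive radii `r`. -/
lemma amp_mul_wt_le (L : ℝ) : ∃ C : ℝ, 0 ≤ C ∧ ∀ s : State, ‖s‖ ≤ L → ∀ x : ℝ,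
    amp x * extZero (wt 0 5) (rad s x) ≤ C := by
  refine ⟨√((1 + |L|) * Real.exp |L|) ^ 5, by positivity, fun s hs x => ?_⟩
  rcases lt_or_ge 0 (rad s x) with h | h
  · rw [extZero_of_pos h, wt_zero_five, amp, ← mul_pow]
    have := one_add_abs_le (hs.trans (le_abs_self L)) h.le
    refine pow_le_pow_left₀ (by positivity) ?_ 5
    rw [mul_inv_le_iff₀ (by positivity), ← Real.sqrt_mul (by positivity)]
    exact Real.sqrt_le_sqrt this
  · rw [extZero_of_nonpos h, mul_zero]; positivity

lemma extZero_wt_le {k l k' l' : ℤ} (hk : k' ≤ k) (hl : l' ≤ l) (r : ℝ) :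
    extZero (wt k l) r ≤ extZero (wt k' l') r := by
  unfold extZero; split_ifs with h
  · exact wt_mono hk hl h
  · exact le_rfl

lemma extZero_wt_le_one {k l : ℤ} (hk : 0 ≤ k) (hl : 0 ≤ l) (r : ℝ) : extZero (wt k l) r ≤ 1 := by
  unfold extZero; split_ifs with h
  · rw [← wt_zero_zero r]; exact wt_mono hk hl h
  · exact zero_le_one

section field
variable (α : ℝ) {κ : ℝ} (hκ : Real.sin κ = 0)

lemma abs_dLapseT_le (L : ℝ) (hκ : Real.sin κ = 0) : ∃ C : ℝ, 0 ≤ C ∧ ∀ s : State, ‖s‖ ≤ L → ∀ x : ℝ,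
    |extZero (dLapseT α κ s) (rad s x)| ≤ C := by
  obtain ⟨C, hC, H⟩ := (Weighted.dLapseT α hκ).abs_extZero_le L
  exact ⟨C, hC, fun s hs x => (H s hs _).trans
    (mul_le_of_le_one_right hC (extZero_wt_le_one (by norm_num) (by norm_num) _))⟩

lemma abs_amp_mul_zSource_le (L : ℝ) (hκ : Real.sin κ = 0) : ∃ C : ℝ, 0 ≤ C ∧ ∀ s : State, ‖s‖ ≤ L → ∀ x : ℝ,
    |amp x * extZero (zSource α κ s) (rad s x)| ≤ C := by
  obtain ⟨C, hC, H⟩ := (Weighted.zSource α hκ).abs_extZero_le L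
  obtain ⟨D, hD, I⟩ := amp_mul_wt_le L
  refine ⟨C * D, by positivity, fun s hs x => ?_⟩
  rw [abs_mul, abs_of_pos (amp_pos x)]
  calc _ ≤ amp x * (C * extZero (wt 0 5) (rad s x)) := by
        have := amp_pos x
        gcongr
        exact (H s hs _).trans (by gcongr; exact extZero_wt_le (by norm_num) (by norm_num) _)
    _ = C * (amp x * extZero (wt 0 5) (rad s x)) := by ring
    _ ≤ _ := by gcongr; exact I s hs x

/-- The evolution as an ordinary differential equation for the state: the labels move with the
characteristics `dr/du = -g̃/2`, so that `log ∂ᵣ/∂ₓ` changes with the rate `-∂ᵣ g̃ / 2`, and the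
amplitudes change with the rate `zSource`. -/
def field (α : ℝ) {κ : ℝ} (hκ : Real.sin κ = 0) (s : State) : State :=
  (-(1 / 2) * lapse α κ s 0,
   BoundedContinuousFunction.ofNormedAddCommGroup (fun x => -(1 / 2) * extZero (dLapseT α κ s) (rad s x))
    (continuous_const.mul (((Weighted.dLapseT α hκ).continuous_extZero le_rfl s).comp (continuous_rad s)))
    (1 / 2 * (abs_dLapseT_le α ‖s‖ hκ).choose) (fun x => by
      rw [norm_mul, norm_neg, Real.norm_of_nonneg (by norm_num : (0:ℝ) ≤ 1 / 2)]
      gcongr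
      exact (abs_dLapseT_le α ‖s‖ hκ).choose_spec.2 s le_rfl x),
   BoundedContinuousFunction.ofNormedAddCommGroup (fun x => amp x * extZero (zSource α κ s) (rad s x))
    (continuous_amp.mul (((Weighted.zSource α hκ).continuous_extZero le_rfl s).comp (continuous_rad s)))
    (abs_amp_mul_zSource_le α ‖s‖ hκ).choose
    (fun x => (abs_amp_mul_zSource_le α ‖s‖ hκ).choose_spec.2 s le_rfl x))

lemma field_fst (s : State) : (field α hκ s).1 = -(1 / 2) * lapse α κ s 0 := rfl
lemma field_snd_fst (s : State) (x : ℝ) :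
    (field α hκ s).2.1 x = -(1 / 2) * extZero (dLapseT α κ s) (rad s x) := rfl
lemma field_snd_snd (s : State) (x : ℝ) :
    (field α hκ s).2.2 x = amp x * extZero (zSource α κ s) (rad s x) := rfl

lemma lapse_zero_bounds (κ L : ℝ) : ∃ C : ℝ, 0 ≤ C ∧ (∀ s : State, ‖s‖ ≤ L → |lapse α κ s 0| ≤ C) ∧
    ∀ s₁ s₂ : State, ‖s₁‖ ≤ L → ‖s₂‖ ≤ L → |lapse α κ s₁ 0 - lapse α κ s₂ 0| ≤ C * ‖s₁ - s₂‖ := by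
  obtain ⟨C, hC, H, I⟩ := (Weighted.energy κ).integral_Ioi_bounds le_rfl (by norm_num) L
  set M := |α| * C
  have hM : 0 ≤ M := by positivity
  have hb : ∀ s : State, ‖s‖ ≤ L → -α * ∫ x in Ioi 0, Q κ s x ^ 2 / x ≤ M := fun s hs => by
    refine (le_abs_self _).trans ?_
    rw [abs_mul, abs_neg]
    exact mul_le_mul_of_nonneg_left (H s hs) (abs_nonneg α)
  refine ⟨Real.exp M + Real.exp M * M, by positivity, fun s hs => ?_, fun s₁ s₂ h₁ h₂ => ?_⟩
  · rw [lapse, abs_of_pos (Real.exp_pos _)]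
    have := Real.exp_le_exp.2 (hb s hs)
    have : 0 ≤ Real.exp M * M := by positivity
    linarith
  · refine (abs_exp_sub_exp_le (hb s₁ h₁) (hb s₂ h₂)).trans ?_
    rw [← mul_sub, abs_mul, abs_neg]
    have := I s₁ s₂ h₁ h₂
    have h0 : 0 ≤ Real.exp M * ‖s₁ - s₂‖ := by positivity
    calc _ ≤ Real.exp M * (|α| * (C * ‖s₁ - s₂‖)) := by gcongr
      _ ≤ _ := by simp only [M]; linarith

lemma field_bounds (L : ℝ) : ∃ C : ℝ, 0 ≤ C ∧ (∀ s : State, ‖s‖ ≤ L → ‖field α hκ s‖ ≤ C) ∧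
    ∀ s₁ s₂ : State, ‖s₁‖ ≤ L → ‖s₂‖ ≤ L → ‖field α hκ s₁ - field α hκ s₂‖ ≤ C * ‖s₁ - s₂‖ := by
  obtain ⟨C₁, hC₁, H₁, I₁⟩ := lapse_zero_bounds α κ L
  obtain ⟨C₂, hC₂, H₂⟩ := abs_dLapseT_le α L hκ
  obtain ⟨D₂, hD₂, I₂⟩ := (Weighted.dLapseT α hκ).abs_extZero_sub_le L
  obtain ⟨C₃, hC₃, H₃⟩ := abs_amp_mul_zSource_le α L hκ
  obtain ⟨D₃, hD₃, I₃⟩ := (Weighted.zSource α hκ).abs_extZero_sub_le L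
  obtain ⟨E, hE, J⟩ := amp_mul_wt_le L
  set M := C₁ + C₂ + 2 * D₂ + C₃ + 2 * (D₃ * E)
  have hDE : 0 ≤ D₃ * E := by positivity
  have hM : 0 ≤ M := by positivity
  refine ⟨M, hM, fun s hs => ?_, fun s₁ s₂ h₁ h₂ => ?_⟩
  · refine norm_prod_le_iff.2 ⟨?_, norm_prod_le_iff.2 ⟨?_, ?_⟩⟩
    · rw [field_fst, Real.norm_eq_abs, abs_mul]
      have := H₁ s hs
      norm_num
      simp only [M]
      linarith [abs_nonneg (lapse α κ s 0)]
    · refine (BoundedContinuousFunction.norm_le hM).2 fun x => ?_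
      rw [field_snd_fst, Real.norm_eq_abs, abs_mul]
      have := H₂ s hs x
      norm_num
      simp only [M]
      linarith [abs_nonneg (extZero (dLapseT α κ s) (rad s x))]
    · refine (BoundedContinuousFunction.norm_le hM).2 fun x => ?_
      rw [field_snd_snd, Real.norm_eq_abs]
      have := H₃ s hs x
      simp only [M]
      linarith
  · have hn := norm_nonneg (s₁ - s₂)
    have hMn : 0 ≤ M * ‖s₁ - s₂‖ := by positivity
    refine norm_prod_le_iff.2 ⟨?_, norm_prod_le_iff.2 ⟨?_, ?_⟩⟩
    · rw [Prod.fst_sub, field_fst, field_fst, ← mul_sub, Real.norm_eq_abs, abs_mul]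
      have := I₁ s₁ s₂ h₁ h₂
      have h2 : 0 ≤ (C₂ + 2 * D₂ + C₃ + 2 * (D₃ * E)) * ‖s₁ - s₂‖ := by positivity
      norm_num
      simp only [M]
      linarith [abs_nonneg (lapse α κ s₁ 0 - lapse α κ s₂ 0)]
    · refine (BoundedContinuousFunction.norm_le hMn).2 fun x => ?_
      rw [Prod.snd_sub, Prod.fst_sub, BoundedContinuousFunction.sub_apply, field_snd_fst,
        field_snd_fst, ← mul_sub, Real.norm_eq_abs, abs_mul]
      have h := I₂ s₁ s₂ h₁ h₂ x
      have w1 := extZero_wt_le_one (k := 1 - 1) (l := 4) (by norm_num) (by norm_num) (rad s₁ x)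
      have w2 := extZero_wt_le_one (k := 1 - 1) (l := 4) (by norm_num) (by norm_num) (rad s₂ x)
      have h2 : 0 ≤ (C₁ + C₂ + C₃ + 2 * (D₃ * E)) * ‖s₁ - s₂‖ := by positivity
      have h3 : D₂ * ‖s₁ - s₂‖ * (extZero (wt (1 - 1) 4) (rad s₁ x)
        + extZero (wt (1 - 1) 4) (rad s₂ x)) ≤ D₂ * ‖s₁ - s₂‖ * 2 := by
        gcongr; linarith
      norm_num at h h3 ⊢
      simp only [M]
      linarith [abs_nonneg (extZero (dLapseT α κ s₁) (rad s₁ x) - extZero (dLapseT α κ s₂) (rad s₂ x))]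
    · refine (BoundedContinuousFunction.norm_le hMn).2 fun x => ?_
      rw [Prod.snd_sub, Prod.snd_sub, BoundedContinuousFunction.sub_apply, field_snd_snd,
        field_snd_snd, ← mul_sub, Real.norm_eq_abs, abs_mul, abs_of_pos (amp_pos x)]
      have h := I₃ s₁ s₂ h₁ h₂ x
      have j1 := J s₁ h₁ x
      have j2 := J s₂ h₂ x
      have w1 := extZero_wt_le (k := 1 - 1) (l := 6) (k' := 0) (l' := 5) (by norm_num) (by norm_num)
        (rad s₁ x)
      have w2 := extZero_wt_le (k := 1 - 1) (l := 6) (k' := 0) (l' := 5) (by norm_num) (by norm_num)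
        (rad s₂ x)
      have hp := amp_pos x
      have h2 : 0 ≤ (C₁ + C₂ + C₃ + 2 * D₂) * ‖s₁ - s₂‖ := by positivity
      calc _ ≤ amp x * (D₃ * ‖s₁ - s₂‖ * (extZero (wt 0 5) (rad s₁ x)
              + extZero (wt 0 5) (rad s₂ x))) := by
            gcongr
            exact h.trans (by gcongr)
        _ = D₃ * ‖s₁ - s₂‖ * (amp x * extZero (wt 0 5) (rad s₁ x)
              + amp x * extZero (wt 0 5) (rad s₂ x)) := by ring
        _ ≤ D₃ * ‖s₁ - s₂‖ * (E + E) := by gcongr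
        _ ≤ _ := by simp only [M]; linarith

lemma lipschitzOnWith_field (L : ℝ) : ∃ K : NNReal,
    LipschitzOnWith K (field α hκ) (Metric.closedBall 0 L) := by
  obtain ⟨C, hC, -, H⟩ := field_bounds α hκ L
  refine ⟨⟨C, hC⟩, LipschitzOnWith.of_dist_le_mul fun s₁ h₁ s₂ h₂ => ?_⟩
  rw [dist_eq_norm, dist_eq_norm]
  exact H s₁ s₂ (by simpa using h₁) (by simpa using h₂)

/-- Existence of local solutions of the evolution, by the Picard–Lindelöf theorem. -/
lemma exists_solution (s₀ : State) : ∃ u₀ : ℝ, 0 < u₀ ∧ ∃ s : ℝ → State, s 0 = s₀ ∧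
    ∀ u ∈ Icc (0 : ℝ) u₀, HasDerivWithinAt s (field α hκ (s u)) (Icc 0 u₀) u := by
  obtain ⟨C, hC, H, I⟩ := field_bounds α hκ (‖s₀‖ + 1)
  have hball : ∀ s ∈ Metric.closedBall s₀ ((1 : NNReal) : ℝ), ‖s‖ ≤ ‖s₀‖ + 1 := by
    intro s hs
    rw [mem_closedBall_iff_norm] at hs
    have := norm_le_norm_add_norm_sub' s s₀
    simp at hs
    linarith
  set u₀ : ℝ := 1 / (C + 1)
  have hu₀ : 0 < u₀ := by positivity
  have hPL : IsPicardLindelof (fun _ : ℝ => field α hκ) (tmin := 0) (tmax := u₀)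
      ⟨0, le_rfl, hu₀.le⟩ s₀ 1 0 ⟨C, hC⟩ ⟨C, hC⟩ := by
    refine IsPicardLindelof.of_time_independent (fun s hs => H s (hball s hs)) ?_ ?_
    · refine LipschitzOnWith.of_dist_le_mul fun s₁ h₁ s₂ h₂ => ?_
      rw [dist_eq_norm, dist_eq_norm]
      exact I s₁ s₂ (hball _ h₁) (hball _ h₂)
    · simp only [sub_zero, sub_self]
      rw [max_eq_left hu₀.le]
      simp only [NNReal.coe_one, NNReal.coe_zero, sub_zero, u₀]
      rw [mul_one_div, div_le_one (by positivity)]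
      change C ≤ C + 1
      linarith
  obtain ⟨s, hs0, hs⟩ := hPL.exists_eq_forall_mem_Icc_hasDerivWithinAt₀
  exact ⟨u₀, hu₀, s, hs0, hs⟩

end field

end

/-! ### Differentiation in two variables -/

section

lemma hasDerivWithinAt_intervalIntegral {S : Set ℝ} (hS : Convex ℝ S) {φ φ' : ℝ → ℝ → ℝ}
    {a b u : ℝ} {bound : ℝ → ℝ} (hu : u ∈ S)
    (hd : ∀ v ∈ S, ∀ y ∈ uIoc a b, HasDerivWithinAt (fun v => φ v y) (φ' v y) S v)
    (hb : ∀ v ∈ S, ∀ y ∈ uIoc a b, |φ' v y| ≤ bound y)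
    (hbi : IntervalIntegrable bound MeasureTheory.volume a b)
    (hi : ∀ v ∈ S, IntervalIntegrable (φ v) MeasureTheory.volume a b) :
    HasDerivWithinAt (fun v => ∫ y in a..b, φ v y) (∫ y in a..b, φ' u y) S u := by
  rw [hasDerivWithinAt_iff_tendsto_slope]
  have h : Tendsto (fun v => ∫ y in a..b, (v - u)⁻¹ * (φ v y - φ u y)) (𝓝[S \ {u}] u)
      (𝓝 (∫ y in a..b, φ' u y)) := by
    refine intervalIntegral.tendsto_integral_filter_of_dominated_convergence bound ?_ ?_ hbi ?_
    · filter_upwards [self_mem_nhdsWithin] with v hv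
      exact (((hi v hv.1).sub (hi u hu)).const_mul _).aestronglyMeasurable_restrict_uIoc
    · filter_upwards [self_mem_nhdsWithin] with v hv
      refine Filter.Eventually.of_forall fun y hy => ?_
      have := hS.norm_image_sub_le_of_norm_hasDerivWithin_le (fun v hv => hd v hv y hy)
        (fun v hv => hb v hv y hy) hu hv.1
      have h0 : 0 < |v - u| := abs_pos.2 (sub_ne_zero.2 hv.2)
      rw [norm_mul, norm_inv, Real.norm_eq_abs (v - u), inv_mul_le_iff₀ h0, mul_comm]
      exact this
    · refine Filter.Eventually.of_forall fun y hy => ?_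
      have := hasDerivWithinAt_iff_tendsto_slope.1 (hd u hu y hy)
      simpa [slope_def_field, div_eq_inv_mul, slope_fun_def] using this
  refine h.congr' ?_
  filter_upwards [self_mem_nhdsWithin] with v hv
  rw [intervalIntegral.integral_const_mul, intervalIntegral.integral_sub (hi v hv.1) (hi u hu),
    slope_def_field, div_eq_inv_mul]

/-- The part of the chain rule for `f v (ρ v)` that stems from the motion of `ρ`; only the partial
derivative of `f` in the second variable has to exist. -/
lemma hasDerivWithinAt_along_sub {S : Set ℝ} {f fr : ℝ → ℝ → ℝ} {ρ : ℝ → ℝ} {u ρ' : ℝ}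
    (hρ : HasDerivWithinAt ρ ρ' S u)
    (hd : ∀ᶠ p : ℝ × ℝ in 𝓝[S] u ×ˢ 𝓝 (ρ u), HasDerivAt (f p.1) (fr p.1 p.2) p.2)
    (hc : Tendsto (fun p : ℝ × ℝ => fr p.1 p.2) (𝓝[S] u ×ˢ 𝓝 (ρ u)) (𝓝 (fr u (ρ u)))) :
    HasDerivWithinAt (fun v => f v (ρ v) - f v (ρ u)) (ρ' * fr u (ρ u)) S u := by
  have h1 : (fun v => f v (ρ v) - f v (ρ u) - (ρ v - ρ u) * fr u (ρ u)) =o[𝓝[S] u]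
      fun v => ρ v - ρ u := by
    rw [isLittleO_iff]
    intro ε hε
    have hev := hd.and (Metric.tendsto_nhds.1 hc ε hε)
    rw [Filter.eventually_prod_iff] at hev
    obtain ⟨pa, hpa, pb, hpb, hp⟩ := hev
    obtain ⟨δ, hδ, hball⟩ := Metric.eventually_nhds_iff_ball.1 hpb
    have hρc : ∀ᶠ v in 𝓝[S] u, ρ v ∈ Metric.ball (ρ u) δ :=
      hρ.continuousWithinAt.eventually (Metric.ball_mem_nhds _ hδ)
    filter_upwards [hpa, hρc] with v hv hv2
    have := (convex_ball (ρ u) δ).norm_image_sub_le_of_norm_hasDerivWithin_le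
      (f := fun r => f v r - r * fr u (ρ u)) (f' := fun r => fr v r - fr u (ρ u)) (C := ε)
      (x := ρ u) (y := ρ v)
      (fun r hr => ((hp hv (hball r hr)).1.sub ((hasDerivAt_mul_const _))).hasDerivWithinAt)
      (fun r hr => (hp hv (hball r hr)).2.le) (Metric.mem_ball_self hδ) hv2
    refine le_trans (le_of_eq ?_) this
    congr 1; ring
  have h2 : (fun v => (ρ v - ρ u - (v - u) * ρ') * fr u (ρ u)) =o[𝓝[S] u] fun v => v - u := by
    have := (hasDerivWithinAt_iff_isLittleO.1 hρ).const_mul_left (fr u (ρ u))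
    exact this.congr_left fun v => by simp only [smul_eq_mul]; ring
  have h3 : (fun v => ρ v - ρ u) =O[𝓝[S] u] fun v => v - u := hρ.differentiableWithinAt.isBigO_sub
  rw [hasDerivWithinAt_iff_isLittleO]
  refine ((h1.trans_isBigO h3).add h2).congr_left fun v => ?_
  simp only [smul_eq_mul]
  ring

lemma closure_strip {u₀ : ℝ} (hu₀ : 0 < u₀) :
    closure (Ioo 0 u₀ ×ˢ Ioi (0:ℝ)) = Icc 0 u₀ ×ˢ Ici 0 := by
  rw [closure_prod_eq, closure_Ioo hu₀.ne, closure_Ioi]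

lemma uniqueDiffOn_strip {u₀ : ℝ} (hu₀ : 0 < u₀) :
    UniqueDiffOn ℝ (Icc 0 u₀ ×ˢ Ici (0:ℝ)) :=
  (uniqueDiffOn_Icc hu₀).prod (uniqueDiffOn_Ici 0)

/-- The linear form on the plane with the partial derivatives `a` and `b`. -/
def grad (a b : ℝ) : ℝ × ℝ →L[ℝ] ℝ :=
  (ContinuousLinearMap.toSpanSingleton ℝ a).coprod (ContinuousLinearMap.toSpanSingleton ℝ b)

lemma grad_apply (a b : ℝ) (v : ℝ × ℝ) : grad a b v = v.1 * a + v.2 * b := by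
  simp [grad]

lemma grad_eq (a b : ℝ) : grad a b = a • ContinuousLinearMap.fst ℝ ℝ ℝ
    + b • ContinuousLinearMap.snd ℝ ℝ ℝ := by
  ext <;> simp [grad]

lemma continuous_grad : Continuous fun p : ℝ × ℝ => grad p.1 p.2 := by
  simp only [grad_eq]; fun_prop

/-- On the strip `[0, u₀] × [0, ∞)` it suffices to have continuous partial derivatives in the interior
which extend continuously to the boundary. -/
lemma hasFDerivWithinAt_of_partials {u₀ : ℝ} (hu₀ : 0 < u₀) {f A B : ℝ → ℝ → ℝ}
    (hf : ContinuousOn (fun p : ℝ × ℝ => f p.1 p.2) (Icc 0 u₀ ×ˢ Ici 0))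
    (hA : ContinuousOn (fun p : ℝ × ℝ => A p.1 p.2) (Icc 0 u₀ ×ˢ Ici 0))
    (hB : ContinuousOn (fun p : ℝ × ℝ => B p.1 p.2) (Icc 0 u₀ ×ˢ Ici 0))
    (hdA : ∀ u ∈ Ioo 0 u₀, ∀ r : ℝ, 0 < r → HasDerivAt (fun v => f v r) (A u r) u)
    (hdB : ∀ u ∈ Ioo 0 u₀, ∀ r : ℝ, 0 < r → HasDerivAt (f u) (B u r) r) :
    ∀ p ∈ Icc 0 u₀ ×ˢ Ici (0:ℝ), HasFDerivWithinAt (fun p : ℝ × ℝ => f p.1 p.2)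
      (grad (A p.1 p.2) (B p.1 p.2)) (Icc 0 u₀ ×ˢ Ici 0) p := by
  set s : Set (ℝ × ℝ) := Ioo 0 u₀ ×ˢ Ioi (0:ℝ)
  have hso : IsOpen s := isOpen_Ioo.prod isOpen_Ioi
  have hss : s ⊆ Icc 0 u₀ ×ˢ Ici 0 := prod_mono Ioo_subset_Icc_self Ioi_subset_Ici_self
  have hin : ∀ p ∈ s, HasFDerivAt (fun p : ℝ × ℝ => f p.1 p.2) (grad (A p.1 p.2) (B p.1 p.2)) p := by
    intro p hp
    have hev : ∀ᶠ v in 𝓝 p, v ∈ s := hso.mem_nhds hp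
    have hcA : ContinuousAt (fun p : ℝ × ℝ => A p.1 p.2) p :=
      (hA p (hss hp)).continuousAt (mem_of_superset (hso.mem_nhds hp) hss)
    have hcB : ContinuousAt (fun p : ℝ × ℝ => B p.1 p.2) p :=
      (hB p (hss hp)).continuousAt (mem_of_superset (hso.mem_nhds hp) hss)
    have key := hasStrictFDerivAt_uncurry_coprod (𝕜 := ℝ) (u := p) (f := f)
      (f₁ := fun u r => ContinuousLinearMap.toSpanSingleton ℝ (A u r))
      (f₂ := fun u r => ContinuousLinearMap.toSpanSingleton ℝ (B u r)) ?_ ?_ ?_ ?_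
    · exact key.hasFDerivAt
    · filter_upwards [hev] with v hv using (hdA v.1 hv.1 v.2 hv.2).hasFDerivAt
    · filter_upwards [hev] with v hv using (hdB v.1 hv.1 v.2 hv.2).hasFDerivAt
    · exact (ContinuousLinearMap.toSpanSingletonCLE (𝕜 := ℝ) (E := ℝ)).continuous.continuousAt.comp hcA
    · exact (ContinuousLinearMap.toSpanSingletonCLE (𝕜 := ℝ) (E := ℝ)).continuous.continuousAt.comp hcB
  intro p hp
  rw [← closure_strip hu₀]
  refine hasFDerivWithinAt_closure_of_tendsto_fderiv (fun q hq => (hin q hq).differentiableAt.differentiableWithinAt)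
    ((convex_Ioo 0 u₀).prod (convex_Ioi 0)) hso (fun y hy => ?_) ?_
  · rw [closure_strip hu₀] at hy
    exact (hf y hy).mono hss
  · have h1 : Tendsto (fun q : ℝ × ℝ => grad (A q.1 q.2) (B q.1 q.2)) (𝓝[s] p)
        (𝓝 (grad (A p.1 p.2) (B p.1 p.2))) :=
      ((continuous_grad.comp_continuousOn (hA.prodMk hB)) p hp).mono hss
    refine h1.congr' ?_
    filter_upwards [self_mem_nhdsWithin] with q hq using (hin q hq).fderiv.symm

lemma contDiffOn_one_iff_fderivWithin' {E F : Type*} [NormedAddCommGroup E] [NormedSpace ℝ E]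
    [NormedAddCommGroup F] [NormedSpace ℝ F] {f : E → F} {s : Set E} (hs : UniqueDiffOn ℝ s) :
    ContDiffOn ℝ 1 f s ↔ DifferentiableOn ℝ f s ∧ ContinuousOn (fderivWithin ℝ f s) s := by
  rw [show (1 : WithTop ℕ∞) = 0 + 1 by norm_num, contDiffOn_succ_iff_fderivWithin hs, contDiffOn_zero]
  simp

lemma contDiffOn_of_hasFDerivWithinAt {u₀ : ℝ} (hu₀ : 0 < u₀) {f A B : ℝ → ℝ → ℝ}
    (hA : ContinuousOn (fun p : ℝ × ℝ => A p.1 p.2) (Icc 0 u₀ ×ˢ Ici 0))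
    (hB : ContinuousOn (fun p : ℝ × ℝ => B p.1 p.2) (Icc 0 u₀ ×ˢ Ici 0))
    (h : ∀ p ∈ Icc 0 u₀ ×ˢ Ici (0:ℝ), HasFDerivWithinAt (fun p : ℝ × ℝ => f p.1 p.2)
      (grad (A p.1 p.2) (B p.1 p.2)) (Icc 0 u₀ ×ˢ Ici 0) p) :
    ContDiffOn ℝ 1 (fun p : ℝ × ℝ => f p.1 p.2) (Icc 0 u₀ ×ˢ Ici 0) := by
  rw [contDiffOn_one_iff_fderivWithin' (uniqueDiffOn_strip hu₀)]
  refine ⟨fun p hp => (h p hp).differentiableWithinAt, ?_⟩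
  have h1 : ContinuousOn (fun p : ℝ × ℝ => grad (A p.1 p.2) (B p.1 p.2)) (Icc 0 u₀ ×ˢ Ici 0) :=
    continuous_grad.comp_continuousOn (hA.prodMk hB)
  exact h1.congr fun p hp => (h p hp).fderivWithin (uniqueDiffOn_strip hu₀ p hp)

lemma hasDerivWithinAt_fst_of_grad {u₀ : ℝ} {f : ℝ → ℝ → ℝ} {a b u r : ℝ} (hr : 0 ≤ r)
    (h : HasFDerivWithinAt (fun p : ℝ × ℝ => f p.1 p.2) (grad a b) (Icc 0 u₀ ×ˢ Ici 0) (u, r)) :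
    HasDerivWithinAt (fun v => f v r) a (Icc 0 u₀) u := by
  have h1 := HasFDerivWithinAt.comp_hasDerivWithinAt (f := fun v => (v, r)) (s := Icc 0 u₀)
    (t := Icc 0 u₀ ×ˢ Ici 0) u h
    ((hasDerivWithinAt_id u _).prodMk (hasDerivWithinAt_const u _ r)) (fun v hv => ⟨hv, hr⟩)
  simpa [grad_apply, Function.comp_def] using h1

lemma hasDerivWithinAt_snd_of_grad {u₀ : ℝ} {f : ℝ → ℝ → ℝ} {a b u r : ℝ} (hu : u ∈ Icc 0 u₀)
    (h : HasFDerivWithinAt (fun p : ℝ × ℝ => f p.1 p.2) (grad a b) (Icc 0 u₀ ×ˢ Ici 0) (u, r)) :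
    HasDerivWithinAt (f u) b (Ici 0) r := by
  have h1 := HasFDerivWithinAt.comp_hasDerivWithinAt (f := fun v => (u, v)) (s := Ici 0)
    (t := Icc 0 u₀ ×ˢ Ici 0) r h
    ((hasDerivWithinAt_const r _ u).prodMk (hasDerivWithinAt_id r _)) (fun v hv => ⟨hu, hv⟩)
  simpa [grad_apply, Function.comp_def] using h1

/-- The partial derivatives of a `C¹` function on the strip. -/
lemma exists_partials_of_contDiffOn {u₀ : ℝ} (hu₀ : 0 < u₀) {f : ℝ → ℝ → ℝ}
    (hf : ContDiffOn ℝ 1 (fun p : ℝ × ℝ => f p.1 p.2) (Icc 0 u₀ ×ˢ Ici 0)) :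
    ∃ A B : ℝ → ℝ → ℝ, ContinuousOn (fun p : ℝ × ℝ => A p.1 p.2) (Icc 0 u₀ ×ˢ Ici 0) ∧
      ContinuousOn (fun p : ℝ × ℝ => B p.1 p.2) (Icc 0 u₀ ×ˢ Ici 0) ∧
      ∀ p ∈ Icc 0 u₀ ×ˢ Ici (0:ℝ), HasFDerivWithinAt (fun p : ℝ × ℝ => f p.1 p.2)
        (grad (A p.1 p.2) (B p.1 p.2)) (Icc 0 u₀ ×ˢ Ici 0) p := by
  rw [contDiffOn_one_iff_fderivWithin' (uniqueDiffOn_strip hu₀)] at hf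
  set S : Set (ℝ × ℝ) := Icc 0 u₀ ×ˢ Ici 0
  set F : ℝ × ℝ → ℝ := fun p : ℝ × ℝ => f p.1 p.2
  refine ⟨fun u r => fderivWithin ℝ F S (u, r) (1, 0), fun u r => fderivWithin ℝ F S (u, r) (0, 1),
    hf.2.clm_apply continuousOn_const, hf.2.clm_apply continuousOn_const, fun p hp => ?_⟩
  refine (hf.1 p hp).hasFDerivWithinAt.congr_fderiv ?_
  ext <;> simp [grad_apply]

end

/-! ### Evolutions and characteristics -/

section

open State

namespace Weighted
variable {k l : ℤ} {f : State → ℝ → ℝ}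

lemma tendsto_zero (hf : Weighted k l fun s r _ => f s r) (hk : 1 ≤ k) (s : State) :
    Tendsto (f s) (𝓝[>] 0) (𝓝 0) := by
  have h := ((hf.continuous_extZero hk s).tendsto 0).mono_left (nhdsWithin_le_nhds (s := Ioi 0))
  rw [extZero_of_nonpos le_rfl] at h
  refine h.congr' ?_
  filter_upwards [self_mem_nhdsWithin] with r hr using extZero_of_pos hr

lemma integral_deriv {F : ℝ → ℝ} {F₀ : ℝ} (hf : Weighted k l fun s r _ => f s r) (hk : 1 ≤ k)
    (s : State) (hd : ∀ r, 0 < r → HasDerivAt F (f s r) r) (h0 : Tendsto F (𝓝[>] 0) (𝓝 F₀))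
    {r : ℝ} (hr : 0 < r) : ∫ x in (0 : ℝ)..r, f s x = F r - F₀ :=
  intervalIntegral.integral_eq_sub_of_hasDerivAt_of_tendsto hr (fun x hx => hd x hx.1)
    (hf.intervalIntegrable hk (fun _ _ _ => rfl) s 0 r le_rfl hr.le) h0
    ((hd r hr).continuousAt.tendsto.mono_left nhdsWithin_le_nhds)

end Weighted

lemma tendsto_lapse (α κ : ℝ) (s : State) : Tendsto (lapse α κ s) (𝓝[>] 0) (𝓝 (lapse α κ s 0)) := by
  have h := (((Weighted.energy κ).integral (l' := 0) le_rfl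
    (Or.inl ⟨by norm_num, rfl⟩)).tendsto_zero (by norm_num) s)
  have h2 := (Real.continuous_exp.tendsto _).comp
    ((h.const_sub (∫ x in Ioi 0, Q κ s x ^ 2 / x)).const_mul (-α))
  rw [sub_zero] at h2
  refine h2.congr' ?_
  filter_upwards [self_mem_nhdsWithin] with r hr
  rw [lapse, Weighted.integral_Ioi_energy κ s (le_of_lt hr)]
  rfl

section static
variable (α : ℝ) {κ : ℝ} (hκ : Real.sin κ = 0) (s : State) {r : ℝ}
include hκ

lemma tendsto_lapseT : Tendsto (lapseT α κ s) (𝓝[>] 0) (𝓝 (lapse α κ s 0)) := by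
  have h := (tendsto_lapse α κ s).sub ((Weighted.mass_div α hκ).tendsto_zero (by norm_num) s)
  rw [sub_zero] at h
  exact h

lemma integral_dLapseT (hr : 0 < r) :
    ∫ x in (0 : ℝ)..r, dLapseT α κ s x = lapseT α κ s r - lapse α κ s 0 :=
  (Weighted.dLapseT α hκ).integral_deriv le_rfl s (fun _ h => hasDerivAt_lapseT α κ s hκ h)
    (tendsto_lapseT α hκ s) hr

lemma integral_dFlux (hr : 0 < r) : ∫ x in (0 : ℝ)..r, dFlux α κ s x = flux α κ s r := by
  rw [(Weighted.dFlux α hκ).integral_deriv le_rfl s (fun _ h => hasDerivAt_flux α κ s hκ h)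
    ((Weighted.flux α hκ).tendsto_zero le_rfl s) hr, sub_zero]

end static

/-- `s` carries the labels along the characteristics `dr/du = -g̃/2` of the metric belonging to the
curve of states `E`: the velocity of the label `0` and the rate of change of `log ∂ᵣ/∂ₓ` are the
ones given by `E`.  Nothing is required of the amplitudes of `s`. -/
structure IsTransport (α : ℝ) {κ : ℝ} (hκ : Real.sin κ = 0) (u₀ : ℝ) (E s : ℝ → State) : Prop where
  deriv_fst : ∀ u ∈ Icc (0 : ℝ) u₀,
    HasDerivWithinAt (fun v => (s v).1) (-(1 / 2) * lapse α κ (E u) 0) (Icc 0 u₀) u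
  deriv_log : ∀ u ∈ Icc (0 : ℝ) u₀, ∀ x, HasDerivWithinAt (fun v => (s v).2.1 x)
    (-(1 / 2) * extZero (dLapseT α κ (E u)) (rad (s u) x)) (Icc 0 u₀) u
  exists_norm_le : ∃ L : ℝ, ∀ u ∈ Icc (0 : ℝ) u₀, ‖E u‖ ≤ L ∧ ‖s u‖ ≤ L
  center : (s 0).1 = 0

namespace IsTransport
variable {α κ : ℝ} {hκ : Real.sin κ = 0} {u₀ : ℝ} {E s : ℝ → State}
  (h : IsTransport α hκ u₀ E s) {u : ℝ} (hu : u ∈ Icc (0 : ℝ) u₀)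
include h hu

lemma hasDerivWithinAt_jac (x : ℝ) : HasDerivWithinAt (fun v => jac (s v) x)
    (jac (s u) x * (-(1 / 2) * extZero (dLapseT α κ (E u)) (rad (s u) x))) (Icc 0 u₀) u :=
  (h.deriv_log u hu x).exp

omit hu in
lemma fst_nonpos {u : ℝ} (hu : u ∈ Icc (0 : ℝ) u₀) : (s u).1 ≤ 0 := by
  have hanti : AntitoneOn (fun v => (s v).1) (Icc 0 u₀) := by
    refine antitoneOn_of_deriv_nonpos (convex_Icc _ _)
      (fun v hv => (h.deriv_fst v hv).continuousWithinAt) ?_ ?_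
    · rw [interior_Icc]
      exact fun v hv => ((h.deriv_fst v (Ioo_subset_Icc_self hv)).hasDerivAt
        (Icc_mem_nhds hv.1 hv.2)).differentiableAt.differentiableWithinAt
    · rw [interior_Icc]
      intro v hv
      rw [((h.deriv_fst v (Ioo_subset_Icc_self hv)).hasDerivAt
        (Icc_mem_nhds hv.1 hv.2)).deriv]
      have : 0 < lapse α κ (E v) 0 := Real.exp_pos _
      linarith
  have : (s u).1 ≤ (s 0).1 := hanti ⟨le_rfl, hu.1.trans hu.2⟩ hu hu.1
  rwa [h.center] at this

/-- The velocity of the label `x`. -/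
lemma hasDerivWithinAt_rad' (x : ℝ) : HasDerivWithinAt (fun v => rad (s v) x)
    (-(1 / 2) * lapse α κ (E u) 0 + ∫ y in (0 : ℝ)..x,
      jac (s u) y * (-(1 / 2) * extZero (dLapseT α κ (E u)) (rad (s u) y))) (Icc 0 u₀) u := by
  obtain ⟨L, hL⟩ := h.exists_norm_le
  obtain ⟨C, hC, H⟩ := (Weighted.dLapseT α hκ).abs_extZero_le L
  refine (h.deriv_fst u hu).add (hasDerivWithinAt_intervalIntegral (convex_Icc 0 u₀)
    (bound := fun _ => Real.exp L * C) hu (fun v hv y _ => h.hasDerivWithinAt_jac hv y)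
    (fun v hv y _ => ?_) intervalIntegrable_const
    (fun v _ => (continuous_jac (s v)).intervalIntegrable _ _))
  rw [abs_mul, abs_of_pos (jac_pos _ _)]
  have h1 := jac_le (hL v hv).2 y
  have h2 := (H _ (hL v hv).1 (rad (s v) y)).trans
    (mul_le_of_le_one_right hC (extZero_wt_le_one (by norm_num) (by norm_num) _))
  rw [abs_mul]
  norm_num
  have := abs_nonneg (extZero (dLapseT α κ (E v)) (rad (s v) y))
  gcongr
  linarith

lemma hasDerivWithinAt_rad {x : ℝ} (hx : 0 < rad (s u) x) : HasDerivWithinAt (fun v => rad (s v) x)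
    (-(1 / 2) * lapseT α κ (E u) (rad (s u) x)) (Icc 0 u₀) u := by
  refine (h.hasDerivWithinAt_rad' hu x).congr_deriv ?_
  have h1 := (Weighted.dLapseT α hκ).integral_extZero le_rfl (s := s u) (t := E u) (a := 0) (x := x)
    (by rw [rad_zero]; exact h.fst_nonpos hu) hx.le
  rw [integral_dLapseT α hκ (E u) hx] at h1
  have h2 : ∀ y, jac (s u) y * (-(1 / 2) * extZero (dLapseT α κ (E u)) (rad (s u) y))
      = -(1 / 2) * (extZero (dLapseT α κ (E u)) (rad (s u) y) * jac (s u) y) := fun y => by ring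
  simp only [h2]
  rw [intervalIntegral.integral_const_mul, h1]
  ring

end IsTransport

/-- An integral curve on `[0, u₀]` of the vector field `field`, whose label `0` starts at the centre. -/
structure IsEvolution (α : ℝ) {κ : ℝ} (hκ : Real.sin κ = 0) (u₀ : ℝ) (s : ℝ → State) : Prop where
  deriv : ∀ u ∈ Icc (0 : ℝ) u₀, HasDerivWithinAt s (field α hκ (s u)) (Icc 0 u₀) u
  center : (s 0).1 = 0

namespace IsEvolution
variable {α κ : ℝ} {hκ : Real.sin κ = 0} {u₀ : ℝ} {s : ℝ → State} (h : IsEvolution α hκ u₀ s)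
  {u : ℝ} (hu : u ∈ Icc (0 : ℝ) u₀)
include h

lemma continuousOn : ContinuousOn s (Icc 0 u₀) := fun u hu => (h.deriv u hu).continuousWithinAt

lemma exists_norm_le : ∃ L : ℝ, ∀ u ∈ Icc (0 : ℝ) u₀, ‖s u‖ ≤ L :=
  isCompact_Icc.exists_bound_of_continuousOn h.continuousOn

include hu

lemma hasDerivWithinAt_fst :
    HasDerivWithinAt (fun v => (s v).1) (-(1 / 2) * lapse α κ (s u) 0) (Icc 0 u₀) u :=
  (ContinuousLinearMap.fst ℝ ℝ ((ℝ →ᵇ ℝ) × (ℝ →ᵇ ℝ))).hasFDerivAt.comp_hasDerivWithinAt u (h.deriv u hu)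

lemma hasDerivWithinAt_log (x : ℝ) : HasDerivWithinAt (fun v => (s v).2.1 x)
    (-(1 / 2) * extZero (dLapseT α κ (s u)) (rad (s u) x)) (Icc 0 u₀) u :=
  (((BoundedContinuousFunction.evalCLM ℝ x).comp ((ContinuousLinearMap.fst ℝ (ℝ →ᵇ ℝ) (ℝ →ᵇ ℝ)).comp
    (ContinuousLinearMap.snd ℝ ℝ ((ℝ →ᵇ ℝ) × (ℝ →ᵇ ℝ)))))).hasFDerivAt.comp_hasDerivWithinAt u
      (h.deriv u hu)

lemma hasDerivWithinAt_amp (x : ℝ) : HasDerivWithinAt (fun v => (s v).2.2 x)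
    (amp x * extZero (zSource α κ (s u)) (rad (s u) x)) (Icc 0 u₀) u :=
  (((BoundedContinuousFunction.evalCLM ℝ x).comp ((ContinuousLinearMap.snd ℝ (ℝ →ᵇ ℝ) (ℝ →ᵇ ℝ)).comp
    (ContinuousLinearMap.snd ℝ ℝ ((ℝ →ᵇ ℝ) × (ℝ →ᵇ ℝ)))))).hasFDerivAt.comp_hasDerivWithinAt u
      (h.deriv u hu)

omit hu in
lemma isTransport : IsTransport α hκ u₀ s s where
  deriv_fst _ hu := h.hasDerivWithinAt_fst hu
  deriv_log _ hu x := h.hasDerivWithinAt_log hu x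
  exists_norm_le := by
    obtain ⟨L, hL⟩ := h.exists_norm_le
    exact ⟨L, fun u hu => ⟨hL u hu, hL u hu⟩⟩
  center := h.center

lemma hasDerivWithinAt_rad {x : ℝ} (hx : 0 < rad (s u) x) : HasDerivWithinAt (fun v => rad (s v) x)
    (-(1 / 2) * lapseT α κ (s u) (rad (s u) x)) (Icc 0 u₀) u :=
  h.isTransport.hasDerivWithinAt_rad hu hx

/-- The balance of `r² Z ∂ᵣ/∂ₓ`.  It also holds at the instant at which the shell reaches the centre,
where the quantity vanishes quadratically in the radius. -/
lemma hasDerivWithinAt_sq_Z (x : ℝ) :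
    HasDerivWithinAt (fun v => extZero (fun r => r ^ 2 * Z κ (s v) r) (rad (s v) x) * jac (s v) x)
      (extZero (dFlux α κ (s u)) (rad (s u) x) * jac (s u) x) (Icc 0 u₀) u := by
  have hρ := h.isTransport.hasDerivWithinAt_rad' hu x
  have hρc := hρ.continuousWithinAt
  have hJ := h.isTransport.hasDerivWithinAt_jac hu x
  rcases lt_trichotomy (rad (s u) x) 0 with hx | hx | hx
  · have hev : ∀ᶠ v in 𝓝[Icc 0 u₀] u, rad (s v) x < 0 := hρc.eventually (gt_mem_nhds hx)
    rw [extZero_of_nonpos hx.le, zero_mul]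
    refine (hasDerivWithinAt_const u _ (0:ℝ)).congr_of_eventuallyEq ?_ ?_
    · filter_upwards [hev] with v hv
      rw [extZero_of_nonpos hv.le, zero_mul]
    · rw [extZero_of_nonpos hx.le, zero_mul]
  · rw [extZero_of_nonpos hx.le, zero_mul]
    obtain ⟨L, hL⟩ := h.exists_norm_le
    obtain ⟨C, hC, H⟩ := (Weighted.Z κ).abs_extZero_le L
    have h0 : extZero (fun r => r ^ 2 * Z κ (s u) r) (rad (s u) x) * jac (s u) x = 0 := by
      rw [extZero_of_nonpos hx.le, zero_mul]
    rw [hasDerivWithinAt_iff_isLittleO]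
    simp only [h0, sub_zero, smul_zero]
    have hO : (fun v => extZero (fun r => r ^ 2 * Z κ (s v) r) (rad (s v) x) * jac (s v) x)
        =O[𝓝[Icc 0 u₀] u] fun v => (rad (s v) x - rad (s u) x) * (rad (s v) x - rad (s u) x) := by
      refine IsBigO.of_bound (C * Real.exp L) ?_
      filter_upwards [self_mem_nhdsWithin] with v hv
      rw [hx, sub_zero, norm_mul, norm_mul, Real.norm_of_nonneg (jac_pos _ _).le,
        ← norm_mul (rad (s v) x), Real.norm_eq_abs, Real.norm_eq_abs]
      rcases le_or_gt (rad (s v) x) 0 with h1 | h1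
      · rw [extZero_of_nonpos h1, abs_zero, zero_mul]; positivity
      · have e : extZero (fun r => r ^ 2 * Z κ (s v) r) (rad (s v) x)
            = rad (s v) x * rad (s v) x * Z κ (s v) (rad (s v) x) := by
          rw [extZero_of_pos h1]; ring
        have hz := H _ (hL v hv) (rad (s v) x)
        rw [extZero_of_pos h1] at hz
        have hz2 : |Z κ (s v) (rad (s v) x)| ≤ C :=
          hz.trans (mul_le_of_le_one_right hC (extZero_wt_le_one le_rfl (by norm_num) _))
        have hj := jac_le (hL v hv) x
        rw [e, abs_mul]
        calc _ ≤ |rad (s v) x * rad (s v) x| * C * Real.exp L := by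
              have := (jac_pos (s v) x).le
              gcongr
          _ = _ := by ring
    refine hO.trans_isLittleO ?_
    have hO1 : (fun v => rad (s v) x - rad (s u) x) =O[𝓝[Icc 0 u₀] u] fun v => v - u :=
      hρ.differentiableWithinAt.isBigO_sub
    have ho1 : (fun v => rad (s v) x - rad (s u) x) =o[𝓝[Icc 0 u₀] u] fun _ => (1:ℝ) := by
      rw [isLittleO_one_iff]
      simpa using hρc.tendsto.sub_const (rad (s u) x)
    simpa using ho1.mul_isBigO hO1
  · have hρ' := h.hasDerivWithinAt_rad hu hx
    have hev : ∀ᶠ v in 𝓝[Icc 0 u₀] u, 0 < rad (s v) x := hρc.eventually (lt_mem_nhds hx)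
    have hz := (h.hasDerivWithinAt_amp hu x).mul_const (((√(1 + |x|))⁻¹) ^ 5)
    have hR : HasDerivWithinAt (fun v => refZ κ (rad (s v) x))
        (dRefZ κ (rad (s u) x) * (-(1 / 2) * lapseT α κ (s u) (rad (s u) x))) (Icc 0 u₀) u :=
      HasDerivAt.comp_hasDerivWithinAt (h₂ := refZ κ) (h := fun v => rad (s v) x) u
        (hasDerivAt_refZ κ hx.le) hρ'
    have hall := ((hρ'.pow 2).mul (hR.add hz)).mul hJ
    rw [extZero_of_pos hx]
    have e : ∀ v, 0 < rad (s v) x → extZero (fun r => r ^ 2 * Z κ (s v) r) (rad (s v) x)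
        * jac (s v) x = rad (s v) x ^ 2 * (refZ κ (rad (s v) x)
          + (s v).2.2 x * ((√(1 + |x|))⁻¹) ^ 5) * jac (s v) x := by
      intro v hv
      rw [extZero_of_pos hv, Z, zeta, label_rad]
    refine HasDerivWithinAt.congr_of_eventuallyEq (hall.congr_deriv ?_) ?_ (e u hx)
    · rw [extZero_of_pos hx, extZero_of_pos hx]
      have hZ : Z κ (s u) (rad (s u) x) = refZ κ (rad (s u) x)
          + (s u).2.2 x * ((√(1 + |x|))⁻¹) ^ 5 := by rw [Z, zeta, label_rad]
      have hA : amp x * (√(1 + |x|))⁻¹ ^ 5 = 1 := by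
        rw [amp, ← mul_pow, mul_inv_cancel₀ (by positivity), one_pow]
      simp only [Pi.mul_apply, Pi.add_apply, Pi.pow_apply]
      rw [← hZ, dFlux]
      push_cast
      rw [show amp x * zSource α κ (s u) (rad (s u) x) * (√(1 + |x|))⁻¹ ^ 5
        = (amp x * (√(1 + |x|))⁻¹ ^ 5) * zSource α κ (s u) (rad (s u) x) by ring, hA]
      ring
    · filter_upwards [hev] with v hv using e v hv

omit hu in
lemma exists_bound_dFlux (x : ℝ) : ∃ C : ℝ, ∀ v ∈ Icc 0 u₀, ∀ y ∈ uIcc 0 x,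
    |extZero (dFlux α κ (s v)) (rad (s v) y) * jac (s v) y| ≤ C := by
  have hcont : Continuous fun p : State × ℝ => extZero (dFlux α κ p.1) (rad p.1 p.2) * jac p.1 p.2 := by
    refine ((Weighted.dFlux α hκ).continuous_extZero_rad le_rfl).mul (Real.continuous_exp.comp ?_)
    have h2 : Continuous fun p : State × ℝ => p.1.2.1 := by fun_prop
    exact continuous_eval.comp (h2.prodMk continuous_snd)
  have hm : ContinuousOn (fun p : ℝ × ℝ => (s p.1, p.2)) (Icc 0 u₀ ×ˢ uIcc 0 x) :=
    (h.continuousOn.comp continuousOn_fst fun p hp => hp.1).prodMk continuousOn_snd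
  obtain ⟨C, hC⟩ := (isCompact_Icc.prod isCompact_uIcc).exists_bound_of_continuousOn
    (hcont.comp_continuousOn hm)
  exact ⟨C, fun v hv y hy => hC (v, y) ⟨hv, hy⟩⟩

/-- The transport equation of `W`: the balance of `r² Z ∂ᵣ/∂ₓ` for each label is integrated over the
labels that have positive radius. -/
lemma hasDerivWithinAt_W_rad {x : ℝ} (hx : 0 < rad (s u) x) :
    HasDerivWithinAt (fun v => W κ (s v) (rad (s v) x)) (source α κ (s u) (rad (s u) x))
      (Icc 0 u₀) u := by
  obtain ⟨L, hL⟩ := h.exists_norm_le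
  have hρ := h.hasDerivWithinAt_rad hu hx
  have hev : ∀ᶠ v in 𝓝[Icc 0 u₀] u, 0 < rad (s v) x := hρ.continuousWithinAt.eventually (lt_mem_nhds hx)
  obtain ⟨C, hC⟩ := h.exists_bound_dFlux x
  have hM := hasDerivWithinAt_intervalIntegral (convex_Icc 0 u₀) (a := 0) (b := x)
    (bound := fun _ => C) hu (fun v hv y _ => h.hasDerivWithinAt_sq_Z hv y)
    (fun v hv y hy => hC v hv y (uIoc_subset_uIcc hy)) intervalIntegrable_const
    (fun v _ => (((((Weighted.sq_Z κ).continuous_extZero (by norm_num) (s v)).comp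
      (continuous_rad (s v))).mul (continuous_jac (s v))).intervalIntegrable _ _))
  have hc : ∀ v ∈ Icc 0 u₀, rad (s v) 0 ≤ 0 := fun v hv => by rw [rad_zero]; exact h.isTransport.fst_nonpos hv
  rw [(Weighted.dFlux α hκ).integral_extZero le_rfl (hc u hu) hx.le, integral_dFlux α hκ _ hx] at hM
  have e : ∀ v ∈ Icc 0 u₀, 0 < rad (s v) x → W κ (s v) (rad (s v) x) =
      (∫ y in (0:ℝ)..x, extZero (fun r => r ^ 2 * Z κ (s v) r) (rad (s v) y) * jac (s v) y)
        / rad (s v) x ^ 2 := by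
    intro v hv hpos
    rw [(Weighted.sq_Z κ).integral_extZero (by norm_num) (hc v hv) hpos.le, W]
  have hq := hM.div (hρ.pow 2) (by simpa using hx.ne')
  refine HasDerivWithinAt.congr_of_eventuallyEq (hq.congr_deriv ?_) ?_ (e u hu hx)
  · have eu := e u hu hx
    rw [eq_div_iff (by positivity)] at eu
    simp only [Pi.pow_apply]
    rw [← eu, flux]
    field_simp
    norm_num
    ring
  · filter_upwards [hev, self_mem_nhdsWithin] with v hv hvm using e v hvm hv

end IsEvolution

end

/-! ### Limits at the centre -/

section

open State

/-- The filter of pairs `(s', r)` with `s'` close to `s` and `r > 0` close to `0`. -/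
def nearCenter (s : State) : Filter (State × ℝ) := 𝓝 s ×ˢ 𝓝[>] 0

lemma eventually_pos_nearCenter (s : State) : ∀ᶠ p in nearCenter s, 0 < p.2 :=
  tendsto_snd.eventually self_mem_nhdsWithin

lemma tendsto_snd_nearCenter (s : State) :
    Tendsto (fun p : State × ℝ => p.2) (nearCenter s) (𝓝 0) :=
  tendsto_snd.mono_right nhdsWithin_le_nhds

lemma nearCenter_le (s : State) : nearCenter s ≤ 𝓝 (s, 0) := by
  rw [nhds_prod_eq]; exact Filter.prod_mono le_rfl nhdsWithin_le_nhds

lemma Weighted.tendsto_center {k l : ℤ} {f : State → ℝ → ℝ} (hf : Weighted k l fun s r _ => f s r)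
    (hk : 1 ≤ k) (s : State) : Tendsto (fun p : State × ℝ => f p.1 p.2) (nearCenter s) (𝓝 0) := by
  have h := ((hf.continuous_extZero_uncurry hk).tendsto (s, 0)).mono_left (nearCenter_le s)
  rw [extZero_of_nonpos le_rfl] at h
  refine h.congr' ?_
  filter_upwards [eventually_pos_nearCenter s] with p hp using extZero_of_pos hp

/-- Weighted averages over `[0, r]` have the limits expected at the centre. -/
lemma tendsto_center_integral {f : State → ℝ → ℝ} {c : ℝ} (n : ℕ) {s : State}
    (hi : ∀ s r, 0 < r → IntervalIntegrable (fun x => x ^ n * f s x) MeasureTheory.volume 0 r)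
    (hf : Tendsto (fun p : State × ℝ => f p.1 p.2) (nearCenter s) (𝓝 c)) :
    Tendsto (fun p : State × ℝ => (∫ x in (0 : ℝ)..p.2, x ^ n * f p.1 x) / p.2 ^ (n + 1))
      (nearCenter s) (𝓝 (c / (n + 1))) := by
  rw [Metric.tendsto_nhds]
  intro ε hε
  have h := Metric.tendsto_nhds.1 hf (ε / 2) (by positivity)
  obtain ⟨pa, hpa, pb, hpb, hp⟩ := Filter.eventually_prod_iff.1 h
  obtain ⟨δ, hδ, hball⟩ := mem_nhdsGT_iff_exists_Ioo_subset.1 hpb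
  refine Filter.eventually_prod_iff.2 ⟨pa, hpa, fun r => r ∈ Ioo 0 δ, Ioo_mem_nhdsGT hδ,
    fun {s'} hs {r} hr => ?_⟩
  have h1 : (∫ x in (0 : ℝ)..r, x ^ n * f s' x) / r ^ (n + 1) - c / (n + 1)
      = (∫ x in (0 : ℝ)..r, x ^ n * (f s' x - c)) / r ^ (n + 1) := by
    have : (∫ x in (0 : ℝ)..r, x ^ n * (f s' x - c)) = (∫ x in (0 : ℝ)..r, x ^ n * f s' x)
        - c * (r ^ (n + 1) / (n + 1)) := by
      simp only [mul_sub]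
      rw [intervalIntegral.integral_sub (hi s' r hr.1) (by
        apply Continuous.intervalIntegrable; fun_prop), intervalIntegral.integral_mul_const,
        integral_pow]
      simp
      ring
    rw [this]
    have := hr.1.ne'
    field_simp
  have h2 : ‖∫ x in (0 : ℝ)..r, x ^ n * (f s' x - c)‖ ≤ r ^ n * (ε / 2) * |r - 0| := by
    refine intervalIntegral.norm_integral_le_of_norm_le_const fun x hx => ?_
    rw [uIoc_of_le hr.1.le] at hx
    have h3 := hp hs (hball ⟨hx.1, hx.2.trans_lt hr.2⟩)
    rw [Real.dist_eq] at h3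
    rw [norm_mul, norm_pow, Real.norm_of_nonneg hx.1.le, Real.norm_eq_abs]
    have := hx.1.le
    have h5 : x ^ n ≤ r ^ n := pow_le_pow_left₀ this hx.2 n
    exact mul_le_mul h5 h3.le (abs_nonneg _) (pow_nonneg hr.1.le n)
  have h0 := hr.1
  rw [Real.dist_eq, h1, abs_div, abs_of_pos (show 0 < r ^ (n + 1) by positivity),
    div_lt_iff₀ (by positivity)]
  rw [sub_zero, abs_of_pos h0, Real.norm_eq_abs] at h2
  refine h2.trans_lt ?_
  rw [pow_succ]
  have : 0 < r ^ n * r := by positivity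
  nlinarith

/-- After the substitution `t = r τ` the integrals of the kernels extend continuously to `r = 0`,
because `sin (r τ) / r = τ sinc (r τ)`. -/
lemma continuous_rescaled_integral {φ : ℝ → ℝ} (hφ : Continuous φ) :
    Continuous fun p : ℝ × ℝ => ∫ τ in (0 : ℝ)..p.2, φ (τ * Real.sinc (p.1 * τ)) := by
  refine intervalIntegral.continuous_parametric_primitive_of_continuous (a₀ := 0)
    (f := fun r τ => φ (τ * Real.sinc (r * τ))) ?_
  have := Real.continuous_sinc
  simp only [Function.uncurry_def]
  fun_prop

lemma sin_eq_mul_sinc (x : ℝ) : Real.sin x = x * Real.sinc x := by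
  rcases eq_or_ne x 0 with rfl | h
  · simp
  · rw [Real.sinc_of_ne_zero h]; field_simp

lemma root_mul {r : ℝ} (hr : 0 < r) (τ : ℝ) :
    root r (r * τ) = r * √(1 + 2 * (τ * Real.sinc (r * τ)) ^ 2) := by
  rw [root, sin_eq_mul_sinc, show r ^ 2 + 2 * (r * τ * Real.sinc (r * τ)) ^ 2
    = r ^ 2 * (1 + 2 * (τ * Real.sinc (r * τ)) ^ 2) by ring, Real.sqrt_mul (by positivity),
    Real.sqrt_sq hr.le]

lemma rescale_integral (k : ℝ → ℝ) {r : ℝ} (hr : 0 < r) (y : ℝ) :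
    ∫ t in (0 : ℝ)..y, k t = r * ∫ τ in (0 : ℝ)..(y / r), k (r * τ) := by
  rw [intervalIntegral.integral_comp_mul_left k hr.ne', mul_zero, mul_div_cancel₀ _ hr.ne',
    smul_eq_mul]
  field_simp

lemma theta_div_sq {r : ℝ} (hr : 0 < r) (y : ℝ) :
    theta r y / r ^ 2 = ∫ τ in (0 : ℝ)..(y / r), √(1 + 2 * (τ * Real.sinc (r * τ)) ^ 2) := by
  rw [theta, rescale_integral _ hr]
  simp only [root_mul hr]
  rw [intervalIntegral.integral_const_mul]
  field_simp

lemma theta1_div {r : ℝ} (hr : 0 < r) (y : ℝ) :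
    theta1 r y / r = ∫ τ in (0 : ℝ)..(y / r), (√(1 + 2 * (τ * Real.sinc (r * τ)) ^ 2))⁻¹ := by
  rw [theta1, rescale_integral _ hr, mul_div_cancel_left₀ _ hr.ne']
  congr 1; ext τ
  rw [ker1, root_mul hr]
  have : 0 < √(1 + 2 * (τ * Real.sinc (r * τ)) ^ 2) := by positivity
  field_simp

lemma theta2_eq {r : ℝ} (hr : 0 < r) (y : ℝ) :
    theta2 r y = ∫ τ in (0 : ℝ)..(y / r), 2 * (τ * Real.sinc (r * τ)) ^ 2 /
      √(1 + 2 * (τ * Real.sinc (r * τ)) ^ 2) ^ 3 := by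
  rw [theta2, rescale_integral _ hr, ← intervalIntegral.integral_const_mul]
  congr 1; ext τ
  rw [ker2, root_mul hr, sin_eq_mul_sinc]
  have : 0 < √(1 + 2 * (τ * Real.sinc (r * τ)) ^ 2) := by positivity
  field_simp

lemma exists_rescaled_theta_eq (c : ℝ) : ∃ b : ℝ,
    ∫ τ in (0 : ℝ)..b, √(1 + 2 * (τ * Real.sinc (0 * τ)) ^ 2) = c := by
  have hc : Continuous fun b => ∫ τ in (0 : ℝ)..b, √(1 + 2 * (τ * Real.sinc (0 * τ)) ^ 2) :=
    (continuous_rescaled_integral (φ := fun m => √(1 + 2 * m ^ 2)) (by fun_prop)).comp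
      (f := fun b : ℝ => ((0:ℝ), b)) (by fun_prop)
  have hlow : ∀ b, 0 ≤ b → b ≤ ∫ τ in (0 : ℝ)..b, √(1 + 2 * (τ * Real.sinc (0 * τ)) ^ 2) := by
    intro b hb
    have := intervalIntegral.integral_mono_on hb
      (intervalIntegrable_const (c := (1:ℝ)) (μ := MeasureTheory.volume))
      (Continuous.intervalIntegrable (u := fun τ : ℝ => √(1 + 2 * (τ * Real.sinc (0 * τ)) ^ 2))
        (by simp only [zero_mul]; fun_prop) 0 b) fun τ _ => Real.one_le_sqrt.2 (by nlinarith [sq_nonneg (τ * Real.sinc (0 * τ))])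
    simpa using this
  have hodd : ∀ b, ∫ τ in (0 : ℝ)..(-b), √(1 + 2 * (τ * Real.sinc (0 * τ)) ^ 2)
      = -∫ τ in (0 : ℝ)..b, √(1 + 2 * (τ * Real.sinc (0 * τ)) ^ 2) := by
    intro b
    have := intervalIntegral.integral_comp_neg (a := 0) (b := b)
      (fun τ : ℝ => √(1 + 2 * (τ * Real.sinc (0 * τ)) ^ 2))
    simp only [zero_mul, Real.sinc_zero, mul_one, even_two.neg_pow, neg_zero] at this ⊢
    rw [intervalIntegral.integral_symm, ← this]
  have h1 := hlow |c| (abs_nonneg c)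
  have h2 := hodd |c|
  refine mem_range_of_exists_le_of_exists_ge hc ⟨-|c|, ?_⟩ ⟨|c|, (le_abs_self c).trans h1⟩
  rw [h2]; linarith [neg_abs_le c]

/-- The rescaled primitive is expanding in its upper limit, uniformly in `r`. -/
lemma abs_sub_le_rescaled_theta (r b₁ b₂ : ℝ) : |b₁ - b₂| ≤
    |(∫ τ in (0 : ℝ)..b₁, √(1 + 2 * (τ * Real.sinc (r * τ)) ^ 2))
      - ∫ τ in (0 : ℝ)..b₂, √(1 + 2 * (τ * Real.sinc (r * τ)) ^ 2)| := by
  have hc : Continuous fun τ => √(1 + 2 * (τ * Real.sinc (r * τ)) ^ 2) := by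
    have := Real.continuous_sinc; fun_prop
  rw [intervalIntegral.integral_interval_sub_left (hc.intervalIntegrable _ _)
    (hc.intervalIntegrable _ _)]
  wlog h : b₂ ≤ b₁ generalizing b₁ b₂
  · rw [abs_sub_comm, intervalIntegral.integral_symm, abs_neg]
    exact this b₂ b₁ (le_of_not_ge h)
  have := intervalIntegral.integral_mono_on h
      (intervalIntegrable_const (c := (1:ℝ)) (μ := MeasureTheory.volume))
      (hc.intervalIntegrable _ _) fun τ _ => Real.one_le_sqrt.2
        (by nlinarith [sq_nonneg (τ * Real.sinc (r * τ))])
  simp only [intervalIntegral.integral_const, smul_eq_mul, mul_one] at this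
  rw [abs_of_nonneg (sub_nonneg.2 h)]
  exact this.trans (le_abs_self _)

section center
variable (α : ℝ) {κ : ℝ} (s : State)

lemma tendsto_center_Z (κ : ℝ) : Tendsto (fun p : State × ℝ => Z κ p.1 p.2) (nearCenter s)
    (𝓝 (Z κ s 0)) := by
  have h1 : Tendsto (fun p : State × ℝ => refZ κ p.2) (nearCenter s) (𝓝 (refZ κ 0)) :=
    (hasDerivAt_refZ κ le_rfl).continuousAt.tendsto.comp (tendsto_snd_nearCenter s)
  exact h1.add ((continuous_zeta_uncurry.tendsto (s, 0)).mono_left (nearCenter_le s))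

lemma tendsto_center_W_div (κ : ℝ) : Tendsto (fun p : State × ℝ => W κ p.1 p.2 / p.2) (nearCenter s)
    (𝓝 (Z κ s 0 / 3)) := by
  have h := tendsto_center_integral 2 (fun s r hr => (Weighted.sq_Z κ).intervalIntegrable
    (by norm_num) (fun _ _ _ => rfl) s 0 r le_rfl hr.le) (tendsto_center_Z s κ)
  have e : Z κ s 0 / ((2:ℕ) + 1) = Z κ s 0 / 3 := by norm_num
  rw [e] at h
  refine h.congr fun p => ?_
  rw [W, div_div, pow_succ]

lemma tendsto_center_X_div_sq (κ : ℝ) : Tendsto (fun p : State × ℝ => X κ p.1 p.2 / p.2 ^ 2)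
    (nearCenter s) (𝓝 (Z κ s 0 / 6)) := by
  have hW : ∀ (s : State) (x : ℝ), 0 < x → x ^ 1 * (W κ s x / x) = W κ s x := by
    intro s x hx; field_simp
  have h := tendsto_center_integral 1 (fun s r hr => ((Weighted.W κ).intervalIntegrable
    le_rfl (fun _ _ _ => rfl) s 0 r le_rfl hr.le).congr fun x hx => by
      rw [uIoc_of_le hr.le] at hx; exact (hW s x hx.1).symm) (tendsto_center_W_div s κ)
  have e : Z κ s 0 / 3 / ((1:ℕ) + 1) = Z κ s 0 / 6 := by norm_num; ring
  rw [e] at h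
  refine h.congr' ?_
  filter_upwards [eventually_pos_nearCenter s] with p hp
  rw [X]
  congr 1
  refine intervalIntegral.integral_congr_ae (Filter.Eventually.of_forall fun x hx => ?_)
  rw [uIoc_of_le hp.le] at hx
  exact hW _ x hx.1

lemma exists_tendsto_center_ang_div (κ : ℝ) : ∃ b : ℝ,
    Tendsto (fun p : State × ℝ => ang κ p.1 p.2 / p.2) (nearCenter s) (𝓝 b) := by
  obtain ⟨b, hb⟩ := exists_rescaled_theta_eq (Z κ s 0 / 6)
  refine ⟨b, ?_⟩
  rw [tendsto_iff_norm_sub_tendsto_zero]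
  have h1 : Tendsto (fun p : State × ℝ => ∫ τ in (0 : ℝ)..b, √(1 + 2 * (τ * Real.sinc (p.2 * τ)) ^ 2))
      (nearCenter s) (𝓝 (Z κ s 0 / 6)) := by
    rw [← hb]
    exact (((continuous_rescaled_integral (φ := fun m => √(1 + 2 * m ^ 2)) (by fun_prop)).comp
      (f := fun r : ℝ => (r, b)) (by fun_prop)).tendsto 0).comp (tendsto_snd_nearCenter s)
  have h2 := ((tendsto_center_X_div_sq s κ).sub h1).norm
  rw [sub_self, norm_zero] at h2
  refine squeeze_zero' (Filter.Eventually.of_forall fun _ => norm_nonneg _) ?_ h2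
  filter_upwards [eventually_pos_nearCenter s] with p hp
  rw [← theta_ang κ p.1 hp, theta_div_sq hp]
  exact abs_sub_le_rescaled_theta _ _ _

lemma tendsto_center_ang (κ : ℝ) :
    Tendsto (fun p : State × ℝ => ang κ p.1 p.2) (nearCenter s) (𝓝 0) :=
  (Weighted.ang κ).tendsto_center le_rfl s

lemma exists_tendsto_center_sin_div (κ : ℝ) : ∃ b : ℝ,
    Tendsto (fun p : State × ℝ => Real.sin (ang κ p.1 p.2) / p.2) (nearCenter s) (𝓝 b) := by
  obtain ⟨b, hb⟩ := exists_tendsto_center_ang_div s κ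
  refine ⟨_, (hb.mul ((Real.continuous_sinc.tendsto 0).comp (tendsto_center_ang s κ))).congr
    fun p => ?_⟩
  rw [sin_eq_mul_sinc (ang κ p.1 p.2), Function.comp]; ring

lemma exists_tendsto_center_root_div (κ : ℝ) : ∃ b : ℝ, b ≠ 0 ∧
    Tendsto (fun p : State × ℝ => root p.2 (ang κ p.1 p.2) / p.2) (nearCenter s) (𝓝 b) := by
  obtain ⟨b, hb⟩ := exists_tendsto_center_sin_div s κ
  refine ⟨√(1 + 2 * b ^ 2), by positivity, ?_⟩
  refine ((((hb.pow 2).const_mul 2).const_add 1).sqrt).congr' ?_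
  filter_upwards [eventually_pos_nearCenter s] with p hp
  rw [root, eq_div_iff hp.ne', mul_comm]
  nth_rw 1 [← Real.sqrt_sq hp.le]
  rw [← Real.sqrt_mul (by positivity)]
  congr 1
  field_simp

lemma tendsto_center_rescaled {φ : ℝ → ℝ} (hφ : Continuous φ) {κ b : ℝ}
    (hb : Tendsto (fun p : State × ℝ => ang κ p.1 p.2 / p.2) (nearCenter s) (𝓝 b)) :
    Tendsto (fun p : State × ℝ => ∫ τ in (0 : ℝ)..(ang κ p.1 p.2 / p.2),
      φ (τ * Real.sinc (p.2 * τ))) (nearCenter s)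
      (𝓝 (∫ τ in (0 : ℝ)..b, φ (τ * Real.sinc (0 * τ)))) :=
  ((continuous_rescaled_integral hφ).tendsto (0, b)).comp
    ((tendsto_snd_nearCenter s).prodMk_nhds hb)

lemma exists_tendsto_center_Q_div (κ : ℝ) : ∃ c : ℝ,
    Tendsto (fun p : State × ℝ => Q κ p.1 p.2 / p.2) (nearCenter s) (𝓝 c) := by
  obtain ⟨b, hb⟩ := exists_tendsto_center_ang_div s κ
  refine ⟨_, ((tendsto_center_W_div s κ).sub (tendsto_center_rescaled s
    (φ := fun m => (√(1 + 2 * m ^ 2))⁻¹)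
    (Continuous.inv₀ (by fun_prop) fun m => by positivity) hb)).congr' ?_⟩
  filter_upwards [eventually_pos_nearCenter s] with p hp
  rw [← theta1_div hp, ← sub_div, Q]

lemma exists_tendsto_center_theta2 (κ : ℝ) : ∃ c : ℝ,
    Tendsto (fun p : State × ℝ => theta2 p.2 (ang κ p.1 p.2)) (nearCenter s) (𝓝 c) := by
  obtain ⟨b, hb⟩ := exists_tendsto_center_ang_div s κ
  refine ⟨_, (tendsto_center_rescaled s (φ := fun m => 2 * m ^ 2 / √(1 + 2 * m ^ 2) ^ 3)
    (Continuous.div (by fun_prop) (by fun_prop) fun m => by positivity) hb).congr' ?_⟩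
  filter_upwards [eventually_pos_nearCenter s] with p hp
  rw [theta2_eq hp]

lemma exists_tendsto_center_slope (κ : ℝ) : ∃ c : ℝ,
    Tendsto (fun p : State × ℝ => slope κ p.1 p.2) (nearCenter s) (𝓝 c) := by
  obtain ⟨b, hb0, hb⟩ := exists_tendsto_center_root_div s κ
  obtain ⟨c, hc⟩ := exists_tendsto_center_Q_div s κ
  refine ⟨_, (hc.div hb hb0).congr' ?_⟩
  filter_upwards [eventually_pos_nearCenter s] with p hp
  simp only [Pi.div_apply]
  rw [State.slope, div_div_div_cancel_right₀ hp.ne']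

lemma tendsto_center_dW (κ : ℝ) : Tendsto (fun p : State × ℝ => dW κ p.1 p.2) (nearCenter s)
    (𝓝 (Z κ s 0 / 3)) := by
  have h := (tendsto_center_Z s κ).sub ((tendsto_center_W_div s κ).const_mul 2)
  rw [show Z κ s 0 - 2 * (Z κ s 0 / 3) = Z κ s 0 / 3 by ring] at h
  refine h.congr fun p => ?_
  rw [dW]; ring

lemma tendsto_center_lapse (κ : ℝ) : Tendsto (fun p : State × ℝ => lapse α κ p.1 p.2) (nearCenter s)
    (𝓝 (lapse α κ s 0)) := by
  have h1 : Tendsto (fun p : State × ℝ => lapse α κ p.1 0) (nearCenter s) (𝓝 (lapse α κ s 0)) := by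
    obtain ⟨C, hC, -, H⟩ := lapse_zero_bounds α κ (‖s‖ + 1)
    have : ContinuousAt (fun s => lapse α κ s 0) s := by
      rw [ContinuousAt, tendsto_iff_norm_sub_tendsto_zero]
      have hb : Tendsto (fun t : State => C * ‖t - s‖) (𝓝 s) (𝓝 0) := by
        have : Continuous fun t : State => C * ‖t - s‖ := by fun_prop
        simpa using this.tendsto s
      refine squeeze_zero' (Filter.Eventually.of_forall fun _ => norm_nonneg _) ?_ hb
      filter_upwards [continuous_norm.continuousAt.eventually
        (gt_mem_nhds (show ‖s‖ < ‖s‖ + 1 by simp))] with t ht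
      exact H t s ht.le (by simp)
    exact this.tendsto.comp (tendsto_fst (g := 𝓝[>] (0:ℝ)))
  have h2 := ((Weighted.energy κ).integral (l' := 0) le_rfl
    (Or.inl ⟨by norm_num, rfl⟩)).tendsto_center (by norm_num) s
  have h3 := h1.mul ((Real.continuous_exp.tendsto _).comp (h2.const_mul α))
  rw [mul_zero, Real.exp_zero, mul_one] at h3
  refine h3.congr' ?_
  filter_upwards [eventually_pos_nearCenter s] with p hp
  simp only [Function.comp]
  rw [lapse, lapse, Weighted.integral_Ioi_energy κ p.1 hp.le, ← Real.exp_add]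
  congr 1; ring

section
variable (hκ : Real.sin κ = 0)
include hκ

lemma tendsto_center_lapseT : Tendsto (fun p : State × ℝ => lapseT α κ p.1 p.2) (nearCenter s)
    (𝓝 (lapse α κ s 0)) := by
  have h := (tendsto_center_lapse α s κ).sub ((Weighted.mass_div α hκ).tendsto_center (by norm_num) s)
  rw [sub_zero] at h
  exact h

lemma tendsto_center_source : Tendsto (fun p : State × ℝ => source α κ p.1 p.2) (nearCenter s)
    (𝓝 (-(lapse α κ s 0 * (Z κ s 0 / 6)))) := by
  obtain ⟨c, hc⟩ := exists_tendsto_center_theta2 s κ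
  have h1 := (((Weighted.dLapseT α hκ).mul (Weighted.Q κ)).const_mul (1/2)).tendsto_center
    (by norm_num) s
  have h2 := (((Weighted.mass_div α hκ).tendsto_center (by norm_num) s).const_mul (1/2)).mul hc
  have h3 := (tendsto_center_lapse α s κ).mul ((tendsto_center_X_div_sq s κ).add
    ((Weighted.intK κ).tendsto_center (by norm_num) s))
  have h := (h1.add h2).sub h3
  simp only [mul_zero, zero_mul, add_zero, zero_sub] at h
  refine h.congr fun p => ?_
  rw [source]; ring

end

lemma exists_tendsto_center_mul_dSlope (κ : ℝ) : ∃ c : ℝ,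
    Tendsto (fun p : State × ℝ => p.2 * dSlope κ p.1 p.2) (nearCenter s) (𝓝 c) := by
  obtain ⟨b, hb0, hb⟩ := exists_tendsto_center_root_div s κ
  obtain ⟨c, hc⟩ := exists_tendsto_center_Q_div s κ
  obtain ⟨d, hd⟩ := exists_tendsto_center_theta2 s κ
  obtain ⟨q, hq⟩ := exists_tendsto_center_slope s κ
  obtain ⟨m, hm⟩ := exists_tendsto_center_sin_div s κ
  have hC := (Real.continuous_cos.tendsto 0).comp (tendsto_center_ang s κ)
  have hdQ := ((tendsto_center_dW s κ).sub hd).sub (hq.mul (hb.inv₀ hb0))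
  have h1 := hdQ.div hb hb0
  have h2 := (hc.mul ((((hm.const_mul 2).mul hC).mul hq).const_add 1)).div (hb.pow 3)
    (pow_ne_zero 3 hb0)
  refine ⟨_, (h1.sub h2).congr' ?_⟩
  filter_upwards [eventually_pos_nearCenter s] with p hp
  have := root_pos hp (ang κ p.1 p.2)
  simp only [Pi.div_apply, Function.comp]
  rw [dSlope, dQ, ker1]
  field_simp

end center

end

/-! ### The profile of an evolution -/

section

open State

namespace State
/-- The `u`-derivative of `W` at fixed radius along an evolution. -/
def evolW (α κ : ℝ) (s : State) (r : ℝ) : ℝ := source α κ s r + 1 / 2 * (lapseT α κ s r * dW κ s r)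
/-- The `u`-derivative of `X` at fixed radius along an evolution. -/
def evolX (α κ : ℝ) (s : State) (r : ℝ) : ℝ := ∫ x in (0 : ℝ)..r, evolW α κ s x
/-- The `u`-derivative of the angle at fixed radius along an evolution. -/
def evolAng (α κ : ℝ) (s : State) (r : ℝ) : ℝ := evolX α κ s r / root r (ang κ s r)
/-- The `u`-derivative of `slope` at fixed radius along an evolution. -/
def evolSlope (α κ : ℝ) (s : State) (r : ℝ) : ℝ :=
  (evolW α κ s r - ker1 r (ang κ s r) * evolAng α κ s r) / root r (ang κ s r)
    - Q κ s r * (2 * Real.sin (ang κ s r) * Real.cos (ang κ s r) * evolAng α κ s r)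
      / root r (ang κ s r) ^ 3
end State

/-- Continuous extension to the centre, jointly with the state, from limits along `nearCenter`. -/
lemma continuousOn_ext_of_tendsto {F : State → ℝ → ℝ}
    (hF : ContinuousOn (fun p : State × ℝ => F p.1 p.2) (univ ×ˢ Ioi 0))
    (hc : ∀ s, ∃ c, Tendsto (fun p : State × ℝ => F p.1 p.2) (nearCenter s) (𝓝 c)) :
    ∃ G : State → ℝ → ℝ, ContinuousOn (fun p : State × ℝ => G p.1 p.2) (univ ×ˢ Ici 0) ∧
      (∀ s r, 0 < r → G s r = F s r) ∧
      ∀ s c, Tendsto (fun p : State × ℝ => F p.1 p.2) (nearCenter s) (𝓝 c) → G s 0 = c := by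
  have hcl : univ ×ˢ Ici (0:ℝ) ⊆ closure ((univ : Set State) ×ˢ Ioi (0:ℝ)) := by
    rw [closure_prod_eq, closure_univ, closure_Ioi]
  have hn : ∀ s : State, 𝓝[univ ×ˢ Ioi (0:ℝ)] (s, (0:ℝ)) = nearCenter s := by
    intro s; rw [nhdsWithin_prod_eq, nhdsWithin_univ]; rfl
  have hmem : ∀ s : State, (s, (0:ℝ)) ∈ closure ((univ : Set State) ×ˢ Ioi (0:ℝ)) :=
    fun s => hcl ⟨mem_univ _, self_mem_Ici⟩
  refine ⟨fun s r => extendFrom (univ ×ˢ Ioi (0:ℝ)) (fun p : State × ℝ => F p.1 p.2) (s, r), ?_, ?_, ?_⟩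
  · refine continuousOn_extendFrom hcl fun p hp => ?_
    rcases eq_or_lt_of_le (show (0:ℝ) ≤ p.2 from hp.2) with h | h
    · obtain ⟨c, hc⟩ := hc p.1
      refine ⟨c, ?_⟩
      have : p = (p.1, 0) := by rw [h]
      rw [this, hn]; exact hc
    · exact ⟨_, hF p ⟨mem_univ _, h⟩⟩
  · intro s r hr
    exact extendFrom_eq (subset_closure ⟨mem_univ _, hr⟩) (hF (s, r) ⟨mem_univ _, hr⟩)
  · intro s c hc
    refine extendFrom_eq (hmem s) ?_
    rw [hn]; exact hc

section
variable (α : ℝ) {κ : ℝ} (hκ : Real.sin κ = 0)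

lemma continuousOn_root_ang (κ : ℝ) :
    ContinuousOn (fun p : State × ℝ => root p.2 (ang κ p.1 p.2)) (univ ×ˢ Ioi 0) :=
  continuous_root.comp_continuousOn (continuousOn_snd.prodMk (Weighted.ang κ).continuousOn_uncurry)

include hκ

lemma Weighted.evolW : Weighted 0 4 (fun s r _ => State.evolW α κ s r) :=
  (Weighted.source α hκ).add ((((Weighted.lapseT α hκ).mul (Weighted.dW κ)).const_mul
    (1 / 2)).mono (by norm_num) (by norm_num))

lemma tendsto_center_evolW (s : State) :
    Tendsto (fun p : State × ℝ => evolW α κ p.1 p.2) (nearCenter s) (𝓝 0) := by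
  have h := (tendsto_center_source α s hκ).add
    (((tendsto_center_lapseT α s hκ).mul (tendsto_center_dW s κ)).const_mul (1 / 2))
  rwa [show -(lapse α κ s 0 * (Z κ s 0 / 6)) + 1 / 2 * (lapse α κ s 0 * (Z κ s 0 / 3)) = 0 by ring]
    at h

lemma exists_evolW_ext : ∃ G : State → ℝ → ℝ, (Continuous fun p : State × ℝ => G p.1 |p.2|) ∧
    (∀ s r, 0 < r → G s r = evolW α κ s r) := by
  obtain ⟨G, hG, hGF, -⟩ := continuousOn_ext_of_tendsto (Weighted.evolW α hκ).continuousOn_uncurry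
    fun s => ⟨0, tendsto_center_evolW α hκ s⟩
  exact ⟨G, hG.comp_continuous (f := fun p : State × ℝ => (p.1, |p.2|)) (by fun_prop)
    fun p => ⟨mem_univ _, mem_Ici.2 (abs_nonneg _)⟩, hGF⟩

lemma intervalIntegrable_evolW (s : State) {r : ℝ} (hr : 0 < r) :
    IntervalIntegrable (evolW α κ s) MeasureTheory.volume 0 r := by
  obtain ⟨G, hG, hGF⟩ := exists_evolW_ext α hκ
  refine ((hG.comp (f := fun x : ℝ => (s, x)) (by fun_prop)).intervalIntegrable 0 r).congr
    fun x hx => ?_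
  rw [uIoc_of_le hr.le] at hx
  simp only [Function.comp]
  rw [abs_of_pos hx.1, hGF s x hx.1]

lemma continuousOn_evolX :
    ContinuousOn (fun p : State × ℝ => evolX α κ p.1 p.2) (univ ×ˢ Ioi 0) := by
  obtain ⟨G, hG, hGF⟩ := exists_evolW_ext α hκ
  have h := intervalIntegral.continuous_parametric_intervalIntegral_of_continuous' (a₀ := 0) (b₀ := 1)
    (μ := MeasureTheory.volume) (f := fun (p : State × ℝ) t => G p.1 |t * p.2|)
    (hG.comp (f := fun q : (State × ℝ) × ℝ => (q.1.1, q.2 * q.1.2)) (by fun_prop))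
  refine (continuousOn_snd.mul h.continuousOn).congr fun p hp => ?_
  simp only [evolX]
  rw [integral_eq_mul_average]
  congr 1
  refine intervalIntegral.integral_congr_ae (Filter.Eventually.of_forall fun t ht => ?_)
  rw [uIoc_of_le zero_le_one] at ht
  have : 0 < t * p.2 := mul_pos ht.1 hp.2
  rw [abs_of_pos this, hGF _ _ this]

lemma tendsto_center_evolX_div (s : State) :
    Tendsto (fun p : State × ℝ => evolX α κ p.1 p.2 / p.2) (nearCenter s) (𝓝 0) := by
  have h := tendsto_center_integral 0 (fun s r hr => by
    simpa using intervalIntegrable_evolW α hκ s hr) (tendsto_center_evolW α hκ s)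
  simpa [evolX] using h

lemma continuousOn_evolAng :
    ContinuousOn (fun p : State × ℝ => evolAng α κ p.1 p.2) (univ ×ˢ Ioi 0) :=
  (continuousOn_evolX α hκ).div (continuousOn_root_ang κ) fun _ hp => (root_pos hp.2 _).ne'

lemma continuousOn_evolSlope :
    ContinuousOn (fun p : State × ℝ => evolSlope α κ p.1 p.2) (univ ×ˢ Ioi 0) := by
  have h1 := (Weighted.evolW α hκ).continuousOn_uncurry
  have h2 := (Weighted.ker1_ang κ).continuousOn_uncurry
  have h3 := continuousOn_root_ang κ
  have h4 := (Weighted.ang κ).continuousOn_uncurry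
  have h5 := (Weighted.Q κ).continuousOn_uncurry
  have h6 := continuousOn_evolAng α hκ
  exact ((h1.sub (h2.mul h6)).div h3 fun p hp => (root_pos hp.2 _).ne').sub
    ((h5.mul (((continuousOn_const.mul (Real.continuous_sin.comp_continuousOn h4)).mul
      (Real.continuous_cos.comp_continuousOn h4)).mul h6)).div (h3.pow 3)
      fun p hp => pow_ne_zero 3 (root_pos hp.2 _).ne')

lemma tendsto_center_evolAng (s : State) :
    Tendsto (fun p : State × ℝ => evolAng α κ p.1 p.2) (nearCenter s) (𝓝 0) := by
  obtain ⟨b, hb0, hb⟩ := exists_tendsto_center_root_div s κ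
  have h := (tendsto_center_evolX_div α hκ s).div hb hb0
  rw [zero_div] at h
  refine h.congr' ?_
  filter_upwards [eventually_pos_nearCenter s] with p hp
  simp only [Pi.div_apply]
  rw [evolAng, div_div_div_cancel_right₀ hp.ne']

lemma tendsto_center_mul_evolSlope (s : State) :
    Tendsto (fun p : State × ℝ => p.2 * evolSlope α κ p.1 p.2) (nearCenter s) (𝓝 0) := by
  obtain ⟨b, hb0, hb⟩ := exists_tendsto_center_root_div s κ
  obtain ⟨c, hc⟩ := exists_tendsto_center_Q_div s κ
  obtain ⟨m, hm⟩ := exists_tendsto_center_sin_div s κ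
  have hC := (Real.continuous_cos.tendsto 0).comp (tendsto_center_ang s κ)
  have hA := tendsto_center_evolAng α hκ s
  have h1 := ((tendsto_center_evolW α hκ s).sub ((hb.inv₀ hb0).mul hA)).div hb hb0
  have h2 := (hc.mul (((hm.const_mul 2).mul hC).mul hA)).div (hb.pow 3)
    (pow_ne_zero 3 hb0)
  have h := h1.sub h2
  simp only [mul_zero, sub_zero, zero_div] at h
  refine h.congr' ?_
  filter_upwards [eventually_pos_nearCenter s] with p hp
  have := root_pos hp (ang κ p.1 p.2)
  simp only [Pi.div_apply, Function.comp]
  rw [evolSlope, ker1]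
  field_simp

end

namespace IsEvolution
variable {α κ : ℝ} {hκ : Real.sin κ = 0} {u₀ : ℝ} {s : ℝ → State} (h : IsEvolution α hκ u₀ s)
  {u r : ℝ} (hu : u ∈ Icc (0 : ℝ) u₀) (hr : 0 < r)
include h hu hr

omit hr in
lemma tendsto_prodMk : Tendsto (fun p : ℝ × ℝ => (s p.1, p.2)) (𝓝[Icc 0 u₀] u ×ˢ 𝓝 r)
    (𝓝 (s u, r)) := by
  rw [nhds_prod_eq]
  exact (h.continuousOn u hu).tendsto.prodMap tendsto_id

lemma hasDerivWithinAt_W :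
    HasDerivWithinAt (fun v => W κ (s v) r) (evolW α κ (s u) r) (Icc 0 u₀) u := by
  have hx : rad (s u) (label (s u) r) = r := rad_label _ _
  have h1 := h.hasDerivWithinAt_W_rad hu (x := label (s u) r) (by rw [hx]; exact hr)
  have hρ := h.hasDerivWithinAt_rad hu (x := label (s u) r) (by rw [hx]; exact hr)
  have h2 := hasDerivWithinAt_along_sub (f := fun v => W κ (s v)) (fr := fun v => dW κ (s v)) hρ ?_ ?_
  · refine ((h1.sub h2).congr (fun v hv => ?_) ?_).congr_deriv ?_
    · simp only [Pi.sub_apply, hx]; ring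
    · simp only [Pi.sub_apply, hx]; ring
    · simp only [hx]; rw [evolW]; ring
  · rw [hx]
    have : ∀ᶠ p : ℝ × ℝ in 𝓝[Icc 0 u₀] u ×ˢ 𝓝 r, 0 < p.2 :=
      tendsto_snd.eventually (lt_mem_nhds hr)
    filter_upwards [this] with p hp using State.hasDerivAt_W κ _ hp
  · rw [hx]
    have h3 := ((Weighted.dW κ).continuousOn_uncurry.continuousAt
      ((isOpen_univ.prod isOpen_Ioi).mem_nhds (show (s u, r) ∈ univ ×ˢ Ioi (0:ℝ) from ⟨mem_univ _, hr⟩)))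
    exact Tendsto.comp (f := fun p : ℝ × ℝ => (s p.1, p.2)) (g := fun p : State × ℝ => dW κ p.1 p.2)
      (y := 𝓝 (s u, r)) h3.tendsto (h.tendsto_prodMk hu)

lemma hasDerivWithinAt_X :
    HasDerivWithinAt (fun v => X κ (s v) r) (evolX α κ (s u) r) (Icc 0 u₀) u := by
  obtain ⟨L, hL⟩ := h.exists_norm_le
  obtain ⟨C, hC, H⟩ := (Weighted.evolW α hκ).bound L
  refine hasDerivWithinAt_intervalIntegral (φ := fun v x => W κ (s v) x)
    (φ' := fun v x => evolW α κ (s v) x) (convex_Icc 0 u₀) (bound := fun _ => C) hu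
    (fun v hv x hx => ?_) (fun v hv x hx => ?_) intervalIntegrable_const
    (fun v hv => (Weighted.W κ).intervalIntegrable le_rfl (fun _ _ _ => rfl) _ 0 r le_rfl hr.le)
  · rw [uIoc_of_le hr.le] at hx
    exact h.hasDerivWithinAt_W hv hx.1
  · rw [uIoc_of_le hr.le] at hx
    refine (H _ (hL v hv) x hx.1 0 (by simp)).trans (mul_le_of_le_one_right hC ?_)
    refine (wt_mono (k' := 0) (l' := 0) le_rfl (by norm_num) hx.1).trans_eq (wt_zero_zero _)

lemma hasDerivWithinAt_ang :
    HasDerivWithinAt (fun v => ang κ (s v) r) (evolAng α κ (s u) r) (Icc 0 u₀) u := by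
  have h1 : HasDerivAt (theta r) (root r (ang κ (s u) r)) (ang κ (s u) r) :=
    ((continuous_root_snd r).integral_hasStrictDerivAt 0 _).hasDerivAt
  have hF : HasFDerivAt (fun p : ℝ × ℝ => theta r p.2)
      ((ContinuousLinearMap.toSpanSingleton ℝ (0:ℝ)).coprod
      (ContinuousLinearMap.toSpanSingleton ℝ (root r (ang κ (s u) r)))) (u, ang κ (s u) r) := by
    refine (HasFDerivAt.comp (g := theta r) (u, ang κ (s u) r) h1.hasFDerivAt hasFDerivAt_snd).congr_fderiv ?_
    ext <;> simp
  have hc := ((Weighted.ang κ).continuousOn_uncurry.continuousAt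
      ((isOpen_univ.prod isOpen_Ioi).mem_nhds (show (s u, r) ∈ univ ×ˢ Ioi (0:ℝ) from ⟨mem_univ _, hr⟩)))
  refine (hasDerivWithinAt_of_implicit (y := fun v => ang κ (s v) r) hF (root_pos hr _).ne' ?_
    (h.hasDerivWithinAt_X hu hr) (fun v hv => State.theta_ang κ _ hr) hu).congr_deriv ?_
  · exact hc.comp_continuousWithinAt (f := fun v => (s v, r))
      ((h.continuousOn u hu).prodMk continuousWithinAt_const)
  · rw [sub_zero, evolAng]

lemma hasDerivWithinAt_slope :
    HasDerivWithinAt (fun v => slope κ (s v) r) (evolSlope α κ (s u) r) (Icc 0 u₀) u := by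
  have ha := h.hasDerivWithinAt_ang hu hr
  have h1 := hasDerivWithinAt_theta1 (ρ := fun _ => r) (s := Icc 0 u₀) hr
    (hasDerivWithinAt_const u _ r) ha
  have h2 := (hasDerivAt_root_snd hr (ang κ (s u) r)).comp_hasDerivWithinAt u ha
  have h0 := root_pos hr (ang κ (s u) r)
  refine (((h.hasDerivWithinAt_W hu hr).sub h1).div h2 h0.ne').congr_deriv ?_
  simp only [Pi.sub_apply, Function.comp]
  rw [evolSlope, Q]
  field_simp
  ring

end IsEvolution

/-- The function `h = ∂ᵣ(r ξ) = ξ + r ∂ᵣ ξ` of a state, for `r > 0`; its value at the centre is `κ`. -/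
def profile (κ : ℝ) (s : State) (r : ℝ) : ℝ :=
  κ + extZero (fun r => ang κ s r + r * slope κ s r) r

lemma profile_of_pos (κ : ℝ) (s : State) {r : ℝ} (hr : 0 < r) :
    profile κ s r = κ + ang κ s r + r * slope κ s r := by
  rw [profile, extZero_of_pos hr]; ring

lemma profile_zero (κ : ℝ) (s : State) : profile κ s 0 = κ := by
  rw [profile, extZero_of_nonpos le_rfl, add_zero]

lemma Weighted.ang_add_mul_slope (κ : ℝ) :
    Weighted 1 0 (fun s r _ => State.ang κ s r + r * State.slope κ s r) :=
  (Weighted.ang κ).add ((Weighted.slope κ).mul_radius.mono (by norm_num) (by norm_num))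

lemma continuous_profile (κ : ℝ) : Continuous fun p : State × ℝ => profile κ p.1 p.2 :=
  continuous_const.add ((Weighted.ang_add_mul_slope κ).continuous_extZero_uncurry le_rfl)

lemma hasDerivAt_profile (κ : ℝ) (s : State) {r : ℝ} (hr : 0 < r) :
    HasDerivAt (profile κ s) (2 * slope κ s r + r * dSlope κ s r) r := by
  have h := ((hasDerivAt_ang κ s hr).const_add κ).add
    ((hasDerivAt_id r).mul (hasDerivAt_slope κ s hr))
  refine (h.congr_of_eventuallyEq ?_).congr_deriv ?_
  · filter_upwards [Ioi_mem_nhds hr] with x hx using by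
      rw [profile_of_pos κ s hx]; simp
  · simp only [id]; ring

lemma avg_profile (κ : ℝ) (s : State) {r : ℝ} (hr : 0 < r) :
    avg (profile κ s) r = κ + ang κ s r := by
  have hc : Continuous (profile κ s) := (continuous_profile κ).comp (f := fun r => (s, r)) (by fun_prop)
  have h1 : Tendsto (fun x => x * (κ + ang κ s x)) (𝓝[>] 0) (𝓝 (0 * (κ + 0))) :=
    (tendsto_id.mono_left nhdsWithin_le_nhds).mul
      (((Weighted.ang κ).tendsto_zero le_rfl s).const_add κ)
  have h2 := intervalIntegral.integral_eq_sub_of_hasDerivAt_of_tendsto (f := fun x => x * (κ + ang κ s x))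
    (f' := profile κ s) hr (fun x hx => ?_) (hc.intervalIntegrable 0 r) h1
    (b := r) (fb := r * (κ + ang κ s r)) ?_
  · rw [avg, h2]; field_simp; simp
  · refine ((hasDerivAt_id x).mul ((hasDerivAt_ang κ s hx.1).const_add κ)).congr_deriv ?_
    rw [profile_of_pos κ s hx.1]; simp only [id]; ring
  · exact (continuousAt_id.mul (continuousAt_const.add
      ((Weighted.ang κ).continuousAt s hr))).tendsto.mono_left nhdsWithin_le_nhds

lemma continuousOn_dProfile (κ : ℝ) :
    ContinuousOn (fun p : State × ℝ => 2 * slope κ p.1 p.2 + p.2 * dSlope κ p.1 p.2)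
      (univ ×ˢ Ioi 0) := by
  have h1 := (Weighted.slope κ).continuousOn_uncurry
  have h2 := (Weighted.dQ (κ := κ)).continuousOn_uncurry
  have h3 := continuousOn_root_ang κ
  have h4 := (Weighted.ang κ).continuousOn_uncurry
  have h5 := (Weighted.Q κ).continuousOn_uncurry
  exact (continuousOn_const.mul h1).add (continuousOn_snd.mul
    ((h2.div h3 fun p hp => (root_pos hp.2 _).ne').sub
    ((h5.mul (continuousOn_snd.add (((continuousOn_const.mul (Real.continuous_sin.comp_continuousOn h4)).mul
      (Real.continuous_cos.comp_continuousOn h4)).mul h1))).div (h3.pow 3)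
      fun p hp => pow_ne_zero 3 (root_pos hp.2 _).ne')))

namespace IsEvolution
variable {α κ : ℝ} {hκ : Real.sin κ = 0} {u₀ : ℝ} {s : ℝ → State} (h : IsEvolution α hκ u₀ s)
include h

lemma hasDerivWithinAt_profile {u r : ℝ} (hu : u ∈ Icc (0 : ℝ) u₀) (hr : 0 < r) :
    HasDerivWithinAt (fun v => profile κ (s v) r)
      (evolAng α κ (s u) r + r * evolSlope α κ (s u) r) (Icc 0 u₀) u := by
  refine (((h.hasDerivWithinAt_ang hu hr).const_add κ).add
    ((h.hasDerivWithinAt_slope hu hr).const_mul r)).congr (fun v _ => ?_) ?_ <;>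
  · rw [profile_of_pos κ _ hr]; rfl

/-- The partial derivatives of the profile have limits at the centre, which makes it continuously
differentiable up to `r = 0`. -/
lemma contDiffOn_profile (hu₀ : 0 < u₀) :
    ContDiffOn ℝ 1 (fun p : ℝ × ℝ => profile κ (s p.1) p.2) (Icc 0 u₀ ×ˢ Ici 0) := by
  obtain ⟨A, hA, hAF, -⟩ := continuousOn_ext_of_tendsto
    (F := fun s r => evolAng α κ s r + r * evolSlope α κ s r)
    ((continuousOn_evolAng α hκ).add (continuousOn_snd.mul (continuousOn_evolSlope α hκ)))
    fun s => ⟨_, (tendsto_center_evolAng α hκ s).add (tendsto_center_mul_evolSlope α hκ s)⟩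
  obtain ⟨B, hB, hBF, -⟩ := continuousOn_ext_of_tendsto
    (F := fun s r => 2 * slope κ s r + r * dSlope κ s r) (continuousOn_dProfile κ) fun s => by
      obtain ⟨c, hc⟩ := exists_tendsto_center_slope s κ
      obtain ⟨d, hd⟩ := exists_tendsto_center_mul_dSlope s κ
      exact ⟨_, (hc.const_mul 2).add hd⟩
  have hm : ContinuousOn (fun p : ℝ × ℝ => (s p.1, p.2)) (Icc 0 u₀ ×ˢ Ici 0) :=
    (h.continuousOn.comp continuousOn_fst fun p hp => hp.1).prodMk continuousOn_snd
  have hmt : MapsTo (fun p : ℝ × ℝ => (s p.1, p.2)) (Icc 0 u₀ ×ˢ Ici 0) (univ ×ˢ Ici 0) :=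
    fun p hp => ⟨mem_univ _, hp.2⟩
  have cA : ContinuousOn (fun p : ℝ × ℝ => A (s p.1) p.2) (Icc 0 u₀ ×ˢ Ici 0) := hA.comp hm hmt
  have cB : ContinuousOn (fun p : ℝ × ℝ => B (s p.1) p.2) (Icc 0 u₀ ×ˢ Ici 0) := hB.comp hm hmt
  have cP : ContinuousOn (fun p : ℝ × ℝ => profile κ (s p.1) p.2) (Icc 0 u₀ ×ˢ Ici 0) :=
    (continuous_profile κ).comp_continuousOn (f := fun p : ℝ × ℝ => (s p.1, p.2)) hm
  have dA : ∀ u ∈ Ioo 0 u₀, ∀ r : ℝ, 0 < r →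
      HasDerivAt (fun v => profile κ (s v) r) (A (s u) r) u := fun u hu r hr => by
    rw [hAF _ _ hr]
    exact (h.hasDerivWithinAt_profile (Ioo_subset_Icc_self hu) hr).hasDerivAt
      (Icc_mem_nhds hu.1 hu.2)
  have dB : ∀ u ∈ Ioo 0 u₀, ∀ r : ℝ, 0 < r →
      HasDerivAt (profile κ (s u)) (B (s u) r) r := fun u hu r hr => by
    rw [hBF _ _ hr]
    exact hasDerivAt_profile κ _ hr
  exact contDiffOn_of_hasFDerivWithinAt (f := fun u r => profile κ (s u) r)
    (A := fun u r => A (s u) r) (B := fun u r => B (s u) r) hu₀ cA cB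
    (hasFDerivWithinAt_of_partials (f := fun u r => profile κ (s u) r)
      (A := fun u r => A (s u) r) (B := fun u r => B (s u) r) hu₀ cP cA cB dA dB)

end IsEvolution

end

/-! ### Decay at infinity -/

section

open State

lemma wt_zero_even (n : ℕ) {r : ℝ} (hr : 0 ≤ r) : wt 0 (2 * n) r = 1 / (1 + r) ^ n := by
  unfold wt
  rw [zpow_zero, one_mul, zpow_mul, zpow_natCast, show (2:ℤ) = ((2:ℕ):ℤ) by rfl, zpow_natCast,
    sq_sqrt_inv hr, one_div, one_div, inv_pow]

lemma wt_zero_four {r : ℝ} (hr : 0 ≤ r) : wt 0 4 r = 1 / (1 + r) ^ 2 := wt_zero_even 2 hr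
lemma wt_zero_six {r : ℝ} (hr : 0 ≤ r) : wt 0 6 r = 1 / (1 + r) ^ 3 := wt_zero_even 3 hr

lemma exists_amp_mul_le (L : ℝ) : ∃ C : ℝ, 0 ≤ C ∧ ∀ s : State, ‖s‖ ≤ L → ∀ x : ℝ,
    amp x * extZero (wt 0 6) (rad s x) ≤ C * (√(1 + |x|))⁻¹ := by
  refine ⟨((1 + |L|) * Real.exp |L|) ^ 3, by positivity, fun s hs x => ?_⟩
  rcases lt_or_ge 0 (rad s x) with h | h
  · have h1 := one_add_abs_le (hs.trans (le_abs_self L)) h.le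
    rw [extZero_of_pos h, wt_zero_six h.le, amp]
    have h2 : √(1 + |x|) ^ 6 = (1 + |x|) ^ 3 := by
      rw [show 6 = 2 * 3 by norm_num, pow_mul, Real.sq_sqrt (by positivity)]
    have h3 : 0 < √(1 + |x|) := by positivity
    rw [mul_one_div, ← div_eq_mul_inv, div_le_div_iff₀ (by positivity) h3, ← pow_succ, h2, ← mul_pow]
    exact pow_le_pow_left₀ (by positivity) h1 3
  · rw [extZero_of_nonpos h, mul_zero]; positivity

lemma exists_zeta_le (L C : ℝ) (hC : 0 ≤ C) : ∃ D : ℝ, 0 ≤ D ∧ ∀ s : State, ‖s‖ ≤ L →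
    (∀ x, |s.2.2 x| ≤ C * (√(1 + |x|))⁻¹) → ∀ r, 0 < r → |zeta s r| ≤ D * (1 / (1 + r) ^ 3) := by
  refine ⟨C * ((1 + |L|) * Real.exp |L|) ^ 3, by positivity, fun s hs hz r hr => ?_⟩
  set x := label s r
  have h1 := one_add_rad_le (hs.trans (le_abs_self L)) x
  rw [rad_label, abs_of_pos hr] at h1
  have h2 : (√(1 + |x|))⁻¹ ^ 6 = 1 / (1 + |x|) ^ 3 := by
    rw [show 6 = 2 * 3 by norm_num, pow_mul, sq_sqrt_inv (abs_nonneg x), div_pow, one_pow]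
  calc |zeta s r| = |s.2.2 x| * (√(1 + |x|))⁻¹ ^ 5 := by
        rw [zeta, abs_mul, abs_of_nonneg (show 0 ≤ (√(1 + |label s r|))⁻¹ ^ 5 by positivity)]
    _ ≤ C * (√(1 + |x|))⁻¹ * (√(1 + |x|))⁻¹ ^ 5 := by gcongr; exact hz x
    _ = C * (1 / (1 + |x|) ^ 3) := by rw [← h2]; ring
    _ ≤ C * ((((1 + |L|) * Real.exp |L|) ^ 3) * (1 / (1 + r) ^ 3)) := by
        gcongr
        rw [mul_one_div, div_le_div_iff₀ (by positivity) (by positivity), one_mul, ← mul_pow]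
        exact pow_le_pow_left₀ (by positivity) h1 3
    _ = _ := by ring

namespace IsEvolution
variable {α κ : ℝ} {hκ : Real.sin κ = 0} {u₀ : ℝ} {s : ℝ → State} (h : IsEvolution α hκ u₀ s)
include h

lemma exists_zeta_le {C : ℝ} (hC : 0 ≤ C) (h0 : ∀ x, |(s 0).2.2 x| ≤ C * (√(1 + |x|))⁻¹) :
    ∃ D : ℝ, 0 ≤ D ∧ ∀ u ∈ Icc (0 : ℝ) u₀, ∀ r, 0 < r → |zeta (s u) r| ≤ D * (1 / (1 + r) ^ 3) := by
  obtain ⟨L, hL⟩ := h.exists_norm_le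
  obtain ⟨C₁, hC₁, H⟩ := (Weighted.zSource α hκ).abs_extZero_le L
  obtain ⟨C₂, hC₂, I⟩ := exists_amp_mul_le L
  obtain ⟨D, hD, J⟩ := EinsteinSkyrme.exists_zeta_le L (C + C₁ * C₂ * |u₀|) (by positivity)
  refine ⟨D, hD, fun u hu => J (s u) (hL u hu) fun x => ?_⟩
  have hu0 : (0:ℝ) ∈ Icc 0 u₀ := ⟨le_rfl, hu.1.trans hu.2⟩
  have h1 := (convex_Icc (0:ℝ) u₀).norm_image_sub_le_of_norm_hasDerivWithin_le
    (f := fun v => (s v).2.2 x) (C := C₁ * C₂ * (√(1 + |x|))⁻¹)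
    (fun v hv => h.hasDerivWithinAt_amp hv x) (fun v hv => ?_) hu0 hu
  · have h2 : |(s u).2.2 x| ≤ |(s 0).2.2 x| + |(s u).2.2 x - (s 0).2.2 x| := by
      have := abs_add_le ((s 0).2.2 x) ((s u).2.2 x - (s 0).2.2 x)
      rwa [add_sub_cancel] at this
    have h3 : C₁ * C₂ * (√(1 + |x|))⁻¹ * |u - 0| ≤ C₁ * C₂ * (√(1 + |x|))⁻¹ * |u₀| := by
      rw [sub_zero, abs_of_nonneg hu.1]
      gcongr
      exact hu.2.trans (le_abs_self _)
    have h4 := h0 x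
    simp only [Real.norm_eq_abs] at h1
    linarith
  · rw [Real.norm_eq_abs, abs_mul, abs_of_pos (amp_pos x)]
    have a1 := H (s v) (hL v hv) (rad (s v) x)
    have a2 := I (s v) (hL v hv) x
    have a3 := extZero_wt_le (k := 1) (k' := 0) (l := 6) (l' := 6) (by norm_num) le_rfl (rad (s v) x)
    have := (amp_pos x).le
    calc _ ≤ amp x * (C₁ * extZero (wt 0 6) (rad (s v) x)) := by
          gcongr; exact a1.trans (by gcongr)
      _ = C₁ * (amp x * extZero (wt 0 6) (rad (s v) x)) := by ring
      _ ≤ C₁ * (C₂ * (√(1 + |x|))⁻¹) := by gcongr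
      _ = _ := by ring

/-- The deviation of `W` from its limit `-κ` at infinity decays quadratically, uniformly along the
evolution, if it does so initially. -/
lemma exists_W_add_le {C : ℝ} (hC : 0 ≤ C)
    (h0 : ∀ r, 0 < r → |W κ (s 0) r + κ| ≤ C * (1 / (1 + r) ^ 2)) :
    ∃ D : ℝ, 0 ≤ D ∧ ∀ u ∈ Icc (0 : ℝ) u₀, ∀ r, 0 < r → |W κ (s u) r + κ| ≤ D * (1 / (1 + r) ^ 2) := by
  obtain ⟨L', hL'⟩ := h.exists_norm_le
  set L := |L'|
  have hL : ∀ u ∈ Icc (0 : ℝ) u₀, ‖s u‖ ≤ L := fun u hu => (hL' u hu).trans (le_abs_self _)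
  have hL0 : 0 ≤ L := abs_nonneg _
  obtain ⟨C₁, hC₁, H⟩ := (Weighted.source α hκ).bound L
  obtain ⟨C₂, hC₂, I⟩ := ((Weighted.W κ).mono (k' := 0) (by norm_num) le_rfl).add
    ((Weighted.const κ)) |>.bound L
  set K := (1 + L) * Real.exp L
  have hK1 : 1 ≤ K := by
    have := Real.one_le_exp hL0
    show 1 ≤ (1 + L) * Real.exp L
    nlinarith
  set M := K * K
  set E := (C + C₁ * |u₀|) * M ^ 2 + C₂ * (2 * M) ^ 2
  refine ⟨E, by positivity, fun u hu r hr => ?_⟩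
  have hu0 : (0:ℝ) ∈ Icc 0 u₀ := ⟨le_rfl, hu.1.trans hu.2⟩
  set x := label (s u) r
  have hx : rad (s u) x = r := rad_label _ _
  -- shells with `x ≥ K` stay away from the centre; the others stay in a bounded region
  rcases le_or_gt K x with hxK | hxK
  · have hx0 : 0 ≤ x := by linarith
    have hpos : ∀ v ∈ Icc (0:ℝ) u₀, 0 < rad (s v) x := by
      intro v hv
      have a1 := mul_sub_le_rad_sub (hL v hv) hx0
      have a2 := abs_fst_le (hL v hv)
      rw [rad_zero, sub_zero] at a1
      have a3 : Real.exp (-L) * K ≤ Real.exp (-L) * x := by gcongr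
      have a4 : Real.exp (-L) * K = 1 + L := by
        show Real.exp (-L) * ((1 + L) * Real.exp L) = 1 + L
        rw [Real.exp_neg]; field_simp
      have := neg_abs_le (s v).1
      linarith
    -- the radii reached by one label are comparable
    have hcmp : ∀ v ∈ Icc (0:ℝ) u₀, 1 / (1 + rad (s v) x) ^ 2 ≤ M ^ 2 * (1 / (1 + r) ^ 2) := by
      intro v hv
      have p := hpos v hv
      have a1 := one_add_abs_le (hL v hv) p.le
      have a2 := one_add_rad_le (hL u hu) x
      rw [hx, abs_of_pos hr] at a2
      have a3 : 1 + r ≤ M * (1 + rad (s v) x) := by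
        calc 1 + r ≤ K * (1 + |x|) := a2
          _ ≤ K * (K * (1 + rad (s v) x)) := by gcongr
          _ = _ := by ring
      rw [mul_one_div, div_le_div_iff₀ (by positivity) (by positivity), one_mul, ← mul_pow]
      exact pow_le_pow_left₀ (by positivity) a3 2
    have h1 := (convex_Icc (0:ℝ) u₀).norm_image_sub_le_of_norm_hasDerivWithin_le
      (f := fun v => W κ (s v) (rad (s v) x)) (C := C₁ * (M ^ 2 * (1 / (1 + r) ^ 2)))
      (fun v hv => h.hasDerivWithinAt_W_rad hv (hpos v hv)) (fun v hv => ?_) hu0 hu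
    · simp only [hx, Real.norm_eq_abs] at h1
      have h2 : |W κ (s u) r + κ| ≤ |W κ (s 0) (rad (s 0) x) + κ|
          + |W κ (s u) r - W κ (s 0) (rad (s 0) x)| := by
        have := abs_add_le (W κ (s 0) (rad (s 0) x) + κ) (W κ (s u) r - W κ (s 0) (rad (s 0) x))
        rwa [show W κ (s 0) (rad (s 0) x) + κ + (W κ (s u) r - W κ (s 0) (rad (s 0) x))
          = W κ (s u) r + κ by ring] at this
      have h3 := (h0 _ (hpos 0 hu0)).trans (mul_le_mul_of_nonneg_left (hcmp 0 hu0) hC)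
      have h4 : C₁ * (M ^ 2 * (1 / (1 + r) ^ 2)) * |u - 0| ≤ C₁ * (M ^ 2 * (1 / (1 + r) ^ 2)) * |u₀| := by
        rw [sub_zero, abs_of_nonneg hu.1]
        gcongr
        exact hu.2.trans (le_abs_self _)
      calc |W κ (s u) r + κ| ≤ C * (M ^ 2 * (1 / (1 + r) ^ 2))
            + C₁ * (M ^ 2 * (1 / (1 + r) ^ 2)) * |u₀| := by linarith
        _ = ((C + C₁ * |u₀|) * M ^ 2) * (1 / (1 + r) ^ 2) := by ring
        _ ≤ E * (1 / (1 + r) ^ 2) := by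
            gcongr
            exact le_add_of_nonneg_right (by positivity)
    · rw [Real.norm_eq_abs]
      have a := H (s v) (hL v hv) _ (hpos v hv) 0 (by simp)
      rw [wt_zero_four (hpos v hv).le] at a
      exact a.trans (mul_le_mul_of_nonneg_left (hcmp v hv) hC₁)
  · have a := I (s u) (hL u hu) r hr 0 (by simp)
    rw [wt_zero_zero, mul_one] at a
    have hrM : 1 + r ≤ 2 * M := by
      have a1 := rad_sub_le_mul_sub (hL u hu) hxK.le
      have a2 := (abs_le.1 (abs_fst_le (hL u hu)))
      have hfst := h.isTransport.fst_nonpos hu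
      have a3 := (strictMono_rad (s u)) hxK
      have a4 := rad_sub_le_mul_sub (hL u hu) (show (0:ℝ) ≤ K by linarith)
      rw [rad_zero, sub_zero] at a4
      rw [hx] at a3
      have a5 : Real.exp L ≤ K := by
        show Real.exp L ≤ (1 + L) * Real.exp L
        nlinarith [Real.exp_pos L]
      have a6 : Real.exp L * K ≤ K * K := by gcongr
      have : 1 ≤ M := by
        show 1 ≤ K * K
        nlinarith
      show 1 + r ≤ 2 * (K * K)
      change 1 ≤ K * K at this
      linarith
    have hsq : 1 ≤ (2 * M) ^ 2 * (1 / (1 + r) ^ 2) := by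
      rw [mul_one_div, le_div_iff₀ (by positivity), one_mul]
      exact pow_le_pow_left₀ (by positivity) hrM 2
    calc |W κ (s u) r + κ| ≤ C₂ * 1 := by rw [mul_one]; exact a
      _ ≤ C₂ * ((2 * M) ^ 2 * (1 / (1 + r) ^ 2)) := by gcongr
      _ = C₂ * (2 * M) ^ 2 * (1 / (1 + r) ^ 2) := by ring
      _ ≤ E * (1 / (1 + r) ^ 2) := by
          gcongr
          exact le_add_of_nonneg_left (by positivity)

end IsEvolution

lemma Weighted.ker1_ang_sub_one (κ : ℝ) :
    Weighted 0 4 (fun s r _ => EinsteinSkyrme.ker1 r (State.ang κ s r) - 1) :=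
  (invRoot_sub_one κ).eval_one.congr fun s r hr _ _ => by
    have h1 := root_param κ s hr 1
    have := invRoot_pos κ s r 1
    rw [one_mul] at h1
    rw [EinsteinSkyrme.ker1, h1]; field_simp

/-- Up to `O((1 + r)⁻²)` the profile is `W + κ`, so that its decay follows from that of `W + κ`. -/
lemma Weighted.profile_sub_W (κ : ℝ) :
    Weighted 0 4 (fun s r _ => EinsteinSkyrme.profile κ s r - (State.W κ s r + κ)) := by
  refine ((((ker1_ang_sub_one κ).mul (Q κ)).mono (k' := 0) (l' := 4) (by norm_num) (by norm_num)).sub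
    ((theta1_sub_ang κ).mono (k' := 0) (l' := 4) (by norm_num) (by norm_num))).congr
    fun s r hr _ _ => ?_
  have := root_pos hr (State.ang κ s r)
  rw [profile_of_pos κ s hr, EinsteinSkyrme.ker1, State.slope, State.Q]
  field_simp
  ring

lemma Weighted.dProfile_sub_dW {κ : ℝ} (hκ : Real.sin κ = 0) :
    Weighted 0 6 (fun s r _ => 2 * State.slope κ s r + r * dSlope κ s r - State.dW κ s r) := by
  have hk := ker1_ang κ
  have hk1 := ker1_ang_sub_one κ
  have hq := slope κ
  have t1 : Weighted 0 6 (fun s r _ => State.dW κ s r *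
      (EinsteinSkyrme.ker1 r (State.ang κ s r) - 1)) :=
    ((dW κ).mul hk1).mono (by norm_num) (by norm_num)
  have t2 : Weighted 0 6 (fun s r _ => EinsteinSkyrme.theta2 r (State.ang κ s r) *
      EinsteinSkyrme.ker1 r (State.ang κ s r)) :=
    ((theta2 κ).mul hk).mono (by norm_num) (by norm_num)
  have t3 : Weighted 0 6 (fun s r _ => 2 * (State.slope κ s r * ((EinsteinSkyrme.ker1 r (State.ang κ s r) + 1)
      * (EinsteinSkyrme.ker1 r (State.ang κ s r) - 1)))) :=
    ((hq.mul ((hk.add (const 1)).mul hk1)).mono (by norm_num) (by norm_num)).const_mul 2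
  have t4 : Weighted 0 6 (fun s r _ => 2 * (State.slope κ s r * State.slope κ s r *
      (Real.sin (State.ang κ s r) / r * Real.cos (State.ang κ s r) *
        EinsteinSkyrme.ker1 r (State.ang κ s r) ^ 2))) :=
    (((hq.mul hq).mul (((sin_ang hκ).div_radius.mul (cos_ang κ)).mul (hk.pow 2))).mono
      (by norm_num) (by norm_num)).const_mul 2
  refine (((t1.sub t2).sub t3).sub t4).congr fun s r hr _ _ => ?_
  have := root_pos hr (State.ang κ s r)
  rw [dSlope, State.dQ, EinsteinSkyrme.ker1, ← root_mul_slope κ s hr]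
  field_simp
  ring

lemma exists_dW_le (κ L C C' : ℝ) (hC : 0 ≤ C) (hC' : 0 ≤ C') : ∃ D : ℝ, 0 ≤ D ∧ ∀ s : State,
    ‖s‖ ≤ L → (∀ r, 0 < r → |zeta s r| ≤ C * (1 / (1 + r) ^ 3)) →
    (∀ r, 0 < r → |W κ s r + κ| ≤ C' * (1 / (1 + r) ^ 2)) →
    ∀ r, 0 < r → |dW κ s r| ≤ D * (1 / (1 + r) ^ 3) := by
  obtain ⟨C₁, hC₁, H⟩ := (Weighted.dW κ).bound L
  refine ⟨C₁ * 8 + C + 4 * C' + 100 * |κ|, by positivity, fun s hs hz hw r hr => ?_⟩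
  rcases le_or_gt r 1 with h | h
  · have a := H s hs r hr 0 (by simp)
    have b : wt 0 5 r ≤ 1 := (wt_mono (k' := 0) (l' := 0) le_rfl (by norm_num) hr).trans_eq (wt_zero_zero _)
    have c : 1 ≤ 8 * (1 / (1 + r) ^ 3) := by
      rw [mul_one_div, le_div_iff₀ (by positivity), one_mul]
      calc (1 + r) ^ 3 ≤ 2 ^ 3 := pow_le_pow_left₀ (by positivity) (by linarith) 3
        _ = 8 := by norm_num
    have p : 0 < 1 / (1 + r) ^ 3 := by positivity
    calc |dW κ s r| ≤ C₁ * 1 := a.trans (by gcongr)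
      _ ≤ C₁ * (8 * (1 / (1 + r) ^ 3)) := by gcongr
      _ ≤ _ := by
        have : 0 ≤ (C + 4 * C' + 100 * |κ|) * (1 / (1 + r) ^ 3) := by positivity
        nlinarith
  · have e : dW κ s r = zeta s r - 2 / r * (W κ s r + κ)
        + κ * ((2 + 10 * r + 20 * r ^ 2) / (r * (1 + r) ^ 5)) := by
      rw [dW, Z, refZ]; field_simp; ring
    have h2 : 2 / r * (1 / (1 + r) ^ 2) ≤ 4 * (1 / (1 + r) ^ 3) := by
      rw [div_mul_div_comm, mul_one_div, mul_one, div_le_div_iff₀ (by positivity) (by positivity),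
        show (1 + r) ^ 3 = (1 + r) ^ 2 * (1 + r) by ring]
      have : 0 < (1 + r) ^ 2 := by positivity
      nlinarith
    have h3 : (2 + 10 * r + 20 * r ^ 2) / (r * (1 + r) ^ 5) ≤ 100 * (1 / (1 + r) ^ 3) := by
      rw [mul_one_div, div_le_div_iff₀ (by positivity) (by positivity),
        show (1 + r) ^ 5 = (1 + r) ^ 2 * (1 + r) ^ 3 by ring, ← mul_assoc, ← mul_assoc]
      have : 2 + 10 * r + 20 * r ^ 2 ≤ 100 * r * (1 + r) ^ 2 := by nlinarith [mul_pos hr hr, pow_pos hr 3]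
      gcongr
    have h1 := hz r hr
    have h4 := hw r hr
    have e2 : |dW κ s r| ≤ |zeta s r| + 2 / r * |W κ s r + κ|
        + |κ| * ((2 + 10 * r + 20 * r ^ 2) / (r * (1 + r) ^ 5)) := by
      rw [e]
      refine (abs_add_le _ _).trans (add_le_add ((abs_sub _ _).trans ?_) ?_)
      · rw [abs_mul, abs_of_pos (show 0 < 2 / r by positivity)]
      · rw [abs_mul, abs_of_pos (show 0 < (2 + 10 * r + 20 * r ^ 2) / (r * (1 + r) ^ 5) by positivity)]
    calc |dW κ s r| ≤ C * (1 / (1 + r) ^ 3) + 2 / r * (C' * (1 / (1 + r) ^ 2))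
          + |κ| * (100 * (1 / (1 + r) ^ 3)) := e2.trans (by gcongr)
      _ = C * (1 / (1 + r) ^ 3) + C' * (2 / r * (1 / (1 + r) ^ 2))
          + |κ| * (100 * (1 / (1 + r) ^ 3)) := by ring
      _ ≤ C * (1 / (1 + r) ^ 3) + C' * (4 * (1 / (1 + r) ^ 3))
          + |κ| * (100 * (1 / (1 + r) ^ 3)) := by gcongr
      _ ≤ _ := by
        have : 0 ≤ C₁ * 8 * (1 / (1 + r) ^ 3) := by positivity
        linarith

/-- Decay of the profile and of its radial derivative, from that of `W + κ` and of the remainder. -/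
lemma exists_profile_le {κ : ℝ} (hκ : Real.sin κ = 0) (L C C' : ℝ) (hC : 0 ≤ C) (hC' : 0 ≤ C') :
    ∃ D : ℝ, 0 ≤ D ∧ ∀ s : State,
    ‖s‖ ≤ L → (∀ r, 0 < r → |zeta s r| ≤ C * (1 / (1 + r) ^ 3)) →
    (∀ r, 0 < r → |W κ s r + κ| ≤ C' * (1 / (1 + r) ^ 2)) →
    ∀ r, 0 < r → |profile κ s r| ≤ D * (1 / (1 + r) ^ 2) ∧
      |2 * slope κ s r + r * dSlope κ s r| ≤ D * (1 / (1 + r) ^ 3) := by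
  obtain ⟨C₁, hC₁, H₁⟩ := (Weighted.profile_sub_W κ).bound L
  obtain ⟨C₂, hC₂, H₂⟩ := (Weighted.dProfile_sub_dW hκ).bound L
  obtain ⟨C₃, hC₃, H₃⟩ := exists_dW_le κ L C C' hC hC'
  refine ⟨C₁ + C' + (C₂ + C₃), by positivity, fun s hs hz hw r hr => ⟨?_, ?_⟩⟩
  · have a := H₁ s hs r hr 0 (by simp)
    rw [wt_zero_four hr.le] at a
    have b := abs_add_le (profile κ s r - (W κ s r + κ)) (W κ s r + κ)
    rw [sub_add_cancel] at b
    have p : 0 ≤ (C₂ + C₃) * (1 / (1 + r) ^ 2) := by positivity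
    linarith [hw r hr]
  · have a := H₂ s hs r hr 0 (by simp)
    rw [wt_zero_six hr.le] at a
    have b := abs_add_le (2 * slope κ s r + r * dSlope κ s r - dW κ s r) (dW κ s r)
    rw [sub_add_cancel] at b
    have p : 0 ≤ (C₁ + C') * (1 / (1 + r) ^ 3) := by positivity
    linarith [H₃ s hs hz hw r hr]

lemma le_of_forall_pos {f : ℝ → ℝ} (hf : ContinuousOn f (Ici 0)) {c : ℝ}
    (h : ∀ r, 0 < r → f r ≤ c) : ∀ r, 0 ≤ r → f r ≤ c := by
  intro r hr
  have := (hf r hr).mono (Ioi_subset_Ici_self)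
  have hne : (𝓝[Ioi 0] r).NeBot := by
    rw [← mem_closure_iff_nhdsWithin_neBot, closure_Ioi]; exact hr
  exact le_of_tendsto this (by filter_upwards [self_mem_nhdsWithin] with x hx using h x hx)

lemma IsEvolution.memWeightedC1 {α κ : ℝ} {hκ : Real.sin κ = 0} {u₀ : ℝ} {s : ℝ → State}
    (h : IsEvolution α hκ u₀ s) (hu₀ : 0 < u₀) {C C' : ℝ} (hC : 0 ≤ C) (hC' : 0 ≤ C')
    (hz : ∀ x, |(s 0).2.2 x| ≤ C * (√(1 + |x|))⁻¹)
    (hw : ∀ r, 0 < r → |W κ (s 0) r + κ| ≤ C' * (1 / (1 + r) ^ 2)) :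
    MemWeightedC1 u₀ (fun u r => profile κ (s u) r) := by
  obtain ⟨L, hL⟩ := h.exists_norm_le
  obtain ⟨D, hD, H⟩ := h.exists_zeta_le hC hz
  obtain ⟨D', hD', H'⟩ := h.exists_W_add_le hC' hw
  obtain ⟨E, hE, I⟩ := exists_profile_le hκ L D D' hD hD'
  have hC1 := h.contDiffOn_profile hu₀
  obtain ⟨A, B, hA, hB, hAB⟩ := exists_partials_of_contDiffOn hu₀
    (f := fun u r => profile κ (s u) r) hC1
  refine ⟨hC1, E + E, fun u hu r hr => ?_⟩
  have hBr : ∀ r, 0 ≤ r → partialR (fun u r => profile κ (s u) r) u r = B u r := fun r hr =>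
    (hasDerivWithinAt_snd_of_grad (f := fun u r => profile κ (s u) r) (a := A u r) (b := B u r) hu
      (hAB (u, r) ⟨hu, hr⟩)).derivWithin (uniqueDiffOn_Ici 0 r hr)
  rw [hBr r hr]
  have hBc : ContinuousOn (B u) (Ici 0) := hB.comp (f := fun r : ℝ => (u, r)) (by fun_prop)
    fun r hr => ⟨hu, hr⟩
  have hpc : Continuous (profile κ (s u)) :=
    (continuous_profile κ).comp (f := fun r : ℝ => (s u, r)) (by fun_prop)
  refine le_of_forall_pos (f := fun r => (1 + r) ^ 2 * |profile κ (s u) r| + (1 + r) ^ 3 * |B u r|)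
    ((Continuous.continuousOn (by fun_prop)).add ((Continuous.continuousOn (by fun_prop)).mul hBc.abs))
    (fun r hr => ?_) r hr
  have hb : B u r = 2 * slope κ (s u) r + r * dSlope κ (s u) r := by
    rw [← hBr r hr.le]
    exact (hasDerivAt_profile κ (s u) hr).hasDerivWithinAt.derivWithin (uniqueDiffOn_Ici 0 r hr.le)
  obtain ⟨a, b⟩ := I (s u) (hL u hu) (H u hu) (H' u hu) r hr
  rw [mul_one_div, le_div_iff₀ (by positivity)] at a b
  rw [hb]
  linarith

end

/-! ### The reduced equation -/

section

open State

section metric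
variable (α : ℝ) {κ : ℝ} (hκ : Real.sin κ = 0) (s : State) {r : ℝ}

include hκ in
lemma cos_sq_of_sin_eq_zero : Real.cos κ ^ 2 = 1 := by
  have := Real.sin_sq_add_cos_sq κ
  rw [hκ] at this; linarith

include hκ in
lemma sin_sq_add (y : ℝ) : Real.sin (κ + y) ^ 2 = Real.sin y ^ 2 := by
  rw [Real.sin_add, hκ, zero_mul, zero_add, mul_pow, cos_sq_of_sin_eq_zero hκ, one_mul]

include hκ in
lemma sin_mul_cos_add (y : ℝ) :
    Real.sin (κ + y) * Real.cos (κ + y) = Real.sin y * Real.cos y := by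
  rw [Real.sin_add, Real.cos_add, hκ]
  linear_combination Real.sin y * Real.cos y * cos_sq_of_sin_eq_zero hκ

lemma integral_congr_pos {f g : ℝ → ℝ} (h : ∀ x, 0 < x → f x = g x) {r : ℝ} (hr : 0 ≤ r) :
    ∫ x in (0 : ℝ)..r, f x = ∫ x in (0 : ℝ)..r, g x := by
  refine intervalIntegral.integral_congr_ae (Filter.Eventually.of_forall fun x hx => ?_)
  rw [uIoc_of_le hr] at hx
  exact h x hx.1

lemma avg_congr {f f' : ℝ → ℝ} (h : ∀ x, 0 < x → f x = f' x) {r : ℝ} (hr : 0 ≤ r) :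
    avg f r = avg f' r := by
  unfold avg
  rw [integral_congr_pos h hr]

include hκ in
lemma metricG_eq {f : ℝ → ℝ} (hf : ∀ x, 0 < x → f x = profile κ s x) (hr : 0 ≤ r) :
    metricG α f r = lapse α κ s r := by
  unfold metricG lapse
  congr 2
  refine MeasureTheory.setIntegral_congr_fun measurableSet_Ioi fun x hx => ?_
  have hx0 : 0 < x := lt_of_le_of_lt hr hx
  have h1 := sq_root x (ang κ s x)
  rw [avg_congr hf hx0.le, avg_profile κ s hx0, hf x hx0, profile_of_pos κ s hx0, sin_sq_add hκ,
    ← root_mul_slope κ s hx0, mul_pow, h1]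
  field_simp
  ring

lemma intervalIntegrable_lapse (κ : ℝ) (hr : 0 < r) :
    IntervalIntegrable (lapse α κ s) MeasureTheory.volume 0 r := by
  have h := ((Weighted.energy κ).integral (l' := 0) le_rfl
    (Or.inl ⟨by norm_num, rfl⟩)).continuous_extZero (by norm_num) s
  have hc : Continuous fun x => Real.exp (-α * ((∫ x in Ioi 0, Q κ s x ^ 2 / x)
      - extZero (fun r => ∫ x in (0 : ℝ)..r, Q κ s x ^ 2 / x) x)) := by fun_prop
  refine (hc.intervalIntegrable 0 r).congr fun x hx => ?_
  rw [uIoc_of_le hr.le] at hx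
  rw [extZero_of_pos hx.1, lapse, Weighted.integral_Ioi_energy κ s hx.1.le]

/-- Integration by parts for the average of `g`, with `∂ᵣ g = α g Q² / r`. -/
lemma integral_lapse (κ : ℝ) (hr : 0 < r) : ∫ x in (0 : ℝ)..r, lapse α κ s x =
    r * lapse α κ s r - α * ∫ x in (0 : ℝ)..r, lapse α κ s x * Q κ s x ^ 2 := by
  have hi1 := intervalIntegrable_lapse α s κ hr
  have hi2 := ((Weighted.lapse α κ).mul ((Weighted.Q κ).pow 2)).intervalIntegrable (by norm_num)
    (fun _ _ _ => rfl) s 0 r le_rfl hr.le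
  have h0 : Tendsto (fun x => x * lapse α κ s x) (𝓝[>] 0) (𝓝 (0 * lapse α κ s 0)) :=
    (tendsto_id.mono_left nhdsWithin_le_nhds).mul (tendsto_lapse α κ s)
  have h := intervalIntegral.integral_eq_sub_of_hasDerivAt_of_tendsto (f := fun x => x * lapse α κ s x)
    (f' := fun x => lapse α κ s x + α * (lapse α κ s x * Q κ s x ^ 2)) hr (fun x hx => ?_)
    (hi1.add (hi2.const_mul α)) h0 (b := r) (fb := r * lapse α κ s r)
    ((continuousAt_id.mul (continuousAt_lapse α κ s hr)).tendsto.mono_left nhdsWithin_le_nhds)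
  · rw [intervalIntegral.integral_add hi1 (hi2.const_mul α), intervalIntegral.integral_const_mul] at h
    linarith
  · refine ((hasDerivAt_id x).mul (hasDerivAt_lapse α κ s hx.1)).congr_deriv ?_
    have := hx.1.ne'
    rw [dLapse]
    simp only [id]
    field_simp

include hκ in
lemma metricGTilde_eq {f : ℝ → ℝ} (hf : ∀ x, 0 < x → f x = profile κ s x) (hr : 0 < r) :
    metricGTilde α f r = lapseT α κ s r := by
  have h1 : avg (metricG α f) r = avg (lapse α κ s) r :=
    avg_congr (fun x hx => metricG_eq α hκ s hf hx.le) hr.le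
  have h2 : ∫ x in (0 : ℝ)..r, x ^ 2 * metricG α f x * skyrmePotential f x =
      mass α κ s r - ∫ x in (0 : ℝ)..r, lapse α κ s x * Q κ s x ^ 2 := by
    rw [mass, ← intervalIntegral.integral_sub
      ((Weighted.massDensity α hκ).intervalIntegrable (by norm_num) (fun _ _ _ => rfl) s 0 r le_rfl hr.le)
      (((Weighted.lapse α κ).mul ((Weighted.Q κ).pow 2)).intervalIntegrable (by norm_num)
        (fun _ _ _ => rfl) s 0 r le_rfl hr.le)]
    refine intervalIntegral.integral_congr_ae (Filter.Eventually.of_forall fun x hx => ?_)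
    rw [uIoc_of_le hr.le] at hx
    have hx0 := hx.1
    rw [metricG_eq α hκ s hf hx0.le, skyrmePotential, avg_congr hf hx0.le, avg_profile κ s hx0,
      show Real.sin (κ + ang κ s x) ^ 4 = (Real.sin (κ + ang κ s x) ^ 2) ^ 2 by ring, sin_sq_add hκ,
      massDensity]
    field_simp
    ring
  rw [metricGTilde, h1, h2, avg, integral_lapse α s κ hr, lapseT]
  field_simp
  ring

end metric

section equation
variable {α κ : ℝ} (hκ : Real.sin κ = 0) {u₀ : ℝ} {s : ℝ → State} {h : ℝ → ℝ → ℝ}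
  {u r au qu : ℝ}
include hκ

/-- The reduced equation is the transport equation of `W`: with `au` and `qu` the `u`-derivatives of
the angle and of its slope, the last factor is `∂ᵤ W` minus the value `evolW` demanded by
`D W = source`. -/
lemma mul_dynamicalExpr (hu₀ : 0 < u₀)
    (hh : ∀ v ∈ Icc (0 : ℝ) u₀, ∀ r, 0 < r → h v r = profile κ (s v) r)
    (hu : u ∈ Icc (0 : ℝ) u₀) (hr : 0 < r)
    (ha : HasDerivWithinAt (fun v => ang κ (s v) r) au (Icc 0 u₀) u)
    (hq : HasDerivWithinAt (fun v => slope κ (s v) r) qu (Icc 0 u₀) u) :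
    r * dynamicalExpr α u₀ h u r = root r (ang κ (s u) r) *
      (ker1 r (ang κ (s u) r) * au + root r (ang κ (s u) r) * qu
        + 2 * Real.sin (ang κ (s u) r) * Real.cos (ang κ (s u) r) / root r (ang κ (s u) r) * au
          * slope κ (s u) r - evolW α κ (s u) r) := by
  have hud := (uniqueDiffOn_Icc hu₀) u hu
  have hrd := (uniqueDiffOn_Ici (0:ℝ)) r hr.le
  have hm : ∀ v ∈ Icc 0 u₀, ∀ x, 0 < x → avg (h v) x = κ + ang κ (s v) x := fun v hv x hx => by
    rw [avg_congr (hh v hv) hx.le, avg_profile κ _ hx]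
  have hev : ∀ᶠ x in 𝓝[Ici 0] r, 0 < x :=
    mem_nhdsWithin_of_mem_nhds (Ioi_mem_nhds hr)
  have ha' := ha.const_add κ
  have har := ((hasDerivAt_ang κ (s u) hr).const_add κ).hasDerivWithinAt (s := Ici 0)
  -- the partial derivatives that enter the equation
  have e1 : partialU u₀ h u r = au + r * qu :=
    ((ha'.add (hq.const_mul r)).congr (fun v hv => by
      rw [hh v hv r hr, profile_of_pos κ _ hr]; rfl) (by
      rw [hh u hu r hr, profile_of_pos κ _ hr]; rfl)).derivWithin hud
  have e2 : partialR h u r = 2 * slope κ (s u) r + r * dSlope κ (s u) r :=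
    ((hasDerivAt_profile κ (s u) hr).hasDerivWithinAt.congr_of_eventuallyEq (by
      filter_upwards [hev] with x hx using hh u hu x hx) (hh u hu r hr)).derivWithin hrd
  set m := κ + ang κ (s u) r with hmdef
  have e3 : partialU u₀ (fun v x => Real.sin (avg (h v) x) / x) u r = Real.cos m * au / r :=
    ((ha'.sin.div_const r).congr (fun v hv => by beta_reduce; rw [hm v hv r hr]) (by
      beta_reduce; rw [hm u hu r hr])).derivWithin hud
  have e4 : partialR (fun v x => Real.sin (avg (h v) x) / x) u r =
      (Real.cos m * slope κ (s u) r * r - Real.sin m) / r ^ 2 := by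
    have := (har.sin.div (hasDerivWithinAt_id r (Ici 0)) hr.ne').congr_of_eventuallyEq
      (f₁ := fun x => Real.sin (avg (h u) x) / x) (by
        filter_upwards [hev] with x hx using by rw [hm u hu x hx]; rfl) (by rw [hm u hu r hr]; rfl)
    rw [partialR, this.derivWithin hrd]
    simp only [id, mul_one]; rfl
  have e5 : partialU u₀ (fun v x => Real.sin (avg (h v) x) * (avg (h v) x / x)) u r =
      Real.cos m * au * (m / r) + Real.sin m * (au / r) :=
    ((ha'.sin.mul (ha'.div_const r)).congr (fun v hv => by beta_reduce; rw [hm v hv r hr]; rfl) (by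
      beta_reduce; rw [hm u hu r hr]; rfl)).derivWithin hud
  have e6 : partialR (fun v x => Real.sin (avg (h v) x) * (avg (h v) x / x)) u r =
      Real.cos m * slope κ (s u) r * (m / r)
        + Real.sin m * ((slope κ (s u) r * r - m) / r ^ 2) := by
    have := (har.sin.mul (har.div (hasDerivWithinAt_id r (Ici 0)) hr.ne')).congr_of_eventuallyEq
      (f₁ := fun x => Real.sin (avg (h u) x) * (avg (h u) x / x)) (by
        filter_upwards [hev] with x hx using by rw [hm u hu x hx]; rfl) (by rw [hm u hu r hr]; rfl)
    rw [partialR, this.derivWithin hrd]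
    simp only [id, mul_one]; rfl
  have hS := sin_sq_add hκ (ang κ (s u) r)
  have hSC := sin_mul_cos_add hκ (ang κ (s u) r)
  rw [← hmdef] at hS hSC
  have hR := sq_root r (ang κ (s u) r)
  have hR0 := root_pos hr (ang κ (s u) r)
  have hkey := theta_div_add_intK hr (ang κ (s u) r)
  rw [theta_ang κ (s u) hr] at hkey
  have hh1 : h u r = m + r * slope κ (s u) r := by rw [hh u hu r hr, profile_of_pos κ _ hr]
  have hQ := root_mul_slope κ (s u) hr
  -- the right-hand side in polynomial form
  have hrhs : root r (ang κ (s u) r) *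
      (ker1 r (ang κ (s u) r) * au + root r (ang κ (s u) r) * qu
        + 2 * Real.sin (ang κ (s u) r) * Real.cos (ang κ (s u) r) / root r (ang κ (s u) r) * au
          * slope κ (s u) r - evolW α κ (s u) r) =
      r * au + (r ^ 2 + 2 * Real.sin m ^ 2) * qu + 2 * (Real.sin m * Real.cos m) * au * slope κ (s u) r
      - 1 / 2 * lapseT α κ (s u) r * (2 * r * slope κ (s u) r
        + 2 * (Real.sin m * Real.cos m) * slope κ (s u) r ^ 2
        + (r ^ 2 + 2 * Real.sin m ^ 2) * dSlope κ (s u) r)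
      - 1 / 2 * dLapseT α κ (s u) r * (r ^ 2 + 2 * Real.sin m ^ 2) * slope κ (s u) r
      + lapse α κ (s u) r * (Real.sin m * Real.cos m) * (1 + Real.sin m ^ 2 / r ^ 2) := by
    rw [hSC, hS, ← hR, evolW, source, hkey]
    have hdW : dW κ (s u) r = dQ κ (s u) r + theta2 r (ang κ (s u) r)
        + slope κ (s u) r * ker1 r (ang κ (s u) r) := by rw [dQ]; ring
    have hdS : dQ κ (s u) r = root r (ang κ (s u) r) * dSlope κ (s u) r
        + Q κ (s u) r * (r + 2 * Real.sin (ang κ (s u) r) * Real.cos (ang κ (s u) r)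
          * slope κ (s u) r) / root r (ang κ (s u) r) ^ 2 := by
      rw [dSlope]; field_simp; ring
    rw [hdW, hdS, ← hQ, ker1, lapseT]
    field_simp
    ring
  rw [hrhs]
  unfold dynamicalExpr opD
  simp only []
  rw [e1, e2, e3, e4, e5, e6, hm u hu r hr, hh1, metricG_eq α hκ (s u) (hh u hu) hr.le,
    metricGTilde_eq α hκ (s u) (hh u hu) hr, skyrmePotential, hm u hu r hr, ← hmdef]
  have hd : dLapseT α κ (s u) r = (lapse α κ (s u) r - lapseT α κ (s u) r) / r
      - α * lapse α κ (s u) r * (2 * Real.sin m ^ 2 / r + (Real.sin m ^ 2) ^ 2 / r ^ 3) := by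
    rw [hS, dLapseT, lapseT, pot]; field_simp; ring
  rw [hd]
  field_simp
  ring

end equation

lemma IsEvolution.dynamicalExpr_eq_zero {α κ : ℝ} {hκ : Real.sin κ = 0} {u₀ : ℝ} {s : ℝ → State}
    (h : IsEvolution α hκ u₀ s) (hu₀ : 0 < u₀) {u r : ℝ} (hu : u ∈ Icc (0 : ℝ) u₀) (hr : 0 < r) :
    dynamicalExpr α u₀ (fun u r => profile κ (s u) r) u r = 0 := by
  have h1 := mul_dynamicalExpr (α := α) (h := fun u r => profile κ (s u) r) hκ hu₀ (fun _ _ _ _ => rfl) hu hr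
    (h.hasDerivWithinAt_ang hu hr) (h.hasDerivWithinAt_slope hu hr)
  have hR0 := root_pos hr (ang κ (s u) r)
  have h2 : ker1 r (ang κ (s u) r) * evolAng α κ (s u) r
        + root r (ang κ (s u) r) * evolSlope α κ (s u) r
        + 2 * Real.sin (ang κ (s u) r) * Real.cos (ang κ (s u) r) / root r (ang κ (s u) r)
          * evolAng α κ (s u) r * slope κ (s u) r - evolW α κ (s u) r = 0 := by
    rw [evolSlope, State.slope]
    field_simp
    ring
  rw [h2, mul_zero] at h1
  exact (mul_eq_zero.1 h1).resolve_left hr.ne'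

end

/-! ### States of given profiles -/

section

open State

/-- A jointly continuous family of functions with a common majorant vanishing at infinity is continuous
in the supremum norm. -/
lemma continuous_ofNormedAddCommGroup {U : Type*} [TopologicalSpace U] {F : U → ℝ → ℝ}
    (hF : Continuous fun p : U × ℝ => F p.1 p.2) {g : ℝ → ℝ} (hg : Tendsto g (cocompact ℝ) (𝓝 0))
    (hb : ∀ u x, |F u x| ≤ g x) (E : U → ℝ →ᵇ ℝ) (hE : ∀ u x, E u x = F u x) : Continuous E := by
  rw [continuous_iff_continuousAt]
  intro u
  rw [ContinuousAt, Metric.tendsto_nhds]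
  intro ε hε
  have h1 : ∀ᶠ x in cocompact ℝ, g x < ε / 4 := hg.eventually (gt_mem_nhds (by positivity))
  obtain ⟨K, hK, hKg⟩ := mem_cocompact.1 h1
  let G : C(U × ℝ, ℝ) := ⟨fun p => F p.1 p.2, hF⟩
  have h2 := ContinuousMap.tendsto_iff_forall_isCompact_tendstoUniformlyOn.1
    (G.curry.continuous.tendsto u) K hK
  have h3 := Metric.tendstoUniformlyOn_iff.1 h2 (ε / 2) (by positivity)
  filter_upwards [h3] with v hv
  refine lt_of_le_of_lt ((BoundedContinuousFunction.dist_le (by positivity)).2 fun x => ?_)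
    (half_lt_self hε)
  rw [hE, hE]
  by_cases hx : x ∈ K
  · have := hv x hx
    rw [dist_comm] at this
    exact this.le
  · have h4 : g x < ε / 4 := hKg hx
    have := hb u x
    have := hb v x
    rw [Real.dist_eq]
    have := abs_sub (F v x) (F u x)
    linarith

lemma tendsto_inv_sqrt_cocompact (C : ℝ) :
    Tendsto (fun x : ℝ => C * (√(1 + |x|))⁻¹) (cocompact ℝ) (𝓝 0) := by
  have h1 : Tendsto (fun x : ℝ => |x|) (cocompact ℝ) atTop := tendsto_norm_cocompact_atTop
  have h2 := (tendsto_inv_atTop_zero.comp (Real.tendsto_sqrt_atTop.comp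
    (tendsto_atTop_add_const_left _ 1 h1))).const_mul C
  simpa [Function.comp_def] using h2

section profile
variable {U : Type*} [TopologicalSpace U]

/-- A family of profiles with common central value `κ` and uniform decay, `f'` being the radial
derivative.  Functions of the radius are defined on all of `ℝ`, but only `r ≥ 0` matters for `f`;
`f'` is to be continuous for all `r`. -/
structure IsProfileFamily (κ C : ℝ) (f f' : U → ℝ → ℝ) : Prop where
  continuous_deriv : Continuous fun p : U × ℝ => f' p.1 p.2
  continuousOn : ∀ u, ContinuousOn (f u) (Ici 0)
  center : ∀ u, f u 0 = κ
  deriv : ∀ u r, 0 < r → HasDerivAt (f u) (f' u r) r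
  bound : ∀ u r, 0 ≤ r → (1 + r) ^ 2 * |f u r| ≤ C
  bound_deriv : ∀ u r, 0 ≤ r → (1 + r) ^ 3 * |f' u r| ≤ C

/-- `(f - κ) / r`, as an average of `f'` that makes sense at the centre. -/
def meanSlope (f' : U → ℝ → ℝ) (u : U) (r : ℝ) : ℝ := ∫ τ in (0 : ℝ)..1, f' u (τ * r)
/-- `(avg f - κ) / r`. -/
def angRatio (f' : U → ℝ → ℝ) (u : U) (r : ℝ) : ℝ := ∫ τ in (0 : ℝ)..1, τ * meanSlope f' u (τ * r)
/-- The derivative `(f - avg f) / r` of `avg f`. -/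
def avgSlope (f' : U → ℝ → ℝ) (u : U) (r : ℝ) : ℝ := meanSlope f' u r - angRatio f' u r

/-- The field `Z` of a profile, in a form that is continuous at the centre. -/
def profileZ (f' : U → ℝ → ℝ) (u : U) (r : ℝ) : ℝ :=
  (∫ τ in (0 : ℝ)..(angRatio f' u r), 2 * (τ * Real.sinc (r * τ)) ^ 2 /
      √(1 + 2 * (τ * Real.sinc (r * τ)) ^ 2) ^ 3)
    + 2 * (∫ τ in (0 : ℝ)..(angRatio f' u r), (√(1 + 2 * (τ * Real.sinc (r * τ)) ^ 2))⁻¹)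
    + 2 * (avgSlope f' u r / √(1 + 2 * (angRatio f' u r * Real.sinc (r * angRatio f' u r)) ^ 2))
    + 2 * (angRatio f' u r * Real.sinc (r * angRatio f' u r) * Real.cos (r * angRatio f' u r)
      * avgSlope f' u r ^ 2 / √(1 + 2 * (angRatio f' u r * Real.sinc (r * angRatio f' u r)) ^ 2))
    + √(1 + 2 * (angRatio f' u r * Real.sinc (r * angRatio f' u r)) ^ 2) * f' u r

/-- The field `W` of a profile. -/
def profileW (f' : U → ℝ → ℝ) (u : U) (r : ℝ) : ℝ :=
  theta1 r (r * angRatio f' u r) + root r (r * angRatio f' u r) * avgSlope f' u r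

namespace IsProfileFamily
variable {κ C : ℝ} {f f' : U → ℝ → ℝ} (h : IsProfileFamily κ C f f')
include h

lemma continuous_meanSlope : Continuous fun p : U × ℝ => meanSlope f' p.1 p.2 :=
  intervalIntegral.continuous_parametric_intervalIntegral_of_continuous' (a₀ := 0) (b₀ := 1)
    (μ := MeasureTheory.volume) (f := fun (p : U × ℝ) t => f' p.1 (t * p.2))
    (h.continuous_deriv.comp (f := fun q : (U × ℝ) × ℝ => (q.1.1, q.2 * q.1.2)) (by fun_prop))

lemma continuous_angRatio : Continuous fun p : U × ℝ => angRatio f' p.1 p.2 :=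
  intervalIntegral.continuous_parametric_intervalIntegral_of_continuous' (a₀ := 0) (b₀ := 1)
    (μ := MeasureTheory.volume) (f := fun (p : U × ℝ) t => t * meanSlope f' p.1 (t * p.2))
    (continuous_snd.mul
      (h.continuous_meanSlope.comp (f := fun q : (U × ℝ) × ℝ => (q.1.1, q.2 * q.1.2)) (by fun_prop)))

lemma continuous_avgSlope : Continuous fun p : U × ℝ => avgSlope f' p.1 p.2 :=
  h.continuous_meanSlope.sub h.continuous_angRatio

lemma continuous_profileZ : Continuous fun p : U × ℝ => profileZ f' p.1 p.2 := by
  have h1 := h.continuous_angRatio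
  have h2 := h.continuous_avgSlope
  have h3 := h.continuous_deriv
  have hm : Continuous fun p : U × ℝ => (p.2, angRatio f' p.1 p.2) := continuous_snd.prodMk h1
  have h4 := (continuous_rescaled_integral (φ := fun m => 2 * m ^ 2 / √(1 + 2 * m ^ 2) ^ 3)
    (Continuous.div (by fun_prop) (by fun_prop) fun m => by positivity)).comp hm
  have h5 := (continuous_rescaled_integral (φ := fun m => (√(1 + 2 * m ^ 2))⁻¹)
    (Continuous.inv₀ (by fun_prop) fun m => by positivity)).comp hm
  have h6 : Continuous fun p : U × ℝ => angRatio f' p.1 p.2 * Real.sinc (p.2 * angRatio f' p.1 p.2) :=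
    h1.mul (Real.continuous_sinc.comp (continuous_snd.mul h1))
  have h7 : Continuous fun p : U × ℝ =>
      √(1 + 2 * (angRatio f' p.1 p.2 * Real.sinc (p.2 * angRatio f' p.1 p.2)) ^ 2) := by fun_prop
  have h8 : ∀ p : U × ℝ,
      √(1 + 2 * (angRatio f' p.1 p.2 * Real.sinc (p.2 * angRatio f' p.1 p.2)) ^ 2) ≠ 0 :=
    fun p => by positivity
  exact (((h4.add (h5.const_mul 2)).add ((h2.div h7 h8).const_mul 2)).add
    ((((h6.mul (Real.continuous_cos.comp (continuous_snd.mul h1))).mul (h2.pow 2)).div h7 h8).const_mul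
      2)).add (h7.mul h3)

lemma eq_add (u : U) {r : ℝ} (hr : 0 ≤ r) : f u r = κ + r * meanSlope f' u r := by
  have h1 := intervalIntegral.integral_eq_sub_of_hasDerivAt_of_le hr
    ((h.continuousOn u).mono Icc_subset_Ici_self) (fun x hx => h.deriv u x hx.1)
    ((h.continuous_deriv.comp (f := fun x : ℝ => (u, x)) (by fun_prop)).intervalIntegrable 0 r)
  rw [integral_eq_mul_average, h.center] at h1
  rw [meanSlope]; linarith

lemma avg_eq (u : U) {r : ℝ} (hr : 0 < r) : avg (f u) r = κ + r * angRatio f' u r := by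
  have h1 : ∫ x in (0 : ℝ)..r, f u x = ∫ x in (0 : ℝ)..r, (κ + x * meanSlope f' u x) := by
    refine intervalIntegral.integral_congr fun x hx => ?_
    rw [uIcc_of_le hr.le] at hx
    exact h.eq_add u hx.1
  have hc : Continuous fun x => x * meanSlope f' u x :=
    continuous_id.mul (h.continuous_meanSlope.comp (f := fun x : ℝ => (u, x)) (by fun_prop))
  rw [avg, h1, intervalIntegral.integral_add intervalIntegrable_const (hc.intervalIntegrable _ _),
    integral_eq_mul_average (fun x => x * meanSlope f' u x)]
  have e : ∀ t, t * r * meanSlope f' u (t * r) = r * (t * meanSlope f' u (t * r)) := fun t => by ring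
  simp only [e]
  rw [intervalIntegral.integral_const_mul]
  simp only [intervalIntegral.integral_const, smul_eq_mul, sub_zero, angRatio]
  field_simp

lemma hasDerivAt_ang (u : U) {r : ℝ} (hr : 0 < r) :
    HasDerivAt (fun r => r * angRatio f' u r) (avgSlope f' u r) r := by
  have hc : Continuous fun x => κ + x * meanSlope f' u x :=
    continuous_const.add (continuous_id.mul
      (h.continuous_meanSlope.comp (f := fun x : ℝ => (u, x)) (by fun_prop)))
  have h1 := (hc.integral_hasStrictDerivAt 0 r).hasDerivAt
  have h2 := (h1.div (hasDerivAt_id r) hr.ne').sub_const κ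
  have hint : ∀ x, 0 < x → ∫ y in (0:ℝ)..x, (κ + y * meanSlope f' u y) = x * (κ + x * angRatio f' u x) := by
    intro x hx
    have h3 := h.avg_eq u hx
    rw [avg] at h3
    have h4 : ∫ y in (0 : ℝ)..x, f u y = ∫ y in (0 : ℝ)..x, (κ + y * meanSlope f' u y) := by
      refine intervalIntegral.integral_congr fun y hy => ?_
      rw [uIcc_of_le hx.le] at hy
      exact h.eq_add u hy.1
    rw [← h4, ← h3]; field_simp
  refine (h2.congr_of_eventuallyEq ?_).congr_deriv ?_
  · filter_upwards [Ioi_mem_nhds hr] with x hx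
    have hx0 : (0:ℝ) < x := hx
    simp only [Pi.div_apply, id]
    rw [hint x hx]
    field_simp
    ring
  · simp only [id]
    rw [hint r hr, avgSlope]
    field_simp
    ring

lemma hasDerivAt_avgSlope (u : U) {r : ℝ} (hr : 0 < r) :
    HasDerivAt (avgSlope f' u) ((f' u r - 2 * avgSlope f' u r) / r) r := by
  have h1 := (((h.deriv u r hr).sub_const κ).sub (h.hasDerivAt_ang u hr)).div (hasDerivAt_id r) hr.ne'
  refine (h1.congr_of_eventuallyEq ?_).congr_deriv ?_
  · filter_upwards [Ioi_mem_nhds hr] with x hx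
    have hx0 : (0:ℝ) < x := hx
    simp only [Pi.div_apply, Pi.sub_apply, id]
    rw [h.eq_add u hx0.le, avgSlope]
    field_simp
    ring
  · simp only [id]
    rw [Pi.sub_apply, h.eq_add u hr.le]
    simp only [avgSlope]
    field_simp
    ring

omit h [TopologicalSpace U] in
lemma sqrt_sinRatio {r : ℝ} (hr : 0 < r) (b : ℝ) :
    √(1 + 2 * (b * Real.sinc (r * b)) ^ 2) = root r (r * b) / r := by
  rw [root_mul hr]; field_simp

omit h [TopologicalSpace U] in
lemma profileZ_eq (f' : U → ℝ → ℝ) (u : U) {r : ℝ} (hr : 0 < r) : profileZ f' u r =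
    theta2 r (r * angRatio f' u r) + 2 * theta1 r (r * angRatio f' u r) / r
    + 2 * r * avgSlope f' u r / root r (r * angRatio f' u r)
    + 2 * Real.sin (r * angRatio f' u r) * Real.cos (r * angRatio f' u r) * avgSlope f' u r ^ 2
      / root r (r * angRatio f' u r)
    + root r (r * angRatio f' u r) * f' u r / r := by
  have h1 := theta1_div hr (r * angRatio f' u r)
  have h2 := theta2_eq hr (r * angRatio f' u r)
  rw [mul_div_cancel_left₀ _ hr.ne'] at h1 h2
  rw [profileZ, ← h1, ← h2, sqrt_sinRatio hr, sin_eq_mul_sinc (r * angRatio f' u r)]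
  have := root_pos hr (r * angRatio f' u r)
  field_simp

lemma hasDerivAt_sq_profileW (u : U) {r : ℝ} (hr : 0 < r) :
    HasDerivAt (fun r => r ^ 2 * profileW f' u r) (r ^ 2 * profileZ f' u r) r := by
  have ha := h.hasDerivAt_ang u hr
  have h1 := hasDerivWithinAt_theta1 (s := univ) (ρ := id) hr (hasDerivAt_id r).hasDerivWithinAt
    ha.hasDerivWithinAt
  rw [hasDerivWithinAt_univ] at h1
  have hp : (0:ℝ) < r ^ 2 + 2 * Real.sin (r * angRatio f' u r) ^ 2 := by positivity
  have h2 := (((hasDerivAt_id r).pow 2).add ((ha.sin.pow 2).const_mul 2)).sqrt (by simpa using hp.ne')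
  have h3 := ((hasDerivAt_id r).pow 2).mul (h1.add (h2.mul (h.hasDerivAt_avgSlope u hr)))
  refine HasDerivAt.congr_deriv (f := fun r => r ^ 2 * profileW f' u r) h3 ?_
  have h0 := root_pos hr (r * angRatio f' u r)
  have hsq := sq_root r (r * angRatio f' u r)
  simp only [Pi.add_apply, Pi.pow_apply, Pi.mul_apply, id, ker1]
  rw [profileZ_eq f' u hr]
  unfold root at h0 hsq ⊢
  set R := √(r ^ 2 + 2 * Real.sin (r * angRatio f' u r) ^ 2)
  field_simp
  push_cast
  ring

lemma exists_tendsto_profileW_div (u : U) :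
    ∃ c, Tendsto (fun r => profileW f' u r / r) (𝓝[>] 0) (𝓝 c) := by
  have h1 := h.continuous_angRatio
  have hm : Continuous fun r : ℝ => (r, angRatio f' u r) :=
    continuous_id.prodMk (h1.comp (f := fun r : ℝ => (u, r)) (by fun_prop))
  have h5 := (continuous_rescaled_integral (φ := fun m => (√(1 + 2 * m ^ 2))⁻¹)
    (Continuous.inv₀ (by fun_prop) fun m => by positivity)).comp hm
  have h6 : Continuous fun r : ℝ => angRatio f' u r * Real.sinc (r * angRatio f' u r) :=
    hm.snd.mul (Real.continuous_sinc.comp (hm.fst.mul hm.snd))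
  have h7 : Continuous fun r : ℝ =>
      √(1 + 2 * (angRatio f' u r * Real.sinc (r * angRatio f' u r)) ^ 2) := by fun_prop
  have h8 := h7.mul (h.continuous_avgSlope.comp (f := fun r : ℝ => (u, r)) (by fun_prop))
  refine ⟨_, (((h5.add h8).tendsto 0).mono_left nhdsWithin_le_nhds).congr' ?_⟩
  filter_upwards [self_mem_nhdsWithin] with r hr
  have hr0 : (0:ℝ) < r := hr
  have h1 := theta1_div hr0 (r * angRatio f' u r)
  rw [mul_div_cancel_left₀ _ hr0.ne'] at h1
  rw [profileW, add_div, h1, mul_div_right_comm, ← sqrt_sinRatio hr0]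
  rfl

lemma integral_sq_profileZ (u : U) {r : ℝ} (hr : 0 < r) :
    ∫ x in (0 : ℝ)..r, x ^ 2 * profileZ f' u x = r ^ 2 * profileW f' u r := by
  obtain ⟨c, hc⟩ := h.exists_tendsto_profileW_div u
  have h0 : Tendsto (fun r => r ^ 2 * profileW f' u r) (𝓝[>] 0) (𝓝 0) := by
    have h3 : Tendsto (fun r : ℝ => r ^ 3) (𝓝[>] 0) (𝓝 0) := by
      have : Continuous fun r : ℝ => r ^ 3 := by fun_prop
      simpa using (this.tendsto 0).mono_left nhdsWithin_le_nhds
    have h4 := h3.mul hc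
    rw [zero_mul] at h4
    refine h4.congr' ?_
    filter_upwards [self_mem_nhdsWithin] with r hr
    have hr0 : (0:ℝ) < r := hr
    field_simp
  have hc : Continuous fun x => x ^ 2 * profileZ f' u x :=
    (continuous_pow 2).mul (h.continuous_profileZ.comp (f := fun x : ℝ => (u, x)) (by fun_prop))
  rw [intervalIntegral.integral_eq_sub_of_hasDerivAt_of_tendsto hr
    (fun x hx => h.hasDerivAt_sq_profileW u hx.1) (hc.intervalIntegrable 0 r) h0
    ((h.hasDerivAt_sq_profileW u hr).continuousAt.tendsto.mono_left nhdsWithin_le_nhds), sub_zero]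

lemma hasDerivAt_theta_profile (u : U) {r : ℝ} (hr : 0 < r) :
    HasDerivAt (fun r => theta r (r * angRatio f' u r)) (profileW f' u r) r := by
  have h1 := hasDerivWithinAt_theta (s := univ) (ρ := id) hr (hasDerivAt_id r).hasDerivWithinAt
    (h.hasDerivAt_ang u hr).hasDerivWithinAt
  rw [hasDerivWithinAt_univ] at h1
  refine h1.congr_deriv ?_
  rw [profileW]; simp only [id]; ring

lemma tendsto_theta_profile (u : U) :
    Tendsto (fun r => theta r (r * angRatio f' u r)) (𝓝[>] 0) (𝓝 0) := by
  have h1 := h.continuous_angRatio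
  have hm : Continuous fun r : ℝ => (r, angRatio f' u r) :=
    continuous_id.prodMk (h1.comp (f := fun r : ℝ => (u, r)) (by fun_prop))
  have h2 := (continuous_rescaled_integral (φ := fun m => √(1 + 2 * m ^ 2)) (by fun_prop)).comp hm
  have h3 := (((continuous_pow 2).mul h2).tendsto 0).mono_left (nhdsWithin_le_nhds (s := Ioi (0:ℝ)))
  have e0 : ((fun r : ℝ => r ^ 2) * ((fun p : ℝ × ℝ => ∫ τ in (0 : ℝ)..p.2,
      √(1 + 2 * (τ * Real.sinc (p.1 * τ)) ^ 2)) ∘ fun r => (r, angRatio f' u r))) 0 = 0 := by simp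
  rw [e0] at h3
  refine h3.congr' ?_
  filter_upwards [self_mem_nhdsWithin] with r hr
  have hr0 : (0:ℝ) < r := hr
  have h1 := theta_div_sq hr0 (r * angRatio f' u r)
  rw [mul_div_cancel_left₀ _ hr0.ne'] at h1
  change r ^ 2 * (∫ τ in (0 : ℝ)..angRatio f' u r, √(1 + 2 * (τ * Real.sinc (r * τ)) ^ 2)) = _
  rw [← h1]; field_simp

end IsProfileFamily

lemma abs_theta1_sub_le {r : ℝ} (hr : 0 < r) (y : ℝ) : |theta1 r y - y| ≤ |y| / r ^ 2 := by
  have hc : Continuous (ker1 r) := continuousOn_ker1.comp_continuous (f := fun t : ℝ => (r, t))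
    (by fun_prop) fun t => ⟨hr, mem_univ _⟩
  have e : theta1 r y - y = ∫ t in (0:ℝ)..y, (ker1 r t - 1) := by
    rw [intervalIntegral.integral_sub (hc.intervalIntegrable _ _) intervalIntegrable_const, theta1]
    simp
  have h1 := intervalIntegral.norm_integral_le_of_norm_le_const (a := 0) (b := y) (C := 1 / r ^ 2)
    (f := fun t => ker1 r t - 1) fun t _ => ?_
  · rw [e]
    rw [sub_zero, Real.norm_eq_abs] at h1
    exact h1.trans_eq (by ring)
  · have h0 := root_pos hr t
    have h2 := sq_root r t
    have h3 := le_root (r := r) t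
    have h4 := Real.sin_sq_le_one t
    rw [ker1, Real.norm_eq_abs, abs_sub_comm, abs_of_nonneg (by
      rw [sub_nonneg, div_le_one h0]; exact h3), one_sub_div h0.ne', div_le_div_iff₀ h0 (by positivity)]
    have h5 : (root r t - r) * (root r t + r) = 2 * Real.sin t ^ 2 := by linarith [h2, sq_nonneg r]
    have h6 : (root r t - r) * (2 * r) ≤ 2 := by nlinarith
    have h7 : (root r t - r) * r ^ 2 ≤ r := by nlinarith
    linarith

lemma abs_theta2_le {r : ℝ} (hr : 0 < r) (y : ℝ) : |theta2 r y| ≤ 2 * |y| / r ^ 3 := by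
  have h1 := intervalIntegral.norm_integral_le_of_norm_le_const (a := 0) (b := y) (C := 2 / r ^ 3)
    (f := ker2 r) fun t _ => ?_
  · rw [sub_zero, Real.norm_eq_abs] at h1
    exact h1.trans_eq (by ring)
  · have h0 := root_pos hr t
    have h3 := le_root (r := r) t
    have h4 := Real.sin_sq_le_one t
    rw [ker2, Real.norm_eq_abs, abs_of_nonneg (by positivity)]
    gcongr
    linarith

lemma abs_refZ_add_le (κ : ℝ) {r : ℝ} (hr : 1 ≤ r) : |refZ κ r + 2 * κ / r| ≤ 100 * |κ| / r ^ 3 := by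
  have hr0 : 0 < r := by linarith
  have e : refZ κ r + 2 * κ / r = κ * ((2 + 10 * r + 20 * r ^ 2) / (r * (1 + r) ^ 5)) := by
    rw [refZ]; field_simp; ring
  have h3 : (2 + 10 * r + 20 * r ^ 2) / (r * (1 + r) ^ 5) ≤ 100 / r ^ 3 := by
    rw [div_le_div_iff₀ (by positivity) (by positivity)]
    have h1 : 2 + 10 * r + 20 * r ^ 2 ≤ 100 * r * (1 + r) ^ 2 := by nlinarith [pow_pos hr0 3]
    have h2 : r ^ 3 ≤ (1 + r) ^ 3 := by gcongr; linarith
    calc _ ≤ 100 * r * (1 + r) ^ 2 * (1 + r) ^ 3 := by gcongr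
      _ = _ := by ring
  rw [e, abs_mul, abs_of_pos (show 0 < (2 + 10 * r + 20 * r ^ 2) / (r * (1 + r) ^ 5) by positivity)]
  calc _ ≤ |κ| * (100 / r ^ 3) := by gcongr
    _ = _ := by ring

namespace IsProfileFamily
variable {κ C : ℝ} {f f' : U → ℝ → ℝ} (h : IsProfileFamily κ C f f')
include h

lemma bound_nonneg (u : U) : 0 ≤ C := by
  have := h.bound u 0 le_rfl
  exact le_trans (by positivity) this

/-- Pointwise decay of the quantities that determine `Z`. -/
lemma abs_le_of_one_le (u : U) {r : ℝ} (hr : 1 ≤ r) : |f u r| ≤ C / r ^ 2 ∧ |f' u r| ≤ C / r ^ 3 ∧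
    |r * angRatio f' u r| ≤ |κ| + C ∧ |avgSlope f' u r| ≤ 2 * C / r ^ 2 := by
  have hr0 : 0 < r := by linarith
  have hC := h.bound_nonneg u
  have a1 : |f u r| ≤ C / r ^ 2 := by
    rw [le_div_iff₀ (by positivity), mul_comm]
    refine le_trans ?_ (h.bound u r hr0.le)
    gcongr; linarith
  have a2 : |f' u r| ≤ C / r ^ 3 := by
    rw [le_div_iff₀ (by positivity), mul_comm]
    refine le_trans ?_ (h.bound_deriv u r hr0.le)
    gcongr; linarith
  have a3 : |∫ x in (0:ℝ)..r, f u x| ≤ C := by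
    have hG : ∀ x ∈ uIcc 0 r, HasDerivAt (fun x : ℝ => -C / (1 + x)) (C / (1 + x) ^ 2) x := by
      intro x hx
      rw [uIcc_of_le hr0.le] at hx
      have : 1 + x ≠ 0 := by linarith [hx.1]
      refine ((hasDerivAt_const x (-C)).div ((hasDerivAt_id x).const_add 1) this).congr_deriv ?_
      simp
    have hGi : IntervalIntegrable (fun x : ℝ => C / (1 + x) ^ 2) MeasureTheory.volume 0 r := by
      apply ContinuousOn.intervalIntegrable
      rw [uIcc_of_le hr0.le]
      refine ContinuousOn.div (by fun_prop) (by fun_prop) fun x hx => ?_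
      have := hx.1
      positivity
    have h1 := intervalIntegral.integral_eq_sub_of_hasDerivAt hG hGi
    have h2 := intervalIntegral.norm_integral_le_of_norm_le hr0.le (f := f u)
      (g := fun x => C / (1 + x) ^ 2) (Filter.Eventually.of_forall fun x hx => by
        have := hx.1
        rw [Real.norm_eq_abs, le_div_iff₀ (by positivity), mul_comm]
        exact h.bound u x this.le) hGi
    rw [h1, Real.norm_eq_abs] at h2
    refine h2.trans ?_
    have : 0 ≤ C / (1 + r) := by positivity
    rw [neg_div, neg_div]
    simp only [add_zero, div_one]
    linarith
  have a4 : |avg (f u) r| ≤ C / r := by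
    rw [avg, abs_mul, abs_of_pos (show 0 < 1 / r by positivity), one_div, ← div_eq_inv_mul]
    gcongr
  have a5 := h.avg_eq u hr0
  have hC1 : C / r ≤ C := div_le_self hC hr
  refine ⟨a1, a2, ?_, ?_⟩
  · rw [show r * angRatio f' u r = avg (f u) r - κ by rw [a5]; ring]
    have := abs_sub (avg (f u) r) κ
    linarith
  · have e : avgSlope f' u r = (f u r - avg (f u) r) / r := by
      rw [a5, h.eq_add u hr0.le, avgSlope]; field_simp; ring
    rw [e, abs_div, abs_of_pos hr0, div_le_iff₀ hr0]
    have b1 := abs_sub (f u r) (avg (f u) r)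
    have b2 : C / r ^ 2 ≤ C / r := by
      gcongr; nlinarith
    have b3 : 2 * C / r ^ 2 * r = 2 * (C / r) := by field_simp
    linarith

/-- The leading term of `Z` at infinity is `-2 κ / r`, as for the reference field, since the angle tends
to `-κ`. -/
lemma abs_profileZ_sub_le_of_one_le (u : U) {r : ℝ} (hr : 1 ≤ r) :
    |profileZ f' u r - refZ κ r| ≤ (104 * |κ| + 20 * C + 8 * C ^ 2) / r ^ 3 := by
  have hr0 : 0 < r := by linarith
  have hC := h.bound_nonneg u
  obtain ⟨b1, b2, b3, b4⟩ := h.abs_le_of_one_le u hr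
  set a := r * angRatio f' u r
  set q := avgSlope f' u r
  have hf : κ + a + r * q = f u r := by
    rw [h.eq_add u hr0.le]; simp only [a, q, avgSlope]; ring
  have h0 := root_pos hr0 a
  have h2 := sq_root r a
  have h3 := le_root (r := r) a
  have h4 := Real.sin_sq_le_one a
  have hR : root r a ≤ 2 * r := by
    rw [root]
    refine Real.sqrt_le_iff.2 ⟨by positivity, ?_⟩
    nlinarith
  have e : profileZ f' u r - refZ κ r = theta2 r a + 2 / r * (theta1 r a - a)
      + 2 * q * (r / root r a - 1) + 2 * (Real.sin a * Real.cos a) * q ^ 2 / root r a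
      + root r a / r * f' u r + 2 / r * f u r - (refZ κ r + 2 * κ / r) := by
    have eZ := profileZ_eq f' u hr0
    rw [eZ, ← hf]
    change theta2 r a + 2 * theta1 r a / r + 2 * r * q / root r a
      + 2 * Real.sin a * Real.cos a * q ^ 2 / root r a + root r a * f' u r / r - refZ κ r = _
    field_simp
    ring
  have t1 : |theta2 r a| ≤ 2 * (|κ| + C) / r ^ 3 := (abs_theta2_le hr0 a).trans (by gcongr)
  have t2 : |2 / r * (theta1 r a - a)| ≤ 2 * (|κ| + C) / r ^ 3 := by
    rw [abs_mul, abs_of_pos (show 0 < 2 / r by positivity)]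
    calc _ ≤ 2 / r * ((|κ| + C) / r ^ 2) := by
          gcongr
          exact (abs_theta1_sub_le hr0 a).trans (by gcongr)
      _ = _ := by field_simp
  have hle3 : ∀ n : ℕ, 3 ≤ n → (1:ℝ) / r ^ n ≤ 1 / r ^ 3 := fun n hn => by
    gcongr
  have t3 : |2 * q * (r / root r a - 1)| ≤ 4 * C / r ^ 3 := by
    have k1 : |r / root r a - 1| ≤ 1 / r := by
      rw [abs_sub_comm, abs_of_nonneg (by rw [sub_nonneg, div_le_one h0]; exact h3),
        one_sub_div h0.ne', div_le_div_iff₀ h0 hr0]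
      have h5 : (root r a - r) * (root r a + r) = 2 * Real.sin a ^ 2 := by linarith [h2, sq_nonneg r]
      nlinarith
    rw [abs_mul, abs_mul, abs_two]
    calc 2 * |q| * |r / root r a - 1| ≤ 2 * (2 * C / r ^ 2) * (1 / r) := by gcongr
      _ = _ := by field_simp; ring
  have t4 : |2 * (Real.sin a * Real.cos a) * q ^ 2 / root r a| ≤ 8 * C ^ 2 / r ^ 3 := by
    have k1 : |Real.sin a * Real.cos a| ≤ 1 := by
      rw [abs_mul]
      exact mul_le_one₀ (Real.abs_sin_le_one a) (abs_nonneg _) (Real.abs_cos_le_one a)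
    rw [abs_div, abs_of_pos h0, abs_mul, abs_mul, abs_two, abs_pow]
    calc 2 * |Real.sin a * Real.cos a| * |q| ^ 2 / root r a ≤ 2 * 1 * (2 * C / r ^ 2) ^ 2 / r := by
          gcongr
      _ = 8 * C ^ 2 * (1 / r ^ 5) := by field_simp; ring
      _ ≤ 8 * C ^ 2 * (1 / r ^ 3) := by gcongr ?_ * ?_; exact hle3 5 (by norm_num)
      _ = _ := by ring
  have t5 : |root r a / r * f' u r| ≤ 2 * C / r ^ 3 := by
    rw [abs_mul, abs_of_pos (show 0 < root r a / r by positivity)]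
    calc _ ≤ 2 * (C / r ^ 3) := by
          gcongr
          rw [div_le_iff₀ hr0]; exact hR
      _ = _ := by ring
  have t6 : |2 / r * f u r| ≤ 2 * C / r ^ 3 := by
    rw [abs_mul, abs_of_pos (show 0 < 2 / r by positivity)]
    calc _ ≤ 2 / r * (C / r ^ 2) := by gcongr
      _ = _ := by field_simp
  have t7 := abs_refZ_add_le κ hr
  rw [e]
  have n1 := abs_sub (theta2 r a + 2 / r * (theta1 r a - a)
      + 2 * q * (r / root r a - 1) + 2 * (Real.sin a * Real.cos a) * q ^ 2 / root r a
      + root r a / r * f' u r + 2 / r * f u r) (refZ κ r + 2 * κ / r)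
  have n2 := abs_add_le (theta2 r a + 2 / r * (theta1 r a - a)
      + 2 * q * (r / root r a - 1) + 2 * (Real.sin a * Real.cos a) * q ^ 2 / root r a
      + root r a / r * f' u r) (2 / r * f u r)
  have n3 := abs_add_le (theta2 r a + 2 / r * (theta1 r a - a)
      + 2 * q * (r / root r a - 1) + 2 * (Real.sin a * Real.cos a) * q ^ 2 / root r a) (root r a / r * f' u r)
  have n4 := abs_add_le (theta2 r a + 2 / r * (theta1 r a - a)
      + 2 * q * (r / root r a - 1)) (2 * (Real.sin a * Real.cos a) * q ^ 2 / root r a)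
  have n5 := abs_add_le (theta2 r a + 2 / r * (theta1 r a - a)) (2 * q * (r / root r a - 1))
  have n6 := abs_add_le (theta2 r a) (2 / r * (theta1 r a - a))
  have hsum : (104 * |κ| + 20 * C + 8 * C ^ 2) / r ^ 3 = 2 * (|κ| + C) / r ^ 3 + 2 * (|κ| + C) / r ^ 3
    + 4 * C / r ^ 3 + 8 * C ^ 2 / r ^ 3 + 2 * C / r ^ 3 + 2 * C / r ^ 3 + 100 * |κ| / r ^ 3
    + 8 * C / r ^ 3 := by ring
  have : 0 ≤ 8 * C / r ^ 3 := by positivity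
  rw [hsum]
  linarith

lemma abs_profileW_add_le_of_one_le (u : U) {r : ℝ} (hr : 1 ≤ r) :
    |profileW f' u r + κ| ≤ (|κ| + 4 * C) / r ^ 2 := by
  have hr0 : 0 < r := by linarith
  have hC := h.bound_nonneg u
  obtain ⟨b1, b2, b3, b4⟩ := h.abs_le_of_one_le u hr
  set a := r * angRatio f' u r
  set q := avgSlope f' u r
  have hf : κ + a + r * q = f u r := by
    rw [h.eq_add u hr0.le]; simp only [a, q, avgSlope]; ring
  have h2 := sq_root r a
  have h3 := le_root (r := r) a
  have h4 := Real.sin_sq_le_one a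
  have e : profileW f' u r + κ = (theta1 r a - a) + f u r + (root r a - r) * q := by
    rw [← hf, profileW]; ring
  have t1 : |theta1 r a - a| ≤ (|κ| + C) / r ^ 2 := (abs_theta1_sub_le hr0 a).trans (by gcongr)
  have t2 : |(root r a - r) * q| ≤ 2 * C / r ^ 2 := by
    rw [abs_mul, abs_of_nonneg (sub_nonneg.2 h3)]
    have h5 : (root r a - r) * (root r a + r) = 2 * Real.sin a ^ 2 := by linarith [h2, sq_nonneg r]
    have h6 : root r a - r ≤ 1 := by nlinarith
    calc (root r a - r) * |q| ≤ 1 * (2 * C / r ^ 2) := by gcongr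
      _ = _ := one_mul _
  rw [e]
  have n1 := abs_add_le ((theta1 r a - a) + f u r) ((root r a - r) * q)
  have n2 := abs_add_le (theta1 r a - a) (f u r)
  have hsum : (|κ| + 4 * C) / r ^ 2 = (|κ| + C) / r ^ 2 + C / r ^ 2 + 2 * C / r ^ 2 := by ring
  rw [hsum]; linarith

lemma exists_profileZ_sub_le [CompactSpace U] [Nonempty U] : ∃ D : ℝ, 0 ≤ D ∧ ∀ u r, 0 ≤ r →
    |profileZ f' u r - refZ κ r| ≤ D * (1 / (1 + r) ^ 3) := by
  have hc : ContinuousOn (fun p : U × ℝ => profileZ f' p.1 p.2 - refZ κ p.2) (univ ×ˢ Icc 0 1) := by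
    have hZ : ContinuousOn (refZ κ) (Icc 0 1) := fun r hr =>
      (hasDerivAt_refZ κ hr.1).continuousAt.continuousWithinAt
    exact h.continuous_profileZ.continuousOn.sub (hZ.comp continuousOn_snd fun p hp => hp.2)
  obtain ⟨M, hM⟩ := (isCompact_univ.prod isCompact_Icc).exists_bound_of_continuousOn hc
  set K := 104 * |κ| + 20 * C + 8 * C ^ 2
  have hK : 0 ≤ K := by
    have := h.bound_nonneg (Classical.arbitrary U)
    positivity
  have hM0 : 0 ≤ M := (norm_nonneg _).trans (hM (Classical.arbitrary U, 0) ⟨mem_univ _, by simp⟩)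
  refine ⟨8 * (K + M), by positivity, fun u r hr => ?_⟩
  have h8 : (1 + r) ^ 3 ≤ 8 * max 1 r ^ 3 := by
    have : 1 + r ≤ 2 * max 1 r := by linarith [le_max_left 1 r, le_max_right 1 r]
    calc (1 + r) ^ 3 ≤ (2 * max 1 r) ^ 3 := by gcongr
      _ = _ := by ring
  rcases le_total r 1 with h1 | h1
  · have := hM (u, r) ⟨mem_univ _, hr, h1⟩
    rw [max_eq_left h1] at h8
    rw [mul_one_div, le_div_iff₀ (by positivity)]
    simp only [Real.norm_eq_abs] at this
    calc _ ≤ M * (8 * 1 ^ 3) := by gcongr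
      _ ≤ _ := by linarith
  · have := h.abs_profileZ_sub_le_of_one_le u h1
    rw [max_eq_right h1] at h8
    have hr0 : 0 < r := by linarith
    rw [mul_one_div, le_div_iff₀ (by positivity)]
    calc _ ≤ K / r ^ 3 * (8 * r ^ 3) := by gcongr
      _ = 8 * K := by field_simp
      _ ≤ _ := by linarith

/-- The states of a compact family of profiles, with the trivial labels `rad x = x`.  The amplitudes at
negative labels play no role and are chosen by reflection. -/
lemma exists_state [CompactSpace U] [Nonempty U] : ∃ e : U → State, Continuous e ∧
    (∃ D : ℝ, 0 ≤ D ∧ ∀ u x, |(e u).2.2 x| ≤ D * (√(1 + |x|))⁻¹) ∧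
    ∀ u, (e u).1 = 0 ∧ (e u).2.1 = 0 ∧
      ∀ x, (e u).2.2 x = amp x * (profileZ f' u |x| - refZ κ |x|) := by
  obtain ⟨D, hD, H⟩ := h.exists_profileZ_sub_le
  have hZ : Continuous fun x : ℝ => refZ κ |x| := by
    rw [continuous_iff_continuousAt]
    exact fun x => ContinuousAt.comp (g := refZ κ) (hasDerivAt_refZ κ (abs_nonneg x)).continuousAt
      continuous_abs.continuousAt
  have hF : Continuous fun p : U × ℝ => amp p.2 * (profileZ f' p.1 |p.2| - refZ κ |p.2|) :=
    (continuous_amp.comp continuous_snd).mul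
      ((h.continuous_profileZ.comp (f := fun p : U × ℝ => (p.1, |p.2|)) (by fun_prop)).sub
        (hZ.comp continuous_snd))
  have hb : ∀ u x, |amp x * (profileZ f' u |x| - refZ κ |x|)| ≤ D * (√(1 + |x|))⁻¹ := by
    intro u x
    have h1 := H u |x| (abs_nonneg x)
    have h3 : 0 < √(1 + |x|) := by positivity
    have h2 : (1 + |x|) ^ 3 = √(1 + |x|) ^ 6 := by
      rw [show 6 = 2 * 3 by norm_num, pow_mul, Real.sq_sqrt (by positivity)]
    rw [h2] at h1
    rw [abs_mul, abs_of_pos (amp_pos x), amp]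
    calc _ ≤ √(1 + |x|) ^ 5 * (D * (1 / √(1 + |x|) ^ 6)) := by gcongr
      _ = _ := by field_simp
  have hb' : ∀ u x, |amp x * (profileZ f' u |x| - refZ κ |x|)| ≤ D := fun u x =>
    (hb u x).trans (mul_le_of_le_one_right hD (inv_le_one_of_one_le₀ (Real.one_le_sqrt.2
      (by linarith [abs_nonneg x]))))
  let E : U → ℝ →ᵇ ℝ := fun u => BoundedContinuousFunction.ofNormedAddCommGroup
    (fun x => amp x * (profileZ f' u |x| - refZ κ |x|))
    (hF.comp (f := fun x : ℝ => (u, x)) (by fun_prop)) D (fun x => hb' u x)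
  have hE : Continuous E := continuous_ofNormedAddCommGroup hF (tendsto_inv_sqrt_cocompact D) hb E
    fun _ _ => rfl
  exact ⟨fun u => (0, 0, E u), continuous_const.prodMk (continuous_const.prodMk hE),
    ⟨D, hD, fun u x => hb u x⟩, fun u => ⟨rfl, rfl, fun x => rfl⟩⟩

end IsProfileFamily
end profile

/-! ### States with trivial labels -/

section static
variable {s : State} (h1 : s.1 = 0) (h2 : s.2.1 = 0)
include h1 h2

lemma rad_of_static (x : ℝ) : rad s x = x := by
  simp [rad, jac, h1, h2]

lemma label_of_static (r : ℝ) : label s r = r := by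
  have := rad_label s r
  rwa [rad_of_static h1 h2] at this

variable {U : Type*} [TopologicalSpace U] {κ C : ℝ} {f f' : U → ℝ → ℝ} (h : IsProfileFamily κ C f f') {u : U}
  (hz : ∀ x, s.2.2 x = amp x * (profileZ f' u |x| - refZ κ |x|)) {r : ℝ}

include hz
omit [TopologicalSpace U] in
lemma Z_of_static (hr : 0 ≤ r) : Z κ s r = profileZ f' u r := by
  rw [Z, zeta, label_of_static h1 h2, hz, abs_of_nonneg hr, amp, abs_of_nonneg hr]
  have : 0 < √(1 + r) := by positivity
  field_simp
  ring

include h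
lemma W_of_static (hr : 0 < r) : W κ s r = profileW f' u r := by
  have : ∫ x in (0 : ℝ)..r, x ^ 2 * Z κ s x = ∫ x in (0 : ℝ)..r, x ^ 2 * profileZ f' u x := by
    refine intervalIntegral.integral_congr fun x hx => ?_
    rw [uIcc_of_le hr.le] at hx
    simp only [Z_of_static h1 h2 hz hx.1]
  rw [W, this, h.integral_sq_profileZ u hr]
  field_simp

lemma X_of_static (hr : 0 < r) : X κ s r = theta r (r * angRatio f' u r) := by
  rw [X, intervalIntegral.integral_eq_sub_of_hasDerivAt_of_tendsto hr
    (fun x hx => ?_) ((Weighted.W κ).intervalIntegrable le_rfl (fun _ _ _ => rfl) s 0 r le_rfl hr.le)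
    (h.tendsto_theta_profile u)
    ((h.hasDerivAt_theta_profile u hr).continuousAt.tendsto.mono_left nhdsWithin_le_nhds), sub_zero]
  rw [W_of_static h1 h2 h hz hx.1]
  exact h.hasDerivAt_theta_profile u hx.1

lemma ang_of_static (hr : 0 < r) : ang κ s r = r * angRatio f' u r := by
  rw [ang, X_of_static h1 h2 h hz hr, thetaInv_theta hr]

lemma slope_of_static (hr : 0 < r) : slope κ s r = avgSlope f' u r := by
  have := root_pos hr (r * angRatio f' u r)
  rw [State.slope, Q, W_of_static h1 h2 h hz hr, ang_of_static h1 h2 h hz hr, profileW]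
  field_simp
  ring

lemma profile_of_static (hr : 0 ≤ r) : profile κ s r = f u r := by
  rcases eq_or_lt_of_le hr with rfl | hr
  · rw [profile_zero, h.center]
  · rw [profile_of_pos κ s hr, ang_of_static h1 h2 h hz hr, slope_of_static h1 h2 h hz hr,
      h.eq_add u hr.le, avgSlope]
    ring

lemma exists_W_add_le_of_static : ∃ D : ℝ, 0 ≤ D ∧
    ∀ r, 0 < r → |W κ s r + κ| ≤ D * (1 / (1 + r) ^ 2) := by
  obtain ⟨M, hM0, hM⟩ := ((Weighted.W κ).mono (k' := 0) (by norm_num) le_rfl).add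
    ((Weighted.const κ)) |>.bound ‖s‖
  set K := |κ| + 4 * C
  have hK : 0 ≤ K := by
    have := h.bound_nonneg u
    positivity
  refine ⟨4 * (K + M), by positivity, fun r hr => ?_⟩
  have h8 : (1 + r) ^ 2 ≤ 4 * max 1 r ^ 2 := by
    have : 1 + r ≤ 2 * max 1 r := by linarith [le_max_left 1 r, le_max_right 1 r]
    calc (1 + r) ^ 2 ≤ (2 * max 1 r) ^ 2 := by gcongr
      _ = _ := by ring
  rw [mul_one_div, le_div_iff₀ (by positivity)]
  rcases le_total r 1 with h1r | h1r
  · have := hM s le_rfl r hr 0 (by simp)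
    rw [max_eq_left h1r] at h8
    rw [wt_zero_zero, mul_one] at this
    calc _ ≤ M * (4 * 1 ^ 2) := by gcongr
      _ ≤ _ := by linarith
  · have := h.abs_profileW_add_le_of_one_le u h1r
    rw [W_of_static h1 h2 h hz hr]
    rw [max_eq_right h1r] at h8
    calc _ ≤ K / r ^ 2 * (4 * r ^ 2) := by gcongr
      _ = 4 * K := by field_simp
      _ ≤ _ := by linarith

end static

end

/-! ### Transport of the labels -/

section

open State

/-- Labels at which the radius is positive are comparable with it. -/
lemma exists_extZero_wt_le (L : ℝ) : ∃ C : ℝ, 0 ≤ C ∧ ∀ s : State, ‖s‖ ≤ L → ∀ x : ℝ,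
    extZero (wt 0 1) (rad s x) ≤ C * (√(1 + |x|))⁻¹ := by
  refine ⟨√((1 + |L|) * Real.exp |L|), by positivity, fun s hs x => ?_⟩
  rcases lt_or_ge 0 (rad s x) with h | h
  · have h1 := one_add_abs_le (hs.trans (le_abs_self L)) h.le
    rw [extZero_of_pos h, wt, zpow_zero, one_mul, zpow_one, ← div_eq_mul_inv,
      le_div_iff₀ (by positivity), inv_mul_le_iff₀ (by positivity), mul_comm,
      ← Real.sqrt_mul (by positivity)]
    exact Real.sqrt_le_sqrt h1
  · rw [extZero_of_nonpos h]; positivity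

/-- The extension by zero of a function with `φ = O(r / (1 + r))` and `φ' = O(1 / (1 + r))` is
Lipschitz along the labels: a change of the state moves the label `x` by a multiple of `1 + |x|`,
which is comparable with `1 + r`. -/
lemma abs_extZero_rad_sub_le {φ φ' : ℝ → ℝ} {C L : ℝ} (hC : 0 ≤ C)
    (hd : ∀ r, 0 < r → HasDerivAt φ (φ' r) r)
    (hb : ∀ r, 0 < r → |φ r| ≤ C * (r / (1 + r))) (hb' : ∀ r, 0 < r → |φ' r| ≤ C * (1 / (1 + r)))
    {s₁ s₂ : State} (h₁ : ‖s₁‖ ≤ L) (h₂ : ‖s₂‖ ≤ L) (x : ℝ) :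
    |extZero φ (rad s₁ x) - extZero φ (rad s₂ x)| ≤
      C * (Real.exp L * ((1 + L) * Real.exp L)) * ‖s₁ - s₂‖ := by
  have hL : 0 ≤ L := (norm_nonneg _).trans h₁
  have key : ∀ s₁ s₂ : State, ‖s₁‖ ≤ L → ‖s₂‖ ≤ L → rad s₁ x ≤ rad s₂ x →
      |extZero φ (rad s₁ x) - extZero φ (rad s₂ x)| ≤
        C * (Real.exp L * ((1 + L) * Real.exp L)) * ‖s₁ - s₂‖ := by
    intro s₁ s₂ h₁ h₂ hle
    have hR := abs_rad_sub_le h₁ h₂ x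
    rw [abs_sub_comm, abs_of_nonneg (sub_nonneg.2 hle)] at hR
    have fin : ∀ c, 0 < c → 1 + |x| ≤ (1 + L) * Real.exp L * (1 + c) →
        C * ((rad s₂ x - rad s₁ x) / (1 + c)) ≤
          C * (Real.exp L * ((1 + L) * Real.exp L)) * ‖s₁ - s₂‖ := by
      intro c hc hxc
      rw [mul_assoc]
      refine mul_le_mul_of_nonneg_left ?_ hC
      rw [div_le_iff₀ (by positivity)]
      refine hR.trans ((mul_le_mul_of_nonneg_left hxc (by positivity)).trans_eq (by ring))
    rcases le_or_gt (rad s₂ x) 0 with hb0 | hb0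
    · rw [extZero_of_nonpos hb0, extZero_of_nonpos (hle.trans hb0), sub_zero, abs_zero]
      positivity
    rcases le_or_gt (rad s₁ x) 0 with ha0 | ha0
    · rw [extZero_of_nonpos ha0, extZero_of_pos hb0, zero_sub, abs_neg]
      refine (hb _ hb0).trans (le_trans ?_ (fin _ hb0 (one_add_abs_le h₂ hb0.le)))
      gcongr
      linarith
    · rw [extZero_of_pos ha0, extZero_of_pos hb0]
      refine le_trans ?_ (fin _ ha0 (one_add_abs_le h₁ ha0.le))
      have h := (convex_Icc (rad s₁ x) (rad s₂ x)).norm_image_sub_le_of_norm_hasDerivWithin_le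
        (f := φ) (C := C * (1 / (1 + rad s₁ x)))
        (fun r hr => (hd r (ha0.trans_le hr.1)).hasDerivWithinAt) (fun r hr => by
          refine (hb' r (ha0.trans_le hr.1)).trans ?_
          gcongr
          exact hr.1) (right_mem_Icc.2 hle) (left_mem_Icc.2 hle)
      rw [Real.norm_eq_abs, Real.norm_eq_abs, abs_sub_comm (rad s₁ x),
        abs_of_nonneg (sub_nonneg.2 hle)] at h
      exact h.trans_eq (by ring)
  rcases le_total (rad s₁ x) (rad s₂ x) with h | h
  · exact key s₁ s₂ h₁ h₂ h
  · rw [abs_sub_comm, norm_sub_rev]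
    exact key s₂ s₁ h₂ h₁ h

section transport
variable (α : ℝ) {κ : ℝ} (hκ : Real.sin κ = 0)

lemma continuous_lapse_zero (κ : ℝ) : Continuous fun s : State => lapse α κ s 0 := by
  refine continuous_iff_continuousAt.2 fun s => ?_
  obtain ⟨C, hC, -, H⟩ := lapse_zero_bounds α κ (‖s‖ + 1)
  refine continuousAt_of_locally_lipschitz zero_lt_one C fun t ht => ?_
  rw [dist_eq_norm] at ht
  rw [Real.dist_eq, dist_eq_norm]
  refine H t s ?_ (by linarith)
  have := norm_le_norm_add_norm_sub' t s
  linarith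

/-- The vector field that moves the labels of `s` along the characteristics of the metric
belonging to the state `t`. -/
def transport (α : ℝ) {κ : ℝ} (hκ : Real.sin κ = 0) (t s : State) : State :=
  (-(1 / 2) * lapse α κ t 0,
   BoundedContinuousFunction.ofNormedAddCommGroup
    (fun x => -(1 / 2) * extZero (dLapseT α κ t) (rad s x))
    (continuous_const.mul (((Weighted.dLapseT α hκ).continuous_extZero le_rfl t).comp
      (continuous_rad s)))
    (1 / 2 * ((Weighted.dLapseT α hκ).abs_extZero_le ‖t‖).choose) (fun x => by
      have h := ((Weighted.dLapseT α hκ).abs_extZero_le ‖t‖).choose_spec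
      rw [norm_mul, norm_neg, Real.norm_of_nonneg (by norm_num : (0:ℝ) ≤ 1 / 2)]
      gcongr
      exact (h.2 t le_rfl _).trans
        (mul_le_of_le_one_right h.1 (extZero_wt_le_one (by norm_num) (by norm_num) _))),
   0)

lemma transport_snd_fst (t s : State) (x : ℝ) :
    (transport α hκ t s).2.1 x = -(1 / 2) * extZero (dLapseT α κ t) (rad s x) := rfl

lemma exists_norm_transport_le (L : ℝ) : ∃ C : ℝ, 0 ≤ C ∧ ∀ t s : State, ‖t‖ ≤ L →
    ‖transport α hκ t s‖ ≤ C := by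
  obtain ⟨C₁, hC₁, H₁, -⟩ := lapse_zero_bounds α κ L
  obtain ⟨C₂, hC₂, H₂⟩ := (Weighted.dLapseT α hκ).abs_extZero_le L
  refine ⟨C₁ + C₂, by positivity, fun t s ht => norm_prod_le_iff.2 ⟨?_, norm_prod_le_iff.2 ⟨?_, ?_⟩⟩⟩
  · have := H₁ t ht
    rw [transport, Real.norm_eq_abs, abs_mul]
    norm_num
    linarith [abs_nonneg (lapse α κ t 0)]
  · refine (BoundedContinuousFunction.norm_le (by positivity)).2 fun x => ?_
    have h := (H₂ t ht (rad s x)).trans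
      (mul_le_of_le_one_right hC₂ (extZero_wt_le_one (by norm_num) (by norm_num) _))
    rw [transport_snd_fst, Real.norm_eq_abs, abs_mul]
    norm_num
    linarith [abs_nonneg (extZero (dLapseT α κ t) (rad s x))]
  · simp only [transport, norm_zero]; positivity

lemma exists_norm_transport_sub_le (L : ℝ) : ∃ C : ℝ, 0 ≤ C ∧ ∀ t s₁ s₂ : State, ‖t‖ ≤ L →
    ‖s₁‖ ≤ L → ‖s₂‖ ≤ L → ‖transport α hκ t s₁ - transport α hκ t s₂‖ ≤ C * ‖s₁ - s₂‖ := by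
  obtain ⟨C₁, hC₁, H₁⟩ := (Weighted.dLapseT α hκ).bound L
  obtain ⟨C₂, hC₂, H₂⟩ := (Weighted.d2LapseT α hκ).bound L
  set C := C₁ + C₂
  have hC : 0 ≤ C := by positivity
  have hL : L ≤ |L| := le_abs_self L
  set M := C * (Real.exp |L| * ((1 + |L|) * Real.exp |L|))
  have hM : 0 ≤ M := by positivity
  refine ⟨M, hM, fun t s₁ s₂ ht h₁ h₂ => ?_⟩
  have hn := norm_nonneg (s₁ - s₂)
  refine norm_prod_le_iff.2 ⟨?_, norm_prod_le_iff.2 ⟨?_, ?_⟩⟩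
  · simp only [transport, Prod.fst_sub, sub_self, norm_zero]; positivity
  · refine (BoundedContinuousFunction.norm_le (by positivity)).2 fun x => ?_
    have h := abs_extZero_rad_sub_le hC (fun r hr => hasDerivAt_dLapseT α κ t hκ hr) (fun r hr => ?_)
      (fun r hr => ?_) (h₁.trans hL) (h₂.trans hL) x
    · rw [Prod.snd_sub, Prod.fst_sub, BoundedContinuousFunction.sub_apply, transport_snd_fst,
        transport_snd_fst, ← mul_sub, Real.norm_eq_abs, abs_mul]
      norm_num
      linarith [abs_nonneg (extZero (dLapseT α κ t) (rad s₁ x) - extZero (dLapseT α κ t) (rad s₂ x))]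
    · have h := H₁ t ht r hr 0 (by simp)
      have w := wt_mono (k := 1) (l := 4) (k' := 1) (l' := 0) le_rfl (by norm_num) hr
      rw [wt_one_zero] at w
      have : 0 ≤ r / (1 + r) := by positivity
      calc _ ≤ C₁ * (r / (1 + r)) := h.trans (by gcongr)
        _ ≤ _ := by simp only [C]; gcongr; linarith
    · have h := H₂ t ht r hr 0 (by simp)
      have w := wt_mono (k := 0) (l := 6) (k' := 0) (l' := 2) le_rfl (by norm_num) hr
      rw [wt_zero_two hr] at w
      calc _ ≤ C₂ * (1 / (1 + r)) := h.trans (by gcongr)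
        _ ≤ _ := by simp only [C]; gcongr; linarith
  · simp only [transport, Prod.snd_sub, sub_self, norm_zero]; positivity

variable {E : ℝ → State} (hE : Continuous E) {L : ℝ} (hL : ∀ u, ‖E u‖ ≤ L)
include hE hL

lemma continuous_transport (s : State) : Continuous fun u => transport α hκ (E u) s := by
  obtain ⟨C, hC, H⟩ := (Weighted.dLapseT α hκ).abs_extZero_le L
  obtain ⟨D, hD, I⟩ := exists_extZero_wt_le ‖s‖
  refine (continuous_const.mul ((continuous_lapse_zero α κ).comp hE)).prodMk
    ((continuous_ofNormedAddCommGroup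
      (F := fun u x => -(1 / 2) * extZero (dLapseT α κ (E u)) (rad s x)) ?_
      (tendsto_inv_sqrt_cocompact (C * D)) (fun u x => ?_) _ fun u x => rfl).prodMk continuous_const)
  · exact continuous_const.mul (((Weighted.dLapseT α hκ).continuous_extZero_uncurry le_rfl).comp
      (f := fun p : ℝ × ℝ => (E p.1, rad s p.2))
      ((hE.comp continuous_fst).prodMk ((continuous_rad s).comp continuous_snd)))
  · have h := H (E u) (hL u) (rad s x)
    have w := extZero_wt_le (k := 1) (l := 4) (k' := 0) (l' := 1) (by norm_num) (by norm_num) (rad s x)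
    have h0 := abs_nonneg (extZero (dLapseT α κ (E u)) (rad s x))
    have h2 : |extZero (dLapseT α κ (E u)) (rad s x)| ≤ C * (D * (√(1 + |x|))⁻¹) :=
      h.trans (by gcongr; exact w.trans (I s le_rfl x))
    rw [abs_mul]
    norm_num
    rw [← mul_assoc] at h2
    linarith

/-- The characteristics exist as long as the metric does, since `transport` is bounded. -/
lemma exists_hasDerivWithinAt_transport {u₀ : ℝ} (hu₀ : 0 ≤ u₀) : ∃ s : ℝ → State, s 0 = 0 ∧
    ∀ u ∈ Icc (0 : ℝ) u₀, HasDerivWithinAt s (transport α hκ (E u) (s u)) (Icc 0 u₀) u := by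
  obtain ⟨M, hM, HM⟩ := exists_norm_transport_le α hκ L
  set a : ℝ := M * u₀
  have ha : 0 ≤ a := by positivity
  obtain ⟨K, hK, HK⟩ := exists_norm_transport_sub_le α hκ (max L a)
  have hball : ∀ s ∈ Metric.closedBall (0 : State) a, ‖s‖ ≤ max L a := fun s hs => by
    rw [mem_closedBall_zero_iff] at hs
    exact hs.trans (le_max_right _ _)
  have hPL : IsPicardLindelof (fun u => transport α hκ (E u)) (tmin := 0) (tmax := u₀)
      ⟨0, le_rfl, hu₀⟩ (0 : State) ⟨a, ha⟩ 0 ⟨M, hM⟩ ⟨K, hK⟩ := by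
    refine ⟨fun u _ => LipschitzOnWith.of_dist_le_mul fun s₁ h₁ s₂ h₂ => ?_,
      fun s _ => (continuous_transport α hκ hE hL s).continuousOn, fun u _ s _ => HM _ _ (hL u), ?_⟩
    · rw [dist_eq_norm, dist_eq_norm]
      exact HK _ _ _ ((hL u).trans (le_max_left _ _)) (hball s₁ h₁) (hball s₂ h₂)
    · simp only [sub_zero, sub_self]
      rw [max_eq_left hu₀, NNReal.coe_zero, sub_zero]
      exact le_rfl
  exact hPL.exists_eq_forall_mem_Icc_hasDerivWithinAt₀

end transport

end

/-! ### Balances along the characteristics of a given solution -/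

section

open State

section congr
variable (α κ : ℝ) {s t : State} (h : ∀ r, 0 < r → zeta s r = zeta t r) {r : ℝ}
include h

lemma Z_congr (hr : 0 < r) : Z κ s r = Z κ t r := by rw [Z, Z, h r hr]

lemma W_congr (hr : 0 < r) : W κ s r = W κ t r := by
  rw [W, W, integral_congr_pos (fun x hx => by rw [Z_congr κ h hx]) hr.le]

lemma X_congr (hr : 0 < r) : X κ s r = X κ t r :=
  integral_congr_pos (fun _ hx => W_congr κ h hx) hr.le

lemma ang_congr (hr : 0 < r) : ang κ s r = ang κ t r := by rw [ang, ang, X_congr κ h hr]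

lemma Q_congr (hr : 0 < r) : Q κ s r = Q κ t r := by
  rw [Q, Q, W_congr κ h hr, ang_congr κ h hr]

lemma slope_congr (hr : 0 < r) : slope κ s r = slope κ t r := by
  rw [State.slope, State.slope, Q_congr κ h hr, ang_congr κ h hr]

lemma lapse_congr (hr : 0 ≤ r) : lapse α κ s r = lapse α κ t r := by
  unfold lapse
  rw [MeasureTheory.setIntegral_congr_fun measurableSet_Ioi fun x hx => ?_]
  rw [Q_congr κ h (lt_of_le_of_lt hr hx)]

lemma massDensity_congr (hr : 0 < r) : massDensity α κ s r = massDensity α κ t r := by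
  rw [massDensity, massDensity, lapse_congr α κ h hr.le, Q_congr κ h hr, ang_congr κ h hr]

lemma mass_congr (hr : 0 < r) : mass α κ s r = mass α κ t r :=
  integral_congr_pos (fun _ hx => massDensity_congr α κ h hx) hr.le

lemma pot_congr (hr : 0 < r) : pot κ s r = pot κ t r := by rw [pot, pot, ang_congr κ h hr]

lemma dLapseT_congr (hr : 0 < r) : dLapseT α κ s r = dLapseT α κ t r := by
  rw [dLapseT, dLapseT, mass_congr α κ h hr, lapse_congr α κ h hr.le, pot_congr κ h hr]

lemma dLapse_congr (hr : 0 < r) : dLapse α κ s r = dLapse α κ t r := by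
  rw [dLapse, dLapse, lapse_congr α κ h hr.le, Q_congr κ h hr]

lemma d2LapseT_congr (hr : 0 < r) : d2LapseT α κ s r = d2LapseT α κ t r := by
  rw [d2LapseT, d2LapseT, massDensity_congr α κ h hr, mass_congr α κ h hr, dLapse_congr α κ h hr,
    pot_congr κ h hr, lapse_congr α κ h hr.le, dPot, dPot, ang_congr κ h hr, slope_congr κ h hr]

lemma zSource_congr (hr : 0 < r) : zSource α κ s r = zSource α κ t r := by
  rw [zSource, zSource, d2LapseT_congr α κ h hr, dLapseT_congr α κ h hr, Q_congr κ h hr, dQ, dQ, dW, dW,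
    Z_congr κ h hr, W_congr κ h hr, ang_congr κ h hr, slope_congr κ h hr, massDensity_congr α κ h hr,
    mass_congr α κ h hr, dLapse_congr α κ h hr, X_congr κ h hr, lapse_congr α κ h hr.le]

lemma profile_congr (r : ℝ) : profile κ s r = profile κ t r := by
  rcases le_or_gt r 0 with hr | hr
  · rw [profile, profile, extZero_of_nonpos hr, extZero_of_nonpos hr]
  · rw [profile_of_pos κ s hr, profile_of_pos κ t hr, ang_congr κ h hr, slope_congr κ h hr]

end congr

namespace IsTransport
variable {α κ : ℝ} {hκ : Real.sin κ = 0} {u₀ : ℝ} {E s : ℝ → State}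
  (h : IsTransport α hκ u₀ E s) {u : ℝ} (hu : u ∈ Icc (0 : ℝ) u₀)
include h hu

/-- Labels only move inwards at the centre, hence never come out of it. -/
lemma rad_pos {x v : ℝ} (hx : 0 < rad (s u) x) (hv : v ∈ Icc 0 u) : 0 < rad (s v) x := by
  by_contra! hle
  have hsub : ∀ w ∈ Icc v u, w ∈ Icc 0 u₀ := fun w hw => ⟨hv.1.trans hw.1, hw.2.trans hu.2⟩
  have := image_le_of_deriv_right_lt_deriv_boundary' (f := fun w => rad (s w) x) (a := v) (b := u)
    (B := fun _ => 0) (B' := fun _ => 0)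
    (fun w hw => (h.hasDerivWithinAt_rad' (hsub w hw) x).continuousWithinAt.mono fun w hw => hsub w hw)
    (fun w hw => (h.hasDerivWithinAt_rad' (hsub w ⟨hw.1, hw.2.le⟩) x).mono_of_mem_nhdsWithin ?_) hle
    continuousOn_const (fun w _ => hasDerivWithinAt_const _ _ _) (fun w hw h0 => ?_)
    (right_mem_Icc.2 hv.2)
  · exact absurd hx (not_lt.2 this)
  · exact mem_of_superset (Icc_mem_nhdsGE hw.2) fun z hz => hsub z ⟨hw.1.trans hz.1, hz.2⟩
  · have hw0 := h.fst_nonpos (hsub w ⟨hw.1, hw.2.le⟩)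
    have hx0 : 0 ≤ x := by
      rw [← (strictMono_rad (s w)).le_iff_le, rad_zero, h0]; exact hw0
    have hz : ∫ y in (0 : ℝ)..x, jac (s w) y * (-(1 / 2) * extZero (dLapseT α κ (E w)) (rad (s w) y))
        = ∫ y in (0 : ℝ)..x, (0 : ℝ) := by
      refine intervalIntegral.integral_congr fun y hy => ?_
      rw [uIcc_of_le hx0] at hy
      have : rad (s w) y ≤ 0 := by rw [← h0]; exact (strictMono_rad (s w)).monotone hy.2
      rw [extZero_of_nonpos this, mul_zero, mul_zero]
    rw [hz, intervalIntegral.integral_zero, add_zero]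
    have : 0 < lapse α κ (E w) 0 := Real.exp_pos _
    linarith

end IsTransport

/-- A continuous bounded curve of states whose `W` solves the transport equation at every fixed
radius.  In contrast to `IsEvolution` the labels need not move with the characteristics. -/
structure IsEulerian (α κ u₀ : ℝ) (E : ℝ → State) : Prop where
  continuous : Continuous E
  exists_norm_le : ∃ L : ℝ, ∀ u, ‖E u‖ ≤ L
  deriv : ∀ u ∈ Icc (0 : ℝ) u₀, ∀ r, 0 < r →
    HasDerivWithinAt (fun v => W κ (E v) r) (evolW α κ (E u) r) (Icc 0 u₀) u

namespace IsEulerian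
variable {α κ : ℝ} {hκ : Real.sin κ = 0} {u₀ : ℝ} {E s : ℝ → State} (hE : IsEulerian α κ u₀ E)
  (hs : IsTransport α hκ u₀ E s) {u : ℝ} (hu : u ∈ Icc (0 : ℝ) u₀)
include hE hs hu

lemma hasDerivWithinAt_W_rad {x : ℝ} (hx : 0 < rad (s u) x) :
    HasDerivWithinAt (fun v => W κ (E v) (rad (s v) x)) (source α κ (E u) (rad (s u) x))
      (Icc 0 u₀) u := by
  have hρ := hs.hasDerivWithinAt_rad hu hx
  have hm : Tendsto (fun p : ℝ × ℝ => (E p.1, p.2)) (𝓝[Icc 0 u₀] u ×ˢ 𝓝 (rad (s u) x))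
      (𝓝 (E u, rad (s u) x)) := by
    rw [nhds_prod_eq]
    exact (hE.continuous.continuousWithinAt.tendsto).prodMap tendsto_id
  have h2 := hasDerivWithinAt_along_sub (f := fun v => W κ (E v)) (fr := fun v => dW κ (E v)) hρ ?_ ?_
  · refine ((h2.add (hE.deriv u hu _ hx)).congr (fun v _ => ?_) ?_).congr_deriv ?_
    · simp only [Pi.add_apply]; ring
    · simp only [Pi.add_apply]; ring
    · rw [evolW]; ring
  · filter_upwards [tendsto_snd.eventually (lt_mem_nhds hx)] with p hp
    exact hasDerivAt_W κ _ hp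
  · have hc : ContinuousAt (fun p : State × ℝ => dW κ p.1 p.2) (E u, rad (s u) x) :=
      ((Weighted.dW κ).continuousOn_uncurry.continuousAt
        (prod_mem_nhds univ_mem (Ioi_mem_nhds hx)))
    exact Tendsto.comp (g := fun p : State × ℝ => dW κ p.1 p.2) (f := fun p : ℝ × ℝ => (E p.1, p.2))
      (y := 𝓝 (E u, rad (s u) x)) hc.tendsto hm

lemma hasDerivWithinAt_sq_W_rad {x : ℝ} (hx : 0 < rad (s u) x) :
    HasDerivWithinAt (fun v => rad (s v) x ^ 2 * W κ (E v) (rad (s v) x))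
      (flux α κ (E u) (rad (s u) x)) (Icc 0 u₀) u := by
  refine (((hs.hasDerivWithinAt_rad hu hx).pow 2).mul
    (hE.hasDerivWithinAt_W_rad hs hu hx)).congr_deriv ?_
  simp only [Pi.pow_apply]
  rw [flux]
  push_cast
  ring

variable (hsc : Continuous s)
include hsc

omit hs hu in
lemma continuous_extZero_rad {k l : ℤ} {f : State → ℝ → ℝ} (hf : Weighted k l fun s r _ => f s r)
    (hk : 1 ≤ k) : Continuous fun p : ℝ × ℝ => extZero (f (E p.1)) (rad (s p.1) p.2) :=
  (hf.continuous_extZero_uncurry hk).comp (f := fun p : ℝ × ℝ => (E p.1, rad (s p.1) p.2))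
    ((hE.continuous.comp continuous_fst).prodMk (continuous_rad_uncurry.comp
      (f := fun p : ℝ × ℝ => (s p.1, p.2)) ((hsc.comp continuous_fst).prodMk continuous_snd)))

omit hE hs hu in
lemma continuous_jac_uncurry : Continuous fun p : ℝ × ℝ => jac (s p.1) p.2 := by
  refine Real.continuous_exp.comp ?_
  have h2 : Continuous fun p : ℝ × ℝ => (s p.1).2.1 := by fun_prop
  exact continuous_eval.comp (h2.prodMk continuous_snd)

/-- The balance of `r² W` along a characteristic. -/
lemma integral_flux {x : ℝ} (hx : 0 < rad (s u) x) :
    ∫ v in (0 : ℝ)..u, extZero (flux α κ (E v)) (rad (s v) x) =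
      rad (s u) x ^ 2 * W κ (E u) (rad (s u) x) - rad (s 0) x ^ 2 * W κ (E 0) (rad (s 0) x) := by
  have hsub : ∀ v ∈ Icc 0 u, v ∈ Icc 0 u₀ := fun v hv => ⟨hv.1, hv.2.trans hu.2⟩
  refine intervalIntegral.integral_eq_sub_of_hasDerivAt_of_le
    (f := fun v => rad (s v) x ^ 2 * W κ (E v) (rad (s v) x)) hu.1
    (fun v hv => (hE.hasDerivWithinAt_sq_W_rad hs (hsub v hv)
      (hs.rad_pos hu hx hv)).continuousWithinAt.mono hsub) (fun v hv => ?_) ?_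
  · have hv' : v ∈ Icc 0 u := Ioo_subset_Icc_self hv
    have hp := hs.rad_pos hu hx hv'
    rw [extZero_of_pos hp]
    exact (hE.hasDerivWithinAt_sq_W_rad hs (hsub v hv') hp).hasDerivAt
      (Icc_mem_nhds hv.1 (hv.2.trans_le hu.2))
  · exact ((hE.continuous_extZero_rad hsc (Weighted.flux α hκ) le_rfl).comp
      (f := fun v : ℝ => (v, x)) (by fun_prop)).intervalIntegrable _ _

/-- The balance of `r² Z ∂ᵣ/∂ₓ`, the derivative in the label of `integral_flux`. -/
lemma integral_dFlux {x : ℝ} (hx : 0 < rad (s u) x) :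
    ∫ v in (0 : ℝ)..u, extZero (dFlux α κ (E v)) (rad (s v) x) * jac (s v) x =
      rad (s u) x ^ 2 * Z κ (E u) (rad (s u) x) * jac (s u) x
        - rad (s 0) x ^ 2 * Z κ (E 0) (rad (s 0) x) * jac (s 0) x := by
  have hpos : ∀ᶠ y in 𝓝 x, 0 < rad (s u) y :=
    (continuous_rad (s u)).continuousAt.eventually (lt_mem_nhds hx)
  obtain ⟨ε, hε, hball⟩ := Metric.nhds_basis_closedBall.mem_iff.1 hpos
  rw [Real.closedBall_eq_Icc] at hball
  set S := Icc (x - ε) (x + ε)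
  have hxS : x ∈ S := ⟨by linarith, by linarith⟩
  have hSx : S ∈ 𝓝 x := Icc_mem_nhds (by linarith) (by linarith)
  have hderiv : ∀ v, ∀ y, 0 < rad (s v) y →
      HasDerivAt (fun y => rad (s v) y ^ 2 * W κ (E v) (rad (s v) y))
        (rad (s v) y ^ 2 * Z κ (E v) (rad (s v) y) * jac (s v) y) y := by
    intro v y hy
    have h1 := ((hasDerivAt_id (rad (s v) y)).pow 2).mul (hasDerivAt_W κ (E v) hy)
    refine (HasDerivAt.comp y h1 (hasDerivAt_rad (s v) y)).congr_deriv ?_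
    simp only [Pi.pow_apply, id, dW]
    push_cast
    field_simp
    ring
  have hc : Continuous fun p : ℝ × ℝ => extZero (dFlux α κ (E p.1)) (rad (s p.1) p.2) * jac (s p.1) p.2 :=
    (hE.continuous_extZero_rad hsc (Weighted.dFlux α hκ) le_rfl).mul (continuous_jac_uncurry hsc)
  obtain ⟨C, hC⟩ := (isCompact_uIcc (a := (0:ℝ)) (b := u)).prod (isCompact_Icc (a := x - ε) (b := x + ε))
    |>.exists_bound_of_continuousOn hc.continuousOn
  have hl := hasDerivWithinAt_intervalIntegral (S := S) (convex_Icc _ _) (a := 0) (b := u)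
    (φ := fun y v => extZero (flux α κ (E v)) (rad (s v) y))
    (φ' := fun y v => extZero (dFlux α κ (E v)) (rad (s v) y) * jac (s v) y) (bound := fun _ => C) hxS
    (fun y hy v hv => ?_) (fun y hy v hv => hC (v, y) ⟨uIoc_subset_uIcc hv, hy⟩)
    intervalIntegrable_const
    (fun y _ => ((hE.continuous_extZero_rad hsc (Weighted.flux α hκ) le_rfl).comp
      (f := fun v : ℝ => (v, y)) (by fun_prop)).intervalIntegrable _ _)
  · have h0 : 0 < rad (s 0) x := hs.rad_pos hu hx ⟨le_rfl, hu.1⟩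
    have hr := ((hderiv u x hx).sub (hderiv 0 x h0)).hasDerivWithinAt (s := S)
    have hl' := hl.congr (f₁ := fun y => rad (s u) y ^ 2 * W κ (E u) (rad (s u) y)
      - rad (s 0) y ^ 2 * W κ (E 0) (rad (s 0) y))
      (fun y hy => (hE.integral_flux hs hu hsc (hball hy)).symm)
      (hE.integral_flux hs hu hsc hx).symm
    exact (hl'.hasDerivAt hSx).unique (hr.hasDerivAt hSx)
  · rw [uIoc_of_le hu.1] at hv
    have hp : 0 < rad (s v) y := hs.rad_pos hu (hball hy) ⟨hv.1.le, hv.2⟩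
    have h1 := (hasDerivAt_flux α κ (E v) hκ hp).comp y (hasDerivAt_rad (s v) y)
    rw [extZero_of_pos hp]
    refine (h1.congr_of_eventuallyEq ?_).hasDerivWithinAt
    filter_upwards [(continuous_rad (s v)).continuousAt.eventually (lt_mem_nhds hp)] with z hz
    exact extZero_of_pos hz

/-- The remainder of `Z` is carried along the characteristics with rate `zSource`. -/
lemma hasDerivWithinAt_zeta_rad {x : ℝ} (hx : 0 < rad (s u) x) {w : ℝ} (hw : w ∈ Icc 0 u) :
    HasDerivWithinAt (fun v => zeta (E v) (rad (s v) x)) (zSource α κ (E w) (rad (s w) x))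
      (Icc 0 u) w := by
  have hsub : Icc 0 u ⊆ Icc 0 u₀ := fun v hv => ⟨hv.1, hv.2.trans hu.2⟩
  have hp : ∀ v ∈ Icc 0 u, 0 < rad (s v) x := fun v hv => hs.rad_pos hu hx hv
  have hc : Continuous fun v => extZero (dFlux α κ (E v)) (rad (s v) x) * jac (s v) x :=
    ((hE.continuous_extZero_rad hsc (Weighted.dFlux α hκ) le_rfl).mul
      (continuous_jac_uncurry hsc)).comp (f := fun v : ℝ => (v, x)) (by fun_prop)
  have hI := ((hc.integral_hasStrictDerivAt 0 w).hasDerivAt.hasDerivWithinAt (s := Icc 0 u)).const_add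
    (rad (s 0) x ^ 2 * Z κ (E 0) (rad (s 0) x) * jac (s 0) x)
  have hρ := (hs.hasDerivWithinAt_rad (hsub hw) (hp w hw)).mono hsub
  have hJ := (hs.hasDerivWithinAt_jac (hsub hw) x).mono hsub
  have hR : HasDerivWithinAt (fun v => refZ κ (rad (s v) x))
      (dRefZ κ (rad (s w) x) * (-(1 / 2) * lapseT α κ (E w) (rad (s w) x))) (Icc 0 u) w :=
    HasDerivAt.comp_hasDerivWithinAt (h₂ := refZ κ) (h := fun v => rad (s v) x) w
      (hasDerivAt_refZ κ (hp w hw).le) hρ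
  have hr0 := (hp w hw).ne'
  have hj0 := (jac_pos (s w) x).ne'
  have e : ∀ v ∈ Icc 0 u, zeta (E v) (rad (s v) x) =
      (rad (s 0) x ^ 2 * Z κ (E 0) (rad (s 0) x) * jac (s 0) x
        + ∫ t in (0 : ℝ)..v, extZero (dFlux α κ (E t)) (rad (s t) x) * jac (s t) x)
        / (rad (s v) x ^ 2 * jac (s v) x) - refZ κ (rad (s v) x) := by
    intro v hv
    have h1 := (hp v hv).ne'
    have h2 := (jac_pos (s v) x).ne'
    rw [hE.integral_dFlux hs (hsub hv) hsc (hp v hv), Z, Z]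
    field_simp
    ring
  have hZ : rad (s 0) x ^ 2 * Z κ (E 0) (rad (s 0) x) * jac (s 0) x
        + ∫ t in (0 : ℝ)..w, extZero (dFlux α κ (E t)) (rad (s t) x) * jac (s t) x
      = rad (s w) x ^ 2 * Z κ (E w) (rad (s w) x) * jac (s w) x := by
    rw [hE.integral_dFlux hs (hsub hw) hsc (hp w hw)]; ring
  have hall := (hI.div ((hρ.pow 2).mul hJ) (mul_ne_zero (pow_ne_zero 2 hr0) hj0)).sub hR
  refine (hall.congr e (e w hw)).congr_deriv ?_
  simp only [Pi.mul_apply, Pi.pow_apply]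
  rw [hZ, extZero_of_pos (hp w hw), extZero_of_pos (hp w hw), dFlux]
  push_cast
  field_simp
  ring

end IsEulerian

end

/-! ### Uniqueness of evolutions -/

section

open State

section
variable {α κ : ℝ} (hκ : Real.sin κ = 0) {u₀ : ℝ}

include hκ in
/-- The rate of change of the amplitudes prescribed by the curve `E`, in the labels of `s`, is a
continuous curve of bounded functions. -/
lemma exists_continuous_zSource {E s : ℝ → State} (hE : Continuous E) (hs : Continuous s) {L : ℝ}
    (hL : ∀ u, ‖E u‖ ≤ L ∧ ‖s u‖ ≤ L) : ∃ ψ : ℝ → ℝ →ᵇ ℝ, Continuous ψ ∧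
      ∀ v x, ψ v x = amp x * extZero (zSource α κ (E v)) (rad (s v) x) := by
  obtain ⟨C, hC, H⟩ := (Weighted.zSource α hκ).abs_extZero_le L
  obtain ⟨D, hD, I⟩ := exists_amp_mul_le L
  have hb : ∀ v x, |amp x * extZero (zSource α κ (E v)) (rad (s v) x)| ≤
      C * D * (√(1 + |x|))⁻¹ := fun v x => by
    have ha := amp_pos x
    rw [abs_mul, abs_of_pos ha]
    calc _ ≤ amp x * (C * extZero (wt 0 6) (rad (s v) x)) := by
          gcongr
          exact (H _ (hL v).1 _).trans (by gcongr; exact extZero_wt_le (by norm_num) (by norm_num) _)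
      _ = C * (amp x * extZero (wt 0 6) (rad (s v) x)) := by ring
      _ ≤ C * (D * (√(1 + |x|))⁻¹) := mul_le_mul_of_nonneg_left (I _ (hL v).2 x) hC
      _ = _ := by ring
  have hc : Continuous fun p : ℝ × ℝ => amp p.2 * extZero (zSource α κ (E p.1)) (rad (s p.1) p.2) :=
    (continuous_amp.comp continuous_snd).mul
      (((Weighted.zSource α hκ).continuous_extZero_uncurry le_rfl).comp
        (f := fun p : ℝ × ℝ => (E p.1, rad (s p.1) p.2)) ((hE.comp continuous_fst).prodMk
        (continuous_rad_uncurry.comp (f := fun p : ℝ × ℝ => (s p.1, p.2))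
          ((hs.comp continuous_fst).prodMk continuous_snd))))
  have hψ : ∀ v x, ‖amp x * extZero (zSource α κ (E v)) (rad (s v) x)‖ ≤ C * D := fun v x => by
    refine (hb v x).trans (mul_le_of_le_one_right (by positivity) ?_)
    refine inv_le_one_of_one_le₀ (Real.one_le_sqrt.2 ?_)
    linarith [abs_nonneg x]
  exact ⟨fun v => BoundedContinuousFunction.ofNormedAddCommGroup
    (fun x => amp x * extZero (zSource α κ (E v)) (rad (s v) x))
    (hc.comp (f := fun x : ℝ => (v, x)) (by fun_prop)) (C * D) (hψ v),
    continuous_ofNormedAddCommGroup (F := fun v x => amp x * extZero (zSource α κ (E v)) (rad (s v) x))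
      hc (tendsto_inv_sqrt_cocompact (C * D)) hb _ fun _ _ => rfl, fun _ _ => rfl⟩

/-- Moving the labels with the characteristics turns a solution of the transport equation into a
solution of the evolution equation with the same remainder of `Z`. -/
lemma IsEulerian.exists_isEvolution {E : ℝ → State} (hE : IsEulerian α κ u₀ E) (hu₀ : 0 ≤ u₀)
    (h1 : (E 0).1 = 0) (h2 : (E 0).2.1 = 0) : ∃ s : ℝ → State, IsEvolution α hκ u₀ s ∧ s 0 = E 0 ∧
      ∀ u ∈ Icc (0 : ℝ) u₀, ∀ r, 0 < r → zeta (s u) r = zeta (E u) r := by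
  obtain ⟨L, hL⟩ := hE.exists_norm_le
  obtain ⟨σ, hσ0, hσ⟩ := exists_hasDerivWithinAt_transport α hκ hE.continuous hL hu₀
  set τ : ℝ → State := fun u => σ (projIcc 0 u₀ hu₀ u)
  have hτσ : ∀ u ∈ Icc (0 : ℝ) u₀, τ u = σ u := fun u hu => by
    simp only [τ, projIcc_of_mem hu₀ hu]
  have hσc : ContinuousOn σ (Icc 0 u₀) := fun u hu => (hσ u hu).continuousWithinAt
  have hτc : Continuous τ :=
    hσc.comp_continuous (continuous_subtype_val.comp continuous_projIcc) fun u => (projIcc 0 u₀ hu₀ u).2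
  have hτ : ∀ u ∈ Icc (0 : ℝ) u₀, HasDerivWithinAt τ (transport α hκ (E u) (τ u)) (Icc 0 u₀) u :=
    fun u hu => by
      rw [hτσ u hu]
      exact (hσ u hu).congr hτσ (hτσ u hu)
  obtain ⟨M, hM⟩ := isCompact_Icc.exists_bound_of_continuousOn hσc
  obtain ⟨ψ, hψc, hψ⟩ := exists_continuous_zSource (α := α) hκ hE.continuous hτc (L := max L M)
    fun u => ⟨(hL u).trans (le_max_left _ _),
      (hM _ (projIcc 0 u₀ hu₀ u).2).trans (le_max_right _ _)⟩
  have hz : ∀ u, HasDerivAt (fun u => (E 0).2.2 + ∫ v in (0 : ℝ)..u, ψ v) (ψ u) u := fun u =>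
    (hψc.integral_hasStrictDerivAt 0 u).hasDerivAt.const_add _
  set s : ℝ → State := fun u => ((τ u).1, (τ u).2.1, (E 0).2.2 + ∫ v in (0 : ℝ)..u, ψ v)
  have hzc : Continuous fun u => (E 0).2.2 + ∫ v in (0 : ℝ)..u, ψ v :=
    continuous_iff_continuousAt.2 fun u => (hz u).continuousAt
  have hsc : Continuous s := hτc.fst.prodMk (hτc.snd.fst.prodMk hzc)
  have hrad : ∀ u, rad (s u) = rad (τ u) := fun u => rfl
  have hs0 : s 0 = E 0 := by
    have e : τ 0 = 0 := by rw [hτσ 0 ⟨le_rfl, hu₀⟩, hσ0]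
    refine Prod.ext ?_ (Prod.ext ?_ ?_)
    · simp only [s, e, h1]; rfl
    · simp only [s, e, h2]; rfl
    · simp [s]
  have hfst : ∀ u ∈ Icc (0 : ℝ) u₀,
      HasDerivWithinAt (fun v => (τ v).1) (-(1 / 2) * lapse α κ (E u) 0) (Icc 0 u₀) u := fun u hu =>
    (ContinuousLinearMap.fst ℝ ℝ ((ℝ →ᵇ ℝ) × (ℝ →ᵇ ℝ))).hasFDerivAt.comp_hasDerivWithinAt u (hτ u hu)
  have hlog : ∀ u ∈ Icc (0 : ℝ) u₀,
      HasDerivWithinAt (fun v => (τ v).2.1) (transport α hκ (E u) (τ u)).2.1 (Icc 0 u₀) u :=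
    fun u hu => ((ContinuousLinearMap.fst ℝ (ℝ →ᵇ ℝ) (ℝ →ᵇ ℝ)).comp
      (ContinuousLinearMap.snd ℝ ℝ ((ℝ →ᵇ ℝ) × (ℝ →ᵇ ℝ)))).hasFDerivAt.comp_hasDerivWithinAt u (hτ u hu)
  have hT : IsTransport α hκ u₀ E s :=
    { deriv_fst := hfst
      deriv_log := fun u hu x => (BoundedContinuousFunction.evalCLM ℝ x :
        (ℝ →ᵇ ℝ) →L[ℝ] ℝ).hasFDerivAt.comp_hasDerivWithinAt u (hlog u hu)
      exists_norm_le := by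
        obtain ⟨N, hN⟩ := isCompact_Icc.exists_bound_of_continuousOn hsc.continuousOn (s := Icc 0 u₀)
        exact ⟨max L N, fun u hu => ⟨(hL u).trans (le_max_left _ _), (hN u hu).trans (le_max_right _ _)⟩⟩
      center := by rw [hs0, h1] }
  have hzeta : ∀ u ∈ Icc (0 : ℝ) u₀, ∀ r, 0 < r → zeta (s u) r = zeta (E u) r := by
    intro u hu r hr
    set x := label (s u) r
    have hx : rad (s u) x = r := rad_label _ _
    have hx0 : 0 < rad (s u) x := by rw [hx]; exact hr
    have hd : ∀ w ∈ Icc 0 u, HasDerivWithinAt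
        (fun v => (s v).2.2 x * ((√(1 + |x|))⁻¹) ^ 5 - zeta (E v) (rad (s v) x)) 0 (Icc 0 u) w := by
      intro w hw
      have ha : HasDerivAt (fun v => (s v).2.2 x) (ψ w x) w :=
        (BoundedContinuousFunction.evalCLM ℝ x : (ℝ →ᵇ ℝ) →L[ℝ] ℝ).hasFDerivAt.comp_hasDerivAt w (hz w)
      refine ((ha.hasDerivWithinAt.mul_const (((√(1 + |x|))⁻¹) ^ 5)).sub
        (hE.hasDerivWithinAt_zeta_rad hT hu hsc hx0 hw)).congr_deriv ?_
      rw [hψ, ← hrad, extZero_of_pos (hT.rad_pos hu hx0 hw)]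
      have hA : amp x * (√(1 + |x|))⁻¹ ^ 5 = 1 := by
        rw [amp, ← mul_pow, mul_inv_cancel₀ (by positivity), one_pow]
      linear_combination zSource α κ (E w) (rad (s w) x) * hA
    have h := (convex_Icc 0 u).norm_image_sub_le_of_norm_hasDerivWithin_le (C := 0) hd
      (fun w _ => by simp) ⟨le_rfl, hu.1⟩ ⟨hu.1, le_rfl⟩
    rw [zero_mul, norm_le_zero_iff, sub_eq_zero] at h
    have h0 : zeta (E 0) (rad (s 0) x) = (s 0).2.2 x * ((√(1 + |x|))⁻¹) ^ 5 := by
      rw [hs0, zeta, label_rad]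
    rw [h0, sub_self, sub_eq_zero, hx] at h
    rw [← h, zeta]
  refine ⟨s, ⟨fun u hu => ?_, by rw [hs0, h1]⟩, hs0, hzeta⟩
  have hc := hzeta u hu
  refine ((hfst u hu).prodMk ((hlog u hu).prodMk (hz u).hasDerivWithinAt)).congr_deriv ?_
  have hext : ∀ {f g : ℝ → ℝ}, (∀ r, 0 < r → f r = g r) → ∀ r, extZero f r = extZero g r := by
    intro f g hfg r
    rcases lt_or_ge 0 r with hr | hr
    · rw [extZero_of_pos hr, extZero_of_pos hr, hfg r hr]
    · rw [extZero_of_nonpos hr, extZero_of_nonpos hr]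
  refine Prod.ext ?_ (Prod.ext ?_ ?_)
  · rw [field_fst, lapse_congr α κ hc le_rfl]
  · ext x
    rw [field_snd_fst, transport_snd_fst, hrad, hext fun r hr => dLapseT_congr α κ hc hr]
  · ext x
    rw [field_snd_snd, hψ, hrad, hext fun r hr => zSource_congr α κ hc hr]

/-- Evolutions are determined by their initial state. -/
lemma IsEvolution.eq_of_eq {s t : ℝ → State} (hs : IsEvolution α hκ u₀ s)
    (ht : IsEvolution α hκ u₀ t) (h0 : s 0 = t 0) {u : ℝ} (hu : u ∈ Icc (0 : ℝ) u₀) : s u = t u := by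
  obtain ⟨L, hL⟩ := hs.exists_norm_le
  obtain ⟨M, hM⟩ := ht.exists_norm_le
  obtain ⟨K, hK⟩ := lipschitzOnWith_field α hκ (max L M)
  refine ODE_solution_unique_of_mem_Icc_right (v := fun _ => field α hκ)
    (s := fun _ => Metric.closedBall 0 (max L M)) (fun _ _ => hK)
    hs.continuousOn (fun v hv => ?_) (fun v hv => ?_) ht.continuousOn (fun v hv => ?_) (fun v hv => ?_)
    h0 hu
  · exact (hs.deriv v (Ico_subset_Icc_self hv)).mono_of_mem_nhdsWithin
      (mem_of_superset (Icc_mem_nhdsGE hv.2) (Icc_subset_Icc_left hv.1))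
  · rw [mem_closedBall_zero_iff]
    exact (hL v (Ico_subset_Icc_self hv)).trans (le_max_left _ _)
  · exact (ht.deriv v (Ico_subset_Icc_self hv)).mono_of_mem_nhdsWithin
      (mem_of_superset (Icc_mem_nhdsGE hv.2) (Icc_subset_Icc_left hv.1))
  · rw [mem_closedBall_zero_iff]
    exact (hM v (Ico_subset_Icc_self hv)).trans (le_max_right _ _)

end

end

/-! ### Topological charge and uniqueness of classical solutions -/

section

open State

lemma meanSlope_congr {U V : Type*} {f' : U → ℝ → ℝ} {g' : V → ℝ → ℝ} {u : U} {v : V}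
    (h : f' u = g' v) : meanSlope f' u = meanSlope g' v := by
  funext r; simp only [meanSlope, h]

lemma angRatio_congr {U V : Type*} {f' : U → ℝ → ℝ} {g' : V → ℝ → ℝ} {u : U} {v : V}
    (h : f' u = g' v) : angRatio f' u = angRatio g' v := by
  funext r; simp only [angRatio, meanSlope_congr h]

lemma profileZ_congr {U V : Type*} {f' : U → ℝ → ℝ} {g' : V → ℝ → ℝ} {u : U} {v : V}
    (h : f' u = g' v) : profileZ f' u = profileZ g' v := by
  funext r; simp only [profileZ, avgSlope, angRatio_congr h, meanSlope_congr h, h]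

/-- The profiles of an element of the weighted space, over any family of times with a common
central value. -/
lemma MemWeightedC1.exists_isProfileFamily {u₀ κ : ℝ} {h : ℝ → ℝ → ℝ} (hu₀ : 0 < u₀)
    (hm : MemWeightedC1 u₀ h) : ∃ C : ℝ, ∀ {U : Type} [TopologicalSpace U] {ι : U → ℝ}, Continuous ι →
      (∀ u, ι u ∈ Icc 0 u₀) → (∀ u, h (ι u) 0 = κ) →
      IsProfileFamily κ C (fun u => h (ι u)) (fun u r => partialR h (ι u) |r|) := by
  obtain ⟨hd, C, hC⟩ := hm
  obtain ⟨A, B, -, hB, hAB⟩ := exists_partials_of_contDiffOn hu₀ hd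
  have hR : ∀ u ∈ Icc 0 u₀, ∀ r, 0 ≤ r → HasDerivWithinAt (h u) (B u r) (Ici 0) r := fun u hu r hr =>
    hasDerivWithinAt_snd_of_grad (f := h) (a := A u r) hu (hAB (u, r) ⟨hu, hr⟩)
  have hRB : ∀ u ∈ Icc 0 u₀, ∀ r, 0 ≤ r → partialR h u r = B u r := fun u hu r hr =>
    (hR u hu r hr).derivWithin (uniqueDiffOn_Ici 0 r hr)
  refine ⟨C, fun {U} _ {ι} hι hmem hc => ⟨?_, fun u r hr => ?_, hc, fun u r hr => ?_, fun u r hr => ?_,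
    fun u r hr => ?_⟩⟩
  · refine (hB.comp_continuous (f := fun p : U × ℝ => (ι p.1, |p.2|))
      ((hι.comp continuous_fst).prodMk continuous_snd.abs)
      fun p => ⟨hmem _, abs_nonneg p.2⟩).congr fun p => ?_
    simp only [Function.comp, hRB _ (hmem _) _ (abs_nonneg _)]
  · exact (hR _ (hmem u) r hr).continuousWithinAt
  · rw [abs_of_pos hr, hRB _ (hmem u) r hr.le]
    exact (hR _ (hmem u) r hr.le).hasDerivAt (Ici_mem_nhds hr)
  · have h1 := hC _ (hmem u) r hr
    have : 0 ≤ (1 + r) ^ 3 * |partialR h (ι u) r| := by positivity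
    linarith
  · have h1 := hC _ (hmem u) r hr
    have : 0 ≤ (1 + r) ^ 2 * |h (ι u) r| := by positivity
    rw [abs_of_nonneg hr]
    linarith

section charge
variable {U : Type*} [TopologicalSpace U] {κ C : ℝ} {f f' : U → ℝ → ℝ}

/-- The charge density is the `r`-derivative of a multiple of `ξ - sin ξ cos ξ`, so that only the
central value of the profile matters. -/
lemma IsProfileFamily.topologicalCharge_eq (h : IsProfileFamily κ C f f') (u : U) :
    topologicalCharge (f u) = (κ - Real.sin κ * Real.cos κ) / Real.pi := by
  set a : ℝ → ℝ := fun r => κ + r * angRatio f' u r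
  have hac : Continuous a := continuous_const.add
    (continuous_id.mul (h.continuous_angRatio.comp (f := fun r : ℝ => (u, r)) (by fun_prop)))
  have hqc : Continuous fun r => avgSlope f' u r :=
    h.continuous_avgSlope.comp (f := fun r : ℝ => (u, r)) (by fun_prop)
  have ha : ∀ r, 0 < r → HasDerivAt a (avgSlope f' u r) r := fun r hr =>
    (h.hasDerivAt_ang u hr).const_add κ
  have havg : ∀ r, 0 < r → avg (f u) r = a r := fun r hr => h.avg_eq u hr
  have hda : ∀ r, 0 < r → _root_.deriv (avg (f u)) r = avgSlope f' u r := fun r hr =>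
    ((ha r hr).congr_of_eventuallyEq (by
      filter_upwards [Ioi_mem_nhds hr] with x hx using havg x hx)).deriv
  have hinf : Tendsto a atTop (𝓝 0) := by
    have hb : Tendsto (fun r : ℝ => 3 * C * r⁻¹) atTop (𝓝 0) := by
      simpa using tendsto_inv_atTop_zero.const_mul (3 * C)
    refine squeeze_zero_norm' ?_ hb
    filter_upwards [eventually_ge_atTop 1] with r hr
    have hr0 : 0 < r := by linarith
    have hC := h.bound_nonneg u
    obtain ⟨b1, -, -, b4⟩ := h.abs_le_of_one_le u hr
    have e : a r = f u r - r * avgSlope f' u r := by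
      rw [h.eq_add u hr0.le, avgSlope]; simp only [a]; ring
    have h2 : C / r ^ 2 ≤ C * r⁻¹ := by
      rw [← div_eq_mul_inv]
      refine div_le_div_of_nonneg_left hC hr0 ?_
      nlinarith
    rw [Real.norm_eq_abs, e]
    calc _ ≤ |f u r| + |r * avgSlope f' u r| := abs_sub _ _
      _ ≤ C / r ^ 2 + r * (2 * C / r ^ 2) := by
          rw [abs_mul, abs_of_pos hr0]; gcongr
      _ = C / r ^ 2 + 2 * C * r⁻¹ := by field_simp
      _ ≤ _ := by linarith
  have hint : MeasureTheory.IntegrableOn (fun r => Real.sin (a r) ^ 2 * avgSlope f' u r) (Ioi 0) := by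
    have hc : Continuous fun r => Real.sin (a r) ^ 2 * avgSlope f' u r := by fun_prop
    rw [← Ioc_union_Ioi_eq_Ioi zero_le_one]
    refine MeasureTheory.IntegrableOn.union (hc.integrableOn_Ioc) ?_
    refine MeasureTheory.Integrable.mono'
      ((integrableOn_Ioi_rpow_of_lt (show (-2 : ℝ) < -1 by norm_num) zero_lt_one).const_mul (2 * C))
      hc.aestronglyMeasurable.restrict ?_
    refine (MeasureTheory.ae_restrict_iff' measurableSet_Ioi).2 (Filter.Eventually.of_forall
      fun r hr => ?_)
    have hr1 : (1:ℝ) < r := hr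
    obtain ⟨-, -, -, b4⟩ := h.abs_le_of_one_le u hr1.le
    rw [norm_mul, Real.norm_eq_abs, Real.norm_eq_abs, abs_of_nonneg (sq_nonneg _),
      Real.rpow_neg (by linarith), show (2:ℝ) = ((2:ℕ):ℝ) by norm_num, Real.rpow_natCast]
    push_cast
    rw [← div_eq_mul_inv]
    exact (mul_le_of_le_one_left (abs_nonneg _) (Real.sin_sq_le_one _)).trans b4
  have key := MeasureTheory.integral_Ioi_of_hasDerivAt_of_tendsto (a := 0)
    (f := fun r => (a r - Real.sin (a r) * Real.cos (a r)) / 2)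
    (f' := fun r => Real.sin (a r) ^ 2 * avgSlope f' u r) (m := 0)
    (by fun_prop) (fun r hr => ?_) hint ?_
  · have e : ∫ r in Ioi (0 : ℝ), ∫ θ in (0 : ℝ)..Real.pi, ∫ _φ in (0 : ℝ)..(2 * Real.pi),
        Real.sin (avg (f u) r) ^ 2 * _root_.deriv (avg (f u)) r * Real.sin θ =
        ∫ r in Ioi (0 : ℝ), 4 * Real.pi * (Real.sin (a r) ^ 2 * avgSlope f' u r) := by
      refine MeasureTheory.setIntegral_congr_fun measurableSet_Ioi fun r hr => ?_
      have hr0 : (0:ℝ) < r := hr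
      simp only [intervalIntegral.integral_const, smul_eq_mul, sub_zero,
        intervalIntegral.integral_const_mul, integral_sin, Real.cos_zero, Real.cos_pi]
      rw [havg r hr0, hda r hr0]
      ring
    have hpi := Real.pi_ne_zero
    rw [topologicalCharge, e, MeasureTheory.integral_const_mul, key]
    simp only [a, zero_mul, add_zero]
    field_simp
    ring
  · have hs := Real.sin_sq_add_cos_sq (a r)
    have hd := ha r hr
    refine ((hd.sub (hd.sin.mul hd.cos)).div_const 2).congr_deriv ?_
    linear_combination -(avgSlope f' u r / 2) * hs
  · have hc : Continuous fun y : ℝ => (y - Real.sin y * Real.cos y) / 2 := by fun_prop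
    simpa [Function.comp_def] using (hc.tendsto 0).comp hinf

end charge

section eulerian
variable {α κ : ℝ} (hκ : Real.sin κ = 0) {u₀ : ℝ} {h : ℝ → ℝ → ℝ}

include hκ in
/-- A classical solution as a curve of states with the trivial labels. -/
lemma MemWeightedC1.exists_isEulerian (hu₀ : 0 < u₀) (hm : MemWeightedC1 u₀ h)
    (hc : ∀ u ∈ Icc (0 : ℝ) u₀, h u 0 = κ)
    (heq : ∀ u ∈ Icc (0 : ℝ) u₀, ∀ r : ℝ, 0 < r → dynamicalExpr α u₀ h u r = 0) :
    ∃ E : ℝ → State, IsEulerian α κ u₀ E ∧ (E 0).1 = 0 ∧ (E 0).2.1 = 0 ∧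
      (∀ x, (E 0).2.2 x = amp x *
        (profileZ (fun (u : ℝ) r => partialR h u |r|) 0 |x| - refZ κ |x|)) ∧
      ∀ u ∈ Icc (0 : ℝ) u₀, ∀ r, 0 ≤ r → profile κ (E u) r = h u r := by
  obtain ⟨C, hC⟩ := hm.exists_isProfileFamily (κ := κ) hu₀
  have hF := hC (U := Icc (0 : ℝ) u₀) continuous_subtype_val (fun u => u.2) fun u => hc u u.2
  obtain ⟨A, B, hA, -, hAB⟩ := exists_partials_of_contDiffOn hu₀ hm.1
  have h0 : (0:ℝ) ∈ Icc 0 u₀ := ⟨le_rfl, hu₀.le⟩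
  have : Nonempty (Icc (0 : ℝ) u₀) := ⟨⟨0, h0⟩⟩
  obtain ⟨e, hec, -, he⟩ := hF.exists_state
  set f' : Icc (0 : ℝ) u₀ → ℝ → ℝ := fun u r => partialR h u |r|
  set E : ℝ → State := fun u => e (projIcc 0 u₀ hu₀.le u)
  have hE : ∀ u (hu : u ∈ Icc 0 u₀), E u = e ⟨u, hu⟩ := fun u hu => by
    simp only [E, projIcc_of_mem hu₀.le hu]
  have hprof : ∀ u ∈ Icc (0 : ℝ) u₀, ∀ r, 0 ≤ r → profile κ (E u) r = h u r := fun u hu r hr => by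
    rw [hE u hu]
    exact profile_of_static (he _).1 (he _).2.1 hF (he _).2.2 hr
  refine ⟨E, ⟨hec.comp continuous_projIcc, ?_, fun u hu r hr => ?_⟩, (he _).1, (he _).2.1,
    fun x => ?_, hprof⟩
  · obtain ⟨L, hL⟩ := isCompact_univ.exists_bound_of_continuousOn hec.continuousOn
    exact ⟨L, fun u => hL _ (mem_univ _)⟩
  · -- the derivatives in `u` of the average and of its slope, by differentiation under the integral
    have hdA : ∀ v ∈ Icc 0 u₀, ∀ x, 0 ≤ x → HasDerivWithinAt (fun v => h v x) (A v x) (Icc 0 u₀) v :=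
      fun v hv x hx => hasDerivWithinAt_fst_of_grad (f := h) (a := A v x) hx (hAB (v, x) ⟨hv, hx⟩)
    have hsub : uIcc 0 r ⊆ Ici 0 := by rw [uIcc_of_le hr.le]; exact Icc_subset_Ici_self
    obtain ⟨M, hM⟩ := (isCompact_Icc.prod isCompact_uIcc).exists_bound_of_continuousOn
      (hA.mono (prod_mono_right (s := Icc 0 u₀) hsub))
    have hI := hasDerivWithinAt_intervalIntegral (convex_Icc 0 u₀) (a := 0) (b := r)
      (φ := h) (φ' := A) (bound := fun _ => M) hu
      (fun v hv y hy => hdA v hv y (hsub (uIoc_subset_uIcc hy)))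
      (fun v hv y hy => hM (v, y) ⟨hv, uIoc_subset_uIcc hy⟩) intervalIntegrable_const
      (fun v hv => ((hF.continuousOn ⟨v, hv⟩).mono hsub).intervalIntegrable)
    have hang : ∀ v ∈ Icc 0 u₀, ang κ (E v) r = (1 / r) * (∫ y in (0 : ℝ)..r, h v y) - κ := by
      intro v hv
      have := hF.avg_eq ⟨v, hv⟩ hr
      rw [hE v hv, ang_of_static (he _).1 (he _).2.1 hF (he _).2.2 hr]
      rw [avg] at this
      linarith
    have ha := ((hI.const_mul (1 / r)).sub_const κ).congr hang (hang u hu)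
    have hslope : ∀ v ∈ Icc 0 u₀, slope κ (E v) r = (h v r - ang κ (E v) r - κ) / r := by
      intro v hv
      rw [← hprof v hv r hr.le, profile_of_pos κ _ hr]
      field_simp
      ring
    have hq := (((hdA u hu r hr.le).sub ha).sub_const κ |>.div_const r).congr hslope (hslope u hu)
    have hmul := mul_dynamicalExpr (α := α) hκ hu₀ (fun v hv r hr => (hprof v hv r hr.le).symm) hu hr ha hq
    rw [heq u hu r hr, mul_zero] at hmul
    have hz := (mul_eq_zero.1 hmul.symm).resolve_left (root_pos hr _).ne'
    have hW : ∀ v, W κ (E v) r = theta1 r (ang κ (E v) r) + root r (ang κ (E v) r) * slope κ (E v) r :=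
      fun v => by rw [root_mul_slope κ _ hr, Q]; ring
    have h1 := hasDerivWithinAt_theta1 (ρ := fun _ => r) (s := Icc 0 u₀) hr
      (hasDerivWithinAt_const u _ r) ha
    have h2 := (hasDerivAt_root_snd hr (ang κ (E u) r)).comp_hasDerivWithinAt u ha
    refine ((h1.add (h2.mul hq)).congr (fun v _ => hW v) (hW u)).congr_deriv ?_
    simp only [Function.comp]
    linear_combination hz
  · rw [hE 0 h0, (he _).2.2 x, profileZ_congr (g' := fun (u : ℝ) r => partialR h u |r|) (v := 0) rfl]

/-- Classical solutions with the same initial datum as an evolution coincide with its profile. -/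
lemma IsEvolution.eq_profile {s : ℝ → State} (hs : IsEvolution α hκ u₀ s) (hu₀ : 0 < u₀)
    (hm : MemWeightedC1 u₀ h) (hc : ∀ u ∈ Icc (0 : ℝ) u₀, h u 0 = κ)
    (heq : ∀ u ∈ Icc (0 : ℝ) u₀, ∀ r : ℝ, 0 < r → dynamicalExpr α u₀ h u r = 0)
    (h2 : (s 0).2.1 = 0) (hz : ∀ x, (s 0).2.2 x = amp x *
      (profileZ (fun (u : ℝ) r => partialR h u |r|) 0 |x| - refZ κ |x|))
    {u : ℝ} (hu : u ∈ Icc (0 : ℝ) u₀) {r : ℝ} (hr : 0 ≤ r) : h u r = profile κ (s u) r := by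
  obtain ⟨E, hE, e1, e2, e3, hp⟩ := hm.exists_isEulerian hκ hu₀ hc heq
  obtain ⟨t, ht, ht0, htE⟩ := hE.exists_isEvolution hκ hu₀.le e1 e2
  have h0 : s 0 = t 0 := by
    rw [ht0]
    refine Prod.ext (hs.center.trans e1.symm) (Prod.ext (h2.trans e2.symm) ?_)
    ext x
    rw [hz, e3]
  rw [hs.eq_of_eq hκ ht h0 hu, profile_congr κ (htE u hu), hp u hu r hr]

end eulerian

end

/-! ### The initial datum -/

section

open State

lemma exists_mul_abs_le_of_isBigO {g : ℝ → ℝ} {n : ℕ} (hg : ContinuousOn g (Ici 0))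
    (hO : g =O[atTop] fun r : ℝ => (r ^ n)⁻¹) :
    ∃ C : ℝ, ∀ r, 0 ≤ r → (1 + r) ^ n * |g r| ≤ C := by
  obtain ⟨c, hc0, hc⟩ := hO.exists_nonneg
  obtain ⟨R, hR⟩ := eventually_atTop.1 (isBigOWith_iff.1 hc)
  obtain ⟨M, hM⟩ := (isCompact_Icc (a := (0:ℝ)) (b := max R 1)).exists_bound_of_continuousOn
    (f := fun r => (1 + r) ^ n * |g r|)
    ((by fun_prop : Continuous fun r : ℝ => (1 + r) ^ n).continuousOn.mul
      (hg.mono Icc_subset_Ici_self).abs)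
  refine ⟨max M (2 ^ n * c), fun r hr => ?_⟩
  rcases le_or_gt r (max R 1) with h | h
  · exact (le_abs_self _).trans ((hM r ⟨hr, h⟩).trans (le_max_left _ _))
  · have h1 : 1 < r := (le_max_right _ _).trans_lt h
    have h2 := hR r ((le_max_left _ _).trans h.le)
    rw [norm_inv, norm_pow, Real.norm_eq_abs, Real.norm_eq_abs, abs_of_nonneg hr] at h2
    refine le_trans ?_ (le_max_right _ _)
    calc _ ≤ (2 * r) ^ n * (c * (r ^ n)⁻¹) := by gcongr; linarith
      _ = 2 ^ n * c := by
        rw [mul_pow]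
        field_simp

lemma isBigO_of_mul_abs_le {g : ℝ → ℝ} {n : ℕ} {C : ℝ} (h : ∀ r, 0 ≤ r → (1 + r) ^ n * |g r| ≤ C) :
    g =O[atTop] fun r : ℝ => (r ^ n)⁻¹ := by
  refine IsBigO.of_bound C ?_
  filter_upwards [eventually_gt_atTop 0] with r hr
  rw [norm_inv, norm_pow, Real.norm_eq_abs, Real.norm_eq_abs, abs_of_pos hr, ← div_eq_mul_inv,
    le_div_iff₀ (by positivity), mul_comm]
  refine le_trans ?_ (h r hr.le)
  gcongr
  linarith

lemma MemWeightedC1.isBigO {u₀ : ℝ} {h : ℝ → ℝ → ℝ} (hm : MemWeightedC1 u₀ h) {u : ℝ}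
    (hu : u ∈ Icc (0 : ℝ) u₀) : (h u =O[atTop] fun r : ℝ => (r ^ 2)⁻¹) ∧
      (partialR h u =O[atTop] fun r : ℝ => (r ^ 3)⁻¹) := by
  obtain ⟨-, C, hC⟩ := hm
  refine ⟨isBigO_of_mul_abs_le (C := C) fun r hr => ?_, isBigO_of_mul_abs_le (C := C) fun r hr => ?_⟩
  · have := hC u hu r hr
    have : 0 ≤ (1 + r) ^ 3 * |partialR h u r| := by positivity
    linarith
  · have := hC u hu r hr
    have : 0 ≤ (1 + r) ^ 2 * |h u r| := by positivity
    linarith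

/-- An admissible datum is an element of the weighted space, as a function independent of `u`. -/
lemma memWeightedC1_const {h₀ : ℝ → ℝ} (hC1 : ContDiffOn ℝ 1 h₀ (Ici 0))
    (hdecay : h₀ =O[atTop] fun r : ℝ => (r ^ 2)⁻¹)
    (hdecay' : derivWithin h₀ (Ici 0) =O[atTop] fun r : ℝ => (r ^ 3)⁻¹) (u₀ : ℝ) :
    MemWeightedC1 u₀ fun _ => h₀ := by
  obtain ⟨C, hC⟩ := exists_mul_abs_le_of_isBigO hC1.continuousOn hdecay
  obtain ⟨D, hD⟩ := exists_mul_abs_le_of_isBigO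
    (hC1.continuousOn_derivWithin (uniqueDiffOn_Ici 0) le_rfl) hdecay'
  exact ⟨hC1.comp contDiffOn_snd fun p hp => hp.2, C + D,
    fun u _ r hr => add_le_add (hC r hr) (hD r hr)⟩

/-- For profiles that vanish at the centre modulo `π` the charge determines the central value. -/
lemma MemWeightedC1.topologicalCharge_eq {u₀ : ℝ} {h : ℝ → ℝ → ℝ} (hu₀ : 0 < u₀)
    (hm : MemWeightedC1 u₀ h) {u : ℝ} (hu : u ∈ Icc (0 : ℝ) u₀) (hs : Real.sin (h u 0) = 0) :
    topologicalCharge (h u) = h u 0 / Real.pi := by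
  obtain ⟨C, hC⟩ := hm.exists_isProfileFamily (κ := h u 0) hu₀
  have := (hC (U := Unit) (ι := fun _ => u) continuous_const (fun _ => hu) fun _ => rfl).topologicalCharge_eq ()
  rw [this, hs, zero_mul, sub_zero]

end

end EinsteinSkyrme

end

theorem theorem1 (α : ℝ) (hα : 0 < α) (B : ℤ) (hB : 0 < B) (h₀ : ℝ → ℝ)
    (hC1 : ContDiffOn ℝ 1 h₀ (Ici 0))
    (hdecay : h₀ =O[atTop] fun r : ℝ => (r ^ 2)⁻¹)
    (hdecay' : derivWithin h₀ (Ici 0) =O[atTop] fun r : ℝ => (r ^ 3)⁻¹)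
    (hcenter : Real.sin (h₀ 0) = 0)
    (hcharge : EinsteinSkyrme.topologicalCharge h₀ = B) :
    ∃ u₀ : ℝ, 0 < u₀ ∧
      ∃ h : ℝ → ℝ → ℝ,
        EinsteinSkyrme.IsClassicalSolution α B u₀ h₀ h ∧
        (∀ u ∈ Icc (0 : ℝ) u₀,
          (h u =O[atTop] fun r : ℝ => (r ^ 2)⁻¹) ∧
          (EinsteinSkyrme.partialR h u =O[atTop] fun r : ℝ => (r ^ 3)⁻¹)) ∧
        (∀ h' : ℝ → ℝ → ℝ, EinsteinSkyrme.IsClassicalSolution α B u₀ h₀ h' →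
          ∀ u ∈ Icc (0 : ℝ) u₀, ∀ r : ℝ, 0 ≤ r → h' u r = h u r) := by
  have hm₀ := EinsteinSkyrme.memWeightedC1_const hC1 hdecay hdecay' 1
  set κ := h₀ 0 with hκdef
  obtain ⟨C, hC⟩ := hm₀.exists_isProfileFamily (κ := κ) zero_lt_one
  have hF := hC (U := Unit) (ι := fun _ => 0) continuous_const (fun _ => by simp) fun _ => rfl
  obtain ⟨e, -, ⟨D, hD, hDe⟩, he⟩ := hF.exists_state
  obtain ⟨e1, e2, e3⟩ := he ()
  obtain ⟨K, hK, hW⟩ := EinsteinSkyrme.exists_W_add_le_of_static e1 e2 hF e3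
  -- the datum determines a state, from which the evolution starts
  obtain ⟨u₀, hu₀, s, hs0, hs⟩ := EinsteinSkyrme.exists_solution α hcenter (e ())
  have hev : EinsteinSkyrme.IsEvolution α hcenter u₀ s := ⟨hs, by rw [hs0, e1]⟩
  have hmem : EinsteinSkyrme.MemWeightedC1 u₀ fun u r => EinsteinSkyrme.profile κ (s u) r :=
    hev.memWeightedC1 hu₀ hD hK (by rw [hs0]; exact hDe ()) (by rw [hs0]; exact hW)
  have hκB : κ / Real.pi = B := by
    rw [← hcharge]
    exact (hm₀.topologicalCharge_eq zero_lt_one (u := 0) (by simp) hcenter).symm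
  refine ⟨u₀, hu₀, fun u r => EinsteinSkyrme.profile κ (s u) r,
    ⟨hmem, fun r hr => ?_, fun u _ => ?_, fun u hu => ?_,
    fun u hu r hr => hev.dynamicalExpr_eq_zero hu₀ hu hr⟩, fun u hu => hmem.isBigO hu,
    fun h' h'sol u hu r hr => ?_⟩
  · rw [hs0]
    exact EinsteinSkyrme.profile_of_static e1 e2 hF e3 hr
  · rw [EinsteinSkyrme.profile_zero, hcenter]
  · have hsin : Real.sin (EinsteinSkyrme.profile κ (s u) 0) = 0 := by
      rw [EinsteinSkyrme.profile_zero, hcenter]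
    have := hmem.topologicalCharge_eq hu₀ hu hsin
    rw [this, EinsteinSkyrme.profile_zero, hκB]
  · have hc' : ∀ v ∈ Icc (0 : ℝ) u₀, h' v 0 = κ := fun v hv => by
      have h1 := h'sol.mem.topologicalCharge_eq hu₀ hv (h'sol.center v hv)
      rw [h'sol.charge v hv, ← hκB] at h1
      exact ((div_left_inj' Real.pi_ne_zero).1 h1).symm
    refine hev.eq_profile hcenter hu₀ h'sol.mem hc' h'sol.equation (by rw [hs0, e2]) (fun x => ?_)
      hu hr
    have hd : (fun (_ : ℝ) r => EinsteinSkyrme.partialR h' 0 |r|) 0 =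
        fun r => EinsteinSkyrme.partialR (fun _ => h₀) (0:ℝ) |r| := by
      funext r
      exact derivWithin_congr (fun y hy => h'sol.initial y hy) (h'sol.initial _ (abs_nonneg r))
    rw [hs0, e3,
      EinsteinSkyrme.profileZ_congr (g' := fun (u : ℝ) r => EinsteinSkyrme.partialR h' u |r|) (v := 0) hd.symm]
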